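/- All vector spaces are over $\mathbb C$ and $\mathbb Z/2$-graded. A Lie conformal superalgebra $R$ is a graded $\mathbb C[\partial]$-module with a bilinear even bracket $[a_\lambda b]\in\mathbb C[\lambda]\otimes R$ satisfying sesquilinearity ($[\partial a_\lambda b]=-\lambda[a_\lambda b]$, $[a_\lambda\partial b]=(\partial+\lambda)[a_\lambda b]$), skew-commutativity ($[b_\lambda a]=-(-1)^{p(a)p(b)}[a_{-\lambda-\partial}b]$) and the Jacobi identity ($[a_\lambda[b_\mu c]]=[[a_\lambda b]_{\lambda+\mu}c]+(-1)^{p(a)p(b)}[b_\mu[a_\lambda c]]$); its $n$-th products are given by $[a_\lambda b]=\sum_n\frac{\lambda^n}{n!}a_{(n)}b$. A central extension of $R$ by a superspace $K$ (with zero bracket and zero action of $\partial$) is a $\mathbb C[\partial]$-split exact sequence $0\to K\to E\to R\to0$ of Lie conformal superalgebras with $K$ central in $E$. Two such extensions are equivalent if they are isomorphic by an isomorphism inducing the identity on $K$ and on $R$; an extension is trivial if $E\to R$ has a section that is a homomorphism of Lie conformal superalgebras. A (reduced) $2$-cocycle on $R$ is a bilinear map $\alpha_\lambda:R\times R\to\mathbb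 C[\lambda]$ with $\alpha_\lambda(\partial a,b)=-\lambda\alpha_\lambda(a,b)$, $\alpha_\lambda(a,\partial b)=\lambda\alpha_\lambda(a,b)$, $\alpha_\lambda(b,a)=-(-1)^{p(a)p(b)}\alpha_{-\lambda}(a,b)$ and $\alpha_\lambda(a,[b_\mu c])=\alpha_{\lambda+\mu}([a_\lambda b],c)+(-1)^{p(a)p(b)}\alpha_\mu(b,[a_\lambda c])$. It is trivial if $\alpha_\lambda(a,b)=\varphi([a_\lambda b])$ for some linear $\varphi:R\to\mathbb C$ with $\varphi(\partial R)=0$; $H^2(R)$ is the space of $2$-cocycles modulo trivial ones. Write $\alpha_\lambda=\sum_n\alpha_n\lambda^n/n!$. Let $\Lambda(N)$ be the Grassmann algebra on $\xi_1,\dots,\xi_N$, with $\partial_i=\partial/\partial\xi_i$, and let $K_N=\mathbb C[\partial]\otimes\Lambda(N)$ with the sesquilinear bracket determined, for $A,B\in\Lambda(N)$ homogeneous of degrees $r,s$, by $$[A_\lambda B]=\Big(\tfrac r2-1\Big)\partial(AB)+(-1)^r\tfrac12\sum_{i=1}^N(\partial_iA)(\partial_iB)+\lambda\Big(\tfrac{r+s}2-2\Big)AB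 .$$ Let $K_4'$ be the derived subalgebra of $K_4$ (the $\mathbb C[\partial]$-span of all $n$-th products), and let $CK_6\subset K_6$ be the $\mathbb C[\partial]$-span of the elements $f-\sqrt{-1}\,(-1)^{r(r+1)/2}(-\partial)^{3-r}f^*$, where $f$ runs over the monomials of degree $r\le3$ and $f^*$ is the monomial (with sign) such that $ff^*=\xi_1\cdots\xi_6$. We say that cocycles $\psi_1,\dots,\psi_m$ parameterize the central extensions of $R$ if their classes form a basis of $H^2(R)$ and, for every superspace $K$, the central extensions of $R$ by $K$ up to equivalence correspond bijectively to $m$-tuples $(k_1,\dots,k_m)$ of even vectors of $K$, the tuple $(k_i)$ corresponding to the extension with cocycle $\sum_i\psi_i\otimes k_i$. Theorem. $K_4'$, $K_N$ ($0\le N\le 3$ or $N\ge5$) and $CK_6$ are Lie conformal superalgebras ($CK_6$ is a subalgebra of $K_6$), and: (1) The central extensions of $K_4'$ are parameterized by two cocycles $\alpha,\beta$ (so $\dim H^2(K_4')=2$), whose non-zero values on the generators $\xi_{i_1}\cdots\xi_{i_r}$ ($r\le3$), $\partial\xi_1\xi_2\xi_3\xi_4$ are, up to skew-commutativity and reordering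 of the factors $\xi_i$, $$\alpha_3(1,1)=\tfrac12,\quad \alpha_2(\xi_i,\xi_i)=\tfrac16,\quad \alpha_1(\xi_i\xi_j,\xi_i\xi_j)=-\tfrac1{12},\quad \alpha_0(\xi_i\xi_j\xi_k,\xi_i\xi_j\xi_k)=-\tfrac1{12},\quad \alpha_1(\partial\xi_1\xi_2\xi_3\xi_4,\partial\xi_1\xi_2\xi_3\xi_4)=-\tfrac1{12};$$ $$\beta_2(1,\partial\xi_1\xi_2\xi_3\xi_4)=2,\quad \beta_1(\xi_i,\partial_i(\xi_1\xi_2\xi_3\xi_4))=1,\quad \beta_1(\xi_i\xi_j,\partial_i\partial_j(\xi_1\xi_2\xi_3\xi_4))=-1$$ ($i,j,k$ pairwise distinct). (2) For $N=0,1,2,3$ the central extensions of $K_N$ are parameterized by one cocycle $\alpha$ (so $\dim H^2(K_N)=1$), with non-zero values $\alpha_3(1,1)=\frac12$, $\alpha_2(\xi_i,\xi_i)=\frac16$, $\alpha_1(\xi_i\xi_j,\xi_i\xi_j)=-\frac1{12}$, $\alpha_0(\xi_i\xi_j\xi_k,\xi_i\xi_j\xi_k)=-\frac1{12}$ on monomials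 ($i,j,k$ pairwise distinct in $\{1,\dots,N\}$). (3) For every $N\ge5$, $H^2(K_N)=0$ and every central extension of $K_N$ is trivial. (4) $H^2(CK_6)=0$ and every central extension of $CK_6$ is trivial. -/

import Mathlib

open scoped Polynomial TensorProduct

universe u

noncomputable section

/-! ### Lie conformal superalgebras

The indeterminate `X` of `ℂ[X]` plays the role of `∂` when it acts on a module `R`, and the role of
`λ` in the left factor of `ℂ[X] ⊗[ℂ] R`, which is `ℂ[λ] ⊗ R`. -/

section Conformal

variable {R : Type*} [AddCommGroup R] [Module ℂ R] [Module ℂ[X] R] [IsScalarTower ℂ ℂ[X] R]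

/-- Substitution of `λ = p(∂)` in an element of `ℂ[λ] ⊗ R`: the map `f(λ) ⊗ r ↦ f(p(∂)) r`.
For `p = C z` this is the value at the complex number `λ = z`. -/
def substAt (p : ℂ[X]) : ℂ[X] ⊗[ℂ] R →ₗ[ℂ] R :=
  TensorProduct.lift ((Algebra.lsmul ℂ ℂ R).toLinearMap ∘ₗ (Polynomial.aeval p).toLinearMap)

/-- The coefficient of `λ ^ n` of an element of `ℂ[λ] ⊗ R`. -/
def lambdaCoeff (n : ℕ) : ℂ[X] ⊗[ℂ] R →ₗ[ℂ] R :=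
  (TensorProduct.lid ℂ R).toLinearMap ∘ₗ (Polynomial.lcoeff ℂ n).rTensor R

end Conformal

/-- The Koszul sign `(-1) ^ (i j)` for parities `i`, `j`. -/
def koszulSign (i j : ZMod 2) : ℂ := (-1) ^ (i.val * j.val)

/-- A `ℂ[∂]`-module with even and odd parts and a `ℂ`-bilinear `λ`-bracket with values in
`ℂ[λ] ⊗ R`. The axioms are stated in `ConformalData.IsLie`. -/
structure ConformalData (R : Type*) [AddCommGroup R] [Module ℂ R] [Module ℂ[X] R] where
  parity : ZMod 2 → Submodule ℂ[X] R
  bracket : R →ₗ[ℂ] R →ₗ[ℂ] ℂ[X] ⊗[ℂ] R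

namespace ConformalData

section Basic

variable {R : Type*} [AddCommGroup R] [Module ℂ R] [Module ℂ[X] R]

/-- The `n`-th product: `[a_λ b] = ∑ λ ^ n / n! • a_(n) b`. -/
def nthProduct (D : ConformalData R) (n : ℕ) (a b : R) : R :=
  (n.factorial : ℂ) • lambdaCoeff n (D.bracket a b)

variable [IsScalarTower ℂ ℂ[X] R]

/-- The bracket `[a_p b]`, with `λ` replaced by the operator `p(∂)`. -/
def brk (D : ConformalData R) (p : ℂ[X]) (a b : R) : R := substAt p (D.bracket a b)

/-- The axioms of a Lie conformal superalgebra. An identity between polynomials in `λ`, `μ` with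
coefficients in a complex vector space is stated at all complex values of `λ`, `μ`. -/
structure IsLie (D : ConformalData R) : Prop where
  isCompl : IsCompl (D.parity 0) (D.parity 1)
  parity_bracket : ∀ i j : ZMod 2, ∀ a ∈ D.parity i, ∀ b ∈ D.parity j, ∀ n : ℕ,
    D.nthProduct n a b ∈ D.parity (i + j)
  sesq_left : ∀ (z : ℂ) (a b : R),
    D.brk (.C z) ((.X : ℂ[X]) • a) b = -(z • D.brk (.C z) a b)
  sesq_right : ∀ (z : ℂ) (a b : R),
    D.brk (.C z) a ((.X : ℂ[X]) • b) = ((.X + .C z : ℂ[X])) • D.brk (.C z) a b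
  skew : ∀ i j : ZMod 2, ∀ a ∈ D.parity i, ∀ b ∈ D.parity j, ∀ z : ℂ,
    D.brk (.C z) b a = -(koszulSign i j • D.brk (-.C z - .X) a b)
  jacobi : ∀ i j : ZMod 2, ∀ a ∈ D.parity i, ∀ b ∈ D.parity j, ∀ (c : R) (z w : ℂ),
    D.brk (.C z) a (D.brk (.C w) b c) =
      D.brk (.C (z + w)) (D.brk (.C z) a b) c
        + koszulSign i j • D.brk (.C w) b (D.brk (.C z) a c)

/-- A `ℂ[∂]`-submodule closed under all `n`-th products. -/
def IsSubalgebra (D : ConformalData R) (S : Submodule ℂ[X] R) : Prop :=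
  ∀ a ∈ S, ∀ b ∈ S, ∀ n : ℕ, D.nthProduct n a b ∈ S

end Basic

end ConformalData

/-- An element of `ℂ[λ] ⊗ R` is the sum of its terms `λ ^ n ⊗ r_n`. -/
lemma exists_eq_sum_lambdaCoeff {R : Type*} [AddCommGroup R] [Module ℂ R] (x : ℂ[X] ⊗[ℂ] R) :    ∃ M : ℕ, ∀ m ≥ M, x = ∑ n ∈ Finset.range m, (.X ^ n : ℂ[X]) ⊗ₜ[ℂ] lambdaCoeff n x := by
  induction x with
  | zero => exact ⟨0, fun m _ => by simp⟩
  | add x y hx hy =>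
    obtain ⟨M, hM⟩ := hx
    obtain ⟨M', hM'⟩ := hy
    refine ⟨max M M', fun m hm => ?_⟩
    simp only [map_add, TensorProduct.tmul_add, Finset.sum_add_distrib]
    rw [← hM m (le_trans (le_max_left _ _) hm), ← hM' m (le_trans (le_max_right _ _) hm)]
  | tmul f r =>
    refine ⟨f.natDegree + 1, fun m hm => ?_⟩
    simp only [lambdaCoeff, LinearMap.comp_apply, LinearMap.rTensor_tmul,
      LinearEquiv.coe_coe, TensorProduct.lid_tmul, Polynomial.lcoeff_apply]
    simp only [← TensorProduct.smul_tmul, ← TensorProduct.sum_tmul]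
    congr 1
    conv_lhs => rw [f.as_sum_range' m (by omega)]
    simp [← Polynomial.C_mul_X_pow_eq_monomial, Polynomial.smul_eq_C_mul]

section Restrict

variable {R : Type*} [AddCommGroup R] [Module ℂ R] [Module ℂ[X] R] [IsScalarTower ℂ ℂ[X] R]

/-- The inclusion `ℂ[λ] ⊗ S → ℂ[λ] ⊗ R` for a submodule `S` of `R`. -/
def lambdaIncl (S : Submodule ℂ[X] R) : ℂ[X] ⊗[ℂ] S →ₗ[ℂ] ℂ[X] ⊗[ℂ] R :=
  (S.subtype.restrictScalars ℂ).lTensor ℂ[X]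

lemma lambdaIncl_injective (S : Submodule ℂ[X] R) : Function.Injective (lambdaIncl S) :=
  Module.Flat.lTensor_preserves_injective_linearMap _ S.injective_subtype

lemma mem_range_lambdaIncl (S : Submodule ℂ[X] R) (x : ℂ[X] ⊗[ℂ] R)
    (h : ∀ n, lambdaCoeff n x ∈ S) : x ∈ LinearMap.range (lambdaIncl S) := by
  obtain ⟨M, hM⟩ := exists_eq_sum_lambdaCoeff x
  rw [hM M le_rfl]
  refine Submodule.sum_mem _ fun n _ => ⟨(.X ^ n : ℂ[X]) ⊗ₜ[ℂ] ⟨_, h n⟩, ?_⟩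
  simp [lambdaIncl]

namespace ConformalData

lemma IsSubalgebra.bracket_mem {D : ConformalData R} {S : Submodule ℂ[X] R}
    (hS : D.IsSubalgebra S) (a b : S) :
    D.bracket a b ∈ LinearMap.range (lambdaIncl S) := by
  refine mem_range_lambdaIncl S _ fun n => ?_
  have h := S.smul_mem ((.C ((n.factorial : ℂ)⁻¹) : ℂ[X])) (hS a a.2 b b.2 n)
  have h0 : (n.factorial : ℂ) ≠ 0 := by exact_mod_cast n.factorial_ne_zero
  have e : ∀ (z : ℂ) (r : R), (.C z : ℂ[X]) • r = z • r := fun z r => by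
    rw [← Polynomial.algebraMap_eq, algebraMap_smul]
  rwa [e, nthProduct, smul_smul, inv_mul_cancel₀ h0, one_smul] at h

/-- The restriction of the structure to a subalgebra. -/
def restrict (D : ConformalData R) (S : Submodule ℂ[X] R) (hS : D.IsSubalgebra S) :
    ConformalData S where
  parity i := (D.parity i).comap S.subtype
  bracket := LinearMap.mk₂ ℂ
    (fun a b => (LinearEquiv.ofInjective _ (lambdaIncl_injective S)).symm
      ⟨D.bracket a b, hS.bracket_mem a b⟩)
    (fun a a' b => by
      rw [← map_add]; congr 1; ext1; simp)
    (fun z a b => by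
      rw [← map_smul]; congr 1; ext1; simp)
    (fun a b b' => by
      rw [← map_add]; congr 1; ext1; simp)
    (fun z a b => by
      rw [← map_smul]; congr 1; ext1; simp)

/-- The bracket of `restrict` is the bracket of the ambient algebra. -/
lemma lambdaIncl_restrict_bracket (D : ConformalData R) (S : Submodule ℂ[X] R)
    (hS : D.IsSubalgebra S) (a b : S) :
    lambdaIncl S ((D.restrict S hS).bracket a b) = D.bracket a b := by
  have := LinearEquiv.apply_symm_apply (LinearEquiv.ofInjective _ (lambdaIncl_injective S))
    ⟨D.bracket a b, hS.bracket_mem a b⟩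
  exact congrArg Subtype.val this

/-- The derived subalgebra, generated as a `ℂ[∂]`-module by all `n`-th products. -/
def derived (D : ConformalData R) : Submodule ℂ[X] R :=
  Submodule.span ℂ[X] {x | ∃ (n : ℕ) (a b : R), x = D.nthProduct n a b}

lemma derived_isSubalgebra {R : Type*} [AddCommGroup R] [Module ℂ R] [Module ℂ[X] R]
    (D : ConformalData R) : D.IsSubalgebra D.derived :=
  fun a _ b _ n => Submodule.subset_span ⟨n, a, b, rfl⟩

end ConformalData

end Restrict

/-! ### Reduced second cohomology and central extensions -/

namespace ConformalData

section Cohomology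

variable {R : Type*} [AddCommGroup R] [Module ℂ R] [Module ℂ[X] R] [IsScalarTower ℂ ℂ[X] R]

variable (R) in
/-- Bilinear maps `R × R → ℂ[λ]`. -/
abbrev LambdaForm : Type _ := R →ₗ[ℂ] R →ₗ[ℂ] ℂ[X]

instance : AddCommGroup (LambdaForm R) := inferInstance

/-- The reduced `2`-cocycles with trivial coefficients: bilinear maps `(a, b) ↦ α_λ(a, b) ∈ ℂ[λ]`
(even, odd, or a sum of both), where `∂` acts on `ℂ` by `0`. -/
def twoCocycles (D : ConformalData R) : Submodule ℂ (LambdaForm R) where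
  carrier := {α |
    (∀ a b, α ((.X : ℂ[X]) • a) b = -(.X * α a b)) ∧
    (∀ a b, α a ((.X : ℂ[X]) • b) = .X * α a b) ∧
    (∀ i j : ZMod 2, ∀ a ∈ D.parity i, ∀ b ∈ D.parity j,
      α b a = -(koszulSign i j • (α a b).comp (-.X))) ∧
    (∀ i j : ZMod 2, ∀ a ∈ D.parity i, ∀ b ∈ D.parity j, ∀ (c : R) (z w : ℂ),
      (α a (D.brk (.C w) b c)).eval z =
        (α (D.brk (.C z) a b) c).eval (z + w)
          + koszulSign i j * (α b (D.brk (.C z) a c)).eval w)}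
  zero_mem' := by simp
  add_mem' := by
    rintro α β ⟨h1, h2, h3, h4⟩ ⟨k1, k2, k3, k4⟩
    refine ⟨fun a b => ?_, fun a b => ?_, fun i j a ha b hb => ?_,
      fun i j a ha b hb c z w => ?_⟩
    · simp only [LinearMap.add_apply, h1, k1]; ring
    · simp only [LinearMap.add_apply, h2, k2]; ring
    · simp only [LinearMap.add_apply, h3 i j a ha b hb, k3 i j a ha b hb, Polynomial.add_comp,
        smul_add]; ring
    · simp only [LinearMap.add_apply, Polynomial.eval_add, h4 i j a ha b hb c z w,
        k4 i j a ha b hb c z w]; ring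
  smul_mem' := by
    rintro r α ⟨h1, h2, h3, h4⟩
    refine ⟨fun a b => ?_, fun a b => ?_, fun i j a ha b hb => ?_,
      fun i j a ha b hb c z w => ?_⟩
    · simp only [LinearMap.smul_apply, h1, Polynomial.smul_eq_C_mul]; ring
    · simp only [LinearMap.smul_apply, h2, Polynomial.smul_eq_C_mul]; ring
    · simp only [LinearMap.smul_apply, h3 i j a ha b hb, Polynomial.smul_eq_C_mul,
        Polynomial.mul_comp, Polynomial.C_comp]; ring
    · simp only [LinearMap.smul_apply, Polynomial.eval_smul, h4 i j a ha b hb c z w,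
        smul_eq_mul]; ring

/-- The trivial cocycles `α_λ(a, b) = φ([a_λ b])`, for linear `φ : R → ℂ` vanishing on `∂R`. -/
def twoCoboundaries (D : ConformalData R) : Submodule ℂ (LambdaForm R) where
  carrier := {α | ∃ φ : R →ₗ[ℂ] ℂ, (∀ a, φ ((.X : ℂ[X]) • a) = 0) ∧
    ∀ a b, α a b = TensorProduct.rid ℂ ℂ[X] (φ.lTensor ℂ[X] (D.bracket a b))}
  zero_mem' := ⟨0, by simp, by simp⟩
  add_mem' := by
    rintro α β ⟨φ, h1, h2⟩ ⟨ψ, k1, k2⟩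
    exact ⟨φ + ψ, by simp [h1, k1], by simp [h2, k2, LinearMap.lTensor_add]⟩
  smul_mem' := by
    rintro r α ⟨φ, h1, h2⟩
    exact ⟨r • φ, by simp [h1], by simp [h2, LinearMap.lTensor_smul]⟩

/-- The second reduced cohomology `H²(R)` with trivial coefficients. -/
abbrev H2 (D : ConformalData R) : Type _ :=
  D.twoCocycles ⧸ D.twoCoboundaries.submoduleOf D.twoCocycles

/-- The cohomology class of a cocycle. -/
def cls (D : ConformalData R) (α : D.twoCocycles) : D.H2 :=
  (D.twoCoboundaries.submoduleOf D.twoCocycles).mkQ α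

end Cohomology

section Extensions

variable {R : Type} [AddCommGroup R] [Module ℂ R] [Module ℂ[X] R] [IsScalarTower ℂ ℂ[X] R]
variable {K : Type u} [AddCommGroup K] [Module ℂ K]

/-- A central extension `0 → K → E → R → 0` of `R` by a superspace `K` with even and odd parts
`P 0`, `P 1` (with zero `λ`-bracket and zero action of `∂`). -/
structure CentralExtension (D : ConformalData R) (P : ZMod 2 → Submodule ℂ K) where
  E : Type u
  [addCommGroup : AddCommGroup E]
  [moduleC : Module ℂ E]
  [modulePoly : Module ℂ[X] E]
  [isScalarTower : IsScalarTower ℂ ℂ[X] E]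
  str : ConformalData E
  isLie : str.IsLie
  incl : K →ₗ[ℂ] E
  proj : E →ₗ[ℂ[X]] R
  incl_parity : ∀ i, ∀ k ∈ P i, incl k ∈ str.parity i
  proj_parity : ∀ i, ∀ x ∈ str.parity i, proj x ∈ D.parity i
  incl_injective : Function.Injective incl
  proj_surjective : Function.Surjective proj
  exact : Function.Exact incl proj
  proj_bracket : ∀ x y, (proj.restrictScalars ℂ).lTensor ℂ[X] (str.bracket x y) =
    D.bracket (proj x) (proj y)
  central : ∀ k x, str.bracket (incl k) x = 0
  partial_incl : ∀ k, (.X : ℂ[X]) • incl k = 0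
  split : ∃ s : R →ₗ[ℂ[X]] E, proj ∘ₗ s = LinearMap.id

attribute [instance] CentralExtension.addCommGroup CentralExtension.moduleC
  CentralExtension.modulePoly CentralExtension.isScalarTower

namespace CentralExtension

variable {D : ConformalData R} {P : ZMod 2 → Submodule ℂ K}

/-- Equivalence of central extensions of `R` by `K`: an isomorphism of Lie conformal superalgebras
which is the identity on `K` and on `R`. -/
def Equivalent (A B : CentralExtension D P) : Prop :=
  ∃ f : A.E ≃ₗ[ℂ[X]] B.E,
    (∀ i, ∀ x ∈ A.str.parity i, f x ∈ B.str.parity i) ∧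
    (∀ x y, (f.toLinearMap.restrictScalars ℂ).lTensor ℂ[X] (A.str.bracket x y) =
      B.str.bracket (f x) (f y)) ∧
    (∀ k, f (A.incl k) = B.incl k) ∧
    ∀ x, B.proj (f x) = A.proj x

/-- The extension is given by the `K`-valued cocycle `κ`: for some even `ℂ[∂]`-linear section `s`
of the projection, `[s(a)_λ s(b)] = s([a_λ b]) + κ_λ(a, b)`. -/
def IsGivenBy (A : CentralExtension D P) (κ : R → R → ℂ[X] ⊗[ℂ] K) : Prop :=
  ∃ s : R →ₗ[ℂ[X]] A.E, (∀ i, ∀ a ∈ D.parity i, s a ∈ A.str.parity i) ∧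
    A.proj ∘ₗ s = LinearMap.id ∧
    ∀ a b, A.str.bracket (s a) (s b) =
      (s.restrictScalars ℂ).lTensor ℂ[X] (D.bracket a b) + A.incl.lTensor ℂ[X] (κ a b)

/-- The extension is trivial: the projection has a section that is a homomorphism of Lie conformal
superalgebras. -/
def IsTrivial (A : CentralExtension D P) : Prop := A.IsGivenBy (fun _ _ => 0)

end CentralExtension

/-- The cocycles `ψ i` parameterize the central extensions of `R`: their classes form a basis of
`H²(R)`, and for every superspace `K` the central extensions of `R` by `K`, up to equivalence,
correspond bijectively to the families `k` of even vectors of `K`, the extension attached to `k`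
being given by the cocycle `∑ i, ψ i ⊗ k i`. -/
structure ParameterizeCentralExtensions (D : ConformalData R) {ι : Type} [Fintype ι]
    (ψ : ι → D.twoCocycles) : Prop where
  linearIndependent : LinearIndependent ℂ (fun i => D.cls (ψ i))
  span_eq_top : Submodule.span ℂ (Set.range fun i => D.cls (ψ i)) = ⊤
  exists_extension : ∀ (K : Type u) [AddCommGroup K] [Module ℂ K] (P : ZMod 2 → Submodule ℂ K),
    IsCompl (P 0) (P 1) → ∀ k : ι → K, (∀ i, k i ∈ P 0) →
      ∃ A : CentralExtension D P, A.IsGivenBy fun a b => ∑ i, (ψ i).1 a b ⊗ₜ[ℂ] k i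
  exists_parameter : ∀ (K : Type u) [AddCommGroup K] [Module ℂ K] (P : ZMod 2 → Submodule ℂ K),
    IsCompl (P 0) (P 1) → ∀ A : CentralExtension D P,
      ∃ k : ι → K, (∀ i, k i ∈ P 0) ∧ A.IsGivenBy fun a b => ∑ i, (ψ i).1 a b ⊗ₜ[ℂ] k i
  equivalent_iff : ∀ (K : Type u) [AddCommGroup K] [Module ℂ K] (P : ZMod 2 → Submodule ℂ K),
    IsCompl (P 0) (P 1) → ∀ (A B : CentralExtension D P) (k l : ι → K),
      (∀ i, k i ∈ P 0) → (∀ i, l i ∈ P 0) →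
      A.IsGivenBy (fun a b => ∑ i, (ψ i).1 a b ⊗ₜ[ℂ] k i) →
      B.IsGivenBy (fun a b => ∑ i, (ψ i).1 a b ⊗ₜ[ℂ] l i) →
      (A.Equivalent B ↔ k = l)

/-- `R` has no non-trivial central extensions, and `H²(R) = 0`. -/
structure HasOnlyTrivialCentralExtensions (D : ConformalData R) : Prop where
  subsingleton_H2 : Subsingleton D.H2
  isTrivial : ∀ (K : Type u) [AddCommGroup K] [Module ℂ K] (P : ZMod 2 → Submodule ℂ K),
    IsCompl (P 0) (P 1) → ∀ A : CentralExtension D P, A.IsTrivial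

end Extensions

end ConformalData

/-! ### The Lie conformal superalgebras `K_N`, `K_4'`, `CK_6` -/

/-- The Grassmann algebra `Λ(N)` on `ξ_1, …, ξ_N`. -/
abbrev Grassmann (N : ℕ) : Type := ExteriorAlgebra ℂ (Fin N → ℂ)

/-- The monomial `ξ_I`: the product of the `ξ_i`, `i ∈ I`, in increasing order. -/
def xiMono {N : ℕ} (I : Finset (Fin N)) : Grassmann N :=
  (Pi.basisFun ℂ (Fin N)).ExteriorAlgebra I

/-- The generator `ξ_i`. -/
def xi {N : ℕ} (i : Fin N) : Grassmann N := ExteriorAlgebra.ι ℂ (Pi.single i 1)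

/-- The odd derivation `∂_i = ∂/∂ξ_i` of `Λ(N)`. -/
def dxi {N : ℕ} (i : Fin N) : Grassmann N →ₗ[ℂ] Grassmann N :=
  CliffordAlgebra.contractLeft (Q := (0 : QuadraticForm ℂ (Fin N → ℂ))) (LinearMap.proj i)

/-- The Euler operator `∑ ξ_i ∂_i`, which multiplies a monomial of degree `r` by `r`. -/
def euler (N : ℕ) : Grassmann N →ₗ[ℂ] Grassmann N :=
  ∑ i : Fin N, LinearMap.mulLeft ℂ (xi i) ∘ₗ dxi i

/-- The parity automorphism `A ↦ (-1) ^ r A` for `A` of degree `r`. -/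
def gradeInv (N : ℕ) : Grassmann N →ₗ[ℂ] Grassmann N :=
  (CliffordAlgebra.involute (Q := (0 : QuadraticForm ℂ (Fin N → ℂ)))).toLinearMap

/-- The `ℂ[∂]`-module `K_N = ℂ[∂] ⊗ Λ(N)`. -/
abbrev KSpace (N : ℕ) : Type := ℂ[X] ⊗[ℂ] Grassmann N

/-- `(A, B) ↦ (r / 2 - 1) A B` for `A` of degree `r`. -/
def kPart₀ (N : ℕ) : Grassmann N →ₗ[ℂ] Grassmann N →ₗ[ℂ] Grassmann N :=
  (LinearMap.mul ℂ (Grassmann N)) ∘ₗ ((1 / 2 : ℂ) • euler N - LinearMap.id)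

/-- `(A, B) ↦ (-1) ^ r (1 / 2) ∑ ∂_i A ∂_i B` for `A` of degree `r`. -/
def kPart₁ (N : ℕ) : Grassmann N →ₗ[ℂ] Grassmann N →ₗ[ℂ] Grassmann N :=
  (1 / 2 : ℂ) • ∑ i : Fin N,
    (LinearMap.mul ℂ (Grassmann N)).compl₁₂ (dxi i ∘ₗ gradeInv N) (dxi i)

/-- `(A, B) ↦ ((r + s) / 2 - 2) A B` for `A` of degree `r` and `B` of degree `s`. -/
def kPart₂ (N : ℕ) : Grassmann N →ₗ[ℂ] Grassmann N →ₗ[ℂ] Grassmann N :=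
  (1 / 2 : ℂ) • (LinearMap.mul ℂ (Grassmann N)) ∘ₗ euler N
    + (1 / 2 : ℂ) • (LinearMap.mul ℂ (Grassmann N)).compl₂ (euler N)
    - (2 : ℂ) • LinearMap.mul ℂ (Grassmann N)

/-- For `m ∈ ℂ[λ] ⊗ ℂ[∂]`, the bilinear map
`(p, q) ↦ p(-λ) q(∂ + λ) m(λ, ∂) ∈ ℂ[λ] ⊗ ℂ[∂]`. -/
def sesqMul (m : ℂ[X] ⊗[ℂ] ℂ[X]) : ℂ[X] →ₗ[ℂ] ℂ[X] →ₗ[ℂ] ℂ[X] ⊗[ℂ] ℂ[X] :=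
  ((LinearMap.mul ℂ (ℂ[X] ⊗[ℂ] ℂ[X])).compl₁₂
    (Polynomial.aeval (-((.X : ℂ[X]) ⊗ₜ[ℂ] (1 : ℂ[X])))).toLinearMap
    (Polynomial.aeval ((1 : ℂ[X]) ⊗ₜ[ℂ] (.X : ℂ[X]) + (.X : ℂ[X]) ⊗ₜ[ℂ] (1 : ℂ[X]))).toLinearMap
    ).compr₂ (LinearMap.mulRight ℂ m)

/-- The `λ`-bracket of `K_N`: the sesquilinear extension of
`[A_λ B] = (r/2 - 1) ∂(AB) + (-1)^r (1/2) ∑ ∂_i A ∂_i B + λ ((r + s)/2 - 2) AB`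
for `A`, `B` in `Λ(N)` of degrees `r`, `s`. -/
def kBracket (N : ℕ) : KSpace N →ₗ[ℂ] KSpace N →ₗ[ℂ] ℂ[X] ⊗[ℂ] KSpace N :=
  (TensorProduct.map₂ (sesqMul ((1 : ℂ[X]) ⊗ₜ[ℂ] (.X : ℂ[X]))) (kPart₀ N)
    + TensorProduct.map₂ (sesqMul 1) (kPart₁ N)
    + TensorProduct.map₂ (sesqMul ((.X : ℂ[X]) ⊗ₜ[ℂ] (1 : ℂ[X]))) (kPart₂ N)).compr₂
    (TensorProduct.assoc ℂ ℂ[X] ℂ[X] (Grassmann N)).toLinearMap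

/-- `K_N`. -/
def KAlg (N : ℕ) : ConformalData (KSpace N) where
  parity i := Submodule.baseChange ℂ[X]
    (CliffordAlgebra.evenOdd (0 : QuadraticForm ℂ (Fin N → ℂ)) i)
  bracket := kBracket N

/-- The underlying module of `K_4'`, the derived subalgebra of `K_4`. -/
abbrev K4'Space : Submodule ℂ[X] (KSpace 4) := (KAlg 4).derived

/-- `K_4'`. -/
def K4'Alg : ConformalData K4'Space :=
  (KAlg 4).restrict K4'Space (KAlg 4).derived_isSubalgebra

/-- The Hodge dual `ξ_I^*`, the monomial with `ξ_I ξ_I^* = ξ_1 ⋯ ξ_N`, obtained by applying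
`∂_i`, `i ∈ I`, to `ξ_1 ⋯ ξ_N` in increasing order. -/
def hodgeStar {N : ℕ} (I : Finset (Fin N)) : Grassmann N :=
  (I.sort (· ≤ ·)).foldl (fun w i => dxi i w) (xiMono Finset.univ)

/-- The underlying module of `CK_6`, generated by
`f - i (-1)^{r(r+1)/2} (-∂)^{3-r} f^*`, for the monomials `f` of degree `r ≤ 3` in `Λ(6)`. -/
def CK6Space : Submodule ℂ[X] (KSpace 6) :=
  Submodule.span ℂ[X] {x | ∃ I : Finset (Fin 6), I.card ≤ 3 ∧
    x = (1 : ℂ[X]) ⊗ₜ[ℂ] xiMono I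
      - (Complex.I * (-1 : ℂ) ^ (I.card * (I.card + 1) / 2)) •
        (((-.X : ℂ[X]) ^ (3 - I.card)) ⊗ₜ[ℂ] hodgeStar I)}

/-! Elements of `K_4'`. -/

section Elements

lemma dxi_xi_mul {N : ℕ} (i j : Fin N) (w : Grassmann N) :
    dxi i (xi j * w) = (if i = j then w else 0) - xi j * dxi i w := by
  have := CliffordAlgebra.contractLeft_ι_mul (Q := (0 : QuadraticForm ℂ (Fin N → ℂ)))
    (d := LinearMap.proj i) (Pi.single j 1) w
  unfold dxi xi
  refine this.trans ?_
  congr 1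
  by_cases h : i = j
  · subst h; simp
  · simp [h]

lemma dxi_dxi {N : ℕ} (i j : Fin N) (w : Grassmann N) : dxi i (dxi j w) = -dxi j (dxi i w) :=
  CliffordAlgebra.contractLeft_comm _ _ _

lemma euler_apply {N : ℕ} (w : Grassmann N) : euler N w = ∑ i, xi i * dxi i w := by
  simp [euler]

lemma euler_dxi {N : ℕ} (i : Fin N) (w : Grassmann N) :
    euler N (dxi i w) = dxi i (euler N w) - dxi i w := by
  simp only [euler_apply, map_sum, dxi_xi_mul, Finset.sum_sub_distrib, Finset.sum_ite_eq,
    Finset.mem_univ, if_true]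
  simp only [dxi_dxi i, mul_neg, Finset.sum_neg_distrib]
  abel

lemma euler_ι_mul {N : ℕ} (v : Fin N → ℂ) (w : Grassmann N) :
    euler N (ExteriorAlgebra.ι ℂ v * w)
      = ExteriorAlgebra.ι ℂ v * w + ExteriorAlgebra.ι ℂ v * euler N w := by
  have hv : ExteriorAlgebra.ι ℂ v = ∑ j, v j • (xi j : Grassmann N) := by
    simp only [xi, ← map_smul, ← map_sum]
    congr 1
    ext k
    simp [Finset.sum_apply, Pi.single_apply]
  have h : ∀ j : Fin N, euler N (xi j * w) = xi j * w + xi j * euler N w := fun j => by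
    have e : ∀ i : Fin N, (xi i * xi j : Grassmann N) = -(xi j * xi i) := fun i =>
      eq_neg_of_add_eq_zero_left (ExteriorAlgebra.ι_add_mul_swap _ _)
    simp only [euler_apply, dxi_xi_mul, mul_sub, ← mul_assoc, e,
      neg_mul, sub_neg_eq_add, Finset.mul_sum, mul_ite, mul_zero, Finset.sum_add_distrib]
    simp
  simp only [hv, Finset.sum_mul, smul_mul_assoc, map_sum, map_smul, h, smul_add,
    Finset.sum_add_distrib]

lemma euler_of_mem {N : ℕ} (n : ℕ) (w : Grassmann N)
    (hw : w ∈ (LinearMap.range (ExteriorAlgebra.ι ℂ (M := Fin N → ℂ))) ^ n) :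
    euler N w = (n : ℂ) • w := by
  induction n generalizing w with
  | zero =>
    rw [pow_zero] at hw
    obtain ⟨z, rfl⟩ := Submodule.mem_one.1 hw
    simp only [euler_apply, Nat.cast_zero, zero_smul]
    refine Finset.sum_eq_zero fun i _ => ?_
    have : dxi i (algebraMap ℂ (Grassmann N) z) = 0 :=
      CliffordAlgebra.contractLeft_algebraMap (Q := (0 : QuadraticForm ℂ (Fin N → ℂ)))
        (LinearMap.proj i) z
    rw [this, mul_zero]
  | succ n ih =>
    rw [pow_succ'] at hw
    refine Submodule.mul_induction_on hw ?_ ?_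
    · rintro _ ⟨v, rfl⟩ y hy
      rw [euler_ι_mul, ih y hy, mul_smul_comm]
      push_cast
      rw [add_smul, one_smul, add_comm]
    · intro x y hx hy
      rw [map_add, hx, hy, smul_add]

lemma euler_xiMono {N : ℕ} (I : Finset (Fin N)) :
    euler N (xiMono I) = (I.card : ℂ) • xiMono I := by
  refine euler_of_mem _ _ ?_
  rw [xiMono, ExteriorAlgebra.basis_apply]
  exact (exteriorPower.ιMulti_family ℂ I.card _ _).2

lemma euler_one (N : ℕ) : euler N 1 = 0 := by
  have := euler_of_mem (N := N) 0 1 (by rw [pow_zero]; exact Submodule.one_le.1 le_rfl)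
  simpa using this

lemma kBracket_one_left {N : ℕ} (w : Grassmann N) :
    kBracket N ((1 : ℂ[X]) ⊗ₜ[ℂ] 1) ((1 : ℂ[X]) ⊗ₜ[ℂ] w) =
      -((1 : ℂ[X]) ⊗ₜ[ℂ] ((.X : ℂ[X]) ⊗ₜ[ℂ] w))
        + (.X : ℂ[X]) ⊗ₜ[ℂ] ((1 : ℂ[X]) ⊗ₜ[ℂ] ((1 / 2 : ℂ) • euler N w - (2 : ℂ) • w)) := by
  have h1 : ∀ i : Fin N, dxi i (gradeInv N 1) = 0 := fun i => by
    have : gradeInv N 1 = 1 := by simp [gradeInv]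
    rw [this]; 
    exact CliffordAlgebra.contractLeft_one (Q := (0 : QuadraticForm ℂ (Fin N → ℂ)))
      (d := LinearMap.proj i)
  have p0 : kPart₀ N 1 w = -w := by simp [kPart₀, euler_one]
  have p1 : kPart₁ N 1 w = 0 := by simp [kPart₁, h1]
  have p2 : kPart₂ N 1 w = (1 / 2 : ℂ) • euler N w - (2 : ℂ) • w := by
    simp [kPart₂, euler_one]
  have s0 : ∀ m, sesqMul m 1 1 = m := fun m => by simp [sesqMul]
  simp only [kBracket, LinearMap.compr₂_apply, LinearMap.add_apply, TensorProduct.map₂_apply_tmul,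
    TensorProduct.map_tmul, p0, p1, p2, s0, TensorProduct.tmul_zero, map_add,
    LinearEquiv.coe_coe, TensorProduct.assoc_tmul, add_zero]
  rw [TensorProduct.tmul_neg, TensorProduct.tmul_neg]

lemma lambdaCoeff_tmul {R : Type*} [AddCommGroup R] [Module ℂ R] (n : ℕ) (f : ℂ[X]) (r : R) :
    lambdaCoeff n (f ⊗ₜ[ℂ] r) = f.coeff n • r := by
  simp [lambdaCoeff]

/-- Every homogeneous `w` of degree different from `4` lies in `K_4'`. -/
lemma one_tmul_mem_K4' (w : Grassmann 4) (k : ℂ) (hk : k ≠ 4) (hw : euler 4 w = k • w) :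
    (1 : ℂ[X]) ⊗ₜ[ℂ] w ∈ K4'Space := by
  have h : (KAlg 4).nthProduct 1 ((1 : ℂ[X]) ⊗ₜ[ℂ] 1) ((1 : ℂ[X]) ⊗ₜ[ℂ] w) ∈ K4'Space :=
    Submodule.subset_span ⟨1, _, _, rfl⟩
  have e : (KAlg 4).nthProduct 1 ((1 : ℂ[X]) ⊗ₜ[ℂ] 1) ((1 : ℂ[X]) ⊗ₜ[ℂ] w) =
      (.C (k / 2 - 2) : ℂ[X]) • ((1 : ℂ[X]) ⊗ₜ[ℂ] w : KSpace 4) := by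
    have e1 : (1 / 2 : ℂ) • euler 4 w - (2 : ℂ) • w = (k / 2 - 2) • w := by
      rw [hw, smul_smul, ← sub_smul]; congr 1; ring
    rw [ConformalData.nthProduct]
    change _ • lambdaCoeff 1 (kBracket 4 _ _) = _
    rw [kBracket_one_left, e1, map_add, map_neg, lambdaCoeff_tmul, lambdaCoeff_tmul,
      TensorProduct.tmul_smul, ← Polynomial.algebraMap_eq, algebraMap_smul]
    simp [Polynomial.coeff_one]
  rw [e] at h
  have hk' : k / 2 - 2 ≠ 0 := fun h0 => hk (by linear_combination 2 * h0)
  have := K4'Space.smul_mem (.C (k / 2 - 2)⁻¹ : ℂ[X]) h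
  rwa [smul_smul, ← Polynomial.C_mul, inv_mul_cancel₀ hk', Polynomial.C_1, one_smul] at this

/-- `∂w` lies in `K_4'` for every `w`. -/
lemma X_tmul_mem_K4' (w : Grassmann 4) : (.X : ℂ[X]) ⊗ₜ[ℂ] w ∈ K4'Space := by
  have h : (KAlg 4).nthProduct 0 ((1 : ℂ[X]) ⊗ₜ[ℂ] 1) ((1 : ℂ[X]) ⊗ₜ[ℂ] w) ∈ K4'Space :=
    Submodule.subset_span ⟨0, _, _, rfl⟩
  have e : (KAlg 4).nthProduct 0 ((1 : ℂ[X]) ⊗ₜ[ℂ] 1) ((1 : ℂ[X]) ⊗ₜ[ℂ] w) =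
      -((.X : ℂ[X]) ⊗ₜ[ℂ] w : KSpace 4) := by
    rw [ConformalData.nthProduct]
    change _ • lambdaCoeff 0 (kBracket 4 _ _) = _
    rw [kBracket_one_left, map_add, map_neg, lambdaCoeff_tmul, lambdaCoeff_tmul]
    simp
  rw [e] at h
  simpa using K4'Space.neg_mem h

/-- The generators of `K_4'` over `ℂ[∂]`: the monomials `ξ_I` of degree at most `3`, and
`∂ ξ_1 ξ_2 ξ_3 ξ_4`. -/
def k4'Gen (I : Finset (Fin 4)) : K4'Space :=
  if h : I = Finset.univ then ⟨(.X : ℂ[X]) ⊗ₜ[ℂ] xiMono I, X_tmul_mem_K4' _⟩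
  else ⟨(1 : ℂ[X]) ⊗ₜ[ℂ] xiMono I, one_tmul_mem_K4' _ I.card
    (fun h' => h (Finset.card_eq_iff_eq_univ _ |>.1 (by simpa using Nat.cast_injective h')))
    (euler_xiMono I)⟩

/-- `∂_i (ξ_1 ξ_2 ξ_3 ξ_4)` as an element of `K_4'`. -/
def k4'D (i : Fin 4) : K4'Space :=
  ⟨(1 : ℂ[X]) ⊗ₜ[ℂ] dxi i (xiMono Finset.univ), one_tmul_mem_K4' _ 3 (by norm_num) (by
    simp only [euler_dxi, euler_xiMono, map_smul, Finset.card_univ, Fintype.card_fin]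
    push_cast
    module)⟩

/-- `∂_i ∂_j (ξ_1 ξ_2 ξ_3 ξ_4)` as an element of `K_4'`. -/
def k4'DD (i j : Fin 4) : K4'Space :=
  ⟨(1 : ℂ[X]) ⊗ₜ[ℂ] dxi i (dxi j (xiMono Finset.univ)), one_tmul_mem_K4' _ 2 (by norm_num) (by
    simp only [euler_dxi, euler_xiMono, map_smul, map_sub, Finset.card_univ, Fintype.card_fin]
    push_cast
    module)⟩

/-- `ξ_i ξ_j` as an element of `K_4'`. -/
def k4'XiXi (i j : Fin 4) : K4'Space :=
  ⟨(1 : ℂ[X]) ⊗ₜ[ℂ] (xi i * xi j), one_tmul_mem_K4' _ 2 (by norm_num) (by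
    refine euler_of_mem 2 _ ?_
    rw [pow_two]
    exact Submodule.mul_mem_mul ⟨_, rfl⟩ ⟨_, rfl⟩)⟩

end Elements

/-! ### The explicit cocycles -/

/-- `α_λ(ξ_I, ξ_I)` for `|I| = 0, 1, 2, 3`. With `α_λ = ∑ α_n λ ^ n / n!`, this says `α_3 = 1/2`,
`α_2 = 1/6`, `α_1 = -1/12`, `α_0 = -1/12` respectively. -/
def alphaPoly : ℕ → ℂ[X]
  | 0 => .C ((1 / 2) / (Nat.factorial 3 : ℂ)) * .X ^ 3
  | 1 => .C ((1 / 6) / (Nat.factorial 2 : ℂ)) * .X ^ 2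
  | 2 => .C (-1 / 12) * .X
  | 3 => .C (-1 / 12)
  | _ => 0

/-- The cocycle `α` on `K_N`, `N ≤ 3`, by its values on monomials. -/
def IsAlpha (N : ℕ) (α : (KAlg N).twoCocycles) : Prop :=
  ∀ I J : Finset (Fin N),
    α.1 ((1 : ℂ[X]) ⊗ₜ[ℂ] xiMono I) ((1 : ℂ[X]) ⊗ₜ[ℂ] xiMono J) =
      if I = J then alphaPoly I.card else 0

/-- The cocycle `α` on `K_4'`, by its values on the generators; `α_1(θ, θ) = -1/12` for
`θ = ∂ ξ_1 ξ_2 ξ_3 ξ_4`. -/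
def IsAlpha' (α : K4'Alg.twoCocycles) : Prop :=
  (∀ I : Finset (Fin 4), I ≠ Finset.univ → α.1 (k4'Gen I) (k4'Gen I) = alphaPoly I.card) ∧
  α.1 (k4'Gen Finset.univ) (k4'Gen Finset.univ) = .C (-1 / 12) * .X ∧
  ∀ I J : Finset (Fin 4), I ≠ J → α.1 (k4'Gen I) (k4'Gen J) = 0

/-- The cocycle `β` on `K_4'`, by its values on the generators (the remaining values follow by
skew-commutativity): `β_2(1, ∂ ξ_1 ξ_2 ξ_3 ξ_4) = 2`, `β_1(ξ_i, ∂_i(ξ_1 ξ_2 ξ_3 ξ_4)) = 1`,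
`β_1(ξ_i ξ_j, ∂_i ∂_j(ξ_1 ξ_2 ξ_3 ξ_4)) = -1`. -/
def IsBeta' (β : K4'Alg.twoCocycles) : Prop :=
  β.1 (k4'Gen ∅) (k4'Gen Finset.univ) = .C (2 / (Nat.factorial 2 : ℂ)) * .X ^ 2 ∧
  (∀ i : Fin 4, β.1 (k4'Gen {i}) (k4'D i) = .X) ∧
  (∀ i j : Fin 4, i ≠ j → β.1 (k4'XiXi i j) (k4'DD i j) = -.X) ∧
  ∀ I J : Finset (Fin 4), J ≠ Iᶜ → β.1 (k4'Gen I) (k4'Gen J) = 0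

end

open scoped Polynomial TensorProduct

set_option linter.unusedSectionVars false

/-! Write `L` for the element `1` of `Λ(N)`. Up to sign it is a Virasoro element: `[L_λ B] = -(∂ +
Δλ)B` with weight `Δ = 2 - r/2` for `B` of degree `r`. The `λ`-free part of `[ξ_i_λ B]` gives `∂(ξ_i
B) = -2[ξ_i_0 B] - ∂_i B`, so up to division by `∂` everything is generated by `1` and the `ξ_i`.
Division by `∂` corresponds to cancelling a factor `λ` in a polynomial. Hence the Jacobi identity,
the cocycle identity and the vanishing of a cocycle need checking only for the first argument `1` or
`ξ_i` (`X_smul_emb_xi_mul`, `jacobiFor_emb_and`, `generation_of_xi`).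

Upper bounds. For `a` primary of weight `Δ`, the cocycle identity for `(L, L, a)` is a functional
equation for `α_λ(L, a)`, homogeneous in the two parameters, so it splits into conditions on single
coefficients: `λ^0` needs `Δ = 0`, `λ^2` needs `Δ = 1`, `λ^3` needs `Δ = 2`, and no higher power
occurs (`primary_coeff`). The `λ`-term is removed by a coboundary when `Δ ≠ 0`. The `λ^2`-term at
`ξ_i ξ_j` vanishes, because skew-commutativity makes it symmetric in `i` and `j`. As `ξ_i` has
weight `3/2`, the values `α(ξ_i, ·)` follow from `α(1, ·)`, except at weight `-1/2`. In `K_N` the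
exceptional degrees `4` and `5` are handled by summing over `i` and using Euler's identity, which
produces the factor `N - 4`. So for `N ≠ 4` a cocycle is determined up to coboundaries by `c =
α_3(1,1)`. In `K_4'` the generator `θ = ∂ξ_1ξ_2ξ_3ξ_4` has weight `1` and adds the second parameter
`α_2(1, θ)`.

Vanishing of `c`. One has `λ α(ξ_i B, ξ_i B) = ±α(B, B)` for suitable monomials `B`, so each
variable costs a power of `λ`. Starting from a multiple of `λ^3`, a fourth variable would force `λ`
to divide a constant, whence `c = 0` for `N ≥ 5` (`coeff_three_eq_zero`). In `CK_6` only three steps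
are available, but there `ξ_4ξ_5ξ_6 = √-1 ξ_1ξ_2ξ_3`, and the square of this scalar gives `α(1,1) =
-α(1,1)`.

Existence. The cocycle `α` is `λ^{3-r}(A, B)/12` for `A` of degree `r`, where `(A, B)` is the
constant term of `A(∂_1, …, ∂_N)B`. Its exponent is negative for `r = 4`, so the form `λα` is
constructed on `K_N`, `N ≤ 4`, and divided by `λ` where that is possible, for `N = 4` on the derived
algebra. The cocycle `β` is `λ∫AB`, with `∫` the coefficient of the top monomial.

Extensions. A section of an extension yields a `K`-valued cocycle, which is studied through all
functionals on `K`. The algebras are perfect modulo `∂R`, so the scalar coboundaries obtained from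
the functionals come from a single map `R → K` (`exists_eq_lTensor_bracket`); this transfers the
scalar classification to extensions by arbitrary `K` (`IsClassification.parameterize`). -/

noncomputable section

/-! ### Coefficients, values and substitutions in `ℂ[λ] ⊗ R`. -/

section Evaluation

variable {R : Type*} [AddCommGroup R] [Module ℂ R]

/-- The value at `λ = z` of an element of `ℂ[λ] ⊗ R`. -/
def evalAt (z : ℂ) : ℂ[X] ⊗[ℂ] R →ₗ[ℂ] R :=
  (TensorProduct.lid ℂ R).toLinearMap ∘ₗ (Polynomial.leval z).rTensor R

lemma evalAt_tmul (z : ℂ) (f : ℂ[X]) (r : R) : evalAt z (f ⊗ₜ[ℂ] r) = f.eval z • r := by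
  simp [evalAt]

lemma evalAt_lTensor {S : Type*} [AddCommGroup S] [Module ℂ S] (g : R →ₗ[ℂ] S) (z : ℂ)
    (x : ℂ[X] ⊗[ℂ] R) : evalAt z (g.lTensor ℂ[X] x) = g (evalAt z x) := by
  induction x with
  | zero => simp
  | add x y hx hy => simp [hx, hy]
  | tmul f r => simp [evalAt_tmul]

lemma lambdaCoeff_lTensor {S : Type*} [AddCommGroup S] [Module ℂ S] (g : R →ₗ[ℂ] S) (n : ℕ)
    (x : ℂ[X] ⊗[ℂ] R) : lambdaCoeff n (g.lTensor ℂ[X] x) = g (lambdaCoeff n x) := by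
  induction x with
  | zero => simp
  | add x y hx hy => simp [hx, hy]
  | tmul f r => simp [lambdaCoeff_tmul]

lemma eval_rid_lTensor (g : R →ₗ[ℂ] ℂ) (z : ℂ) (x : ℂ[X] ⊗[ℂ] R) :
    (TensorProduct.rid ℂ ℂ[X] (g.lTensor ℂ[X] x)).eval z = g (evalAt z x) := by
  induction x with
  | zero => simp
  | add x y hx hy => simp [hx, hy]
  | tmul f r => simp [evalAt_tmul, mul_comm]

lemma coeff_rid_lTensor (g : R →ₗ[ℂ] ℂ) (n : ℕ) (x : ℂ[X] ⊗[ℂ] R) :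
    (TensorProduct.rid ℂ ℂ[X] (g.lTensor ℂ[X] x)).coeff n = g (lambdaCoeff n x) := by
  induction x with
  | zero => simp
  | add x y hx hy => simp [hx, hy]
  | tmul f r => simp [lambdaCoeff_tmul, mul_comm]

/-- A polynomial with coefficients in `R` has all coefficients in a subspace as soon as all its
values are. -/
lemma lambdaCoeff_mem_of_evalAt_mem (S : Submodule ℂ R) (x : ℂ[X] ⊗[ℂ] R)
    (h : ∀ z, evalAt z x ∈ S) (n : ℕ) : lambdaCoeff n x ∈ S := by
  rw [← Submodule.Quotient.mk_eq_zero, ← Module.forall_dual_apply_eq_zero_iff ℂ]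
  intro g
  have h0 : TensorProduct.rid ℂ ℂ[X] ((g ∘ₗ S.mkQ).lTensor ℂ[X] x) = 0 := by
    refine Polynomial.funext fun z => ?_
    have : S.mkQ (evalAt z x) = 0 := by simpa using h z
    rw [eval_rid_lTensor, LinearMap.comp_apply, this, map_zero, Polynomial.eval_zero]
  have := coeff_rid_lTensor (g ∘ₗ S.mkQ) n x
  rw [h0, Polynomial.coeff_zero] at this
  exact this.symm

lemma eq_zero_of_lambdaCoeff (x : ℂ[X] ⊗[ℂ] R) (h : ∀ n, lambdaCoeff n x = 0) : x = 0 := by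
  obtain ⟨M, hM⟩ := exists_eq_sum_lambdaCoeff x
  rw [hM M le_rfl]
  simp [h]

/-- Since `ℂ` is infinite, values determine polynomials with coefficients in `R`; axioms stated at
complex parameters thereby become identities in `ℂ[λ] ⊗ R`. -/
lemma ext_evalAt {x y : ℂ[X] ⊗[ℂ] R} (h : ∀ z, evalAt z x = evalAt z y) : x = y := by
  rw [← sub_eq_zero]
  refine eq_zero_of_lambdaCoeff _ fun n => ?_
  have := lambdaCoeff_mem_of_evalAt_mem (⊥ : Submodule ℂ R) (x - y) (fun z => by simp [h]) n
  simpa using this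

variable [Module ℂ[X] R] [IsScalarTower ℂ ℂ[X] R]

lemma C_smul_eq (z : ℂ) (r : R) : (.C z : ℂ[X]) • r = z • r := by
  rw [← Polynomial.algebraMap_eq, algebraMap_smul]

lemma substAt_tmul (p f : ℂ[X]) (r : R) : substAt p (f ⊗ₜ[ℂ] r) = f.comp p • r := by
  simp only [substAt, TensorProduct.lift.tmul, LinearMap.comp_apply, AlgHom.toLinearMap_apply,
    Algebra.lsmul_coe]
  rfl

lemma substAt_C (z : ℂ) (x : ℂ[X] ⊗[ℂ] R) : substAt (.C z) x = evalAt z x := by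
  induction x with
  | zero => simp
  | add x y hx hy => simp [hx, hy]
  | tmul f r => rw [substAt_tmul, evalAt_tmul, Polynomial.comp_C, C_smul_eq]

lemma substAt_lTensor {S : Type*} [AddCommGroup S] [Module ℂ S] [Module ℂ[X] S]
    [IsScalarTower ℂ ℂ[X] S] (g : R →ₗ[ℂ[X]] S) (p : ℂ[X]) (x : ℂ[X] ⊗[ℂ] R) :
    substAt p ((g.restrictScalars ℂ).lTensor ℂ[X] x) = g (substAt p x) := by
  induction x with
  | zero => simp
  | add x y hx hy => simp [hx, hy]
  | tmul f r => simp [substAt_tmul]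

/-- Substitution when `∂` acts by zero on the image of `g`. -/
lemma substAt_lTensor_of_X_smul {K : Type*} [AddCommGroup K] [Module ℂ K] (g : K →ₗ[ℂ] R)
    (hg : ∀ k, (.X : ℂ[X]) • g k = 0) (p : ℂ[X]) (x : ℂ[X] ⊗[ℂ] K) :
    substAt p (g.lTensor ℂ[X] x) = g (evalAt (p.eval 0) x) := by
  have key : ∀ (q : ℂ[X]) (k : K), q • g k = q.eval 0 • g k := fun q k => by
    conv_lhs => rw [← Polynomial.divX_mul_X_add q]
    rw [add_smul, mul_smul, hg, smul_zero, zero_add, C_smul_eq, Polynomial.coeff_zero_eq_eval_zero]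
  induction x with
  | zero => simp
  | add x y hx hy => simp [hx, hy]
  | tmul f r => simp [substAt_tmul, evalAt_tmul, key, Polynomial.eval_comp]

lemma substAt_mem (S : Submodule ℂ[X] R) (p : ℂ[X]) (x : ℂ[X] ⊗[ℂ] R)
    (h : ∀ n, lambdaCoeff n x ∈ S) : substAt p x ∈ S := by
  obtain ⟨M, hM⟩ := exists_eq_sum_lambdaCoeff x
  rw [hM M le_rfl, map_sum]
  refine S.sum_mem fun n _ => ?_
  rw [substAt_tmul]
  exact S.smul_mem _ (h n)

end Evaluation

/-! ### Elementary properties of brackets, and subalgebras. -/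

namespace ConformalData

section Basic

variable {R : Type*} [AddCommGroup R] [Module ℂ R] [Module ℂ[X] R] [IsScalarTower ℂ ℂ[X] R]
  {D : ConformalData R}

lemma brk_C (z : ℂ) (a b : R) : D.brk (.C z) a b = evalAt z (D.bracket a b) := substAt_C _ _

lemma brk_add_left (p : ℂ[X]) (a a' b : R) : D.brk p (a + a') b = D.brk p a b + D.brk p a' b := by
  simp [brk]

lemma brk_add_right (p : ℂ[X]) (a b b' : R) : D.brk p a (b + b') = D.brk p a b + D.brk p a b' := by
  simp [brk]

lemma brk_sub_left (p : ℂ[X]) (a a' b : R) : D.brk p (a - a') b = D.brk p a b - D.brk p a' b := by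
  simp [brk]

lemma brk_sub_right (p : ℂ[X]) (a b b' : R) : D.brk p a (b - b') = D.brk p a b - D.brk p a b' := by
  simp [brk]

lemma brk_smul_left (p : ℂ[X]) (z : ℂ) (a b : R) : D.brk p (z • a) b = z • D.brk p a b := by
  simp [brk]

lemma brk_smul_right (p : ℂ[X]) (z : ℂ) (a b : R) : D.brk p a (z • b) = z • D.brk p a b := by
  simp [brk]

lemma brk_zero_left (p : ℂ[X]) (b : R) : D.brk p 0 b = 0 := by
  simp [brk]

lemma brk_zero_right (p : ℂ[X]) (a : R) : D.brk p a 0 = 0 := by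
  simp [brk]

lemma nthProduct_mem_iff (S : Submodule ℂ[X] R) (n : ℕ) (a b : R) :
    D.nthProduct n a b ∈ S ↔ lambdaCoeff n (D.bracket a b) ∈ S := by
  have h0 : (n.factorial : ℂ) ≠ 0 := by exact_mod_cast n.factorial_ne_zero
  constructor
  · intro h
    have := S.smul_mem (.C ((n.factorial : ℂ)⁻¹) : ℂ[X]) h
    rwa [C_smul_eq, nthProduct, smul_smul, inv_mul_cancel₀ h0, one_smul] at this
  · intro h
    rw [nthProduct, ← C_smul_eq]
    exact S.smul_mem _ h

/-- Parity and subalgebra conditions are stated for coefficients of the bracket, the Jacobi identity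
for its values; this is the passage between the two. -/
lemma forall_nthProduct_mem_iff (S : Submodule ℂ[X] R) (a b : R) :
    (∀ n, D.nthProduct n a b ∈ S) ↔ ∀ z, D.brk (.C z) a b ∈ S := by
  constructor
  · exact fun h z => substAt_mem S _ _ fun n => (nthProduct_mem_iff S n a b).1 (h n)
  · intro h n
    rw [nthProduct_mem_iff]
    refine lambdaCoeff_mem_of_evalAt_mem (S.restrictScalars ℂ) _ (fun z => ?_) n
    rw [← brk_C]
    exact h z

lemma brk_mem {S : Submodule ℂ[X] R} {a b : R} (h : ∀ n, D.nthProduct n a b ∈ S) (p : ℂ[X]) :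
    D.brk p a b ∈ S :=
  substAt_mem S _ _ fun n => (nthProduct_mem_iff S n a b).1 (h n)

lemma IsLie.brk_mem_parity (h : D.IsLie) {i j : ZMod 2} {a b : R} (ha : a ∈ D.parity i)
    (hb : b ∈ D.parity j) (p : ℂ[X]) : D.brk p a b ∈ D.parity (i + j) :=
  brk_mem (h.parity_bracket i j a ha b hb) p

lemma brk_restrict (S : Submodule ℂ[X] R) (hS : D.IsSubalgebra S) (p : ℂ[X]) (a b : S) :
    ((D.restrict S hS).brk p a b : R) = D.brk p a b := by
  rw [brk, brk, ← lambdaIncl_restrict_bracket D S hS a b]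
  exact (substAt_lTensor S.subtype p _).symm

/-- A subalgebra spanned by homogeneous elements is a Lie conformal superalgebra. -/
lemma IsLie.restrict (h : D.IsLie) (S : Submodule ℂ[X] R) (hS : D.IsSubalgebra S) (T : Set R)
    (hT : S = Submodule.span ℂ[X] T) (hhom : ∀ t ∈ T, ∃ i, t ∈ D.parity i) :
    (D.restrict S hS).IsLie where
  isCompl := by
    refine ⟨?_, ?_⟩
    · rw [Submodule.disjoint_def]
      intro x h0 h1
      exact Subtype.ext ((Submodule.disjoint_def.1 h.isCompl.disjoint) x h0 h1)
    · rw [codisjoint_iff, eq_top_iff]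
      rintro ⟨x, hx⟩ -
      have key : ∀ x ∈ Submodule.span ℂ[X] T, ∃ a ∈ S, ∃ b ∈ S, a ∈ D.parity 0 ∧ b ∈ D.parity 1 ∧
          x = a + b := by
        intro x hx
        induction hx using Submodule.span_induction with
        | mem t ht =>
          have hS' : t ∈ S := hT ▸ Submodule.subset_span ht
          obtain ⟨i, hi⟩ := hhom t ht
          fin_cases i
          · exact ⟨t, hS', 0, S.zero_mem, hi, zero_mem _, by simp⟩
          · exact ⟨0, S.zero_mem, t, hS', zero_mem _, hi, by simp⟩
        | zero => exact ⟨0, S.zero_mem, 0, S.zero_mem, zero_mem _, zero_mem _, by simp⟩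
        | add x y _ _ hx hy =>
          obtain ⟨a, ha, b, hb, ha0, hb1, rfl⟩ := hx
          obtain ⟨a', ha', b', hb', ha0', hb1', rfl⟩ := hy
          exact ⟨a + a', S.add_mem ha ha', b + b', S.add_mem hb hb', add_mem ha0 ha0',
            add_mem hb1 hb1', by abel⟩
        | smul p x _ hx =>
          obtain ⟨a, ha, b, hb, ha0, hb1, rfl⟩ := hx
          exact ⟨p • a, S.smul_mem p ha, p • b, S.smul_mem p hb, Submodule.smul_mem _ p ha0,
            Submodule.smul_mem _ p hb1, by rw [smul_add]⟩
      obtain ⟨a, ha, b, hb, ha0, hb1, rfl⟩ := key x (hT ▸ hx)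
      exact Submodule.mem_sup.2 ⟨⟨a, ha⟩, ha0, ⟨b, hb⟩, hb1, rfl⟩
  parity_bracket i j a ha b hb n := by
    have := h.parity_bracket i j a ha b hb
    refine (forall_nthProduct_mem_iff _ _ _).2 (fun z => ?_) n
    change ((D.restrict S hS).brk _ a b : R) ∈ D.parity (i + j)
    rw [brk_restrict]
    exact (forall_nthProduct_mem_iff _ _ _).1 this z
  sesq_left z a b := Subtype.ext <| by
    simpa [brk_restrict] using h.sesq_left z a b
  sesq_right z a b := Subtype.ext <| by
    simpa [brk_restrict] using h.sesq_right z a b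
  skew i j a ha b hb z := Subtype.ext <| by
    simpa [brk_restrict] using h.skew i j a ha b hb z
  jacobi i j a ha b hb c z w := Subtype.ext <| by
    simpa [brk_restrict] using h.jacobi i j a ha b hb c z w

end Basic

end ConformalData

lemma IsCompl.exists_projections {A M : Type*} [Ring A] [AddCommGroup M] [Module A M]
    {p : ZMod 2 → Submodule A M} (h : IsCompl (p 0) (p 1)) :
    ∃ π : ZMod 2 → M →ₗ[A] M, (∀ i x, π i x ∈ p i) ∧ (∀ x, π 0 x + π 1 x = x) ∧
      (∀ i, ∀ x ∈ p i, π i x = x) ∧ ∀ i j, i ≠ j → ∀ x ∈ p i, π j x = 0 := by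
  refine ⟨![Submodule.projection _ _ h, Submodule.projection _ _ h.symm], ?_, ?_, ?_, ?_⟩
  · intro i x
    fin_cases i
    · exact Submodule.projection_apply_mem h x
    · exact Submodule.projection_apply_mem h.symm x
  · intro x
    exact Submodule.projection_add_projection_eq_self h x
  · intro i x hx
    fin_cases i
    · exact Submodule.projection_apply_of_mem_left h hx
    · exact Submodule.projection_apply_of_mem_left h.symm hx
  · intro i j hij x hx
    fin_cases i <;> fin_cases j
    · exact absurd rfl hij
    · exact (Submodule.projection_apply_eq_zero_iff h.symm).2 hx
    · exact (Submodule.projection_apply_eq_zero_iff h).2 hx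
    · exact absurd rfl hij

lemma smul_eq_eval_zero_smul {M : Type*} [AddCommGroup M] [Module ℂ M] [Module ℂ[X] M]
    [IsScalarTower ℂ ℂ[X] M] {m : M} (hm : (.X : ℂ[X]) • m = 0) (q : ℂ[X]) :
    q • m = q.eval 0 • m := by
  conv_lhs => rw [← Polynomial.divX_mul_X_add q]
  rw [add_smul, mul_smul, hm, smul_zero, zero_add, C_smul_eq, Polynomial.coeff_zero_eq_eval_zero]

lemma map_smul_of_map_X_smul {M K : Type*} [AddCommGroup M] [Module ℂ M] [Module ℂ[X] M]
    [IsScalarTower ℂ ℂ[X] M] [AddCommGroup K] [Module ℂ K] (Φ : M →ₗ[ℂ] K)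
    (hΦ : ∀ m, Φ ((.X : ℂ[X]) • m) = 0) (q : ℂ[X]) (m : M) : Φ (q • m) = q.eval 0 • Φ m := by
  conv_lhs => rw [← Polynomial.divX_mul_X_add q]
  rw [add_smul, mul_comm, mul_smul, map_add, hΦ, zero_add, C_smul_eq, map_smul,
    Polynomial.coeff_zero_eq_eval_zero]

/-! ### Scalar forms, and data detecting cohomology classes. -/

namespace ConformalData

section Scalar

variable {R : Type*} [AddCommGroup R] [Module ℂ R]

/-- The scalar form `ℓ ∘ κ` attached to a functional `ℓ` and a `K`-valued form `κ`. -/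
def scalarForm {K : Type*} [AddCommGroup K] [Module ℂ K] (κ : R →ₗ[ℂ] R →ₗ[ℂ] ℂ[X] ⊗[ℂ] K)
    (g : K →ₗ[ℂ] ℂ) : LambdaForm R :=
  κ.compr₂ ((TensorProduct.rid ℂ ℂ[X]).toLinearMap ∘ₗ g.lTensor ℂ[X])

lemma eval_scalarForm {K : Type*} [AddCommGroup K] [Module ℂ K]
    (κ : R →ₗ[ℂ] R →ₗ[ℂ] ℂ[X] ⊗[ℂ] K) (g : K →ₗ[ℂ] ℂ) (a b : R) (z : ℂ) :
    (scalarForm κ g a b).eval z = g (evalAt z (κ a b)) :=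
  eval_rid_lTensor g z _

lemma coeff_scalarForm {K : Type*} [AddCommGroup K] [Module ℂ K]
    (κ : R →ₗ[ℂ] R →ₗ[ℂ] ℂ[X] ⊗[ℂ] K) (g : K →ₗ[ℂ] ℂ) (a b : R) (n : ℕ) :
    (scalarForm κ g a b).coeff n = g (lambdaCoeff n (κ a b)) :=
  coeff_rid_lTensor g n _

variable [Module ℂ[X] R] {ι : Type} [Fintype ι]

/-- The `K`-valued form `∑ ψ_i ⊗ k_i`. -/
def tensorForm {D : ConformalData R} [IsScalarTower ℂ ℂ[X] R] {K : Type*} [AddCommGroup K]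
    [Module ℂ K] (ψ : ι → D.twoCocycles) (k : ι → K) : R →ₗ[ℂ] R →ₗ[ℂ] ℂ[X] ⊗[ℂ] K :=
  ∑ i, (ψ i).1.compr₂ ((TensorProduct.mk ℂ ℂ[X] K).flip (k i))

lemma tensorForm_apply {D : ConformalData R} [IsScalarTower ℂ ℂ[X] R] {K : Type*} [AddCommGroup K]
    [Module ℂ K] (ψ : ι → D.twoCocycles) (k : ι → K) (a b : R) :
    tensorForm ψ k a b = ∑ i, (ψ i).1 a b ⊗ₜ[ℂ] k i := by
  simp [tensorForm, LinearMap.sum_apply]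

lemma scalarForm_tensorForm {D : ConformalData R} [IsScalarTower ℂ ℂ[X] R] {K : Type*}
    [AddCommGroup K] [Module ℂ K] (ψ : ι → D.twoCocycles) (k : ι → K) (g : K →ₗ[ℂ] ℂ) :
    scalarForm (tensorForm ψ k) g = ∑ i, g (k i) • (ψ i).1 := by
  ext1 a; ext1 b
  simp [scalarForm, tensorForm_apply, LinearMap.sum_apply]

/-- The cocycles `ψ_i` are separated by the coefficients of `λ ^ n_i` at `(a_i, b_i)`, which vanish
on trivial cocycles, and cocycles for which these coefficients vanish are trivial. -/
structure IsClassification [IsScalarTower ℂ ℂ[X] R] (D : ConformalData R)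
    (ψ : ι → D.twoCocycles) (a b : ι → R) (n : ι → ℕ) : Prop where
  mem_left : ∀ i, a i ∈ D.parity 0
  mem_right : ∀ i, b i ∈ D.parity 0
  even : ∀ k, ∀ i j, i + j ≠ 0 → ∀ x ∈ D.parity i, ∀ y ∈ D.parity j, (ψ k).1 x y = 0
  coeff_same : ∀ i, ((ψ i).1 (a i) (b i)).coeff (n i) = 1
  coeff_ne : ∀ i j, i ≠ j → ((ψ j).1 (a i) (b i)).coeff (n i) = 0
  coeff_coboundary : ∀ α ∈ D.twoCoboundaries, ∀ i, (α (a i) (b i)).coeff (n i) = 0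
  perfect : Submodule.span ℂ ({x | ∃ r : R, x = (.X : ℂ[X]) • r} ∪
    {x | ∃ n x' y', x = lambdaCoeff n (D.bracket x' y')}) = ⊤
  mem_coboundaries : ∀ α ∈ D.twoCocycles, (∀ i, (α (a i) (b i)).coeff (n i) = 0) →
    α ∈ D.twoCoboundaries

variable [IsScalarTower ℂ ℂ[X] R] {D : ConformalData R} {ψ : ι → D.twoCocycles}
  {a b : ι → R} {n : ι → ℕ}

lemma IsClassification.coeff_sum (h : D.IsClassification ψ a b n) (g : ι → ℂ) (i : ι) :
    ((∑ j, g j • (ψ j).1 : LambdaForm R) (a i) (b i)).coeff (n i) = g i := by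
  simp only [LinearMap.sum_apply, LinearMap.smul_apply, Polynomial.finsetSum_coeff,
    Polynomial.coeff_smul, smul_eq_mul]
  rw [Finset.sum_eq_single i, h.coeff_same, mul_one]
  · intro j _ hj
    rw [h.coeff_ne i j hj.symm, mul_zero]
  · simp

lemma IsClassification.sub_mem_coboundaries (h : D.IsClassification ψ a b n) (α : LambdaForm R)
    (hα : α ∈ D.twoCocycles) :
    α - ∑ j, ((α (a j) (b j)).coeff (n j)) • (ψ j).1 ∈ D.twoCoboundaries := by
  refine h.mem_coboundaries _ (sub_mem hα (sum_mem fun j _ =>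
    Submodule.smul_mem _ _ (ψ j).2)) fun i => ?_
  rw [LinearMap.sub_apply, LinearMap.sub_apply, Polynomial.coeff_sub, h.coeff_sum, sub_self]

lemma IsClassification.linearIndependent (h : D.IsClassification ψ a b n) :
    LinearIndependent ℂ (fun i => D.cls (ψ i)) := by
  rw [Fintype.linearIndependent_iff]
  intro g hg i
  have h1 : (D.twoCoboundaries.submoduleOf D.twoCocycles).mkQ (∑ j, g j • ψ j) = 0 := by
    rw [map_sum, ← hg]
    exact Finset.sum_congr rfl fun j _ => map_smul _ _ _
  rw [Submodule.mkQ_apply, Submodule.Quotient.mk_eq_zero] at h1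
  change ((∑ j, g j • ψ j : D.twoCocycles) : LambdaForm R) ∈ D.twoCoboundaries at h1
  have h2 := h.coeff_coboundary _ h1 i
  rw [← h.coeff_sum g i, ← h2]
  simp

lemma IsClassification.span_eq_top (h : D.IsClassification ψ a b n) :
    Submodule.span ℂ (Set.range fun i => D.cls (ψ i)) = ⊤ := by
  rw [eq_top_iff]
  rintro x -
  obtain ⟨α, rfl⟩ := Submodule.mkQ_surjective _ x
  have h1 := h.sub_mem_coboundaries α.1 α.2
  have h2 : (D.twoCoboundaries.submoduleOf D.twoCocycles).mkQ α =
      ∑ j, ((α.1 (a j) (b j)).coeff (n j)) • D.cls (ψ j) := by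
    have : (D.twoCoboundaries.submoduleOf D.twoCocycles).mkQ
        (α - ∑ j, ((α.1 (a j) (b j)).coeff (n j)) • ψ j) = 0 := by
      rw [Submodule.mkQ_apply, Submodule.Quotient.mk_eq_zero]
      change ((α - ∑ j, ((α.1 (a j) (b j)).coeff (n j)) • ψ j : D.twoCocycles) : LambdaForm R) ∈
        D.twoCoboundaries
      simpa using h1
    rw [map_sub, sub_eq_zero] at this
    rw [this, map_sum]
    exact Finset.sum_congr rfl fun j _ => map_smul _ _ _
  rw [h2]
  exact Submodule.sum_mem _ fun j _ => Submodule.smul_mem _ _ (Submodule.subset_span ⟨j, rfl⟩)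

/-- In a perfect algebra a `K`-valued form is a coboundary as soon as its scalar forms are. -/
lemma exists_eq_lTensor_bracket {K : Type*} [AddCommGroup K] [Module ℂ K]
    (perfect : Submodule.span ℂ ({x | ∃ r : R, x = (.X : ℂ[X]) • r} ∪
      {x | ∃ n x' y', x = lambdaCoeff n (D.bracket x' y')}) = ⊤)
    (κ : R →ₗ[ℂ] R →ₗ[ℂ] ℂ[X] ⊗[ℂ] K) (hκ : ∀ g, scalarForm κ g ∈ D.twoCoboundaries) :
    ∃ Φ : R →ₗ[ℂ] K, (∀ r, Φ ((.X : ℂ[X]) • r) = 0) ∧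
      ∀ x y, κ x y = Φ.lTensor ℂ[X] (D.bracket x y) := by
  choose φ hφ1 hφ2 using hκ
  have hX : ∀ (z : ℂ) (r : R), (.X : ℂ[X]) • z • r = z • (.X : ℂ[X]) • r := fun z r => by
    rw [← C_smul_eq, ← C_smul_eq, smul_smul, smul_smul, mul_comm]
  -- `p` sums coefficients of brackets and an element of `∂R`; perfectness makes it onto. `q`
  -- records the value that the desired map must take on such a sum.
  let p : (ℕ →₀ R ⊗[ℂ] R) × R →ₗ[ℂ] R := LinearMap.coprod
    (Finsupp.lsum ℂ fun n => lambdaCoeff n ∘ₗ TensorProduct.lift D.bracket)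
    { toFun := fun r => (.X : ℂ[X]) • r, map_add' := smul_add _, map_smul' := fun z r => hX z r }
  let q : (ℕ →₀ R ⊗[ℂ] R) × R →ₗ[ℂ] K := LinearMap.coprod
    (Finsupp.lsum ℂ fun n => lambdaCoeff n ∘ₗ TensorProduct.lift κ) 0
  have hp : LinearMap.range p = ⊤ := by
    rw [eq_top_iff, ← perfect, Submodule.span_le]
    rintro _ (⟨r, rfl⟩ | ⟨m, x, y, rfl⟩)
    · exact ⟨(0, r), by simp [p]⟩
    · exact ⟨(Finsupp.single m (x ⊗ₜ y), 0), by simp [p]⟩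
  -- Every functional of `q` factors through `p`. Functionals separate the points of `K`, so `q`
  -- factors through `p`, and composing with any linear section of `p` gives the map.
  have hpq : ∀ g, g ∘ₗ q = φ g ∘ₗ p := by
    intro g
    refine LinearMap.prod_ext ?_ ?_
    · refine Finsupp.lhom_ext' fun m => TensorProduct.ext' fun x y => ?_
      simp only [p, q, LinearMap.comp_apply, LinearMap.coe_inl, LinearMap.coprod_apply,
        Finsupp.lsingle_apply, Finsupp.coe_lsum, map_zero, add_zero, Finsupp.sum_single_index,
        TensorProduct.lift.tmul]
      rw [← coeff_scalarForm, hφ2, coeff_rid_lTensor]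
    · ext r
      simp [p, q, hφ1]
  obtain ⟨s, hs⟩ := p.exists_rightInverse_of_surjective hp
  have key : ∀ g r, g (q (s r)) = φ g r := fun g r => by
    have := LinearMap.congr_fun (hpq g) (s r)
    rw [LinearMap.comp_apply, LinearMap.comp_apply] at this
    rw [this, ← LinearMap.comp_apply p, hs, LinearMap.id_apply]
  refine ⟨q ∘ₗ s, fun r => ?_, fun x y => ?_⟩
  · rw [← Module.forall_dual_apply_eq_zero_iff ℂ]
    intro g
    rw [LinearMap.comp_apply, key, hφ1]
  · rw [← sub_eq_zero]
    refine eq_zero_of_lambdaCoeff _ fun m => ?_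
    rw [← Module.forall_dual_apply_eq_zero_iff ℂ]
    intro g
    rw [map_sub, map_sub, lambdaCoeff_lTensor, LinearMap.comp_apply, key, ← coeff_scalarForm,
      hφ2, coeff_rid_lTensor, sub_self]

end Scalar

end ConformalData

lemma eq_zero_or_eq_one_zmod (i : ZMod 2) : i = 0 ∨ i = 1 := by
  fin_cases i
  · exact Or.inl rfl
  · exact Or.inr rfl

/-! ### From a central extension with a section to a cocycle. -/

namespace ConformalData

section Extensions

variable {R : Type} [AddCommGroup R] [Module ℂ R] [Module ℂ[X] R] [IsScalarTower ℂ ℂ[X] R]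
variable {K : Type u} [AddCommGroup K] [Module ℂ K]
variable {D : ConformalData R} {P : ZMod 2 → Submodule ℂ K}

lemma exists_parity_decomposition {R : Type*} [AddCommGroup R] [Module ℂ R] [Module ℂ[X] R]
    [IsScalarTower ℂ ℂ[X] R] {D : ConformalData R} (hD : D.IsLie) (x : R) :
    ∃ x₀ ∈ D.parity 0, ∃ x₁ ∈ D.parity 1, x = x₀ + x₁ := by
  have : x ∈ D.parity 0 ⊔ D.parity 1 := by rw [hD.isCompl.sup_eq_top]; trivial
  obtain ⟨y, hy, z, hz, h⟩ := Submodule.mem_sup.1 this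
  exact ⟨y, hy, z, hz, h.symm⟩

namespace CentralExtension

/-- Both `K` and `E` are direct sums of their parts, so an injective map respecting parity also
reflects it. -/
lemma mem_of_incl_mem (hP : IsCompl (P 0) (P 1)) (A : CentralExtension D P) (i : ZMod 2) (k : K)
    (hk : A.incl k ∈ A.str.parity i) : k ∈ P i := by
  have hk' : k ∈ P 0 ⊔ P 1 := by rw [hP.sup_eq_top]; trivial
  obtain ⟨k₀, h0, k₁, h1, rfl⟩ := Submodule.mem_sup.1 hk'
  have hd := Submodule.disjoint_def.1 A.isLie.isCompl.disjoint
  have e0 := A.incl_parity 0 k₀ h0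
  have e1 := A.incl_parity 1 k₁ h1
  rw [map_add] at hk
  rcases eq_zero_or_eq_one_zmod i with rfl | rfl
  · have h2 : A.incl k₁ = 0 := hd _ (by simpa using sub_mem hk e0) e1
    rw [A.incl_injective (h2.trans (map_zero _).symm)]
    simpa using h0
  · have h2 : A.incl k₀ = 0 := hd _ e0 (by simpa using sub_mem hk e1)
    rw [A.incl_injective (h2.trans (map_zero _).symm)]
    simpa using h1

/-- The given splitting may mix parities. Its even part is again a section because the projection
respects parity. -/
lemma exists_even_section (hD : D.IsLie) (A : CentralExtension D P) :
    ∃ s : R →ₗ[ℂ[X]] A.E, (∀ i, ∀ a ∈ D.parity i, s a ∈ A.str.parity i) ∧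
      A.proj ∘ₗ s = LinearMap.id := by
  obtain ⟨s, hs⟩ := A.split
  obtain ⟨π, p1, p2, p3, p4⟩ := hD.isCompl.exists_projections
  obtain ⟨ρ, r1, r2, r3, r4⟩ := A.isLie.isCompl.exists_projections
  have hs' : ∀ a, A.proj (s a) = a := fun a => LinearMap.congr_fun hs a
  have hproj : ∀ i, ∀ x ∈ D.parity i, A.proj (ρ i (s x)) = x := by
    intro i x hx
    have e := congrArg A.proj (r2 (s x))
    rw [map_add, hs'] at e
    have m0 := A.proj_parity 0 _ (r1 0 (s x))
    have m1 := A.proj_parity 1 _ (r1 1 (s x))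
    have hd := Submodule.disjoint_def.1 hD.isCompl.disjoint
    rcases eq_zero_or_eq_one_zmod i with rfl | rfl
    · have : A.proj (ρ 1 (s x)) = 0 := hd _ (by
        rw [← e] at hx
        simpa using sub_mem hx m0) m1
      simpa [this] using e
    · have : A.proj (ρ 0 (s x)) = 0 := hd _ m0 (by
        rw [← e] at hx
        simpa using sub_mem hx m1)
      simpa [this] using e
  refine ⟨ρ 0 ∘ₗ s ∘ₗ π 0 + ρ 1 ∘ₗ s ∘ₗ π 1, ?_, ?_⟩
  · intro i a ha
    simp only [LinearMap.add_apply, LinearMap.comp_apply]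
    rcases eq_zero_or_eq_one_zmod i with rfl | rfl
    · rw [p4 0 1 (by decide) a ha, map_zero, map_zero, add_zero]
      exact r1 0 _
    · rw [p4 1 0 (by decide) a ha, map_zero, map_zero, zero_add]
      exact r1 1 _
  · ext1 x
    simp only [LinearMap.add_apply, LinearMap.comp_apply, LinearMap.id_apply, map_add]
    rw [hproj 0 _ (p1 0 x), hproj 1 _ (p1 1 x), p2]

lemma exists_form (A : CentralExtension D P) (s : R →ₗ[ℂ[X]] A.E)
    (hs : A.proj ∘ₗ s = LinearMap.id) :
    ∃ κ : R →ₗ[ℂ] R →ₗ[ℂ] ℂ[X] ⊗[ℂ] K, ∀ a b, A.str.bracket (s a) (s b) =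
      (s.restrictScalars ℂ).lTensor ℂ[X] (D.bracket a b) + A.incl.lTensor ℂ[X] (κ a b) := by
  obtain ⟨g, hg⟩ := A.incl.exists_leftInverse_of_injective
    (LinearMap.ker_eq_bot.2 A.incl_injective)
  let ν : R →ₗ[ℂ] R →ₗ[ℂ] ℂ[X] ⊗[ℂ] A.E :=
    LinearMap.mk₂ ℂ (fun a b => A.str.bracket (s.restrictScalars ℂ a) (s.restrictScalars ℂ b) -
        (s.restrictScalars ℂ).lTensor ℂ[X] (D.bracket a b))
      (fun a a' b => by simp only [map_add, LinearMap.add_apply]; abel)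
      (fun z a b => by simp only [map_smul, LinearMap.smul_apply, smul_sub])
      (fun a a' b => by simp only [map_add]; abel)
      (fun z a b => by simp only [map_smul, smul_sub])
  have hex : Function.Exact (A.incl.lTensor ℂ[X]) ((A.proj.restrictScalars ℂ).lTensor ℂ[X]) :=
    lTensor_exact ℂ[X] (f := A.incl) (g := A.proj.restrictScalars ℂ) A.exact A.proj_surjective
  have hs' : ∀ a, A.proj (s a) = a := fun a => LinearMap.congr_fun hs a
  have hid : (A.proj.restrictScalars ℂ) ∘ₗ (s.restrictScalars ℂ) = LinearMap.id :=
    LinearMap.ext hs'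
  refine ⟨ν.compr₂ (g.lTensor ℂ[X]), fun a b => ?_⟩
  -- The defect of `s` dies in `ℂ[λ] ⊗ R`; right exactness of the tensor product puts it in the
  -- image of `ℂ[λ] ⊗ K`.
  have h1 : (A.proj.restrictScalars ℂ).lTensor ℂ[X] (ν a b) = 0 := by
    simp only [ν, LinearMap.mk₂_apply, map_sub]
    rw [A.proj_bracket, LinearMap.coe_restrictScalars, hs', hs', ← LinearMap.comp_apply,
      ← LinearMap.lTensor_comp, hid, LinearMap.lTensor_id, LinearMap.id_apply, sub_self]
  obtain ⟨y, hy⟩ := (hex _).1 h1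
  have h2 : A.incl.lTensor ℂ[X] (g.lTensor ℂ[X] (ν a b)) = ν a b := by
    rw [← hy, ← LinearMap.comp_apply (g.lTensor _), ← LinearMap.lTensor_comp, hg,
      LinearMap.lTensor_id, LinearMap.id_apply]
  rw [LinearMap.compr₂_apply, h2]
  simp [ν]

/-- Centrality is built into the definition on the left only; skew-commutativity, applied to
homogeneous parts, carries it to the right. -/
lemma bracket_incl_right (hP : IsCompl (P 0) (P 1)) (A : CentralExtension D P) (x : A.E) (k : K) :
    A.str.bracket x (A.incl k) = 0 := by
  have hk' : k ∈ P 0 ⊔ P 1 := by rw [hP.sup_eq_top]; trivial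
  obtain ⟨k₀, h0, k₁, h1, rfl⟩ := Submodule.mem_sup.1 hk'
  obtain ⟨x₀, m0, x₁, m1, rfl⟩ := exists_parity_decomposition A.isLie x
  have key : ∀ i j, ∀ k ∈ P i, ∀ x ∈ A.str.parity j, A.str.bracket x (A.incl k) = 0 := by
    intro i j k hk x hx
    refine ext_evalAt fun z => ?_
    rw [← brk_C, A.isLie.skew i j _ (A.incl_parity i k hk) x hx, brk, A.central]
    simp
  simp only [map_add, LinearMap.add_apply]
  rw [key 0 0 _ h0 _ m0, key 0 1 _ h0 _ m1, key 1 0 _ h1 _ m0, key 1 1 _ h1 _ m1]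
  simp

/-- As `∂` kills `K`, substituting `p(∂)` for `λ` in the `K`-component only sees the value of `p` at
`0`. -/
lemma brk_section (A : CentralExtension D P) (s : R →ₗ[ℂ[X]] A.E)
    (κ : R →ₗ[ℂ] R →ₗ[ℂ] ℂ[X] ⊗[ℂ] K)
    (hκ : ∀ a b, A.str.bracket (s a) (s b) =
      (s.restrictScalars ℂ).lTensor ℂ[X] (D.bracket a b) + A.incl.lTensor ℂ[X] (κ a b))
    (p : ℂ[X]) (a b : R) :
    A.str.brk p (s a) (s b) = s (D.brk p a b) + A.incl (evalAt (p.eval 0) (κ a b)) := by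
  rw [brk, hκ, map_add, substAt_lTensor, substAt_lTensor_of_X_smul _ A.partial_incl]
  rfl

lemma lambdaCoeff_form_mem (A : CentralExtension D P) (s : R →ₗ[ℂ[X]] A.E)
    (κ : R →ₗ[ℂ] R →ₗ[ℂ] ℂ[X] ⊗[ℂ] K)
    (hκ : ∀ a b, A.str.bracket (s a) (s b) =
      (s.restrictScalars ℂ).lTensor ℂ[X] (D.bracket a b) + A.incl.lTensor ℂ[X] (κ a b))
    (hD : D.IsLie) (hP : IsCompl (P 0) (P 1))
    (hs : ∀ i, ∀ a ∈ D.parity i, s a ∈ A.str.parity i) (i j : ZMod 2) (a b : R)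
    (ha : a ∈ D.parity i) (hb : b ∈ D.parity j) (n : ℕ) :
    lambdaCoeff n (κ a b) ∈ P (i + j) := by
  refine A.mem_of_incl_mem hP _ _ ?_
  have h := congrArg (lambdaCoeff n) (hκ a b)
  rw [map_add, lambdaCoeff_lTensor, lambdaCoeff_lTensor] at h
  have e : A.incl (lambdaCoeff n (κ a b)) = lambdaCoeff n (A.str.bracket (s a) (s b)) -
      s (lambdaCoeff n (D.bracket a b)) := by
    rw [h]; simp
  rw [e]
  refine sub_mem ?_ (hs _ _ ?_)
  · exact (nthProduct_mem_iff _ _ _ _).1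
      (A.isLie.parity_bracket i j _ (hs i a ha) _ (hs j b hb) n)
  · exact (nthProduct_mem_iff _ _ _ _).1 (hD.parity_bracket i j _ ha _ hb n)

/-- Each cocycle axiom is the `K`-component of the corresponding axiom of `E`, once the axiom of `R`
is cancelled. -/
lemma scalarForm_mem_twoCocycles (A : CentralExtension D P) (s : R →ₗ[ℂ[X]] A.E)
    (κ : R →ₗ[ℂ] R →ₗ[ℂ] ℂ[X] ⊗[ℂ] K)
    (hκ : ∀ a b, A.str.bracket (s a) (s b) =
      (s.restrictScalars ℂ).lTensor ℂ[X] (D.bracket a b) + A.incl.lTensor ℂ[X] (κ a b))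
    (hD : D.IsLie) (hP : IsCompl (P 0) (P 1))
    (hs : ∀ i, ∀ a ∈ D.parity i, s a ∈ A.str.parity i) (g : K →ₗ[ℂ] ℂ) :
    scalarForm κ g ∈ D.twoCocycles := by
  have hb := A.brk_section s κ hκ
  have hb' : ∀ (z : ℂ) a b, A.str.brk (.C z) (s a) (s b) =
      s (D.brk (.C z) a b) + A.incl (evalAt z (κ a b)) := fun z a b => by
    rw [hb, Polynomial.eval_C]
  have hX := A.partial_incl
  refine ⟨fun a b => ?_, fun a b => ?_, fun i j a ha b hb'' => ?_, fun i j a ha b hb'' c z w => ?_⟩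
  · refine Polynomial.funext fun z => ?_
    have h := A.isLie.sesq_left z (s a) (s b)
    rw [← map_smul, hb', hb', hD.sesq_left] at h
    have : evalAt z (κ ((.X : ℂ[X]) • a) b) = -(z • evalAt z (κ a b)) := by
      apply A.incl_injective
      rw [← C_smul_eq, ← C_smul_eq, map_neg, map_smul, smul_add, neg_add, add_right_inj] at h
      rw [h, map_neg, map_smul, C_smul_eq]
    rw [eval_scalarForm, this]
    simp [eval_scalarForm]
  · refine Polynomial.funext fun z => ?_
    have h := A.isLie.sesq_right z (s a) (s b)
    rw [← map_smul, hb', hb', hD.sesq_right, map_smul] at h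
    have : evalAt z (κ a ((.X : ℂ[X]) • b)) = z • evalAt z (κ a b) := by
      apply A.incl_injective
      rw [smul_add, add_right_inj] at h
      rw [h, smul_eq_eval_zero_smul (m := A.incl (evalAt z (κ a b))) (hX _), map_smul]
      simp
    rw [eval_scalarForm, this]
    simp [eval_scalarForm]
  · refine Polynomial.funext fun z => ?_
    have h := A.isLie.skew i j (s a) (hs i a ha) (s b) (hs j b hb'') z
    rw [hb', hb, hD.skew i j a ha b hb''] at h
    have : evalAt z (κ b a) = -(koszulSign i j • evalAt (-z) (κ a b)) := by
      apply A.incl_injective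
      rw [map_neg, map_smul]
      rw [map_neg, ← C_smul_eq, ← C_smul_eq, map_smul, smul_add, neg_add, add_right_inj] at h
      rw [h, C_smul_eq]
      simp
    rw [eval_scalarForm, this]
    simp [eval_scalarForm]
  · have h := A.isLie.jacobi i j (s a) (hs i a ha) (s b) (hs j b hb'') (s c) z w
    have hz : ∀ p x k, A.str.brk p x (A.incl k) = 0 := fun p x k => by
      rw [brk, A.bracket_incl_right hP, map_zero]
    have hz' : ∀ p x k, A.str.brk p (A.incl k) x = 0 := fun p x k => by
      rw [brk, A.central, map_zero]
    rw [hb', hb', hb', brk_add_right, brk_add_right, brk_add_left, hz, hz, hz', hb', hb', hb',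
      hD.jacobi i j a ha b hb''] at h
    have : evalAt z (κ a (D.brk (.C w) b c)) = evalAt (z + w) (κ (D.brk (.C z) a b) c) +
        koszulSign i j • evalAt w (κ b (D.brk (.C z) a c)) := by
      apply A.incl_injective
      rw [map_add, map_smul]
      rw [map_add, ← C_smul_eq, ← C_smul_eq, map_smul, add_zero, add_zero, add_zero, smul_add,
        C_smul_eq] at h
      rw [← C_smul_eq, C_smul_eq] at h ⊢
      simp only [C_smul_eq] at h ⊢
      have h2 := h
      rw [add_add_add_comm, add_right_inj] at h2
      exact h2
    rw [eval_scalarForm, this]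
    simp [eval_scalarForm]

end CentralExtension

end Extensions

end ConformalData

/-- If `∂` acts by zero, a subspace is a `ℂ[∂]`-submodule. -/
def submoduleOfXSMul {K : Type*} [AddCommGroup K] [Module ℂ K] [Module ℂ[X] K]
    [IsScalarTower ℂ ℂ[X] K] (hX : ∀ k : K, (.X : ℂ[X]) • k = 0) (P : Submodule ℂ K) :
    Submodule ℂ[X] K where
  carrier := P
  zero_mem' := P.zero_mem
  add_mem' := P.add_mem
  smul_mem' p k hk := by
    rw [smul_eq_eval_zero_smul (hX k)]
    exact P.smul_mem _ hk

/-! ### The extension built from a vector-valued cocycle. -/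

namespace ConformalData

section CocycleExtension

variable {R : Type} [AddCommGroup R] [Module ℂ R] [Module ℂ[X] R] [IsScalarTower ℂ ℂ[X] R]
variable {K : Type u} [AddCommGroup K] [Module ℂ K] [Module ℂ[X] K] [IsScalarTower ℂ ℂ[X] K]

/-- The conformal structure on `R ⊕ K` given by a `K`-valued form on `R`. -/
def cocycleData (D : ConformalData R) (hX : ∀ k : K, (.X : ℂ[X]) • k = 0)
    (P : ZMod 2 → Submodule ℂ K)
    (κ : R →ₗ[ℂ] R →ₗ[ℂ] ℂ[X] ⊗[ℂ] K) : ConformalData (R × K) where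
  parity i := (D.parity i).prod (submoduleOfXSMul hX (P i))
  bracket := LinearMap.mk₂ ℂ
    (fun x y => ((LinearMap.inl ℂ[X] R (K)).restrictScalars ℂ).lTensor ℂ[X]
        (D.bracket x.1 y.1) +
      (LinearMap.inr ℂ R (K)).lTensor ℂ[X] (κ x.1 y.1))
    (fun a a' b => by simp only [Prod.fst_add, map_add, LinearMap.add_apply]; abel)
    (fun z a b => by simp only [Prod.smul_fst, map_smul, LinearMap.smul_apply, smul_add])
    (fun a b b' => by simp only [Prod.fst_add, map_add]; abel)
    (fun z a b => by simp only [Prod.smul_fst, map_smul, smul_add])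

variable {D : ConformalData R} {hX : ∀ k : K, (.X : ℂ[X]) • k = 0} {P : ZMod 2 → Submodule ℂ K}
  {κ : R →ₗ[ℂ] R →ₗ[ℂ] ℂ[X] ⊗[ℂ] K}

lemma cocycleData_bracket (x y : R × K) : (cocycleData D hX P κ).bracket x y =
    ((LinearMap.inl ℂ[X] R (K)).restrictScalars ℂ).lTensor ℂ[X] (D.bracket x.1 y.1) +
      (LinearMap.inr ℂ R (K)).lTensor ℂ[X] (κ x.1 y.1) := rfl

lemma cocycleData_brk (p : ℂ[X]) (x y : R × K) :
    (cocycleData D hX P κ).brk p x y = (D.brk p x.1 y.1, evalAt (p.eval 0) (κ x.1 y.1)) := by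
  rw [brk, cocycleData_bracket, map_add, substAt_lTensor]
  rw [substAt_lTensor_of_X_smul _ fun k => Prod.ext (smul_zero _) (hX k)]
  simp only [LinearMap.inl_apply, LinearMap.inr_apply, Prod.mk_add_mk, add_zero, zero_add]
  rfl

/-- Functionals separate the points of `K`, so the `K`-component of each axiom reduces to the scalar
cocycle axioms. -/
lemma cocycleData_isLie (hD : D.IsLie) (hP : IsCompl (P 0) (P 1))
    (hκ : ∀ g : K →ₗ[ℂ] ℂ, scalarForm κ g ∈ D.twoCocycles)
    (hpar : ∀ i j, ∀ a ∈ D.parity i, ∀ b ∈ D.parity j, ∀ n, lambdaCoeff n (κ a b) ∈ P (i + j)) :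
    (cocycleData D hX P κ).IsLie where
  isCompl := by
    refine ⟨?_, ?_⟩
    · rw [Submodule.disjoint_def]
      rintro ⟨x, k⟩ ⟨h1, h2⟩ ⟨h3, h4⟩
      exact Prod.ext (Submodule.disjoint_def.1 hD.isCompl.disjoint x h1 h3)
        (Submodule.disjoint_def.1 hP.disjoint k h2 h4)
    · rw [codisjoint_iff, eq_top_iff]
      rintro ⟨x, k⟩ -
      have hk : k ∈ P 0 ⊔ P 1 := by rw [hP.sup_eq_top]; trivial
      obtain ⟨k₀, h0, k₁, h1, rfl⟩ := Submodule.mem_sup.1 hk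
      obtain ⟨x₀, m0, x₁, m1, rfl⟩ := exists_parity_decomposition hD x
      exact Submodule.mem_sup.2 ⟨(x₀, k₀), ⟨m0, h0⟩, (x₁, k₁), ⟨m1, h1⟩, rfl⟩
  parity_bracket i j a ha b hb n := by
    refine (forall_nthProduct_mem_iff _ _ _).2 (fun z => ?_) n
    rw [cocycleData_brk]
    refine ⟨hD.brk_mem_parity ha.1 hb.1 _, ?_⟩
    change evalAt _ (κ a.1 b.1) ∈ P (i + j)
    obtain ⟨M, hM⟩ := exists_eq_sum_lambdaCoeff (κ a.1 b.1)
    rw [hM M le_rfl, map_sum]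
    refine sum_mem fun n _ => ?_
    rw [evalAt_tmul]
    exact Submodule.smul_mem _ _ (hpar i j _ ha.1 _ hb.1 n)
  sesq_left z a b := by
    have e : evalAt z (κ ((.X : ℂ[X]) • a.1) b.1) = -(z • evalAt z (κ a.1 b.1)) := by
      rw [← sub_eq_zero, ← Module.forall_dual_apply_eq_zero_iff ℂ]
      intro g
      rw [map_sub, map_neg, ← eval_scalarForm, (hκ g).1, map_smul, ← eval_scalarForm]
      simp
    rw [cocycleData_brk, cocycleData_brk]
    refine Prod.ext (hD.sesq_left z a.1 b.1) ?_
    simpa using e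
  sesq_right z a b := by
    have e : evalAt z (κ a.1 ((.X : ℂ[X]) • b.1)) = z • evalAt z (κ a.1 b.1) := by
      rw [← sub_eq_zero, ← Module.forall_dual_apply_eq_zero_iff ℂ]
      intro g
      rw [map_sub, ← eval_scalarForm, (hκ g).2.1, map_smul, ← eval_scalarForm]
      simp
    rw [cocycleData_brk, cocycleData_brk]
    refine Prod.ext (hD.sesq_right z a.1 b.1) ?_
    simpa [add_smul, hX, C_smul_eq] using e
  skew i j a ha b hb z := by
    have e : evalAt z (κ b.1 a.1) = -(koszulSign i j • evalAt (-z) (κ a.1 b.1)) := by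
      rw [← sub_eq_zero, ← Module.forall_dual_apply_eq_zero_iff ℂ]
      intro g
      rw [map_sub, map_neg, map_smul, ← eval_scalarForm, ← eval_scalarForm,
        (hκ g).2.2.1 i j a.1 ha.1 b.1 hb.1]
      simp
    rw [cocycleData_brk, cocycleData_brk]
    refine Prod.ext (hD.skew i j a.1 ha.1 b.1 hb.1 z) ?_
    simpa using e
  jacobi i j a ha b hb c z w := by
    have e : evalAt z (κ a.1 (D.brk (.C w) b.1 c.1)) =
        evalAt (z + w) (κ (D.brk (.C z) a.1 b.1) c.1) +
        koszulSign i j • evalAt w (κ b.1 (D.brk (.C z) a.1 c.1)) := by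
      rw [← sub_eq_zero, ← Module.forall_dual_apply_eq_zero_iff ℂ]
      intro g
      rw [map_sub, map_add, map_smul, ← eval_scalarForm, ← eval_scalarForm, ← eval_scalarForm,
        (hκ g).2.2.2 i j a.1 ha.1 b.1 hb.1]
      simp
    simp only [cocycleData_brk]
    refine Prod.ext (hD.jacobi i j a.1 ha.1 b.1 hb.1 c.1 z w) ?_
    simpa using e

/-- The central extension given by a `K`-valued cocycle. -/
def cocycleExtension (hL : (cocycleData D hX P κ).IsLie) :
    CentralExtension D P where
  E := R × K
  str := cocycleData D hX P κ
  isLie := hL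
  incl := LinearMap.inr ℂ R (K)
  proj := LinearMap.fst ℂ[X] R (K)
  incl_parity i k hk := ⟨(D.parity i).zero_mem, hk⟩
  proj_parity i x hx := hx.1
  incl_injective := LinearMap.inr_injective
  proj_surjective := LinearMap.fst_surjective
  exact := by
    rintro ⟨x, k⟩
    constructor
    · intro h
      exact ⟨k, Prod.ext (Eq.symm h) rfl⟩
    · rintro ⟨k', h⟩
      rw [← h]
      rfl
  proj_bracket x y := by
    refine ext_evalAt fun z => ?_
    rw [evalAt_lTensor, ← brk_C, ← brk_C, cocycleData_brk]
    rfl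
  central k x := by
    refine ext_evalAt fun z => ?_
    rw [← brk_C, cocycleData_brk]
    simp only [LinearMap.inr_apply, brk_zero_left, map_zero, LinearMap.zero_apply]
    rfl
  partial_incl k := Prod.ext (smul_zero _) (hX k)
  split := ⟨LinearMap.inl ℂ[X] R (K), LinearMap.ext fun x => rfl⟩

lemma cocycleExtension_isGivenBy (hL : (cocycleData D hX P κ).IsLie) :
    (cocycleExtension hL).IsGivenBy fun a b => κ a b :=
  ⟨LinearMap.inl ℂ[X] R (K), fun i _ ha => ⟨ha, (P i).zero_mem⟩,
    LinearMap.ext fun _ => rfl, fun _ _ => rfl⟩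

end CocycleExtension

end ConformalData

/-! ### Extensions up to equivalence and families of even vectors. -/

namespace ConformalData

section Parameterize

variable {R : Type} [AddCommGroup R] [Module ℂ R] [Module ℂ[X] R] [IsScalarTower ℂ ℂ[X] R]
  {D : ConformalData R} {ι : Type} [Fintype ι] {ψ : ι → D.twoCocycles} {a b : ι → R} {n : ι → ℕ}

lemma lambdaCoeff_tensorForm {K : Type*} [AddCommGroup K] [Module ℂ K] (k : ι → K) (x y : R)
    (m : ℕ) : lambdaCoeff m (tensorForm ψ k x y) = ∑ i, ((ψ i).1 x y).coeff m • k i := by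
  simp [tensorForm_apply, lambdaCoeff_tmul]

lemma IsClassification.lambdaCoeff_tensorForm_mem (h : D.IsClassification ψ a b n)
    {K : Type u} [AddCommGroup K] [Module ℂ K] {P : ZMod 2 → Submodule ℂ K} {k : ι → K}
    (hk : ∀ i, k i ∈ P 0) (i j : ZMod 2) (x : R) (hx : x ∈ D.parity i) (y : R)
    (hy : y ∈ D.parity j) (m : ℕ) : lambdaCoeff m (tensorForm ψ k x y) ∈ P (i + j) := by
  rw [lambdaCoeff_tensorForm]
  refine sum_mem fun l _ => ?_
  by_cases hij : i + j = 0
  · rw [hij]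
    exact Submodule.smul_mem _ _ (hk l)
  · rw [h.even l i j hij x hx y hy, Polynomial.coeff_zero, zero_smul]
    exact zero_mem _

lemma IsClassification.exists_extension (h : D.IsClassification ψ a b n) (hD : D.IsLie)
    (K : Type u) [AddCommGroup K] [Module ℂ K] (P : ZMod 2 → Submodule ℂ K)
    (hP : IsCompl (P 0) (P 1)) (k : ι → K) (hk : ∀ i, k i ∈ P 0) :
    ∃ A : CentralExtension D P, A.IsGivenBy fun x y => ∑ i, (ψ i).1 x y ⊗ₜ[ℂ] k i := by
  -- Evaluation of polynomials at `0` is the `ℂ[∂]`-structure on `K` for which `∂` acts by zero.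
  let _ : Module ℂ[X] K := Module.compHom K (Polynomial.evalRingHom (0 : ℂ))
  have hs : ∀ (p : ℂ[X]) (v : K), p • v = p.eval 0 • v := fun p v => rfl
  have : IsScalarTower ℂ ℂ[X] K := ⟨fun z p v => by
    rw [hs, hs, Polynomial.eval_smul, smul_assoc]⟩
  have hX : ∀ v : K, (.X : ℂ[X]) • v = 0 := fun v => by rw [hs]; simp
  have hL : (cocycleData D hX P (tensorForm ψ k)).IsLie := by
    refine cocycleData_isLie hD hP (fun g => ?_) (h.lambdaCoeff_tensorForm_mem hk)
    rw [scalarForm_tensorForm]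
    exact sum_mem fun i _ => Submodule.smul_mem _ _ (ψ i).2
  refine ⟨cocycleExtension hL, ?_⟩
  have := cocycleExtension_isGivenBy hL
  simpa only [tensorForm_apply] using this

lemma IsClassification.exists_parameter (h : D.IsClassification ψ a b n) (hD : D.IsLie)
    (K : Type u) [AddCommGroup K] [Module ℂ K] (P : ZMod 2 → Submodule ℂ K)
    (hP : IsCompl (P 0) (P 1)) (A : CentralExtension D P) :
    ∃ k : ι → K, (∀ i, k i ∈ P 0) ∧ A.IsGivenBy fun x y => ∑ i, (ψ i).1 x y ⊗ₜ[ℂ] k i := by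
  obtain ⟨s, hs, hid⟩ := A.exists_even_section hD
  obtain ⟨κ, hκ⟩ := A.exists_form s hid
  have hpar := A.lambdaCoeff_form_mem s κ hκ hD hP hs
  let k : ι → K := fun i => lambdaCoeff (n i) (κ (a i) (b i))
  have hk : ∀ i, k i ∈ P 0 := fun i => by
    simpa using hpar 0 0 _ _ (h.mem_left i) (h.mem_right i) (n i)
  let κ' := κ + tensorForm ψ (fun i => -k i)
  have hneg : ∀ x y, κ' x y = κ x y - tensorForm ψ k x y := fun x y => by
    simp [κ', tensorForm_apply, TensorProduct.tmul_neg, sub_eq_add_neg]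
  have hκ' : ∀ g : K →ₗ[ℂ] ℂ, scalarForm κ' g ∈ D.twoCoboundaries := by
    intro g
    have h1 := h.sub_mem_coboundaries _ (A.scalarForm_mem_twoCocycles s κ hκ hD hP hs g)
    have h2 : scalarForm κ' g = scalarForm κ g -
        ∑ j, ((scalarForm κ g (a j) (b j)).coeff (n j)) • (ψ j).1 := by
      have : scalarForm κ' g = scalarForm κ g - scalarForm (tensorForm ψ k) g := by
        ext1 x; ext1 y
        simp [scalarForm, hneg]
      rw [this, scalarForm_tensorForm]
      simp only [coeff_scalarForm, k]
    rw [h2]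
    exact h1
  obtain ⟨Φ, hΦ1, hΦ2⟩ := exists_eq_lTensor_bracket h.perfect κ' hκ'
  obtain ⟨π, p1, p2, p3, p4⟩ := hD.isCompl.exists_projections
  obtain ⟨ρ, r1, r2, r3, r4⟩ := hP.exists_projections
  -- `Φ` may mix parities while `κ'` respects them. The parity-preserving part of `Φ` has the same
  -- coboundary, and it keeps the corrected section even.
  let Ψ : R →ₗ[ℂ] K := ρ 0 ∘ₗ Φ ∘ₗ (π 0).restrictScalars ℂ + ρ 1 ∘ₗ Φ ∘ₗ (π 1).restrictScalars ℂ
  have hΨpar : ∀ i, ∀ x ∈ D.parity i, Ψ x = ρ i (Φ x) := by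
    intro i x hx
    simp only [Ψ, LinearMap.add_apply, LinearMap.comp_apply, LinearMap.coe_restrictScalars]
    rcases eq_zero_or_eq_one_zmod i with rfl | rfl
    · rw [p4 0 1 (by decide) x hx, p3 0 x hx, map_zero, map_zero, add_zero]
    · rw [p4 1 0 (by decide) x hx, p3 1 x hx, map_zero, map_zero, zero_add]
  have hΨX : ∀ r, Ψ ((.X : ℂ[X]) • r) = 0 := fun r => by
    simp only [Ψ, LinearMap.add_apply, LinearMap.comp_apply, LinearMap.coe_restrictScalars,
      map_smul, hΦ1, map_zero, add_zero]
  clear_value Ψ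
  have hpar' : ∀ i j, ∀ x ∈ D.parity i, ∀ y ∈ D.parity j, ∀ m,
      lambdaCoeff m (κ' x y) ∈ P (i + j) := fun i j x hx y hy m => by
    rw [hneg, map_sub]
    exact sub_mem (hpar i j x y hx hy m) (h.lambdaCoeff_tensorForm_mem hk i j x hx y hy m)
  have hhom : ∀ i j, ∀ x ∈ D.parity i, ∀ y ∈ D.parity j,
      κ' x y = Ψ.lTensor ℂ[X] (D.bracket x y) := by
    intro i j x hx y hy
    rw [← sub_eq_zero]
    refine eq_zero_of_lambdaCoeff _ fun m => ?_
    rw [map_sub, sub_eq_zero, lambdaCoeff_lTensor, hΨpar (i + j) _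
      ((nthProduct_mem_iff _ _ _ _).1 (hD.parity_bracket i j x hx y hy m)),
      ← lambdaCoeff_lTensor, ← hΦ2, r3 _ _ (hpar' i j x hx y hy m)]
  have hall : ∀ x y, κ' x y = Ψ.lTensor ℂ[X] (D.bracket x y) := by
    intro x y
    obtain ⟨x₀, m0, x₁, m1, rfl⟩ := exists_parity_decomposition hD x
    obtain ⟨y₀, l0, y₁, l1, rfl⟩ := exists_parity_decomposition hD y
    simp only [map_add, LinearMap.add_apply]
    rw [hhom 0 0 _ m0 _ l0, hhom 0 1 _ m0 _ l1, hhom 1 0 _ m1 _ l0, hhom 1 1 _ m1 _ l1]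
  -- The map is `ℂ[∂]`-linear because `Ψ` kills `∂R` and `∂` kills `K`. Adding it to `s` absorbs the
  -- coboundary part of `κ`.
  let t : R →ₗ[ℂ[X]] A.E :=
    { toFun := fun x => A.incl (Ψ x)
      map_add' := fun x y => by rw [map_add, map_add]
      map_smul' := fun p x => by
        rw [map_smul_of_map_X_smul Ψ hΨX, map_smul, RingHom.id_apply,
          smul_eq_eval_zero_smul (A.partial_incl _)] }
  have ht : ∀ x, t x = A.incl (Ψ x) := fun x => rfl
  refine ⟨k, hk, s + t, fun i x hx => add_mem (hs i x hx) (A.incl_parity i _ ?_), ?_,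
    fun x y => ?_⟩
  · rw [hΨpar i x hx]
    exact r1 i _
  · ext1 x
    have e1 : A.proj (s x) = x := LinearMap.congr_fun hid x
    have e2 : A.proj (A.incl (Ψ x)) = 0 := (A.exact _).2 ⟨_, rfl⟩
    simp [ht, e1, e2]
  · have e1 : κ x y = Ψ.lTensor ℂ[X] (D.bracket x y) + tensorForm ψ k x y := by
      rw [← hall, hneg, sub_add_cancel]
    have e2 : (s + t).restrictScalars ℂ = s.restrictScalars ℂ + A.incl ∘ₗ Ψ := rfl
    rw [LinearMap.add_apply, LinearMap.add_apply, ht, ht, (A.str.bracket _).map_add,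
      A.bracket_incl_right hP, A.str.bracket.map_add, LinearMap.add_apply, A.central, hκ, e1, e2,
      LinearMap.lTensor_add, LinearMap.add_apply, LinearMap.lTensor_comp_apply,
      map_add, tensorForm_apply, add_zero, add_zero, add_assoc]

/-- Each section identifies the extension with `R ⊕ K`, and the bracket there depends on `κ` alone;
the equivalence matches the two decompositions. -/
lemma CentralExtension.equivalent_of_isGivenBy {K : Type u} [AddCommGroup K] [Module ℂ K]
    {P : ZMod 2 → Submodule ℂ K} (hP : IsCompl (P 0) (P 1)) (A B : CentralExtension D P)
    (κ : R → R → ℂ[X] ⊗[ℂ] K) (hA : A.IsGivenBy κ) (hB : B.IsGivenBy κ) : A.Equivalent B := by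
  obtain ⟨s, s1, s2, s3⟩ := hA
  obtain ⟨t, t1, t2, t3⟩ := hB
  have s2' : ∀ x, A.proj (s x) = x := fun x => LinearMap.congr_fun s2 x
  have t2' : ∀ x, B.proj (t x) = x := fun x => LinearMap.congr_fun t2 x
  have key : ∀ (A : CentralExtension D P) (s : R →ₗ[ℂ[X]] A.E), (∀ x, A.proj (s x) = x) →
      ∀ x, ∃ r k, x = s r + A.incl k := by
    intro A s s2 x
    obtain ⟨k, hk⟩ := (A.exact (x - s (A.proj x))).1 (by rw [map_sub, s2, sub_self])
    exact ⟨A.proj x, k, by rw [hk]; abel⟩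
  have uniq : ∀ (A : CentralExtension D P) (s : R →ₗ[ℂ[X]] A.E), (∀ x, A.proj (s x) = x) →
      ∀ r k r' k', s r + A.incl k = s r' + A.incl k' → r = r' ∧ k = k' := by
    intro A s s2 r k r' k' h
    have e2 : ∀ k, A.proj (A.incl k) = 0 := fun k => (A.exact _).2 ⟨_, rfl⟩
    have h1 := congrArg A.proj h
    simp only [map_add, s2, e2, add_zero] at h1
    subst h1
    exact ⟨rfl, A.incl_injective (add_left_cancel h)⟩
  choose r k hrk using key A s s2'
  have hr : ∀ x y, r (s x + A.incl y) = x ∧ k (s x + A.incl y) = y := fun x y =>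
    (uniq A s s2' _ _ _ _ (hrk (s x + A.incl y))).imp Eq.symm Eq.symm
  have hX : ∀ (C : CentralExtension D P) (p : ℂ[X]) y, C.incl (p.eval 0 • y) = p • C.incl y := by
    intro C p y
    rw [smul_eq_eval_zero_smul (C.partial_incl _), map_smul]
  let f : A.E →ₗ[ℂ[X]] B.E :=
    { toFun := fun x => t (r x) + B.incl (k x)
      map_add' := fun x y => by
        have e : x + y = s (r x + r y) + A.incl (k x + k y) := by
          conv_lhs => rw [hrk x, hrk y]
          rw [map_add, map_add]; abel
        have e1 : r (x + y) = r x + r y := by rw [e, (hr _ _).1]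
        have e2 : k (x + y) = k x + k y := by rw [e, (hr _ _).2]
        rw [e1, e2, map_add, map_add]
        abel
      map_smul' := fun p x => by
        have e : p • x = s (p • r x) + A.incl (p.eval 0 • k x) := by
          conv_lhs => rw [hrk x]
          rw [smul_add, map_smul, hX]
        have e1 : r (p • x) = p • r x := by rw [e, (hr _ _).1]
        have e2 : k (p • x) = p.eval 0 • k x := by rw [e, (hr _ _).2]
        rw [e1, e2, map_smul, hX, RingHom.id_apply, smul_add] }
  have hf : ∀ x y, f (s x + A.incl y) = t x + B.incl y := fun x y => by
    change t (r _) + B.incl (k _) = _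
    rw [(hr x y).1, (hr x y).2]
  have hfs : ∀ x, f (s x) = t x := fun x => by simpa using hf x 0
  have hfi : ∀ y, f (A.incl y) = B.incl y := fun y => by simpa using hf 0 y
  have hfb : Function.Bijective f := by
    constructor
    · intro x y hxy
      rw [hrk x, hrk y, hf, hf] at hxy
      obtain ⟨e1, e2⟩ := uniq B t t2' _ _ _ _ hxy
      rw [hrk x, hrk y, e1, e2]
    · intro y
      obtain ⟨x, k, rfl⟩ := key B t t2' y
      exact ⟨s x + A.incl k, hf x k⟩
  refine ⟨LinearEquiv.ofBijective f hfb, fun i x hx => ?_, fun x y => ?_, hfi, fun x => ?_⟩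
  · change f x ∈ _
    have h1 : A.proj x = r x := by
      conv_lhs => rw [hrk x]
      rw [map_add, s2', (A.exact _).2 ⟨_, rfl⟩, add_zero]
    have h2 : r x ∈ D.parity i := h1 ▸ A.proj_parity i x hx
    have h3 : k x ∈ P i := by
      refine A.mem_of_incl_mem hP i _ ?_
      have : A.incl (k x) = x - s (r x) := by
        conv_rhs => rw [hrk x]
        rw [(hr _ _).1]; abel
      rw [this]
      exact sub_mem hx (s1 i _ h2)
    exact add_mem (t1 i _ h2) (B.incl_parity i _ h3)
  · change (f.restrictScalars ℂ).lTensor ℂ[X] _ = B.str.bracket (f x) (f y)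
    have e1 : f.restrictScalars ℂ ∘ₗ s.restrictScalars ℂ = t.restrictScalars ℂ :=
      LinearMap.ext hfs
    have e2 : f.restrictScalars ℂ ∘ₗ A.incl = B.incl := LinearMap.ext hfi
    obtain ⟨x', k', rfl⟩ := key A s s2' x
    obtain ⟨y', l', rfl⟩ := key A s s2' y
    rw [hf, hf]
    simp only [map_add, LinearMap.add_apply]
    rw [A.central, A.central, A.bracket_incl_right hP, B.central, B.central,
      B.bracket_incl_right hP, s3, t3, map_zero]
    simp only [map_add]
    rw [← LinearMap.lTensor_comp_apply, e1, ← LinearMap.lTensor_comp_apply, e2]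
  · change B.proj (f x) = A.proj x
    conv_lhs => rw [hrk x]
    conv_rhs => rw [hrk x]
    rw [hf, map_add, map_add, s2', t2', (A.exact _).2 ⟨_, rfl⟩, (B.exact _).2 ⟨_, rfl⟩]

/-- An equivalence carries `s` to a section differing from `t` by a map `Φ : R → K`, so the two
cocycles differ by the coboundary of `Φ`. The detecting coefficients, which vanish on coboundaries,
then give the equality after applying any functional. -/
lemma IsClassification.parameter_unique (h : D.IsClassification ψ a b n)
    (K : Type u) [AddCommGroup K] [Module ℂ K] (P : ZMod 2 → Submodule ℂ K)
    (hP : IsCompl (P 0) (P 1)) (A B : CentralExtension D P) (k l : ι → K)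
    (hA : A.IsGivenBy fun x y => ∑ i, (ψ i).1 x y ⊗ₜ[ℂ] k i)
    (hB : B.IsGivenBy fun x y => ∑ i, (ψ i).1 x y ⊗ₜ[ℂ] l i) (hAB : A.Equivalent B) : k = l := by
  obtain ⟨s, s1, s2, s3⟩ := hA
  obtain ⟨t, t1, t2, t3⟩ := hB
  obtain ⟨f, f1, f2, f3, f4⟩ := hAB
  have s2' : ∀ x, A.proj (s x) = x := fun x => LinearMap.congr_fun s2 x
  have t2' : ∀ x, B.proj (t x) = x := fun x => LinearMap.congr_fun t2 x
  obtain ⟨q, hq⟩ := B.incl.exists_leftInverse_of_injective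
    (LinearMap.ker_eq_bot.2 B.incl_injective)
  let d : R →ₗ[ℂ[X]] B.E := f.toLinearMap ∘ₗ s - t
  let Φ : R →ₗ[ℂ] K := q ∘ₗ d.restrictScalars ℂ
  have hΦ : ∀ x, B.incl (Φ x) = d x := by
    intro x
    obtain ⟨y, hy⟩ := (B.exact (d x)).1 (by simp [d, f4, s2', t2'])
    simp only [Φ, LinearMap.comp_apply, LinearMap.coe_restrictScalars]
    rw [← hy, ← LinearMap.comp_apply q, hq, LinearMap.id_apply]
  have hΦX : ∀ x, Φ ((.X : ℂ[X]) • x) = 0 := fun x => B.incl_injective (by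
    rw [hΦ, map_smul, ← hΦ, B.partial_incl, map_zero])
  have hfs : ∀ x, f (s x) = t x + B.incl (Φ x) := fun x => by rw [hΦ]; simp [d]
  have key : ∀ x y, Φ.lTensor ℂ[X] (D.bracket x y) + tensorForm ψ k x y = tensorForm ψ l x y := by
    intro x y
    have h1 := f2 (s x) (s y)
    have e1 : f.toLinearMap.restrictScalars ℂ ∘ₗ s.restrictScalars ℂ =
      t.restrictScalars ℂ + B.incl ∘ₗ Φ := LinearMap.ext hfs
    have e2 : f.toLinearMap.restrictScalars ℂ ∘ₗ A.incl = B.incl := LinearMap.ext f3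
    rw [hfs, hfs, s3, map_add] at h1
    simp only [map_add, LinearMap.add_apply] at h1
    rw [← LinearMap.lTensor_comp_apply, e1, ← LinearMap.lTensor_comp_apply, e2, B.central, B.central, B.bracket_incl_right hP, t3,
      LinearMap.lTensor_add, LinearMap.add_apply, LinearMap.lTensor_comp_apply,
      add_zero, add_zero, add_zero, add_assoc, add_right_inj, ← map_add] at h1
    rw [tensorForm_apply, tensorForm_apply]
    refine Module.Flat.lTensor_preserves_injective_linearMap (M := ℂ[X]) B.incl
      B.incl_injective h1
  funext i
  rw [← sub_eq_zero, ← neg_sub, neg_eq_zero, ← Module.forall_dual_apply_eq_zero_iff ℂ]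
  intro g
  have hc : ∑ j, g (l j - k j) • (ψ j).1 ∈ D.twoCoboundaries := by
    refine ⟨g ∘ₗ Φ, fun x => by simp [hΦX], fun x y => ?_⟩
    have h1 : tensorForm ψ (fun j => l j - k j) x y = Φ.lTensor ℂ[X] (D.bracket x y) := by
      have := key x y
      rw [← eq_sub_iff_add_eq] at this
      rw [this]
      simp [tensorForm_apply, TensorProduct.tmul_sub]
    rw [← scalarForm_tensorForm, scalarForm, LinearMap.compr₂_apply, h1, LinearMap.lTensor_comp _ g Φ]
    rfl
  rw [← h.coeff_sum (fun j => g (l j - k j)) i]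
  exact h.coeff_coboundary _ hc i

/-- A classification of the cocycles of `R` parameterizes the central extensions of `R`. -/
theorem IsClassification.parameterize (h : D.IsClassification ψ a b n) (hD : D.IsLie) :
    ParameterizeCentralExtensions.{u} D ψ where
  linearIndependent := h.linearIndependent
  span_eq_top := h.span_eq_top
  exists_extension K _ _ P hP k hk := h.exists_extension hD K P hP k hk
  exists_parameter K _ _ P hP A := h.exists_parameter hD K P hP A
  equivalent_iff K _ _ P hP A B k l _ _ hA hB := by
    refine ⟨h.parameter_unique K P hP A B k l hA hB, ?_⟩
    rintro rfl
    exact A.equivalent_of_isGivenBy hP B _ hA hB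

/-- A perfect algebra all of whose cocycles are trivial has only trivial central extensions. -/
theorem hasOnlyTrivialCentralExtensions (hD : D.IsLie)
    (perfect : Submodule.span ℂ ({x | ∃ r : R, x = (.X : ℂ[X]) • r} ∪
      {x | ∃ n x' y', x = lambdaCoeff n (D.bracket x' y')}) = ⊤)
    (hH : D.twoCocycles ≤ D.twoCoboundaries) : HasOnlyTrivialCentralExtensions.{u} D := by
  -- Triviality of all cocycles is a classification with no parameters, so the general statement
  -- produces a section with zero cocycle.
  have h : D.IsClassification (fun i : Empty => i.elim) (fun i => i.elim) (fun i => i.elim)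
      (fun i => i.elim) :=
    ⟨nofun, nofun, nofun, nofun, nofun, fun _ _ => nofun, perfect, fun α hα _ => hH hα⟩
  refine ⟨⟨fun x y => ?_⟩, fun K _ _ P hP A => ?_⟩
  · obtain ⟨α, rfl⟩ := Submodule.mkQ_surjective _ x
    obtain ⟨β, rfl⟩ := Submodule.mkQ_surjective _ y
    exact (Submodule.Quotient.eq _).2 (hH (α - β).2)
  · obtain ⟨k, -, hk⟩ := h.exists_parameter hD K P hP A
    simpa [CentralExtension.IsTrivial] using hk

end Parameterize

end ConformalData

/-! ### Calculus in the Grassmann algebra. -/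

section Grassmann

variable {N : ℕ}

/-- The homogeneous part of degree `n` of `Λ(N)`. -/
def degPart (N n : ℕ) : Submodule ℂ (Grassmann N) :=
  (LinearMap.range (ExteriorAlgebra.ι ℂ (M := Fin N → ℂ))) ^ n

lemma ι_eq_sum_xi (v : Fin N → ℂ) : ExteriorAlgebra.ι ℂ v = ∑ j, v j • (xi j : Grassmann N) := by
  simp only [xi, ← map_smul, ← map_sum]
  congr 1
  ext k
  simp [Finset.sum_apply, Pi.single_apply]

lemma one_mem_degPart : (1 : Grassmann N) ∈ degPart N 0 := by
  rw [degPart, pow_zero]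
  exact Submodule.one_le.1 le_rfl

lemma mul_mem_degPart {m n : ℕ} {x y : Grassmann N} (hx : x ∈ degPart N m) (hy : y ∈ degPart N n) :
    x * y ∈ degPart N (m + n) := by
  rw [degPart, pow_add]
  exact Submodule.mul_mem_mul hx hy

lemma xi_mem_degPart (i : Fin N) : xi i ∈ degPart N 1 := by
  rw [degPart, pow_one]
  exact ⟨_, rfl⟩

lemma xi_mul_mem_degPart (i : Fin N) {n : ℕ} {y : Grassmann N} (hy : y ∈ degPart N n) :
    xi i * y ∈ degPart N (n + 1) := by
  rw [add_comm]
  exact mul_mem_degPart (xi_mem_degPart i) hy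

lemma degPart_induction {motive : ℕ → Grassmann N → Prop} (one : motive 0 1)
    (zero : ∀ n, motive n 0) (add : ∀ n x y, motive n x → motive n y → motive n (x + y))
    (smul : ∀ n (z : ℂ) x, motive n x → motive n (z • x))
    (mul : ∀ n i y, y ∈ degPart N n → motive n y → motive (n + 1) (xi i * y)) :
    ∀ n w, w ∈ degPart N n → motive n w := by
  intro n
  induction n with
  | zero =>
    intro w hw
    rw [degPart, pow_zero] at hw
    obtain ⟨z, rfl⟩ := Submodule.mem_one.1 hw
    rw [Algebra.algebraMap_eq_smul_one]
    exact smul _ _ _ one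
  | succ n ih =>
    intro w hw
    rw [degPart, pow_succ'] at hw
    refine Submodule.mul_induction_on hw ?_ (fun x y => add _ x y)
    rintro _ ⟨v, rfl⟩ y hy
    rw [ι_eq_sum_xi, Finset.sum_mul]
    refine Finset.sum_induction _ (motive (n + 1)) (fun x y => add _ x y) (zero _) fun i _ => ?_
    rw [smul_mul_assoc]
    exact smul _ _ _ (mul n i y hy (ih y hy))

lemma iSup_degPart : ⨆ n, degPart N n = ⊤ :=
  CliffordAlgebra.iSup_ι_range_eq_top (0 : QuadraticForm ℂ (Fin N → ℂ))

/-- Induction on an arbitrary element of `Λ(N)`. -/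
lemma grassmann_induction {motive : Grassmann N → Prop} (one : motive 1)
    (add : ∀ x y, motive x → motive y → motive (x + y))
    (smul : ∀ (z : ℂ) x, motive x → motive (z • x))
    (mul : ∀ i y, motive y → motive (xi i * y)) (w : Grassmann N) : motive w := by
  have zero : motive 0 := by simpa using smul 0 1 one
  have hw : w ∈ ⨆ n, degPart N n := by rw [iSup_degPart]; trivial
  induction hw using Submodule.iSup_induction' with
  | mem n x hx =>
    exact degPart_induction (motive := fun _ => motive) one (fun _ => zero) (fun _ => add)
      (fun _ => smul) (fun _ i y _ => mul i y) n x hx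
  | zero => exact zero
  | add x y _ _ hx hy => exact add x y hx hy

lemma xi_mul_xi (i j : Fin N) : (xi i * xi j : Grassmann N) = -(xi j * xi i) :=
  eq_neg_of_add_eq_zero_left (ExteriorAlgebra.ι_add_mul_swap _ _)

lemma xi_mul_xi_mul (i j : Fin N) (w : Grassmann N) : xi i * (xi j * w) = -(xi j * (xi i * w)) := by
  rw [← mul_assoc, xi_mul_xi, neg_mul, mul_assoc]

lemma xi_mul_self (i : Fin N) : (xi i * xi i : Grassmann N) = 0 :=
  ExteriorAlgebra.ι_sq_zero _

lemma xi_mul_xi_mul_self (i : Fin N) (w : Grassmann N) : xi i * (xi i * w) = 0 := by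
  rw [← mul_assoc, xi_mul_self, zero_mul]

lemma dxi_one (i : Fin N) : dxi i (1 : Grassmann N) = 0 :=
  CliffordAlgebra.contractLeft_one (Q := (0 : QuadraticForm ℂ (Fin N → ℂ))) _

lemma dxi_xi (i j : Fin N) : dxi i (xi j : Grassmann N) = if i = j then 1 else 0 := by
  have := dxi_xi_mul i j (1 : Grassmann N)
  rwa [mul_one, dxi_one, mul_zero, sub_zero] at this

lemma dxi_dxi_self (i : Fin N) (w : Grassmann N) : dxi i (dxi i w) = 0 :=
  CliffordAlgebra.contractLeft_contractLeft _ _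

lemma gradeInv_one : gradeInv N 1 = 1 := by simp [gradeInv]

lemma gradeInv_mul (x y : Grassmann N) : gradeInv N (x * y) = gradeInv N x * gradeInv N y := by
  simp [gradeInv]

lemma gradeInv_xi (i : Fin N) : gradeInv N (xi i) = -xi i :=
  CliffordAlgebra.involute_ι _

lemma gradeInv_gradeInv (x : Grassmann N) : gradeInv N (gradeInv N x) = x :=
  CliffordAlgebra.involute_involute _

lemma gradeInv_dxi (i : Fin N) (x : Grassmann N) : gradeInv N (dxi i x) = -dxi i (gradeInv N x) := by
  induction x using grassmann_induction with
  | one => rw [gradeInv_one, dxi_one, map_zero, neg_zero]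
  | add x y hx hy => simp only [map_add, hx, hy]; abel
  | smul z x hx => simp only [map_smul, hx, smul_neg]
  | mul j y hy =>
    rw [dxi_xi_mul, gradeInv_mul, gradeInv_xi, neg_mul, map_neg, dxi_xi_mul, map_sub, gradeInv_mul,
      gradeInv_xi, hy]
    split_ifs <;> simp

lemma xi_mul_gradeInv (i : Fin N) (x : Grassmann N) : xi i * gradeInv N x = x * xi i := by
  induction x using grassmann_induction with
  | one => rw [gradeInv_one, mul_one, one_mul]
  | add x y hx hy => rw [map_add, mul_add, hx, hy, add_mul]
  | smul z x hx => rw [map_smul, mul_smul_comm, hx, smul_mul_assoc]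
  | mul j y hy => rw [gradeInv_mul, gradeInv_xi, neg_mul, mul_neg, xi_mul_xi_mul, neg_neg, hy,
      mul_assoc]

lemma dxi_mul (i : Fin N) (x y : Grassmann N) :
    dxi i (x * y) = dxi i x * y + gradeInv N x * dxi i y := by
  induction x using grassmann_induction with
  | one => rw [gradeInv_one, dxi_one, one_mul, one_mul, zero_mul, zero_add]
  | add x y hx hy => simp only [map_add, add_mul, hx, hy]; abel
  | smul z x hx => simp only [map_smul, smul_mul_assoc, hx, smul_add]
  | mul j x hx =>
    rw [mul_assoc, dxi_xi_mul, dxi_xi_mul, gradeInv_mul, gradeInv_xi, hx, sub_mul, mul_add,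
      mul_assoc, neg_mul, neg_mul, mul_assoc, ite_mul, zero_mul]
    abel

lemma euler_mul (x y : Grassmann N) : euler N (x * y) = euler N x * y + x * euler N y := by
  simp only [euler_apply, dxi_mul, mul_add, Finset.sum_add_distrib, Finset.sum_mul, Finset.mul_sum]
  congr 1
  · exact Finset.sum_congr rfl fun i _ => (mul_assoc _ _ _).symm
  · exact Finset.sum_congr rfl fun i _ => by
      rw [← mul_assoc, xi_mul_gradeInv, mul_assoc]

lemma euler_xi (i : Fin N) : euler N (xi i) = xi i := by
  have := euler_of_mem 1 (xi i : Grassmann N) (xi_mem_degPart i)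
  simpa using this

lemma euler_xi_mul (i : Fin N) (x : Grassmann N) :
    euler N (xi i * x) = xi i * x + xi i * euler N x := by
  rw [euler_mul, euler_xi]

lemma euler_of_mem_degPart {n : ℕ} {w : Grassmann N} (hw : w ∈ degPart N n) :
    euler N w = (n : ℂ) • w := euler_of_mem n w hw

lemma gradeInv_of_mem_degPart {n : ℕ} {w : Grassmann N} (hw : w ∈ degPart N n) :
    gradeInv N w = (-1 : ℂ) ^ n • w := by
  refine degPart_induction (motive := fun n w => gradeInv N w = (-1 : ℂ) ^ n • w) ?_ ?_ ?_ ?_ ?_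
    n w hw
  · rw [gradeInv_one, pow_zero, one_smul]
  · simp
  · intro n x y hx hy
    rw [map_add, hx, hy, smul_add]
  · intro n z x hx
    rw [map_smul, hx, smul_comm]
  · intro n i y _ hy
    rw [gradeInv_mul, gradeInv_xi, hy, pow_succ, mul_smul_comm, neg_mul, mul_smul, smul_neg,
      neg_smul, one_smul, smul_neg]

lemma dxi_mem_degPart (i : Fin N) {n : ℕ} {w : Grassmann N} (hw : w ∈ degPart N n) :
    dxi i w ∈ degPart N (n - 1) := by
  refine degPart_induction (motive := fun n w => dxi i w ∈ degPart N (n - 1)) ?_ ?_ ?_ ?_ ?_ n w hw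
  · rw [dxi_one]
    exact zero_mem _
  · intro n
    rw [map_zero]
    exact zero_mem _
  · intro n x y hx hy
    rw [map_add]
    exact add_mem hx hy
  · intro n z x hx
    rw [map_smul]
    exact Submodule.smul_mem _ _ hx
  · intro n j y hy0 hy
    rw [dxi_xi_mul]
    refine sub_mem ?_ ?_
    · split_ifs
      · exact hy0
      · exact zero_mem _
    · rcases n with _ | n
      · have : dxi i y = 0 := by
          rw [degPart, pow_zero] at hy0
          obtain ⟨z, rfl⟩ := Submodule.mem_one.1 hy0
          rw [Algebra.algebraMap_eq_smul_one, map_smul, dxi_one, smul_zero]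
        rw [this, mul_zero]
        exact zero_mem _
      · exact xi_mul_mem_degPart j hy

lemma dxi_of_mem_degPart_zero (i : Fin N) {w : Grassmann N} (hw : w ∈ degPart N 0) :
    dxi i w = 0 := by
  rw [degPart, pow_zero] at hw
  obtain ⟨z, rfl⟩ := Submodule.mem_one.1 hw
  rw [Algebra.algebraMap_eq_smul_one, map_smul, dxi_one, smul_zero]

lemma xiMono_mem_degPart (I : Finset (Fin N)) : xiMono I ∈ degPart N I.card := by
  rw [xiMono, ExteriorAlgebra.basis_apply]
  exact (exteriorPower.ιMulti_family ℂ I.card _ _).2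

lemma degPart_le_evenOdd (n : ℕ) :
    degPart N n ≤ CliffordAlgebra.evenOdd (0 : QuadraticForm ℂ (Fin N → ℂ)) (n : ZMod 2) :=
  le_iSup (fun j : {n' : ℕ // (n' : ZMod 2) = (n : ZMod 2)} => degPart N j) ⟨n, rfl⟩

lemma gradeInv_of_mem_evenOdd {i : ZMod 2} {w : Grassmann N}
    (hw : w ∈ CliffordAlgebra.evenOdd (0 : QuadraticForm ℂ (Fin N → ℂ)) i) :
    gradeInv N w = (-1 : ℂ) ^ i.val • w := by
  rcases eq_zero_or_eq_one_zmod i with rfl | rfl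
  · rw [ZMod.val_zero, pow_zero, one_smul]
    exact CliffordAlgebra.involute_eq_of_mem_even hw
  · rw [ZMod.val_one, pow_one, neg_smul, one_smul]
    exact CliffordAlgebra.involute_eq_of_mem_odd hw

/-- The contraction `∑ ∂_i A ∂_i B`. -/
def contr (x y : Grassmann N) : Grassmann N := ∑ i, dxi i x * dxi i y

lemma contr_add_right (x y y' : Grassmann N) : contr x (y + y') = contr x y + contr x y' := by
  simp [contr, mul_add, Finset.sum_add_distrib]

lemma contr_smul_left (z : ℂ) (x y : Grassmann N) : contr (z • x) y = z • contr x y := by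
  simp [contr, Finset.smul_sum]

lemma contr_smul_right (z : ℂ) (x y : Grassmann N) : contr x (z • y) = z • contr x y := by
  simp [contr, Finset.smul_sum]

lemma contr_neg_left (x y : Grassmann N) : contr (-x) y = -contr x y := by
  simp [contr]

lemma contr_one_left (y : Grassmann N) : contr 1 y = 0 := by
  simp [contr, dxi_one]

lemma contr_one_right (y : Grassmann N) : contr y 1 = 0 := by
  simp [contr, dxi_one]

lemma contr_xi_left (i : Fin N) (y : Grassmann N) : contr (xi i) y = dxi i y := by
  simp [contr, dxi_xi]

lemma contr_xi_mul_left (i : Fin N) (x y : Grassmann N) :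
    contr (xi i * x) y = x * dxi i y - xi i * contr x y := by
  simp [contr, dxi_xi_mul, sub_mul, Finset.sum_sub_distrib, Finset.mul_sum, mul_assoc]

lemma contr_xi_mul_right (i : Fin N) (x y : Grassmann N) :
    contr x (xi i * y) = dxi i x * y + xi i * contr (gradeInv N x) y := by
  have h : ∀ j, dxi j x * xi i = -(xi i * dxi j (gradeInv N x)) := fun j => by
    rw [← xi_mul_gradeInv, gradeInv_dxi, mul_neg]
  simp [contr, dxi_xi_mul, mul_sub, Finset.sum_add_distrib, Finset.mul_sum, ← mul_assoc, h]

lemma dxi_contr (i : Fin N) (x y : Grassmann N) :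
    dxi i (contr x y) = -contr (dxi i x) y + contr (gradeInv N x) (dxi i y) := by
  have h : ∀ j, dxi i (dxi j x * dxi j y) =
      -(dxi j (dxi i x) * dxi j y) + dxi j (gradeInv N x) * dxi j (dxi i y) := fun j => by
    rw [dxi_mul, gradeInv_dxi, dxi_dxi i j x, dxi_dxi i j y, neg_mul, neg_mul_neg]
  simp only [contr, map_sum, h, Finset.sum_add_distrib, Finset.sum_neg_distrib]

lemma euler_contr (x y : Grassmann N) :
    euler N (contr x y) = contr (euler N x) y + contr x (euler N y) - (2 : ℂ) • contr x y := by
  have h : ∀ j, euler N (dxi j x * dxi j y) = dxi j (euler N x) * dxi j y +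
      dxi j x * dxi j (euler N y) - (2 : ℂ) • (dxi j x * dxi j y) := fun j => by
    rw [euler_mul, euler_dxi, euler_dxi, sub_mul, mul_sub, two_smul]
    abel
  simp only [contr, map_sum, h, Finset.sum_add_distrib, Finset.sum_sub_distrib, Finset.smul_sum]

/-- Sign rule for the product of homogeneous elements. -/
lemma mul_comm_of_evenOdd {i j : ZMod 2} {x y : Grassmann N}
    (hx : x ∈ CliffordAlgebra.evenOdd (0 : QuadraticForm ℂ (Fin N → ℂ)) i)
    (hy : y ∈ CliffordAlgebra.evenOdd (0 : QuadraticForm ℂ (Fin N → ℂ)) j) :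
    y * x = koszulSign i j • (x * y) := by
  have key : ∀ x : Grassmann N, (y : Grassmann N) * x =
      if j = 0 then x * y else gradeInv N x * y := by
    intro x
    induction x using grassmann_induction with
    | one => simp [gradeInv_one]
    | add x x' hx hx' => rw [mul_add, hx, hx', map_add]; split_ifs <;> rw [add_mul]
    | smul z x hx => rw [mul_smul_comm, hx, map_smul]; split_ifs <;> rw [smul_mul_assoc]
    | mul k x hx =>
      have h1 : y * xi k = (-1 : ℂ) ^ j.val • (xi k * y) := by
        rw [← xi_mul_gradeInv, gradeInv_of_mem_evenOdd hy, mul_smul_comm]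
      rw [← mul_assoc, h1, smul_mul_assoc, mul_assoc, hx]
      rcases eq_zero_or_eq_one_zmod j with rfl | rfl
      · simp [mul_assoc]
      · simp [gradeInv_mul, gradeInv_xi, mul_assoc, ZMod.val_one]
  rw [key x, gradeInv_of_mem_evenOdd hx, koszulSign]
  rcases eq_zero_or_eq_one_zmod j with rfl | rfl
  · simp
  · simp [ZMod.val_one]

end Grassmann

/-! ### The bracket of `K_N` as a model. -/

section KBracket

variable {N : ℕ}

lemma kPart₀_apply (A B : Grassmann N) : kPart₀ N A B = (1 / 2 : ℂ) • (euler N A * B) - A * B := by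
  simp [kPart₀]

lemma kPart₁_apply (A B : Grassmann N) : kPart₁ N A B = (1 / 2 : ℂ) • contr (gradeInv N A) B := by
  simp [kPart₁, contr, LinearMap.sum_apply]

lemma kPart₂_apply (A B : Grassmann N) : kPart₂ N A B =
    (1 / 2 : ℂ) • (euler N A * B) + (1 / 2 : ℂ) • (A * euler N B) - (2 : ℂ) • (A * B) := by
  simp [kPart₂]

/-- The inclusion of `Λ(N)` in `K_N = ℂ[∂] ⊗ Λ(N)`. -/
def kEmb (N : ℕ) : Grassmann N →ₗ[ℂ] KSpace N := TensorProduct.mk ℂ ℂ[X] (Grassmann N) 1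

lemma smul_kEmb (f : ℂ[X]) (w : Grassmann N) : f • kEmb N w = f ⊗ₜ[ℂ] w := by
  rw [kEmb, TensorProduct.mk_apply, TensorProduct.smul_tmul', smul_eq_mul, mul_one]

lemma substAt_assoc (p : ℂ[X]) (t : ℂ[X] ⊗[ℂ] ℂ[X]) (w : Grassmann N) :
    substAt p (TensorProduct.assoc ℂ ℂ[X] ℂ[X] (Grassmann N) (t ⊗ₜ[ℂ] w)) =
      Algebra.TensorProduct.productMap (Polynomial.aeval p) (AlgHom.id ℂ ℂ[X]) t ⊗ₜ[ℂ] w := by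
  induction t using TensorProduct.induction_on with
  | zero => simp
  | add x y hx hy =>
    rw [TensorProduct.add_tmul, map_add, map_add, hx, hy, map_add, TensorProduct.add_tmul]
  | tmul f g =>
    rw [TensorProduct.assoc_tmul, substAt_tmul, Algebra.TensorProduct.productMap_apply_tmul,
      TensorProduct.smul_tmul']
    rfl

lemma productMap_sesqMul (p : ℂ[X]) (m : ℂ[X] ⊗[ℂ] ℂ[X]) (f g : ℂ[X]) :
    Algebra.TensorProduct.productMap (Polynomial.aeval p) (AlgHom.id ℂ ℂ[X]) (sesqMul m f g) =
      f.comp (-p) * g.comp (.X + p) *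
        Algebra.TensorProduct.productMap (Polynomial.aeval p) (AlgHom.id ℂ ℂ[X]) m := by
  have h1 : sesqMul m f g = Polynomial.aeval (-((.X : ℂ[X]) ⊗ₜ[ℂ] (1 : ℂ[X]))) f *
      Polynomial.aeval ((1 : ℂ[X]) ⊗ₜ[ℂ] (.X : ℂ[X]) + (.X : ℂ[X]) ⊗ₜ[ℂ] (1 : ℂ[X])) g * m := by
    simp [sesqMul]
  rw [h1, map_mul, map_mul, ← Polynomial.aeval_algHom_apply, ← Polynomial.aeval_algHom_apply]
  simp only [map_neg, map_add, Algebra.TensorProduct.productMap_apply_tmul, map_one, mul_one,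
    one_mul, Polynomial.aeval_X, AlgHom.id_apply]
  rfl

lemma kAlg_brk_tmul (p f g : ℂ[X]) (A B : Grassmann N) :
    (KAlg N).brk p (f ⊗ₜ[ℂ] A) (g ⊗ₜ[ℂ] B) = (f.comp (-p) * g.comp (.X + p)) •
      ((.X : ℂ[X]) ⊗ₜ[ℂ] kPart₀ N A B + (1 : ℂ[X]) ⊗ₜ[ℂ] kPart₁ N A B +
        p ⊗ₜ[ℂ] kPart₂ N A B) := by
  have h0 : ∀ m (k : Grassmann N →ₗ[ℂ] Grassmann N →ₗ[ℂ] Grassmann N),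
      TensorProduct.map₂ (sesqMul m) k (f ⊗ₜ[ℂ] A) (g ⊗ₜ[ℂ] B) = sesqMul m f g ⊗ₜ[ℂ] k A B :=
    fun m k => rfl
  rw [ConformalData.brk]
  change substAt p (TensorProduct.assoc ℂ ℂ[X] ℂ[X] (Grassmann N)
    (TensorProduct.map₂ _ _ (f ⊗ₜ[ℂ] A) (g ⊗ₜ[ℂ] B) + TensorProduct.map₂ _ _ (f ⊗ₜ[ℂ] A) (g ⊗ₜ[ℂ] B) +
      TensorProduct.map₂ _ _ (f ⊗ₜ[ℂ] A) (g ⊗ₜ[ℂ] B))) = _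
  rw [h0, h0, h0, map_add, map_add, map_add, map_add, substAt_assoc, substAt_assoc, substAt_assoc,
    productMap_sesqMul, productMap_sesqMul, productMap_sesqMul]
  simp only [Algebra.TensorProduct.productMap_apply_tmul, map_one, mul_one, one_mul,
    Polynomial.aeval_X, AlgHom.id_apply, smul_add, TensorProduct.smul_tmul', smul_eq_mul]

lemma kAlg_brk_smul_smul (p f g : ℂ[X]) (a b : KSpace N) :
    (KAlg N).brk p (f • a) (g • b) = (f.comp (-p) * g.comp (.X + p)) • (KAlg N).brk p a b := by
  induction a using TensorProduct.induction_on with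
  | zero => rw [smul_zero, ConformalData.brk_zero_left, ConformalData.brk_zero_left, smul_zero]
  | add x y hx hy => rw [smul_add, ConformalData.brk_add_left, hx, hy, ConformalData.brk_add_left,
      smul_add]
  | tmul f' A =>
    induction b using TensorProduct.induction_on with
    | zero => rw [smul_zero, ConformalData.brk_zero_right, ConformalData.brk_zero_right, smul_zero]
    | add x y hx hy => rw [smul_add, ConformalData.brk_add_right, hx, hy,
        ConformalData.brk_add_right, smul_add]
    | tmul g' B =>
      rw [TensorProduct.smul_tmul', TensorProduct.smul_tmul', kAlg_brk_tmul, kAlg_brk_tmul,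
        smul_smul, smul_eq_mul, smul_eq_mul]
      have : (f * f').comp (-p) * (g * g').comp (.X + p) = 
        f.comp (-p) * g.comp (.X + p) * (f'.comp (-p) * g'.comp (.X + p)) := by
        rw [Polynomial.mul_comp, Polynomial.mul_comp]; ring
      rw [this]

/-- The features of `K_N` on which its structure theory rests: it is a `ℂ[∂]`-module generated by
the image of `Λ(N)`, with a sesquilinear bracket given on `Λ(N)` by the formula for `K_N`. -/
structure IsKModel {R : Type*} [AddCommGroup R] [Module ℂ R] [Module ℂ[X] R]
    [IsScalarTower ℂ ℂ[X] R] (D : ConformalData R) (e : Grassmann N →ₗ[ℂ] R) : Prop where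
  brk_smul_smul : ∀ (p f g : ℂ[X]) (a b : R),
    D.brk p (f • a) (g • b) = (f.comp (-p) * g.comp (.X + p)) • D.brk p a b
  brk_emb : ∀ (p : ℂ[X]) (A B : Grassmann N), D.brk p (e A) (e B) =
    (.X : ℂ[X]) • e (kPart₀ N A B) + e (kPart₁ N A B) + p • e (kPart₂ N A B)
  span_emb : Submodule.span ℂ[X] (Set.range e) = ⊤
  parity_eq : ∀ i, D.parity i = Submodule.span ℂ[X]
    (e '' CliffordAlgebra.evenOdd (0 : QuadraticForm ℂ (Fin N → ℂ)) i)
  isCompl : IsCompl (D.parity 0) (D.parity 1)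
  exists_functional : ∀ φ : Grassmann N →ₗ[ℂ] ℂ, ∃ φ' : R →ₗ[ℂ] ℂ,
    (∀ r, φ' ((.X : ℂ[X]) • r) = 0) ∧ ∀ w, φ' (e w) = φ w

/-- The parity automorphism of `Λ(N)`, extended `ℂ[∂]`-linearly, acts by `1` and by `-1` on the two
parts; this separates them. -/
lemma kAlg_isCompl : IsCompl ((KAlg N).parity 0) ((KAlg N).parity 1) := by
  refine ⟨?_, ?_⟩
  · have key : ∀ i, ∀ x ∈ (KAlg N).parity i,
        (gradeInv N).baseChange ℂ[X] x = (-1 : ℂ[X]) ^ i.val • x := by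
      intro i x hx
      have hx' : x ∈ Submodule.span ℂ[X] ((CliffordAlgebra.evenOdd
          (0 : QuadraticForm ℂ (Fin N → ℂ)) i).map (TensorProduct.mk ℂ ℂ[X] (Grassmann N) 1)
          : Set (KSpace N)) := by
        rw [← Submodule.baseChange_eq_span]; exact hx
      clear hx
      induction hx' using Submodule.span_induction with
      | mem y hy =>
        obtain ⟨w, hw, rfl⟩ := hy
        rw [TensorProduct.mk_apply, LinearMap.baseChange_tmul, gradeInv_of_mem_evenOdd hw,
          TensorProduct.tmul_smul, TensorProduct.smul_tmul', TensorProduct.smul_tmul']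
        congr 1
        rw [smul_eq_mul, mul_one, Polynomial.smul_eq_C_mul, mul_one, map_pow, map_neg, map_one]
      | zero => simp
      | add y z _ _ hy hz => rw [map_add, hy, hz, smul_add]
      | smul f y _ hy => rw [map_smul, hy, smul_comm]
    rw [Submodule.disjoint_def]
    intro x h0 h1
    have := (key 0 x h0).symm.trans (key 1 x h1)
    rw [ZMod.val_zero, ZMod.val_one, pow_zero, pow_one, one_smul] at this
    replace this := eq_neg_iff_add_eq_zero.1 (this.trans (neg_one_smul ℂ[X] x))
    have h2 : x = (.C (1 / 2) : ℂ[X]) • (x + x) := by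
      rw [← two_smul ℂ[X], smul_smul]
      have : (.C (1 / 2) : ℂ[X]) * 2 = 1 := by
        rw [← Polynomial.C_ofNat, ← Polynomial.C_mul]; norm_num
      rw [this, one_smul]
    rw [h2, this, smul_zero]
  · rw [codisjoint_iff, eq_top_iff]
    rintro x -
    induction x using TensorProduct.induction_on with
    | zero => exact zero_mem _
    | add x y hx hy => exact add_mem hx hy
    | tmul f w =>
      have hw : w ∈ CliffordAlgebra.evenOdd (0 : QuadraticForm ℂ (Fin N → ℂ)) 0 ⊔
          CliffordAlgebra.evenOdd (0 : QuadraticForm ℂ (Fin N → ℂ)) 1 := by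
        rw [(CliffordAlgebra.evenOdd_isCompl _).sup_eq_top]; trivial
      obtain ⟨w₀, h0, w₁, h1, rfl⟩ := Submodule.mem_sup.1 hw
      rw [TensorProduct.tmul_add]
      exact Submodule.add_mem_sup (Submodule.tmul_mem_baseChange_of_mem _ h0)
        (Submodule.tmul_mem_baseChange_of_mem _ h1)

lemma kAlg_isKModel (N : ℕ) : IsKModel (KAlg N) (kEmb N) where
  brk_smul_smul := kAlg_brk_smul_smul
  brk_emb p A B := by
    rw [smul_kEmb, smul_kEmb]
    refine (kAlg_brk_tmul p 1 1 A B).trans ?_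
    rw [Polynomial.one_comp, Polynomial.one_comp, one_mul, one_smul]
    rfl
  span_emb := by
    rw [eq_top_iff]
    rintro x -
    induction x using TensorProduct.induction_on with
    | zero => exact zero_mem _
    | add x y hx hy => exact add_mem hx hy
    | tmul f w =>
      rw [← smul_kEmb]
      exact Submodule.smul_mem _ _ (Submodule.subset_span ⟨w, rfl⟩)
  parity_eq i := Submodule.baseChange_eq_span _ _
  isCompl := kAlg_isCompl
  exists_functional φ := by
    -- The functional is applied after setting `∂ = 0`, which is possible because `K_N` is free over
    -- `ℂ[∂]`.
    refine ⟨TensorProduct.lift ((LinearMap.lsmul ℂ (Module.Dual ℂ (Grassmann N))).flip φ ∘ₗ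
      Polynomial.lcoeff ℂ 0), fun r => ?_, fun w => ?_⟩
    · induction r using TensorProduct.induction_on with
      | zero => simp
      | add x y hx hy => rw [smul_add, map_add, hx, hy, add_zero]
      | tmul f w => rw [TensorProduct.smul_tmul']; simp
    · rw [kEmb, TensorProduct.mk_apply]
      simp

end KBracket

lemma koszulSign_add_left (i j k : ZMod 2) :
    koszulSign (i + j) k = koszulSign i k * koszulSign j k := by
  rcases eq_zero_or_eq_one_zmod i with rfl | rfl <;>
  rcases eq_zero_or_eq_one_zmod j with rfl | rfl <;>
  rcases eq_zero_or_eq_one_zmod k with rfl | rfl <;>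
  simp [koszulSign, ZMod.val_one, show (1 + 1 : ZMod 2) = 0 from rfl]

lemma koszulSign_comm (i j : ZMod 2) : koszulSign i j = koszulSign j i := by
  rw [koszulSign, koszulSign, mul_comm]

lemma koszulSign_add_right (i j k : ZMod 2) :
    koszulSign i (j + k) = koszulSign i j * koszulSign i k := by
  rw [koszulSign_comm, koszulSign_add_left, koszulSign_comm, koszulSign_comm k]

lemma koszulSign_mul_self (i j : ZMod 2) : koszulSign i j * koszulSign i j = 1 := by
  rw [koszulSign, ← mul_pow]
  norm_num

/-! ### The Jacobi identity for one fixed first argument. -/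

namespace ConformalData

section JacobiFor

variable {R : Type*} [AddCommGroup R] [Module ℂ R] [Module ℂ[X] R] [IsScalarTower ℂ ℂ[X] R]
variable {V : Type*} [AddCommGroup V] [Module ℂ V]

/-- The value at `λ = z` of the bracket, as a bilinear map. -/
def brkAt (D : ConformalData R) (z : ℂ) : R →ₗ[ℂ] R →ₗ[ℂ] R := D.bracket.compr₂ (evalAt z)

lemma brkAt_apply (D : ConformalData R) (z : ℂ) (a b : R) : D.brkAt z a b = D.brk (.C z) a b :=
  (brk_C z a b).symm

/-- The Jacobi identity for the first argument `a` of parity `i`, with outer bracket `F`. For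
`F = D.brkAt` this is the Jacobi identity of `D`, and for a form on `R` the cocycle identity. -/
def JacobiFor (D : ConformalData R) (F : ℂ → R →ₗ[ℂ] R →ₗ[ℂ] V) (i : ZMod 2) (a : R) : Prop :=
  ∀ j, ∀ b ∈ D.parity j, ∀ (c : R) (z w : ℂ), F z a (D.brk (.C w) b c) =
    F (z + w) (D.brk (.C z) a b) c + koszulSign i j • F w b (D.brk (.C z) a c)

variable {D : ConformalData R} {F : ℂ → R →ₗ[ℂ] R →ₗ[ℂ] V} {i j : ZMod 2} {a b : R}

lemma JacobiFor.zero : D.JacobiFor F i 0 := fun j b _ c z w => by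
  simp [brk_zero_left]

lemma JacobiFor.add (ha : D.JacobiFor F i a) (hb : D.JacobiFor F i b) :
    D.JacobiFor F i (a + b) := fun j x hx c z w => by
  simp only [map_add, LinearMap.add_apply, ha j x hx, hb j x hx, brk_add_left, smul_add]
  abel

lemma JacobiFor.smul (r : ℂ) (ha : D.JacobiFor F i a) : D.JacobiFor F i (r • a) :=
  fun j x hx c z w => by
  simp only [map_smul, LinearMap.smul_apply, ha j x hx, brk_smul_left, smul_add]
  rw [smul_comm r]

lemma JacobiFor.X_smul (hD : ∀ z a b, D.brk (.C z) ((.X : ℂ[X]) • a) b = -(z • D.brk (.C z) a b))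
    (hF : ∀ z a b, F z ((.X : ℂ[X]) • a) b = -(z • F z a b)) (ha : D.JacobiFor F i a) :
    D.JacobiFor F i ((.X : ℂ[X]) • a) := fun j x hx c z w => by
  simp only [hF, ha j x hx, hD, map_neg, map_smul, LinearMap.neg_apply, LinearMap.smul_apply,
    smul_add, neg_add, smul_neg]
  rw [smul_comm z]

/-- The identity for `∂a` is `-z` times the identity for `a`. Both sides depend polynomially on `z`,
so the factor can be cancelled, also at `z = 0`. -/
lemma JacobiFor.of_X_smul (hD : ∀ z a b, D.brk (.C z) ((.X : ℂ[X]) • a) b =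
      -(z • D.brk (.C z) a b))
    (hF : ∀ z a b, F z ((.X : ℂ[X]) • a) b = -(z • F z a b))
    (hP : ∀ (g : V →ₗ[ℂ] ℂ) (x y : R), ∃ P : ℂ[X], ∀ z, P.eval z = g (F z x y))
    (ha : D.JacobiFor F i ((.X : ℂ[X]) • a)) :
    D.JacobiFor F i a := fun j x hx c z w => by
  rw [← sub_eq_zero, ← Module.forall_dual_apply_eq_zero_iff ℂ]
  intro g
  obtain ⟨P₁, h1⟩ := hP g a (D.brk (.C w) x c)
  -- Here `z` occurs in the inner bracket and in the outer parameter; expanding the inner bracket in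
  -- powers of `z` leaves a polynomial.
  obtain ⟨P₂, h2⟩ : ∃ P : ℂ[X], ∀ z, P.eval z = g (F (z + w) (D.brk (.C z) a x) c) := by
    obtain ⟨M, hM⟩ := exists_eq_sum_lambdaCoeff (D.bracket a x)
    choose P hP' using fun n => hP g (lambdaCoeff n (D.bracket a x)) c
    refine ⟨∑ n ∈ Finset.range M, .X ^ n * (P n).comp (.X + .C w), fun z => ?_⟩
    rw [brk_C]
    conv_rhs => rw [hM M le_rfl]
    simp [Polynomial.eval_finsetSum, evalAt_tmul, LinearMap.sum_apply, hP']
  obtain ⟨P₃, h3⟩ : ∃ P : ℂ[X], ∀ z, P.eval z = g (F w x (D.brk (.C z) a c)) :=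
    ⟨_, fun z => (eval_rid_lTensor (g ∘ₗ F w x) z (D.bracket a c)).trans (by rw [brk_C]; rfl)⟩
  have key : .X * (P₁ - P₂ - koszulSign i j • P₃) = 0 := by
    refine Polynomial.funext fun z => ?_
    have := ha j x hx c z w
    simp only [hF, hD, map_neg, map_smul, LinearMap.neg_apply, LinearMap.smul_apply] at this
    have h := congrArg g this
    simp only [map_neg, map_add, map_smul, smul_neg, smul_eq_mul] at h
    simp only [Polynomial.eval_mul, Polynomial.eval_X, Polynomial.eval_sub, Polynomial.eval_smul,
      h1, h2, h3, smul_eq_mul, Polynomial.eval_zero]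
    linear_combination -h
  have h0 := (mul_eq_zero.1 key).resolve_left Polynomial.X_ne_zero
  rw [map_sub, map_add, map_smul, ← h1, ← h2, ← h3]
  have := congrArg (Polynomial.eval z) h0
  simp only [Polynomial.eval_sub, Polynomial.eval_smul, Polynomial.eval_zero] at this
  linear_combination this

/-- The commutator of two derivations is a derivation: the identities for `a` and `b` express the
action of `[a_s b]` through those of `a` and `b`. The identity for `D` itself is needed to rewrite
inner brackets. -/
lemma JacobiFor.brk (hpar : ∀ j k, ∀ x ∈ D.parity j, ∀ y ∈ D.parity k, ∀ z,
      D.brk (.C z) x y ∈ D.parity (j + k))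
    (ma : a ∈ D.parity i) (mb : b ∈ D.parity j)
    (ha : D.JacobiFor D.brkAt i a) (hb : D.JacobiFor D.brkAt j b)
    (ha' : D.JacobiFor F i a) (hb' : D.JacobiFor F j b) (s : ℂ) :
    D.JacobiFor F (i + j) (D.brk (.C s) a b) := fun k c mc d z w => by
  simp only [JacobiFor, brkAt_apply] at ha hb
  have key : ∀ z x, F z (D.brk (.C s) a b) x = F s a (D.brk (.C (z - s)) b x) -
      koszulSign i j • F (z - s) b (D.brk (.C s) a x) := fun z x => by
    rw [ha' j b mb, add_sub_cancel, add_sub_cancel_right]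
  have key' : ∀ z x, D.brk (.C z) (D.brk (.C s) a b) x = D.brk (.C s) a (D.brk (.C (z - s)) b x) -
      koszulSign i j • D.brk (.C (z - s)) b (D.brk (.C s) a x) := fun z x => by
    rw [ha j b mb, add_sub_cancel, add_sub_cancel_right]
  rw [key, hb k c mc, ha k c mc, map_add (F s a), map_add (F (z - s) b), map_smul, map_smul,
    ha' (j + k) _ (hpar j k b mb c mc _), ha' k c mc, hb' (i + k) _ (hpar i k a ma c mc _),
    hb' k c mc, koszulSign_add_right, koszulSign_add_right, key', key',
    map_sub (F (z + w)), map_sub (F w c), map_smul, map_smul, koszulSign_add_left,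
    koszulSign_comm j i, LinearMap.sub_apply, LinearMap.smul_apply]
  rw [show s + (z - s + w) = z + w by ring, show z - s + (s + w) = z + w by ring]
  match_scalars <;>
    first | ring1 | linear_combination -koszulSign j k * koszulSign_mul_self i j
end JacobiFor

end ConformalData

/-! ### Sesquilinearity and generators of a model of `K_N`. -/

namespace IsKModel

section Structure

variable {N : ℕ} {R : Type*} [AddCommGroup R] [Module ℂ R] [Module ℂ[X] R] [IsScalarTower ℂ ℂ[X] R]
  {D : ConformalData R} {e : Grassmann N →ₗ[ℂ] R}

lemma brk_smul_left (h : IsKModel D e) (p f : ℂ[X]) (a b : R) :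
    D.brk p (f • a) b = f.comp (-p) • D.brk p a b := by
  have := h.brk_smul_smul p f 1 a b
  rwa [one_smul, Polynomial.one_comp, mul_one] at this

lemma brk_smul_right (h : IsKModel D e) (p g : ℂ[X]) (a b : R) :
    D.brk p a (g • b) = g.comp (.X + p) • D.brk p a b := by
  have := h.brk_smul_smul p 1 g a b
  rwa [one_smul, Polynomial.one_comp, one_mul] at this

lemma sesq_left (h : IsKModel D e) (z : ℂ) (a b : R) :
    D.brk (.C z) ((.X : ℂ[X]) • a) b = -(z • D.brk (.C z) a b) := by
  rw [h.brk_smul_left, Polynomial.X_comp, neg_smul, C_smul_eq]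

lemma sesq_right (h : IsKModel D e) (z : ℂ) (a b : R) :
    D.brk (.C z) a ((.X : ℂ[X]) • b) = ((.X + .C z : ℂ[X])) • D.brk (.C z) a b := by
  rw [h.brk_smul_right, Polynomial.X_comp]

lemma brk_xi (h : IsKModel D e) (p : ℂ[X]) (i : Fin N) (B : Grassmann N) :
    D.brk p (e (xi i)) (e B) =
      p • e ((1 / 2 : ℂ) • (xi i * euler N B) - (3 / 2 : ℂ) • (xi i * B))
        - (1 / 2 : ℂ) • ((.X : ℂ[X]) • e (xi i * B)) - (1 / 2 : ℂ) • e (dxi i B) := by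
  rw [h.brk_emb, kPart₀_apply, kPart₁_apply, kPart₂_apply, euler_xi, gradeInv_xi, contr_neg_left,
    contr_xi_left]
  have e0 : (1 / 2 : ℂ) • (xi i * B) - xi i * B = -(1 / 2 : ℂ) • (xi i * B) := by module
  have e2 : (1 / 2 : ℂ) • (xi i * B) + (1 / 2 : ℂ) • (xi i * euler N B) - (2 : ℂ) • (xi i * B) =
    (1 / 2 : ℂ) • (xi i * euler N B) - (3 / 2 : ℂ) • (xi i * B) := by module
  rw [e0, e2, map_smul, map_smul, map_neg, smul_comm (.X : ℂ[X])]
  module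

lemma emb_mem_parity (h : IsKModel D e) {i : ZMod 2} {A : Grassmann N}
    (hA : A ∈ CliffordAlgebra.evenOdd (0 : QuadraticForm ℂ (Fin N → ℂ)) i) :
    e A ∈ D.parity i := by
  rw [h.parity_eq]
  exact Submodule.subset_span ⟨A, hA, rfl⟩

lemma emb_mem_parity_of_degPart (h : IsKModel D e) {n : ℕ} {A : Grassmann N}
    (hA : A ∈ degPart N n) : e A ∈ D.parity n :=
  h.emb_mem_parity (degPart_le_evenOdd n hA)

lemma parity_induction (h : IsKModel D e) {i : ZMod 2} {motive : R → Prop}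
    (emb : ∀ A ∈ CliffordAlgebra.evenOdd (0 : QuadraticForm ℂ (Fin N → ℂ)) i, motive (e A))
    (add : ∀ a b, motive a → motive b → motive (a + b))
    (smul : ∀ (f : ℂ[X]) a, motive a → motive (f • a)) {a : R} (ha : a ∈ D.parity i) :
    motive a := by
  rw [h.parity_eq] at ha
  induction ha using Submodule.span_induction with
  | mem x hx =>
    obtain ⟨A, hA, rfl⟩ := hx
    exact emb A hA
  | zero => simpa using emb 0 (zero_mem _)
  | add x y _ _ hx hy => exact add x y hx hy
  | smul f x _ hx => exact smul f x hx

end Structure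

end IsKModel

/-! ### Parity of products, derivatives and contractions. -/

section Parity

variable {N : ℕ} {i j : ZMod 2} {A B : Grassmann N}

lemma mul_mem_evenOdd (hA : A ∈ CliffordAlgebra.evenOdd (0 : QuadraticForm ℂ (Fin N → ℂ)) i)
    (hB : B ∈ CliffordAlgebra.evenOdd (0 : QuadraticForm ℂ (Fin N → ℂ)) j) :
    A * B ∈ CliffordAlgebra.evenOdd (0 : QuadraticForm ℂ (Fin N → ℂ)) (i + j) :=
  CliffordAlgebra.evenOdd_mul_le _ i j (Submodule.mul_mem_mul hA hB)

lemma evenOdd_induction {motive : Grassmann N → Prop}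
    (degPart : ∀ n : ℕ, (n : ZMod 2) = i → ∀ A ∈ degPart N n, motive A)
    (add : ∀ A B, motive A → motive B → motive (A + B))
    (hA : A ∈ CliffordAlgebra.evenOdd (0 : QuadraticForm ℂ (Fin N → ℂ)) i) : motive A := by
  refine Submodule.iSup_induction _ (motive := motive) hA ?_ ?_ add
  · rintro ⟨n, hn⟩ x hx
    exact degPart n hn x hx
  · obtain ⟨n, hn⟩ : ∃ n : ℕ, (n : ZMod 2) = i := ⟨i.val, ZMod.natCast_zmod_val i⟩
    exact degPart n hn 0 (zero_mem _)

lemma euler_mem_evenOdd (hA : A ∈ CliffordAlgebra.evenOdd (0 : QuadraticForm ℂ (Fin N → ℂ)) i) :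
    euler N A ∈ CliffordAlgebra.evenOdd (0 : QuadraticForm ℂ (Fin N → ℂ)) i := by
  refine evenOdd_induction (motive := fun A => euler N A ∈ _) (fun n hn x hx => ?_) (fun x y hx hy => ?_) hA
  · rw [euler_of_mem_degPart hx, ← hn]
    exact Submodule.smul_mem _ _ (degPart_le_evenOdd n hx)
  · rw [map_add]
    exact add_mem hx hy

lemma gradeInv_mem_evenOdd (hA : A ∈ CliffordAlgebra.evenOdd (0 : QuadraticForm ℂ (Fin N → ℂ)) i) :
    gradeInv N A ∈ CliffordAlgebra.evenOdd (0 : QuadraticForm ℂ (Fin N → ℂ)) i := by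
  rw [gradeInv_of_mem_evenOdd hA]
  exact Submodule.smul_mem _ _ hA

lemma dxi_mem_evenOdd (k : Fin N)
    (hA : A ∈ CliffordAlgebra.evenOdd (0 : QuadraticForm ℂ (Fin N → ℂ)) i) :
    dxi k A ∈ CliffordAlgebra.evenOdd (0 : QuadraticForm ℂ (Fin N → ℂ)) (i + 1) := by
  refine evenOdd_induction (motive := fun A => dxi k A ∈ _) (fun n hn x hx => ?_) (fun x y hx hy => ?_) hA
  · rcases n with _ | n
    · rw [dxi_of_mem_degPart_zero k hx]
      exact zero_mem _
    · have := degPart_le_evenOdd _ (dxi_mem_degPart k hx)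
      rw [← hn]
      convert this using 2
      push_cast
      rw [add_assoc, show (1 + 1 : ZMod 2) = 0 from rfl, add_zero]
  · rw [map_add]
    exact add_mem hx hy

lemma contr_mem_evenOdd (hA : A ∈ CliffordAlgebra.evenOdd (0 : QuadraticForm ℂ (Fin N → ℂ)) i)
    (hB : B ∈ CliffordAlgebra.evenOdd (0 : QuadraticForm ℂ (Fin N → ℂ)) j) :
    contr A B ∈ CliffordAlgebra.evenOdd (0 : QuadraticForm ℂ (Fin N → ℂ)) (i + j) := by
  refine sum_mem fun k _ => ?_
  have := mul_mem_evenOdd (dxi_mem_evenOdd k hA) (dxi_mem_evenOdd k hB)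
  rwa [add_add_add_comm, show (1 + 1 : ZMod 2) = 0 from rfl, add_zero] at this

lemma contr_swap (hA : A ∈ CliffordAlgebra.evenOdd (0 : QuadraticForm ℂ (Fin N → ℂ)) i)
    (hB : B ∈ CliffordAlgebra.evenOdd (0 : QuadraticForm ℂ (Fin N → ℂ)) j) :
    contr (gradeInv N B) A = -koszulSign i j • contr (gradeInv N A) B := by
  rw [gradeInv_of_mem_evenOdd hA, gradeInv_of_mem_evenOdd hB, contr_smul_left, contr_smul_left,
    contr, contr, Finset.smul_sum, Finset.smul_sum, Finset.smul_sum]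
  refine Finset.sum_congr rfl fun k _ => ?_
  rw [mul_comm_of_evenOdd (dxi_mem_evenOdd k hA) (dxi_mem_evenOdd k hB), smul_smul, smul_smul]
  congr 1
  rcases eq_zero_or_eq_one_zmod i with rfl | rfl <;>
  rcases eq_zero_or_eq_one_zmod j with rfl | rfl <;>
  simp [koszulSign, ZMod.val_one, show (1 + 1 : ZMod 2) = 0 from rfl]

end Parity

/-- `A` is an eigenvector of the Euler operator (eigenvalue `r`) and of the parity automorphism
(eigenvalue `ε`). -/
structure IsGraded {N : ℕ} (A : Grassmann N) (r ε : ℂ) : Prop where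
  euler : euler N A = r • A
  gradeInv : gradeInv N A = ε • A

namespace IsGraded

variable {N : ℕ} {A B : Grassmann N} {r s ε δ : ℂ}

lemma of_degPart {n : ℕ} (hA : A ∈ degPart N n) : IsGraded A n ((-1) ^ n) :=
  ⟨euler_of_mem_degPart hA, gradeInv_of_mem_degPart hA⟩

lemma mul (hA : IsGraded A r ε) (hB : IsGraded B s δ) : IsGraded (A * B) (r + s) (ε * δ) where
  euler := by rw [euler_mul, hA.euler, hB.euler, smul_mul_assoc, mul_smul_comm, add_smul]
  gradeInv := by rw [gradeInv_mul, hA.gradeInv, hB.gradeInv, smul_mul_smul_comm]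

lemma contr (hA : IsGraded A r ε) (hB : IsGraded B s δ) :
    IsGraded (contr A B) (r + s - 2) (ε * δ) where
  euler := by
    rw [euler_contr, hA.euler, hB.euler, contr_smul_left, contr_smul_right]
    module
  gradeInv := by
    have : _root_.gradeInv N (_root_.contr A B) =
        _root_.contr (_root_.gradeInv N A) (_root_.gradeInv N B) := by
      simp only [_root_.contr, map_sum, gradeInv_mul, gradeInv_dxi, neg_mul_neg]
    rw [this, hA.gradeInv, hB.gradeInv, contr_smul_left, contr_smul_right, smul_smul]

lemma xi_mul (i : Fin N) (hA : IsGraded A r ε) : IsGraded (xi i * A) (r + 1) (-ε) where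
  euler := by rw [euler_xi_mul, hA.euler, mul_smul_comm]; module
  gradeInv := by rw [gradeInv_mul, gradeInv_xi, hA.gradeInv, mul_smul_comm]; simp

lemma dxi (i : Fin N) (hA : IsGraded A r ε) : IsGraded (dxi i A) (r - 1) (-ε) where
  euler := by rw [euler_dxi, hA.euler, map_smul]; module
  gradeInv := by rw [gradeInv_dxi, hA.gradeInv, map_smul, neg_smul]

lemma mul_xi (hA : IsGraded A r ε) (i : Fin N) (B : Grassmann N) :
    A * (xi i * B) = ε • (xi i * (A * B)) := by
  have := xi_mul_gradeInv i A
  rw [hA.gradeInv, mul_smul_comm] at this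
  rw [← mul_assoc, ← this, smul_mul_assoc, mul_assoc]

end IsGraded

/-! ### Jacobi identity for `1` and `ξ_i`, and skew-commutativity. -/

namespace IsKModel

section Jacobi

variable {N : ℕ} {R : Type*} [AddCommGroup R] [Module ℂ R] [Module ℂ[X] R] [IsScalarTower ℂ ℂ[X] R]
  {D : ConformalData R} {e : Grassmann N →ₗ[ℂ] R}
  {A B : Grassmann N} {r s ε δ : ℂ}

/-- With the degrees replaced by complex eigenvalues, brackets become polynomial combinations of
embedded elements, so that identities between them can be compared coefficient by coefficient. -/
lemma brk_emb_graded (h : IsKModel D e) (p : ℂ[X]) (hA : IsGraded A r ε) (hB : IsGraded B s δ) :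
    D.brk p (e A) (e B) = (.C (r / 2 - 1) * .X + .C ((r + s) / 2 - 2) * p : ℂ[X]) • e (A * B) +
      (ε / 2) • e (contr A B) := by
  have e0 : kPart₀ N A B = (r / 2 - 1) • (A * B) := by
    rw [kPart₀_apply, hA.euler, smul_mul_assoc]; module
  have e1 : kPart₁ N A B = (ε / 2) • contr A B := by
    rw [kPart₁_apply, hA.gradeInv, contr_smul_left]; module
  have e2 : kPart₂ N A B = ((r + s) / 2 - 2) • (A * B) := by
    rw [kPart₂_apply, hA.euler, hB.euler, smul_mul_assoc, mul_smul_comm]; module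
  rw [h.brk_emb, e0, e1, e2, map_smul, map_smul, map_smul, ← C_smul_eq (r / 2 - 1),
    ← C_smul_eq ((r + s) / 2 - 2), smul_smul, smul_smul, add_smul, mul_comm p, mul_comm (.X : ℂ[X]) (.C _)]
  abel

lemma brk_one_graded (h : IsKModel D e) (p : ℂ[X]) (hB : IsGraded B s δ) :
    D.brk p (e 1) (e B) = (.C (s / 2 - 2) * p - .X : ℂ[X]) • e B := by
  rw [h.brk_emb_graded p (A := 1) (r := 0) (ε := 1) ⟨by simp [euler_one], by simp [gradeInv_one]⟩ hB,
    contr_one_left, one_mul, map_zero, smul_zero, add_zero]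
  congr 1
  refine Polynomial.funext fun t => ?_
  simp
  ring

lemma brk_xi_graded (h : IsKModel D e) (p : ℂ[X]) (i : Fin N) (hB : IsGraded B s δ) :
    D.brk p (e (xi i)) (e B) = (.C ((s - 3) / 2) * p - .C (1 / 2) * .X : ℂ[X]) • e (xi i * B)
      - (1 / 2 : ℂ) • e (dxi i B) := by
  rw [h.brk_emb_graded p (A := xi i) (r := 1) (ε := -1) ⟨by simp [euler_xi], by simp [gradeInv_xi]⟩
    hB, contr_xi_left, sub_eq_add_neg _ ((1 / 2 : ℂ) • e (dxi i B)), ← neg_smul]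
  congr 2
  · refine Polynomial.funext fun t => ?_
    simp
    ring
  · norm_num

lemma jacobiFor_one (h : IsKModel D e) (hB : IsGraded B r ε) {C : Grassmann N}
    (hC : IsGraded C s δ) (z w : ℂ) :
    D.brk (.C z) (e 1) (D.brk (.C w) (e B) (e C)) =
      D.brk (.C (z + w)) (D.brk (.C z) (e 1) (e B)) (e C)
        + D.brk (.C w) (e B) (D.brk (.C z) (e 1) (e C)) := by
  rw [h.brk_emb_graded _ hB hC, h.brk_one_graded _ hB, h.brk_one_graded _ hC, h.brk_smul_left,
    h.brk_smul_right, ConformalData.brk_add_right, ConformalData.brk_smul_right, h.brk_smul_right,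
    h.brk_one_graded _ (hB.mul hC), h.brk_one_graded _ (hB.contr hC), h.brk_emb_graded _ hB hC,
    h.brk_emb_graded _ hB hC]
  match_scalars <;> refine Polynomial.funext fun t => ?_
  · simp
    ring
  · simp
    ring

/-- The Leibniz rules for `∂_i` on products and contractions reduce all terms to finitely many
embedded elements. What remains is an identity between their polynomial coefficients, in which `ε`
is a sign. -/
lemma jacobiFor_xi (h : IsKModel D e) (hε : ε * ε = 1) (i : Fin N) (hB : IsGraded B r ε)
    {C : Grassmann N} (hC : IsGraded C s δ) (z w : ℂ) :
    D.brk (.C z) (e (xi i)) (D.brk (.C w) (e B) (e C)) =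
      D.brk (.C (z + w)) (D.brk (.C z) (e (xi i)) (e B)) (e C)
        + ε • D.brk (.C w) (e B) (D.brk (.C z) (e (xi i)) (e C)) := by
  have d1 := dxi_mul i B C
  rw [hB.gradeInv, smul_mul_assoc] at d1
  have d2 := dxi_contr i B C
  rw [hB.gradeInv, contr_smul_left] at d2
  have d3 := contr_xi_mul_right i B C
  rw [hB.gradeInv, contr_smul_left, mul_smul_comm] at d3
  rw [h.brk_emb_graded _ hB hC, h.brk_xi_graded _ _ hB, h.brk_xi_graded _ _ hC,
    ConformalData.brk_sub_left, ConformalData.brk_sub_right, ConformalData.brk_smul_left,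
    ConformalData.brk_smul_right, h.brk_smul_left,
    h.brk_smul_right, ConformalData.brk_add_right, ConformalData.brk_smul_right, h.brk_smul_right,
    h.brk_xi_graded _ _ (hB.mul hC), h.brk_xi_graded _ _ (hB.contr hC),
    h.brk_emb_graded _ (hB.xi_mul i) hC, h.brk_emb_graded _ hB (hC.xi_mul i),
    h.brk_emb_graded _ (hB.dxi i) hC, h.brk_emb_graded _ hB (hC.dxi i),
    contr_xi_mul_left, d1, d2, d3, hB.mul_xi i, mul_assoc]
  simp only [map_add, map_sub, map_neg, map_smul]
  match_scalars <;> refine Polynomial.funext fun t => ?_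
  all_goals simp
  all_goals rcases mul_self_eq_one_iff.1 hε with rfl | rfl <;> ring

lemma parity_bracket (h : IsKModel D e) (i j : ZMod 2) (a : R) (ha : a ∈ D.parity i) (b : R)
    (hb : b ∈ D.parity j) (z : ℂ) : D.brk (.C z) a b ∈ D.parity (i + j) := by
  refine h.parity_induction (motive := fun a => D.brk (.C z) a b ∈ D.parity (i + j))
    (fun A hA => ?_) (fun x y hx hy => ?_) (fun f x hx => ?_) ha
  · refine h.parity_induction (motive := fun b => D.brk (.C z) (e A) b ∈ D.parity (i + j))
      (fun B hB => ?_) (fun x y hx hy => ?_) (fun f x hx => ?_) hb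
    · have m := mul_mem_evenOdd hA hB
      have m0 : kPart₀ N A B ∈ CliffordAlgebra.evenOdd (0 : QuadraticForm ℂ (Fin N → ℂ)) (i + j) := by
        rw [kPart₀_apply]
        exact sub_mem (Submodule.smul_mem _ _ (mul_mem_evenOdd (euler_mem_evenOdd hA) hB)) m
      have m1 : kPart₁ N A B ∈ CliffordAlgebra.evenOdd (0 : QuadraticForm ℂ (Fin N → ℂ)) (i + j) := by
        rw [kPart₁_apply]
        exact Submodule.smul_mem _ _ (contr_mem_evenOdd (gradeInv_mem_evenOdd hA) hB)
      have m2 : kPart₂ N A B ∈ CliffordAlgebra.evenOdd (0 : QuadraticForm ℂ (Fin N → ℂ)) (i + j) := by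
        rw [kPart₂_apply]
        exact sub_mem (add_mem (Submodule.smul_mem _ _ (mul_mem_evenOdd (euler_mem_evenOdd hA) hB))
          (Submodule.smul_mem _ _ (mul_mem_evenOdd hA (euler_mem_evenOdd hB))))
          (Submodule.smul_mem _ _ m)
      rw [h.brk_emb]
      exact add_mem (add_mem (Submodule.smul_mem _ _ (h.emb_mem_parity m0)) (h.emb_mem_parity m1))
        (Submodule.smul_mem _ _ (h.emb_mem_parity m2))
    · rw [ConformalData.brk_add_right]
      exact add_mem hx hy
    · rw [h.brk_smul_right]
      exact Submodule.smul_mem _ _ hx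
  · rw [ConformalData.brk_add_left]
    exact add_mem hx hy
  · rw [h.brk_smul_left]
    exact Submodule.smul_mem _ _ hx

lemma skew (h : IsKModel D e) (i j : ZMod 2) (a : R) (ha : a ∈ D.parity i) (b : R)
    (hb : b ∈ D.parity j) (z : ℂ) :
    D.brk (.C z) b a = -(koszulSign i j • D.brk (-.C z - .X) a b) := by
  refine h.parity_induction (motive := fun a => D.brk (.C z) b a =
    -(koszulSign i j • D.brk (-.C z - .X) a b))
    (fun A hA => ?_) (fun x y hx hy => ?_) (fun f x hx => ?_) ha
  · refine h.parity_induction (motive := fun b => D.brk (.C z) b (e A) =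
      -(koszulSign i j • D.brk (-.C z - .X) (e A) b))
      (fun B hB => ?_) (fun x y hx hy => ?_) (fun f x hx => ?_) hb
    · have m0 : B * A = koszulSign i j • (A * B) := mul_comm_of_evenOdd hA hB
      have m1 : euler N B * A = koszulSign i j • (A * euler N B) :=
        mul_comm_of_evenOdd hA (euler_mem_evenOdd hB)
      have m2 : B * euler N A = koszulSign i j • (euler N A * B) :=
        mul_comm_of_evenOdd (euler_mem_evenOdd hA) hB
      rw [h.brk_emb, h.brk_emb]
      simp only [kPart₀_apply, kPart₁_apply, kPart₂_apply, m0, m1, m2, contr_swap hA hB,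
        map_sub, map_add, map_smul]
      match_scalars <;> refine Polynomial.funext fun t => ?_ <;> simp <;> ring
    · rw [ConformalData.brk_add_right, ConformalData.brk_add_left, hx, hy, smul_add, neg_add]
    · rw [h.brk_smul_right, h.brk_smul_left, hx, smul_neg, smul_comm (koszulSign i j)]
      congr 4
      ring
  · rw [ConformalData.brk_add_right, ConformalData.brk_add_left, hx, hy, smul_add, neg_add]
  · rw [h.brk_smul_right, h.brk_smul_left, hx, smul_neg, smul_comm (koszulSign i j)]
    congr 4
    ring

end Jacobi

end IsKModel

lemma span_polynomial_induction {M : Type*} [AddCommGroup M] [Module ℂ M] [Module ℂ[X] M]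
    [IsScalarTower ℂ ℂ[X] M] {T : Set M} {motive : M → Prop} (mem : ∀ x ∈ T, motive x)
    (zero : motive 0) (add : ∀ x y, motive x → motive y → motive (x + y))
    (smul : ∀ (z : ℂ) x, motive x → motive (z • x))
    (X_smul : ∀ x, motive x → motive ((.X : ℂ[X]) • x)) {x : M}
    (hx : x ∈ Submodule.span ℂ[X] T) : motive x := by
  induction hx using Submodule.span_induction with
  | mem x hx => exact mem x hx
  | zero => exact zero
  | add x y _ _ hx hy => exact add x y hx hy
  | smul f x _ hx =>
    induction f using Polynomial.induction_on' with
    | add p q hp hq => rw [add_smul]; exact add _ _ hp hq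
    | monomial n z =>
      rw [← Polynomial.C_mul_X_pow_eq_monomial, mul_smul, C_smul_eq]
      refine smul z _ ?_
      induction n with
      | zero => rwa [pow_zero, one_smul]
      | succ n ih => rw [pow_succ', mul_smul]; exact X_smul _ ih

namespace ConformalData

section JacobiSpan

variable {R : Type*} [AddCommGroup R] [Module ℂ R] [Module ℂ[X] R] [IsScalarTower ℂ ℂ[X] R]
variable {V : Type*} [AddCommGroup V] [Module ℂ V]
variable {D : ConformalData R} {F : ℂ → R →ₗ[ℂ] R →ₗ[ℂ] V} {i : ZMod 2} {a : R}

/-- The Jacobi identity with first argument `a`, at given `z` and `w`, may be checked on generators. -/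
lemma jacobi_of_span
    (hD : ∀ z a b, D.brk (.C z) ((.X : ℂ[X]) • a) b = -(z • D.brk (.C z) a b))
    (hD' : ∀ z a b, D.brk (.C z) a ((.X : ℂ[X]) • b) = (.X + .C z : ℂ[X]) • D.brk (.C z) a b)
    (hF : ∀ z a b, F z ((.X : ℂ[X]) • a) b = -(z • F z a b)) (θ : V →ₗ[ℂ] V)
    (hF' : ∀ z a b, F z a ((.X : ℂ[X]) • b) = θ (F z a b) + z • F z a b)
    (T : ZMod 2 → Set R) (hT : ∀ j, D.parity j ≤ Submodule.span ℂ[X] (T j)) (U : Set R)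
    (hU : Submodule.span ℂ[X] U = ⊤)
    (z w : ℂ) (h : ∀ j, ∀ b ∈ T j, ∀ c ∈ U, F z a (D.brk (.C w) b c) =
      F (z + w) (D.brk (.C z) a b) c + koszulSign i j • F w b (D.brk (.C z) a c)) :
    ∀ j, ∀ b ∈ D.parity j, ∀ c, F z a (D.brk (.C w) b c) =
      F (z + w) (D.brk (.C z) a b) c + koszulSign i j • F w b (D.brk (.C z) a c) :=
    fun j b hb c => by
  have hc : c ∈ Submodule.span ℂ[X] U := by rw [hU]; trivial
  refine span_polynomial_induction (motive := fun b => F z a (D.brk (.C w) b c) =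
      F (z + w) (D.brk (.C z) a b) c + koszulSign i j • F w b (D.brk (.C z) a c))
    (fun b hb => ?_) ?_ (fun x y hx hy => ?_) (fun r x hx => ?_) (fun x hx => ?_) (hT j hb)
  · refine span_polynomial_induction (motive := fun c => F z a (D.brk (.C w) b c) =
        F (z + w) (D.brk (.C z) a b) c + koszulSign i j • F w b (D.brk (.C z) a c))
      (fun c hc => h j b hb c hc) ?_ (fun x y hx hy => ?_) (fun r x hx => ?_)
      (fun x hx => ?_) hc
    · simp [brk_zero_right]
    · simp only [brk_add_right, map_add, hx, hy]
      module
    · simp only [brk_smul_right, map_smul, hx]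
      module
    · simp only [hD', add_smul, C_smul_eq, map_add, hF', hx, map_smul]
      module
  · simp [brk_zero_left, brk_zero_right]
  · simp only [brk_add_left, brk_add_right, map_add, LinearMap.add_apply, hx, hy]
    module
  · simp only [brk_smul_left, brk_smul_right, map_smul, LinearMap.smul_apply, hx]
    module
  · simp only [hD, hD', hF, add_smul, C_smul_eq, map_add, map_neg, map_smul, hx,
      LinearMap.add_apply, LinearMap.smul_apply]
    module

end JacobiSpan

end ConformalData

/-! ### `K_N` is a Lie conformal superalgebra. -/

section KLie

variable {N : ℕ}

lemma degPart_succ_induction {n : ℕ} {motive : Grassmann N → Prop}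
    (mul : ∀ i, ∀ y ∈ degPart N n, motive (xi i * y)) (zero : motive 0)
    (add : ∀ x y, motive x → motive y → motive (x + y))
    (smul : ∀ (z : ℂ) x, motive x → motive (z • x)) {A : Grassmann N}
    (hA : A ∈ degPart N (n + 1)) : motive A := by
  rw [degPart, pow_succ'] at hA
  refine Submodule.mul_induction_on hA ?_ add
  rintro _ ⟨v, rfl⟩ y hy
  rw [ι_eq_sum_xi, Finset.sum_mul]
  refine Finset.sum_induction _ motive add zero fun i _ => ?_
  rw [smul_mul_assoc]
  exact smul _ _ (mul i y hy)

/-- The homogeneous elements of `Λ(N)` of parity `j`. -/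
def gradedSet (N : ℕ) (j : ZMod 2) : Set (Grassmann N) :=
  {A | ∃ n : ℕ, (n : ZMod 2) = j ∧ A ∈ degPart N n}

lemma evenOdd_le_span_gradedSet (j : ZMod 2) :
    CliffordAlgebra.evenOdd (0 : QuadraticForm ℂ (Fin N → ℂ)) j ≤
      Submodule.span ℂ (gradedSet N j) := fun A hA => by
  refine evenOdd_induction (motive := fun A => A ∈ Submodule.span ℂ (gradedSet N j))
    (fun n hn x hx => Submodule.subset_span ⟨n, hn, hx⟩) (fun x y => add_mem) hA

lemma neg_one_pow_eq_koszulSign_one (n : ℕ) : (-1 : ℂ) ^ n = koszulSign 1 n := by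
  rw [koszulSign, ZMod.val_one, one_mul, ZMod.val_natCast, ← neg_one_pow_eq_pow_mod_two]

namespace IsKModel

variable {R : Type*} [AddCommGroup R] [Module ℂ R] [Module ℂ[X] R] [IsScalarTower ℂ ℂ[X] R]
  {D : ConformalData R} {e : Grassmann N →ₗ[ℂ] R}

lemma map_span_le (f : Grassmann N →ₗ[ℂ] R) (T : Set (Grassmann N)) {A : Grassmann N}
    (hA : A ∈ Submodule.span ℂ T) : f A ∈ Submodule.span ℂ[X] (f '' T) := by
  have h1 : f A ∈ Submodule.span ℂ (f '' T) := by
    rw [Submodule.span_image]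
    exact Submodule.mem_map_of_mem hA
  exact Submodule.span_subset_span ℂ ℂ[X] _ h1

lemma parity_le_span (h : IsKModel D e) (j : ZMod 2) :
    D.parity j ≤ Submodule.span ℂ[X] (e '' gradedSet N j) := by
  rw [h.parity_eq, Submodule.span_le]
  rintro _ ⟨A, hA, rfl⟩
  exact map_span_le e _ (evenOdd_le_span_gradedSet j hA)

lemma span_graded (h : IsKModel D e) :
    Submodule.span ℂ[X] (e '' {A | ∃ n, A ∈ degPart N n}) = ⊤ := by
  rw [eq_top_iff, ← h.span_emb, Submodule.span_le]
  rintro _ ⟨A, rfl⟩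
  refine map_span_le e _ ?_
  have hA : A ∈ ⨆ n, degPart N n := by rw [iSup_degPart]; trivial
  refine Submodule.iSup_induction _ (motive := fun A => A ∈ Submodule.span ℂ _) hA
    (fun n x hx => Submodule.subset_span ⟨n, hx⟩) (zero_mem _) fun x y => add_mem

/-- The Jacobi identity with first argument `a` may be checked on homogeneous elements of
`Λ(N)`. -/
lemma jacobiFor (h : IsKModel D e) {a : R} {i : ZMod 2}
    (ha : ∀ m n : ℕ, ∀ B ∈ degPart N m, ∀ C ∈ degPart N n, ∀ z w,
      D.brk (.C z) a (D.brk (.C w) (e B) (e C)) =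
        D.brk (.C (z + w)) (D.brk (.C z) a (e B)) (e C)
          + koszulSign i m • D.brk (.C w) (e B) (D.brk (.C z) a (e C))) :
    D.JacobiFor D.brkAt i a := by
  have s1 : ∀ z a b, D.brkAt z ((.X : ℂ[X]) • a) b = -(z • D.brkAt z a b) := fun z a b => by
    rw [ConformalData.brkAt_apply, ConformalData.brkAt_apply, h.sesq_left]
  have s2 : ∀ z a b, D.brkAt z a ((.X : ℂ[X]) • b) =
      Algebra.lsmul ℂ ℂ R (.X : ℂ[X]) (D.brkAt z a b) + z • D.brkAt z a b := fun z a b => by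
    rw [ConformalData.brkAt_apply, ConformalData.brkAt_apply, h.sesq_right, add_smul, C_smul_eq]
    rfl
  intro j b hb c z w
  refine ConformalData.jacobi_of_span h.sesq_left h.sesq_right s1 _ s2
    (fun j => e '' gradedSet N j) h.parity_le_span _ h.span_graded z w ?_ j b hb c
  rintro j _ ⟨B, ⟨m, rfl, hB⟩, rfl⟩ _ ⟨C, ⟨n, hC⟩, rfl⟩
  simp only [ConformalData.brkAt_apply]
  exact ha m n B hB C hC z w

lemma jacobiFor_one_brkAt (h : IsKModel D e) : D.JacobiFor D.brkAt 0 (e 1) := by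
  refine h.jacobiFor fun m n B hB C hC z w => ?_
  rw [h.jacobiFor_one (.of_degPart hB) (.of_degPart hC)]
  simp [koszulSign]

lemma jacobiFor_xi_brkAt (h : IsKModel D e) (i : Fin N) : D.JacobiFor D.brkAt 1 (e (xi i)) := by
  refine h.jacobiFor fun m n B hB C hC z w => ?_
  rw [h.jacobiFor_xi (by rw [← mul_pow]; norm_num) i (.of_degPart hB) (.of_degPart hC),
    neg_one_pow_eq_koszulSign_one]

/-- This is `[ξ_i_λ B]` at `λ = 0`. It expresses `∂(ξ_i B)` by elements of lower degree and `ξ_i`,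
and is the basis of all inductions on degree. -/
lemma X_smul_emb_xi_mul (h : IsKModel D e) (i : Fin N) (B : Grassmann N) :
    (.X : ℂ[X]) • e (xi i * B) =
      -(2 : ℂ) • D.brk (.C 0) (e (xi i)) (e B) - e (dxi i B) := by
  rw [h.brk_xi, Polynomial.C_0, zero_smul]
  generalize (.X : ℂ[X]) • e (xi i * B) = u
  module

/-- The case `n = 0` is separate because `n - 1` truncates there; otherwise `1 + n` and `n - 1`
agree modulo `2`. -/
lemma dxi_induction_step {n : ℕ} (i : Fin N) {y : Grassmann N} (hy : y ∈ degPart N n)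
    {P : ZMod 2 → R → Prop} (zero : ∀ j, P j 0) (ih : ∀ m < n, ∀ A ∈ degPart N m, P m (e A)) :
    P (1 + n) (e (dxi i y)) := by
  rcases n with _ | n
  · rw [dxi_of_mem_degPart_zero i hy, map_zero]
    exact zero _
  · have := ih n (by omega) _ (dxi_mem_degPart i hy)
    convert this using 1
    push_cast
    rw [add_comm, add_assoc, show (1 + 1 : ZMod 2) = 0 from rfl, add_zero]

/-- The two identities are carried together through the induction on degree, because passing to a
bracket for `F` uses the identity of `D` for both entries. -/
lemma jacobiFor_emb_and (h : IsKModel D e) {V : Type*} [AddCommGroup V] [Module ℂ V]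
    {F : ℂ → R →ₗ[ℂ] R →ₗ[ℂ] V} (hF : ∀ z a b, F z ((.X : ℂ[X]) • a) b = -(z • F z a b))
    (hP : ∀ (g : V →ₗ[ℂ] ℂ) (x y : R), ∃ P : ℂ[X], ∀ z, P.eval z = g (F z x y))
    (h1 : D.JacobiFor F 0 (e 1)) (hξ : ∀ i, D.JacobiFor F 1 (e (xi i))) (n : ℕ) :
    ∀ A ∈ degPart N n, D.JacobiFor D.brkAt n (e A) ∧ D.JacobiFor F n (e A) := by
  have hb : ∀ z a b, D.brkAt z ((.X : ℂ[X]) • a) b = -(z • D.brkAt z a b) := fun z a b => by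
    rw [ConformalData.brkAt_apply, ConformalData.brkAt_apply, h.sesq_left]
  have hPb : ∀ (g : R →ₗ[ℂ] ℂ) (x y : R), ∃ P : ℂ[X], ∀ z, P.eval z = g (D.brkAt z x y) :=
    fun g x y => ⟨_, fun z => eval_rid_lTensor g z (D.bracket x y)⟩
  induction n using Nat.strong_induction_on with
  | _ n ih =>
  intro A hA
  rcases n with _ | n
  · rw [degPart, pow_zero] at hA
    obtain ⟨z, rfl⟩ := Submodule.mem_one.1 hA
    rw [Algebra.algebraMap_eq_smul_one, map_smul]
    exact ⟨h.jacobiFor_one_brkAt.smul z, h1.smul z⟩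
  · refine degPart_succ_induction (motive := fun A => D.JacobiFor D.brkAt (n + 1 : ℕ) (e A) ∧
        D.JacobiFor F (n + 1 : ℕ) (e A))
      (fun i y hy => ?_) ?_ (fun x y hx hy => ?_) (fun z x hx => ?_) hA
    · have hi := h.jacobiFor_xi_brkAt i
      have hy' := ih n (by omega) y hy
      have mi := h.emb_mem_parity_of_degPart (xi_mem_degPart i)
      have my := h.emb_mem_parity_of_degPart hy
      rw [Nat.cast_one] at mi
      have hd := dxi_induction_step i hy
        (P := fun j a => D.JacobiFor D.brkAt j a ∧ D.JacobiFor F j a) (fun _ => ⟨.zero, .zero⟩)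
        fun m hm => ih m (by omega)
      have key : (.X : ℂ[X]) • e (xi i * y) =
          -(2 : ℂ) • D.brk (.C 0) (e (xi i)) (e y) + (-1 : ℂ) • e (dxi i y) := by
        rw [X_smul_emb_xi_mul h, sub_eq_add_neg, neg_one_smul ℂ (e (dxi i y))]
      have hn : ((n + 1 : ℕ) : ZMod 2) = 1 + n := by rw [Nat.cast_add, add_comm, Nat.cast_one]
      rw [hn]
      -- After multiplication by `∂`, the element `ξ_i y` becomes a bracket of `ξ_i` with an element
      -- of smaller degree, plus an element of smaller degree.
      refine ⟨.of_X_smul h.sesq_left hb hPb ?_, .of_X_smul h.sesq_left hF hP ?_⟩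
      · rw [key]
        exact ((hi.brk h.parity_bracket mi my hy'.1 hi hy'.1 0).smul _).add (hd.1.smul _)
      · rw [key]
        exact ((hi.brk h.parity_bracket mi my hy'.1 (hξ i) hy'.2 0).smul _).add (hd.2.smul _)
    · rw [map_zero]
      exact ⟨.zero, .zero⟩
    · rw [map_add]
      exact ⟨hx.1.add hy.1, hx.2.add hy.2⟩
    · rw [map_smul]
      exact ⟨hx.1.smul z, hx.2.smul z⟩

lemma jacobiFor_emb (h : IsKModel D e) (n : ℕ) (A : Grassmann N) (hA : A ∈ degPart N n) :
    D.JacobiFor D.brkAt n (e A) :=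
  (h.jacobiFor_emb_and (F := D.brkAt)
    (fun z a b => by rw [ConformalData.brkAt_apply, ConformalData.brkAt_apply, h.sesq_left])
    (fun g x y => ⟨_, fun z => eval_rid_lTensor g z (D.bracket x y)⟩)
    h.jacobiFor_one_brkAt h.jacobiFor_xi_brkAt n A hA).1

theorem isLie (h : IsKModel D e) : D.IsLie where
  isCompl := h.isCompl
  parity_bracket i j a ha b hb :=
    (ConformalData.forall_nthProduct_mem_iff _ a b).2 (h.parity_bracket i j a ha b hb)
  sesq_left := h.sesq_left
  sesq_right := h.sesq_right
  skew i j a ha b hb z := h.skew i j a ha b hb z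
  jacobi i j a ha b hb c z w := by
    have : D.JacobiFor D.brkAt i a := by
      refine span_polynomial_induction (motive := fun a => D.JacobiFor D.brkAt i a) ?_ .zero
        (fun x y hx hy => hx.add hy) (fun z x hx => hx.smul z)
        (fun x hx => hx.X_smul h.sesq_left fun z a b => ?_) (h.parity_le_span i ha)
      · rintro _ ⟨A, ⟨n, rfl, hA⟩, rfl⟩
        exact h.jacobiFor_emb n A hA
      · rw [ConformalData.brkAt_apply, ConformalData.brkAt_apply, h.sesq_left]
    have := this j b hb c z w
    simpa only [ConformalData.brkAt_apply] using this

end IsKModel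

end KLie

/-! ### Cocycles evaluated on primary elements. -/

namespace ConformalData

section Primary

variable {R : Type*} [AddCommGroup R] [Module ℂ R] [Module ℂ[X] R] [IsScalarTower ℂ ℂ[X] R]

/-- `a` is primary of conformal weight `Δ` with respect to `L`, in the normalisation
`[L_λ a] = -(∂ + Δ λ) a`. -/
def IsPrimary (D : ConformalData R) (L : R) (Δ : ℂ) (a : R) : Prop :=
  ∀ z, D.brk (.C z) L a = -((.X : ℂ[X]) • a) - (z * Δ) • a

variable {D : ConformalData R} {α : LambdaForm R} {L G a b : R} {Δ : ℂ}

lemma eval_form_X_left (hα : α ∈ D.twoCocycles) (a b : R) (z : ℂ) :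
    (α ((.X : ℂ[X]) • a) b).eval z = -(z * (α a b).eval z) := by
  rw [hα.1]; simp

lemma eval_form_X_right (hα : α ∈ D.twoCocycles) (a b : R) (z : ℂ) :
    (α a ((.X : ℂ[X]) • b)).eval z = z * (α a b).eval z := by
  rw [hα.2.1]; simp

/-- The cocycle identity for `(L, L, a)`, with `[L_z L]` and `[L_z a]` replaced by their primary
expressions. -/
lemma primary_equation (hα : α ∈ D.twoCocycles) (hL : L ∈ D.parity 0) (hLL : D.IsPrimary L 2 L)
    (ha : D.IsPrimary L Δ a) (z w : ℂ) :
    (w - z) * (α L a).eval (z + w) =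
      (w + z * Δ) * (α L a).eval w - (z + w * Δ) * (α L a).eval z := by
  have h := hα.2.2.2 0 0 L hL L hL a z w
  rw [ha, ha, hLL] at h
  simp only [map_sub, map_neg, map_smul, LinearMap.sub_apply, LinearMap.neg_apply,
    LinearMap.smul_apply, Polynomial.eval_sub, Polynomial.eval_neg, Polynomial.eval_smul,
    eval_form_X_left hα, eval_form_X_right hα, koszulSign, ZMod.val_zero, smul_eq_mul] at h
  linear_combination -h

lemma primary_coeff (hα : α ∈ D.twoCocycles) (hL : L ∈ D.parity 0) (hLL : D.IsPrimary L 2 L)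
    (ha : D.IsPrimary L Δ a) (n : ℕ) (z w : ℂ) :
    ((w - z) * (z + w) ^ n - (w + z * Δ) * w ^ n + (z + w * Δ) * z ^ n) * (α L a).coeff n = 0 := by
  -- Scaling `z` and `w` by an indeterminate separates the coefficients, since all factors of the
  -- equation are linear in `z` and `w`.
  have h : .X * (.C (w - z) * (α L a).comp (.C (z + w) * .X) - .C (w + z * Δ) *
      (α L a).comp (.C w * .X) + .C (z + w * Δ) * (α L a).comp (.C z * .X)) = 0 := by
    refine Polynomial.funext fun t => ?_
    have := primary_equation hα hL hLL ha (t * z) (t * w)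
    simp only [Polynomial.eval_mul, Polynomial.eval_X, Polynomial.eval_sub, Polynomial.eval_add,
      Polynomial.eval_C, Polynomial.eval_comp, Polynomial.eval_zero]
    rw [show t * z + t * w = (z + w) * t by ring, mul_comm t w, mul_comm t z] at this
    linear_combination this
  have h1 := congrArg (Polynomial.coeff · n)
    ((mul_eq_zero.1 h).resolve_left Polynomial.X_ne_zero)
  simp only [Polynomial.coeff_add, Polynomial.coeff_sub, Polynomial.coeff_C_mul,
    Polynomial.comp_C_mul_X_coeff, Polynomial.coeff_zero] at h1
  linear_combination h1

/-- For `n = 0` the factor is `Δ(w - z)`. For `n = 1` it is identically zero, which is why the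
linear coefficient must be removed by a coboundary. -/
lemma primary_coeff_zero (hα : α ∈ D.twoCocycles) (hL : L ∈ D.parity 0)
    (hLL : D.IsPrimary L 2 L) (ha : D.IsPrimary L Δ a) (hΔ : Δ ≠ 0) : (α L a).coeff 0 = 0 := by
  have h := primary_coeff hα hL hLL ha 0 0 1
  simpa [hΔ] using h

/-- At `z = 1`, `w = 2` the factor is `2 - 2Δ`; in the cubic case the same point gives `12 - 6Δ`. -/
lemma primary_coeff_two (hα : α ∈ D.twoCocycles) (hL : L ∈ D.parity 0)
    (hLL : D.IsPrimary L 2 L) (ha : D.IsPrimary L Δ a) (hΔ : Δ ≠ 1) : (α L a).coeff 2 = 0 := by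
  have h := primary_coeff hα hL hLL ha 2 1 2
  refine (mul_eq_zero.1 h).resolve_left fun h0 => hΔ ?_
  linear_combination -(1 / 2 : ℂ) * h0

lemma primary_coeff_three (hα : α ∈ D.twoCocycles) (hL : L ∈ D.parity 0)
    (hLL : D.IsPrimary L 2 L) (ha : D.IsPrimary L Δ a) (hΔ : Δ ≠ 2) : (α L a).coeff 3 = 0 := by
  have h := primary_coeff hα hL hLL ha 3 1 2
  refine (mul_eq_zero.1 h).resolve_left fun h0 => hΔ ?_
  linear_combination -(1 / 6 : ℂ) * h0

lemma primary_coeff_of_four_le (hα : α ∈ D.twoCocycles) (hL : L ∈ D.parity 0)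
    (hLL : D.IsPrimary L 2 L) (ha : D.IsPrimary L Δ a) {n : ℕ} (hn : 4 ≤ n) :
    (α L a).coeff n = 0 := by
  by_contra h0
  have h : ((1 - .X) * (1 + .X) ^ n - (1 + .X * .C Δ) + (.X + .C Δ) * .X ^ n : ℂ[X]) = 0 := by
    refine Polynomial.funext fun z => ?_
    have := (mul_eq_zero.1 (primary_coeff hα hL hLL ha n z 1)).resolve_right h0
    simp only [Polynomial.eval_add, Polynomial.eval_sub, Polynomial.eval_mul, Polynomial.eval_pow,
      Polynomial.eval_one, Polynomial.eval_X, Polynomial.eval_C, Polynomial.eval_zero]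
    rw [one_pow, add_comm z 1] at this
    linear_combination this
  -- For `w = 1` the coefficient of `z^2` in the factor is `n(n-1)/2 - n`, which is non-zero for `n
  -- ≥ 4`.
  have h2 := congrArg (Polynomial.coeff · 2) h
  obtain ⟨m, rfl⟩ := Nat.exists_eq_add_of_le hn
  have e1 : ((.X + .C Δ) * .X ^ (4 + m) : ℂ[X]).coeff 2 = 0 := by
    rw [pow_add, ← mul_assoc, mul_comm _ (Polynomial.X ^ 4), mul_assoc,
      Polynomial.coeff_X_pow_mul']
    simp
  have e2 : (1 + .X * .C Δ : ℂ[X]).coeff 2 = 0 := by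
    simp [Polynomial.coeff_one]
  have e3 : ((1 - .X) * (1 + .X) ^ (4 + m) : ℂ[X]).coeff 2 =
      ((4 + m).choose 2 : ℂ) - ((4 + m).choose 1 : ℂ) := by
    rw [sub_mul, one_mul, Polynomial.coeff_sub, Polynomial.coeff_one_add_X_pow,
      Polynomial.coeff_X_mul, Polynomial.coeff_one_add_X_pow]
  rw [Polynomial.coeff_add, Polynomial.coeff_sub, Polynomial.coeff_zero, e1, e2, e3, sub_zero,
    add_zero, sub_eq_zero] at h2
  have h3 : (4 + m).choose 2 = (4 + m).choose 1 := by exact_mod_cast h2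
  rw [Nat.choose_one_right, Nat.choose_two_right] at h3
  have h4 : (4 + m) * (4 + m - 1) = 2 * (4 + m) := by
    have : 2 ∣ (4 + m) * (4 + m - 1) := (Nat.even_mul_pred_self _).two_dvd
    omega
  have h5 : 4 + m - 1 = 2 := Nat.eq_of_mul_eq_mul_left (show 0 < 4 + m by omega) (by linarith)
  omega

/-- The form `α(L, a)` for a primary element `a`. -/
lemma primary_eq (hα : α ∈ D.twoCocycles) (hL : L ∈ D.parity 0) (hLL : D.IsPrimary L 2 L)
    (ha : D.IsPrimary L Δ a) (hΔ : Δ ≠ 0) (h1 : (α L a).coeff 1 = 0) :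
    α L a = .C ((α L a).coeff 2) * .X ^ 2 + .C ((α L a).coeff 3) * .X ^ 3 := by
  ext n
  simp only [Polynomial.coeff_add, Polynomial.coeff_C_mul, Polynomial.coeff_X_pow]
  rcases n with _ | _ | _ | _ | n
  · simpa using primary_coeff_zero hα hL hLL ha hΔ
  · simpa using h1
  · simp
  · simp
  · simpa using primary_coeff_of_four_le hα hL hLL ha (show 4 ≤ n + 4 by omega)

/-- The relation between `α(G, a)` and `α(L, [G_0 a])` for `G` of conformal weight `3 / 2`. -/
lemma X_mul_primary (hα : α ∈ D.twoCocycles) (hL : L ∈ D.parity 0) {i : ZMod 2}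
    (hG : G ∈ D.parity i)
    (hLG : D.IsPrimary L (3 / 2) G) (ha : D.IsPrimary L Δ a) :
    .X * (α G a + .C (2 * Δ * (α G a).coeff 0)) = -(2 : ℂ) • α L (D.brk (.C 0) G a) := by
  refine Polynomial.funext fun z => ?_
  have h := hα.2.2.2 0 i L hL G hG a z 0
  rw [ha, hLG] at h
  simp only [map_sub, map_neg, map_smul, LinearMap.sub_apply, LinearMap.neg_apply,
    LinearMap.smul_apply, Polynomial.eval_sub, Polynomial.eval_neg, Polynomial.eval_smul,
    eval_form_X_left hα, eval_form_X_right hα, koszulSign, ZMod.val_zero, smul_eq_mul,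
    zero_mul, pow_zero, one_mul, add_zero] at h
  simp only [Polynomial.eval_mul, Polynomial.eval_X, Polynomial.eval_add, Polynomial.eval_C,
    Polynomial.eval_smul, smul_eq_mul, h, Polynomial.coeff_zero_eq_eval_zero]
  ring

/-- The relation reads `λ(p + 2Δ p(0)) = λq` for `p = α(G, a)`. It yields `(1 + 2Δ)p(0) = 0`, so the
weight `-1/2` is the only obstruction. -/
lemma form_eq_of_brk_eq (hα : α ∈ D.twoCocycles) (hL : L ∈ D.parity 0) {i : ZMod 2}
    (hG : G ∈ D.parity i) (hLG : D.IsPrimary L (3 / 2) G) (ha : D.IsPrimary L Δ a)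
    (hΔ : Δ ≠ -1 / 2) {q : ℂ[X]} (hq : q.coeff 0 = 0)
    (h : α L (D.brk (.C 0) G a) = -(1 / 2 : ℂ) • (.X * q)) : α G a = q := by
  have e := X_mul_primary hα hL hG hLG ha
  rw [h, smul_smul, show (-2 : ℂ) * -(1 / 2) = 1 by norm_num, one_smul] at e
  have e1 := mul_left_cancel₀ Polynomial.X_ne_zero e
  have e2 := congrArg (Polynomial.coeff · 0) e1
  simp only [Polynomial.coeff_add, Polynomial.coeff_C_zero, hq] at e2
  have e3 : (α G a).coeff 0 = 0 := by
    have : (1 + 2 * Δ) * (α G a).coeff 0 = 0 := by linear_combination e2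
    refine (mul_eq_zero.1 this).resolve_left fun h0 => hΔ ?_
    linear_combination h0 / 2
  rw [e3, mul_zero, Polynomial.C_0, add_zero] at e1
  exact e1

/-- By the cocycle identity, the elements pairing to zero with everything are closed under brackets.
-/
lemma form_brk_eq_zero (hα : α ∈ D.twoCocycles) {i j : ZMod 2} (ma : a ∈ D.parity i)
    (mb : b ∈ D.parity j) (ha : ∀ c, α a c = 0) (hb : ∀ c, α b c = 0) (z : ℂ) (c : R) :
    α (D.brk (.C z) a b) c = 0 := by
  refine Polynomial.funext fun w => ?_
  have h := hα.2.2.2 i j a ma b mb c z (w - z)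
  rw [ha, hb, add_sub_cancel] at h
  simpa using h.symm

lemma form_eq_zero_of_X_smul (hα : α ∈ D.twoCocycles) (h : α ((.X : ℂ[X]) • a) b = 0) :
    α a b = 0 := by
  rw [hα.1, neg_eq_zero] at h
  exact (mul_eq_zero.1 h).resolve_left Polynomial.X_ne_zero

lemma span_eq_top_of_span {T : Set R} (hT : Submodule.span ℂ[X] T = ⊤) (S : Submodule ℂ R)
    (h : ∀ t ∈ T, t ∈ S) (hX : ∀ r : R, (.X : ℂ[X]) • r ∈ S) : S = ⊤ := by
  rw [eq_top_iff]
  rintro x -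
  have hx : x ∈ Submodule.span ℂ[X] T := by rw [hT]; trivial
  exact span_polynomial_induction (motive := fun x => x ∈ S) h (zero_mem _)
    (fun x y => add_mem) (fun z x => S.smul_mem z) (fun x _ => hX x) hx

end Primary

end ConformalData

/-! ### Operators acting by scalars in each degree. -/

section DegreeOperator

variable {N : ℕ}

/-- The linear operators on `Λ(N)` acting by prescribed scalars in each degree. -/
lemma exists_degree_operator (N : ℕ) (c : ℕ → ℂ) :
    ∃ T : Grassmann N →ₗ[ℂ] Grassmann N, ∀ n, ∀ B ∈ degPart N n, T B = c n • B := by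
  let 𝒜 : ℕ → Submodule ℂ (Grassmann N) := fun i => ⋀[ℂ]^i (Fin N → ℂ)
  refine ⟨DirectSum.toModule ℂ ℕ (Grassmann N) (fun n => c n • (𝒜 n).subtype) ∘ₗ
    (DirectSum.decomposeLinearEquiv 𝒜).toLinearMap, fun n B hB => ?_⟩
  have hB' : B ∈ 𝒜 n := hB
  have : DirectSum.decomposeLinearEquiv 𝒜 B = DirectSum.lof ℂ ℕ (fun n => 𝒜 n) n ⟨B, hB'⟩ :=
    DirectSum.decompose_of_mem 𝒜 hB'
  rw [LinearMap.comp_apply, LinearEquiv.coe_coe, this, DirectSum.toModule_lof]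
  rfl

lemma degPart_one_induction {motive : Grassmann N → Prop} (xi : ∀ i, motive (xi i))
    (zero : motive 0) (add : ∀ x y, motive x → motive y → motive (x + y))
    (smul : ∀ (z : ℂ) x, motive x → motive (z • x)) {A : Grassmann N}
    (hA : A ∈ degPart N 1) : motive A := by
  rw [degPart, pow_one] at hA
  obtain ⟨v, rfl⟩ := hA
  rw [ι_eq_sum_xi]
  exact Finset.sum_induction _ motive add zero fun i _ => smul _ _ (xi i)

lemma sum_xi_mul_dxi {n : ℕ} {B : Grassmann N} (hB : B ∈ degPart N n) :
    ∑ i, xi i * dxi i B = (n : ℂ) • B := by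
  rw [← euler_apply, euler_of_mem_degPart hB]

end DegreeOperator

/-! ### Normalised cocycles on `K_N`, `N ≠ 4`. -/

namespace IsKModel

open ConformalData

variable {N : ℕ} {R : Type*} [AddCommGroup R] [Module ℂ R] [Module ℂ[X] R] [IsScalarTower ℂ ℂ[X] R]
  {D : ConformalData R} {e : Grassmann N →ₗ[ℂ] R} {α : LambdaForm R} {n : ℕ} {B : Grassmann N}

lemma one_mem_parity (h : IsKModel D e) : e 1 ∈ D.parity 0 := by
  simpa using h.emb_mem_parity_of_degPart one_mem_degPart

lemma xi_mem_parity (h : IsKModel D e) (i : Fin N) : e (xi i) ∈ D.parity 1 := by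
  simpa using h.emb_mem_parity_of_degPart (xi_mem_degPart i)

lemma isPrimary (h : IsKModel D e) (hB : B ∈ degPart N n) :
    D.IsPrimary (e 1) (2 - n / 2) (e B) := fun z => by
  rw [h.brk_one_graded _ (.of_degPart hB), sub_smul, mul_smul, C_smul_eq, C_smul_eq]
  generalize (.X : ℂ[X]) • e B = u
  module

lemma isPrimary_one (h : IsKModel D e) : D.IsPrimary (e 1) 2 (e 1) := by
  simpa using h.isPrimary one_mem_degPart

lemma isPrimary_xi (h : IsKModel D e) (i : Fin N) : D.IsPrimary (e 1) (3 / 2) (e (xi i)) := by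
  have := h.isPrimary (xi_mem_degPart i)
  convert this using 1
  norm_num

lemma brk_zero_xi (h : IsKModel D e) (i : Fin N) (B : Grassmann N) :
    D.brk (.C 0) (e (xi i)) (e B) =
      -(1 / 2 : ℂ) • ((.X : ℂ[X]) • e (xi i * B) + e (dxi i B)) := by
  rw [X_smul_emb_xi_mul h]
  module

lemma form_brk_zero_xi (h : IsKModel D e) (hα : α ∈ D.twoCocycles) (i : Fin N) (B : Grassmann N) :
    α (e 1) (D.brk (.C 0) (e (xi i)) (e B)) =
      -(1 / 2 : ℂ) • (.X * α (e 1) (e (xi i * B)) + α (e 1) (e (dxi i B))) := by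
  rw [h.brk_zero_xi, map_smul, map_add, hα.2.1]

/-- A form normalised by a coboundary: `α_1(1, B) = 0` in degrees different from `4`. -/
lemma coeff_two_eq_zero (h : IsKModel D e) (hα : α ∈ D.twoCocycles)
    (h1 : ∀ n ≠ 4, ∀ B ∈ degPart N n, (α (e 1) (e B)).coeff 1 = 0) (hB : B ∈ degPart N 2) :
    (α (e 1) (e B)).coeff 2 = 0 := by
  have f1 : α (e 1) (e 1) = .C ((α (e 1) (e 1)).coeff 3) * .X ^ 3 := by
    have := primary_eq hα h.one_mem_parity h.isPrimary_one h.isPrimary_one (by norm_num)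
      (h1 0 (by norm_num) 1 one_mem_degPart)
    rwa [primary_coeff_two hα h.one_mem_parity h.isPrimary_one h.isPrimary_one (by norm_num),
      Polynomial.C_0, zero_mul, zero_add] at this
  have f2 : ∀ B ∈ degPart N 2, α (e 1) (e B) = .C ((α (e 1) (e B)).coeff 2) * .X ^ 2 := by
    intro B hB
    have := primary_eq hα h.one_mem_parity h.isPrimary_one (h.isPrimary hB) (by norm_num)
      (h1 2 (by norm_num) B hB)
    rwa [primary_coeff_three hα h.one_mem_parity h.isPrimary_one (h.isPrimary hB) (by norm_num),
      Polynomial.C_0, zero_mul, add_zero] at this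
  have key : ∀ i j : Fin N, α (e (xi i)) (e (xi j)) =
      .C ((α (e 1) (e (xi i * xi j))).coeff 2) * .X ^ 2 +
        (if i = j then .C ((α (e 1) (e 1)).coeff 3) * .X ^ 2 else 0) := fun i j => by
    refine form_eq_of_brk_eq hα h.one_mem_parity (h.xi_mem_parity i) (h.isPrimary_xi i)
      (h.isPrimary_xi j) (by norm_num) ?_ ?_
    · split_ifs <;> simp
    · rw [h.form_brk_zero_xi hα, f2 _ (mul_mem_degPart (xi_mem_degPart i) (xi_mem_degPart j)),
        dxi_xi]
      congr 1
      split_ifs with hij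
      · rw [f1]; simp; ring
      · simp
  -- For odd elements skew-commutativity makes the `λ^2`-coefficient of `α(ξ_i, ξ_j)` symmetric,
  -- whereas `ξ_i ξ_j` is antisymmetric.
  have hz : ∀ i j : Fin N, (α (e 1) (e (xi i * xi j))).coeff 2 = 0 := fun i j => by
    have hs := hα.2.2.1 1 1 _ (h.xi_mem_parity i) _ (h.xi_mem_parity j)
    rw [key, key] at hs
    have hs' := congrArg (Polynomial.eval 1) hs
    have e1 : (α (e 1) (e (xi j * xi i))).coeff 2 = -(α (e 1) (e (xi i * xi j))).coeff 2 := by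
      rw [xi_mul_xi, map_neg, map_neg, Polynomial.coeff_neg]
    rw [e1] at hs'
    by_cases hij : i = j
    · subst hij
      rw [xi_mul_self, map_zero, map_zero, Polynomial.coeff_zero]
    · simp [koszulSign, ZMod.val_one, hij, Ne.symm hij] at hs'
      exact self_eq_neg.1 hs'.symm
  refine degPart_succ_induction (motive := fun B => (α (e 1) (e B)).coeff 2 = 0)
    (fun i y hy => ?_) (by simp) (fun x y hx hy => by simp [hx, hy]) (fun z x hx => by simp [hx]) hB
  exact degPart_one_induction (motive := fun y => (α (e 1) (e (xi i * y))).coeff 2 = 0) (hz i)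
    (by simp) (fun x y hx hy => by simp [mul_add, hx, hy]) (fun z x hx => by simp [hx]) hy

/-- The weight leaves room for `λ^3` only in degree `0` and for `λ^2` only in degree `2`, where
antisymmetry excludes it. Degree `4` has weight `0` and needs a separate argument. -/
lemma form_one_eq_zero (h : IsKModel D e) (hN : N ≠ 4) (hα : α ∈ D.twoCocycles)
    (h1 : ∀ n ≠ 4, ∀ B ∈ degPart N n, (α (e 1) (e B)).coeff 1 = 0) (hn : n ≠ 0)
    (hB : B ∈ degPart N n) : α (e 1) (e B) = 0 := by
  have hL := h.one_mem_parity
  have hLL := h.isPrimary_one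
  have c3 : (α (e 1) (e B)).coeff 3 = 0 := by
    refine primary_coeff_three hα hL hLL (h.isPrimary hB) fun h0 => hn ?_
    have : (n : ℂ) = 0 := by linear_combination -2 * h0
    exact_mod_cast this
  have c2 : (α (e 1) (e B)).coeff 2 = 0 := by
    by_cases h2 : n = 2
    · subst h2
      exact h.coeff_two_eq_zero hα h1 hB
    · refine primary_coeff_two hα hL hLL (h.isPrimary hB) fun h0 => h2 ?_
      have : (n : ℂ) = 2 := by linear_combination -2 * h0
      exact_mod_cast this
  by_cases h4 : n = 4
  · subst h4
    -- At weight `0` the constant and linear terms are undecided. The relation for `ξ_i B`, of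
    -- weight `-1/2`, summed over `i` with `∑ ξ_i ∂_i = 4`, writes `(N - 4)α(1, B)` as `λ` times a
    -- polynomial without constant term.
    have hs : .X * ∑ i, (α (e (xi i)) (e (xi i * B)) -
        .C ((α (e (xi i)) (e (xi i * B))).coeff 0)) = ((N : ℂ) - 4) • α (e 1) (e B) := by
      have hi : ∀ i, .X * (α (e (xi i)) (e (xi i * B)) -
          .C ((α (e (xi i)) (e (xi i * B))).coeff 0)) =
          α (e 1) (e B) - α (e 1) (e (xi i * dxi i B)) := fun i => by
        have := X_mul_primary hα hL (h.xi_mem_parity i) (h.isPrimary_xi i)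
          (h.isPrimary (xi_mul_mem_degPart i hB))
        rw [h.form_brk_zero_xi hα, xi_mul_xi_mul_self, dxi_xi_mul, if_pos rfl] at this
        simp only [map_zero, mul_zero, zero_add, map_sub, smul_smul] at this
        norm_num at this
        rw [← this]
        ring
      have hE : ∑ i, α (e 1) (e (xi i * dxi i B)) = ((4 : ℕ) : ℂ) • α (e 1) (e B) := by
        rw [← map_sum, ← map_sum, sum_xi_mul_dxi hB, map_smul, map_smul]
      rw [Finset.mul_sum, Finset.sum_congr rfl fun i _ => hi i, Finset.sum_sub_distrib, hE]
      simp [sub_smul, Nat.cast_smul_eq_nsmul]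
    have hN' : (N : ℂ) - 4 ≠ 0 := by
      rw [sub_ne_zero]
      exact_mod_cast hN
    ext m
    rcases m with _ | _ | _ | _ | m
    · have := congrArg (Polynomial.coeff · 0) hs
      simpa [hN'] using this
    · have := congrArg (Polynomial.coeff · 1) hs
      simp only [Polynomial.coeff_X_mul, Polynomial.finsetSum_coeff, Polynomial.coeff_sub,
        Polynomial.coeff_C_zero, sub_self, Finset.sum_const_zero, Polynomial.coeff_smul] at this
      simpa [hN'] using this
    · exact c2
    · exact c3
    · exact primary_coeff_of_four_le hα hL hLL (h.isPrimary hB) (by omega)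
  · rw [primary_eq hα hL hLL (h.isPrimary hB) ?_ (h1 n h4 B hB), c2, c3]
    · simp
    · intro h0
      apply h4
      have : (n : ℂ) = 4 := by linear_combination -2 * h0
      exact_mod_cast this

end IsKModel

namespace IsKModel

open ConformalData

variable {N : ℕ} {R : Type*} [AddCommGroup R] [Module ℂ R] [Module ℂ[X] R] [IsScalarTower ℂ ℂ[X] R]
  {D : ConformalData R} {e : Grassmann N →ₗ[ℂ] R} {α : LambdaForm R} {n : ℕ} {B : Grassmann N}

lemma form_one_one (h : IsKModel D e) (hα : α ∈ D.twoCocycles)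
    (h1 : ∀ n ≠ 4, ∀ B ∈ degPart N n, (α (e 1) (e B)).coeff 1 = 0) :
    α (e 1) (e 1) = .C ((α (e 1) (e 1)).coeff 3) * .X ^ 3 := by
  have := primary_eq hα h.one_mem_parity h.isPrimary_one h.isPrimary_one (by norm_num)
    (h1 0 (by norm_num) 1 one_mem_degPart)
  rwa [primary_coeff_two hα h.one_mem_parity h.isPrimary_one h.isPrimary_one (by norm_num),
    Polynomial.C_0, zero_mul, zero_add] at this

lemma form_xi_xi (h : IsKModel D e) (hN : N ≠ 4) (hα : α ∈ D.twoCocycles)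
    (h1 : ∀ n ≠ 4, ∀ B ∈ degPart N n, (α (e 1) (e B)).coeff 1 = 0) (i j : Fin N) :
    α (e (xi i)) (e (xi j)) = if i = j then .C ((α (e 1) (e 1)).coeff 3) * .X ^ 2 else 0 := by
  refine form_eq_of_brk_eq hα h.one_mem_parity (h.xi_mem_parity i) (h.isPrimary_xi i)
    (h.isPrimary_xi j) (by norm_num) ?_ ?_
  · split_ifs <;> simp
  · rw [h.form_brk_zero_xi hα, h.form_one_eq_zero hN hα h1 two_ne_zero
      (mul_mem_degPart (xi_mem_degPart i) (xi_mem_degPart j)), dxi_xi]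
    congr 1
    split_ifs with hij
    · rw [h.form_one_one hα h1]; simp; ring
    · simp

/-- Vanishing of `α(1, [ξ_i_0 B])` in degrees different from `1`. -/
lemma form_brk_eq_zero (h : IsKModel D e) (hN : N ≠ 4) (hα : α ∈ D.twoCocycles)
    (h1 : ∀ n ≠ 4, ∀ B ∈ degPart N n, (α (e 1) (e B)).coeff 1 = 0) (hn : n ≠ 1)
    (hB : B ∈ degPart N n) (i : Fin N) :
    α (e 1) (D.brk (.C 0) (e (xi i)) (e B)) = 0 := by
  rw [h.form_brk_zero_xi hα, h.form_one_eq_zero hN hα h1 (Nat.succ_ne_zero n)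
    (xi_mul_mem_degPart i hB), mul_zero, zero_add]
  rcases n with _ | n
  · rw [dxi_of_mem_degPart_zero i hB]
    simp
  · rw [h.form_one_eq_zero hN hα h1 _ (dxi_mem_degPart i hB), smul_zero]
    omega

/-- Degree `1` is excluded because `∂_i B` is then a scalar, met by `α(1,1)`; degree `5` because its
weight is `-1/2`. -/
lemma form_xi_eq_zero (h : IsKModel D e) (hN : N ≠ 4) (hα : α ∈ D.twoCocycles)
    (h1 : ∀ n ≠ 4, ∀ B ∈ degPart N n, (α (e 1) (e B)).coeff 1 = 0) (hn : n ≠ 1) (hn' : n ≠ 5)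
    (hB : B ∈ degPart N n) (i : Fin N) : α (e (xi i)) (e B) = 0 := by
  refine form_eq_of_brk_eq hα h.one_mem_parity (h.xi_mem_parity i) (h.isPrimary_xi i)
    (h.isPrimary hB) (fun h0 => hn' ?_) (by simp) ?_
  · have : (n : ℂ) = 5 := by linear_combination -2 * h0
    exact_mod_cast this
  · rw [h.form_brk_eq_zero hN hα h1 hn hB]
    simp

/-- At weight `-1/2` the relation between `α(ξ_i, ·)` and `α(1, ·)` becomes `λ(p - p(0)) = 0`, which
leaves the constant free. -/
lemma form_xi_eq_C (h : IsKModel D e) (hN : N ≠ 4) (hα : α ∈ D.twoCocycles)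
    (h1 : ∀ n ≠ 4, ∀ B ∈ degPart N n, (α (e 1) (e B)).coeff 1 = 0)
    (hB : B ∈ degPart N 5) (i : Fin N) :
    α (e (xi i)) (e B) = .C ((α (e (xi i)) (e B)).coeff 0) := by
  have := X_mul_primary hα h.one_mem_parity (h.xi_mem_parity i) (h.isPrimary_xi i) (h.isPrimary hB)
  rw [h.form_brk_eq_zero hN hα h1 (by norm_num) hB, smul_zero] at this
  have := (mul_eq_zero.1 this).resolve_left Polynomial.X_ne_zero
  norm_num at this
  rwa [← sub_eq_add_neg, sub_eq_zero] at this

/-- This is the cocycle identity for `(ξ_i, ξ_j, B)` with both parameters `0`: terms containing `∂`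
drop out, and so does `α(1, B)`. -/
lemma coeff_dxi_swap (h : IsKModel D e) (hN : N ≠ 4) (hα : α ∈ D.twoCocycles)
    (h1 : ∀ n ≠ 4, ∀ B ∈ degPart N n, (α (e 1) (e B)).coeff 1 = 0) (hB : B ∈ degPart N 6)
    (i j : Fin N) : (α (e (xi i)) (e (dxi j B))).coeff 0 =
      -(α (e (xi j)) (e (dxi i B))).coeff 0 := by
  have hJ := hα.2.2.2 1 1 _ (h.xi_mem_parity i) _ (h.xi_mem_parity j) (e B) 0 0
  have hd : dxi i (xi j : Grassmann N) = (if i = j then (1 : ℂ) else 0) • 1 := by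
    rw [dxi_xi]
    split_ifs <;> simp
  rw [h.brk_zero_xi, h.brk_zero_xi, h.brk_zero_xi, hd] at hJ
  simp only [map_smul, map_add, LinearMap.smul_apply, LinearMap.add_apply, Polynomial.eval_smul,
    Polynomial.eval_add, eval_form_X_left hα, eval_form_X_right hα, smul_eq_mul,
    h.form_one_eq_zero hN hα h1 (by norm_num) hB, Polynomial.eval_zero, zero_mul, neg_zero,
    mul_zero, add_zero, zero_add, koszulSign, ZMod.val_one, mul_one, pow_one] at hJ
  rw [Polynomial.coeff_zero_eq_eval_zero, Polynomial.coeff_zero_eq_eval_zero]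
  linear_combination -2 * hJ

lemma form_xi_eq_zero_of_normalised (h : IsKModel D e) (hN : N ≠ 4) (hα : α ∈ D.twoCocycles)
    (h1 : ∀ n ≠ 4, ∀ B ∈ degPart N n, (α (e 1) (e B)).coeff 1 = 0)
    (h2 : ∀ B ∈ degPart N 4, ∑ i, (α (e (xi i)) (e (xi i * B))).coeff 0 = 0) (hn : n ≠ 1)
    (hB : B ∈ degPart N n) (i : Fin N) : α (e (xi i)) (e B) = 0 := by
  by_cases hn' : n = 5
  · subst hn'
    -- The antisymmetry is applied to `ξ_j B`. After summation over `j`, Euler's identity gives `(N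
    -- - 5)p = -p` for the constant `p`, since the last sum vanishes by normalisation.
    have hj : ∀ j, (α (e (xi i)) (e B)).coeff 0 - (α (e (xi i)) (e (xi j * dxi j B))).coeff 0 =
        -(if i = j then (α (e (xi j)) (e B)).coeff 0 else 0) +
          (α (e (xi j)) (e (xi j * dxi i B))).coeff 0 := fun j => by
      have := h.coeff_dxi_swap hN hα h1 (xi_mul_mem_degPart j hB) i j
      rw [dxi_xi_mul, dxi_xi_mul, if_pos rfl] at this
      simp only [map_sub, Polynomial.coeff_sub] at this
      rw [this]
      split_ifs
      · ring
      · rw [map_zero, map_zero, Polynomial.coeff_zero]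
        ring
    have hE : ∑ j, (α (e (xi i)) (e (xi j * dxi j B))).coeff 0 =
        ((5 : ℕ) : ℂ) * (α (e (xi i)) (e B)).coeff 0 := by
      rw [← Polynomial.finsetSum_coeff, ← map_sum, ← map_sum, sum_xi_mul_dxi hB, map_smul, map_smul,
        Polynomial.coeff_smul, smul_eq_mul]
    have hs := Finset.sum_congr (rfl : (Finset.univ : Finset (Fin N)) = _) fun j _ => hj j
    rw [Finset.sum_sub_distrib, Finset.sum_add_distrib, h2 _ (dxi_mem_degPart i hB), hE] at hs
    simp only [Finset.sum_const, Finset.card_univ, Fintype.card_fin, nsmul_eq_mul,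
      Finset.sum_neg_distrib, Finset.sum_ite_eq, Finset.mem_univ, if_true] at hs
    have hN' : (N : ℂ) - 4 ≠ 0 := by
      rw [sub_ne_zero]
      exact_mod_cast hN
    rw [h.form_xi_eq_C hN hα h1 hB]
    have : ((N : ℂ) - 4) * (α (e (xi i)) (e B)).coeff 0 = 0 := by
      push_cast at hs
      linear_combination hs
    rw [(mul_eq_zero.1 this).resolve_left hN', Polynomial.C_0]
  · exact h.form_xi_eq_zero hN hα h1 hn hn' hB i

/-- A form vanishing on all generators of degree at most `1` vanishes. -/
lemma form_eq_zero (h : IsKModel D e) (hα : α ∈ D.twoCocycles) (h1 : ∀ b, α (e 1) b = 0)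
    (h2 : ∀ i b, α (e (xi i)) b = 0) : α = 0 := by
  have key : ∀ n, ∀ A ∈ degPart N n, ∀ b, α (e A) b = 0 := by
    intro n
    induction n using Nat.strong_induction_on with
    | _ n ih =>
    intro A hA b
    rcases n with _ | n
    · rw [degPart, pow_zero] at hA
      obtain ⟨z, rfl⟩ := Submodule.mem_one.1 hA
      rw [Algebra.algebraMap_eq_smul_one, map_smul, map_smul, LinearMap.smul_apply, h1, smul_zero]
    · refine degPart_succ_induction (motive := fun A => α (e A) b = 0) (fun i y hy => ?_)
        (by simp) (fun x y hx hy => by simp [hx, hy]) (fun z x hx => by simp [hx]) hA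
      refine form_eq_zero_of_X_smul hα ?_
      rw [X_smul_emb_xi_mul h, map_sub, map_smul, LinearMap.sub_apply, LinearMap.smul_apply,
        ConformalData.form_brk_eq_zero hα (h.xi_mem_parity i) (h.emb_mem_parity_of_degPart hy) (h2 i)
          (ih n (by omega) y hy), smul_zero, zero_sub, neg_eq_zero]
      exact dxi_induction_step i hy (P := fun _ a => α a b = 0) (by simp)
        fun m hm A hA => ih m (by omega) A hA b
  ext1 a
  ext1 b
  have ha : a ∈ Submodule.span ℂ[X] (e '' {A | ∃ n, A ∈ degPart N n}) := by
    rw [h.span_graded]; trivial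
  refine span_polynomial_induction (motive := fun a => α a b = 0) ?_ (by simp)
    (fun x y hx hy => by simp [hx, hy]) (fun z x hx => by simp [hx]) (fun x hx => ?_) ha
  · rintro _ ⟨A, ⟨n, hA⟩, rfl⟩
    exact key n A hA b
  · rw [hα.1, hx, mul_zero, neg_zero]

/-- A cocycle vanishes on `a` if it vanishes against all homogeneous elements of `Λ(N)`. -/
lemma form_left_eq_zero (h : IsKModel D e) (hα : α ∈ D.twoCocycles) {a : R}
    (ha : ∀ n, ∀ B ∈ degPart N n, α a (e B) = 0) (b : R) : α a b = 0 := by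
  have hb : b ∈ Submodule.span ℂ[X] (e '' {A | ∃ n, A ∈ degPart N n}) := by
    rw [h.span_graded]; trivial
  refine span_polynomial_induction (motive := fun b => α a b = 0) ?_ (by simp)
    (fun x y hx hy => by simp [hx, hy]) (fun z x hx => by simp [hx]) (fun x hx => ?_) hb
  · rintro _ ⟨A, ⟨n, hA⟩, rfl⟩
    exact ha n A hA
  · rw [hα.2.1, hx, mul_zero]

/-- Once `α_3(1,1) = 0`, the values at `1` vanish and then those at every `ξ_i`, and these elements
generate. -/
lemma eq_zero_of_normalised (h : IsKModel D e) (hN : N ≠ 4) (hα : α ∈ D.twoCocycles)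
    (h1 : ∀ n ≠ 4, ∀ B ∈ degPart N n, (α (e 1) (e B)).coeff 1 = 0)
    (h2 : ∀ B ∈ degPart N 4, ∑ i, (α (e (xi i)) (e (xi i * B))).coeff 0 = 0)
    (h3 : (α (e 1) (e 1)).coeff 3 = 0) : α = 0 := by
  refine h.form_eq_zero hα (h.form_left_eq_zero hα fun n B hB => ?_)
    fun i => h.form_left_eq_zero hα fun n B hB => ?_
  · rcases n with _ | n
    · rw [degPart, pow_zero] at hB
      obtain ⟨z, rfl⟩ := Submodule.mem_one.1 hB
      rw [Algebra.algebraMap_eq_smul_one, map_smul, map_smul, h.form_one_one hα h1, h3]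
      simp
    · exact h.form_one_eq_zero hN hα h1 (Nat.succ_ne_zero n) hB
  · by_cases hn : n = 1
    · subst hn
      refine degPart_one_induction (motive := fun B => α (e (xi i)) (e B) = 0) (fun j => ?_)
        (by simp) (fun x y hx hy => by simp [hx, hy]) (fun z x hx => by simp [hx]) hB
      rw [h.form_xi_xi hN hα h1, h3]
      simp
    · exact h.form_xi_eq_zero_of_normalised hN hα h1 h2 hn hB i

end IsKModel

/-! ### Coboundaries. -/

namespace ConformalData

section Coboundary

variable {R : Type*} [AddCommGroup R] [Module ℂ R] [Module ℂ[X] R] [IsScalarTower ℂ ℂ[X] R]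
  {D : ConformalData R} {φ : R →ₗ[ℂ] ℂ}

lemma map_substAt (hφ : ∀ r, φ ((.X : ℂ[X]) • r) = 0) (p : ℂ[X]) (x : ℂ[X] ⊗[ℂ] R) :
    φ (substAt p x) = φ (evalAt (p.eval 0) x) := by
  induction x with
  | zero => simp
  | add x y hx hy => simp [hx, hy]
  | tmul f r => rw [substAt_tmul, map_smul_of_map_X_smul φ hφ, evalAt_tmul, map_smul,
      Polynomial.eval_comp]

lemma eval_coboundary (a b : R) (z : ℂ) :
    (scalarForm D.bracket φ a b).eval z = φ (D.brk (.C z) a b) := by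
  rw [eval_scalarForm, brk_C]

lemma coboundary_mem (hφ : ∀ r, φ ((.X : ℂ[X]) • r) = 0) :
    scalarForm D.bracket φ ∈ D.twoCoboundaries := ⟨φ, hφ, fun _ _ => rfl⟩

lemma coboundary_mem_twoCocycles (hD : D.IsLie) (hφ : ∀ r, φ ((.X : ℂ[X]) • r) = 0) :
    scalarForm D.bracket φ ∈ D.twoCocycles := by
  refine ⟨fun a b => ?_, fun a b => ?_, fun i j a ha b hb => ?_, fun i j a ha b hb c z w => ?_⟩
  · refine Polynomial.funext fun z => ?_
    rw [eval_coboundary, hD.sesq_left, map_neg, map_smul]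
    simp [eval_coboundary]
  · refine Polynomial.funext fun z => ?_
    rw [eval_coboundary, hD.sesq_right, map_smul_of_map_X_smul φ hφ]
    simp [eval_coboundary]
  · refine Polynomial.funext fun z => ?_
    rw [eval_coboundary, hD.skew i j a ha b hb, map_neg, map_smul, brk, map_substAt hφ,
      Polynomial.eval_neg, Polynomial.eval_smul, Polynomial.eval_comp, eval_coboundary, brk_C]
    simp
  · rw [eval_coboundary, eval_coboundary, eval_coboundary, hD.jacobi i j a ha b hb, map_add,
      map_smul, smul_eq_mul]

end Coboundary

end ConformalData

/-! ### Normalisation by coboundaries, perfectness, and vanishing for `N ≥ 5`. -/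

namespace IsKModel

open ConformalData

variable {N : ℕ} {R : Type*} [AddCommGroup R] [Module ℂ R] [Module ℂ[X] R] [IsScalarTower ℂ ℂ[X] R]
  {D : ConformalData R} {e : Grassmann N →ₗ[ℂ] R} {α : LambdaForm R} {n : ℕ} {B : Grassmann N}

/-- Every cocycle can be normalised by a coboundary. -/
lemma exists_normalised (h : IsKModel D e) (hN : N ≠ 4) (hα : α ∈ D.twoCocycles) :
    ∃ κ ∈ D.twoCoboundaries, α - κ ∈ D.twoCocycles ∧ (κ (e 1) (e 1)).coeff 3 = 0 ∧
      (∀ n ≠ 4, ∀ B ∈ degPart N n, ((α - κ) (e 1) (e B)).coeff 1 = 0) ∧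
      ∀ B ∈ degPart N 4, ∑ i, ((α - κ) (e (xi i)) (e (xi i * B))).coeff 0 = 0 := by
  -- The coboundary of `φ` has linear coefficient `(n/2 - 2)φ(B)` at `(1, B)`, to be inverted in
  -- degrees other than `4`. In degree `4` the value of `φ` is free, and the sum over `i` at `(ξ_i,
  -- ξ_i B)` contributes `-(N - 4)φ(B)/2`, whence the factor `-2/(N - 4)`.
  obtain ⟨T, hT⟩ := exists_degree_operator N fun n => if n = 4 then 0 else ((n : ℂ) / 2 - 2)⁻¹
  obtain ⟨P, hP⟩ := exists_degree_operator N fun n => if n = 4 then 1 else 0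
  have hN' : (N : ℂ) - 4 ≠ 0 := by
    rw [sub_ne_zero]
    exact_mod_cast hN
  let S : Grassmann N →ₗ[ℂ] ℂ :=
    ∑ i, Polynomial.lcoeff ℂ 0 ∘ₗ α (e (xi i)) ∘ₗ e ∘ₗ LinearMap.mulLeft ℂ (xi i)
  have hS : ∀ B, S B = ∑ i, (α (e (xi i)) (e (xi i * B))).coeff 0 := fun B => by
    simp [S, LinearMap.sum_apply]
  obtain ⟨φ, hφ, hφe⟩ := h.exists_functional
    ((Polynomial.lcoeff ℂ 1 ∘ₗ α (e 1) ∘ₗ e) ∘ₗ T + (-2 / ((N : ℂ) - 4)) • S ∘ₗ P)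
  have hne : ∀ n : ℕ, n ≠ 4 → (n : ℂ) / 2 - 2 ≠ 0 := fun n hn h0 => hn (by
    have : (n : ℂ) = 4 := by linear_combination 2 * h0
    exact_mod_cast this)
  have e1 : ∀ n : ℕ, n ≠ 4 → ∀ B ∈ degPart N n,
      φ (e B) = ((n : ℂ) / 2 - 2)⁻¹ * (α (e 1) (e B)).coeff 1 := fun n hn B hB => by
    rw [hφe]
    simp [hT n B hB, hP n B hB, hn]
  have e2 : ∀ B ∈ degPart N 4, φ (e B) = (-2 / ((N : ℂ) - 4)) *
      ∑ i, (α (e (xi i)) (e (xi i * B))).coeff 0 := fun B hB => by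
    rw [hφe, ← hS]
    simp [hT 4 B hB, hP 4 B hB]
  set κ := scalarForm D.bracket φ with hκ
  have hκ' : κ ∈ D.twoCocycles := coboundary_mem_twoCocycles h.isLie hφ
  have k1 : ∀ n, ∀ B ∈ degPart N n, κ (e 1) (e B) = .C (((n : ℂ) / 2 - 2) * φ (e B)) * .X := by
    intro n B hB
    refine Polynomial.funext fun z => ?_
    rw [hκ, eval_coboundary, h.isPrimary hB, map_sub, map_neg, hφ, map_smul]
    simp
    ring
  have k2 : ∀ i B, (κ (e (xi i)) (e B)).coeff 0 = -(1 / 2) * φ (e (dxi i B)) := fun i B => by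
    rw [Polynomial.coeff_zero_eq_eval_zero, hκ, eval_coboundary, h.brk_zero_xi, map_smul, map_add,
      hφ, zero_add, smul_eq_mul]
  refine ⟨κ, coboundary_mem hφ, sub_mem hα hκ', ?_, fun n hn B hB => ?_, fun B hB => ?_⟩
  · rw [k1 0 1 one_mem_degPart, Polynomial.coeff_C_mul_X]
    simp
  · rw [LinearMap.sub_apply, LinearMap.sub_apply, Polynomial.coeff_sub, k1 n B hB,
        Polynomial.coeff_C_mul_X, e1 n hn B hB, if_pos rfl, mul_inv_cancel_left₀ (hne n hn),
        sub_self]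
  · have hsum : ∑ i, φ (e (dxi i (xi i * B))) = ((N : ℂ) - 4) * φ (e B) := by
      have hE : ∑ i, φ (e (xi i * dxi i B)) = ((4 : ℕ) : ℂ) * φ (e B) := by
        rw [← map_sum, ← map_sum, sum_xi_mul_dxi hB, map_smul, map_smul, smul_eq_mul]
      simp only [dxi_xi_mul, if_true, map_sub, Finset.sum_sub_distrib, hE]
      simp [sub_mul]
    simp only [LinearMap.sub_apply, Polynomial.coeff_sub, Finset.sum_sub_distrib, k2,
      ← Finset.mul_sum]
    rw [hsum, e2 B hB]
    field_simp
    ring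

lemma mem_coboundaries (h : IsKModel D e) (hN : N ≠ 4) (hα : α ∈ D.twoCocycles)
    (h3 : (α (e 1) (e 1)).coeff 3 = 0) : α ∈ D.twoCoboundaries := by
  obtain ⟨κ, hκ, hc, k3, n1, n2⟩ := h.exists_normalised hN hα
  have : α - κ = 0 := h.eq_zero_of_normalised hN hc n1 n2 (by
    rw [LinearMap.sub_apply, LinearMap.sub_apply, Polynomial.coeff_sub, h3, k3, sub_zero])
  rwa [sub_eq_zero.1 this]

/-- Outside degree `4` the bracket with `1` multiplies `B` by a non-zero weight modulo `∂R`. In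
degree `4`, `(N - 4)B = ∑ ∂_i(ξ_i B)`, and each summand is a multiple of `[ξ_i_0 ξ_i B]`. -/
lemma perfect (h : IsKModel D e) (hN : N ≠ 4) :
    Submodule.span ℂ ({x | ∃ r : R, x = (.X : ℂ[X]) • r} ∪
      {x | ∃ n x' y', x = lambdaCoeff n (D.bracket x' y')}) = ⊤ := by
  refine span_eq_top_of_span h.span_graded _ ?_ fun r => Submodule.subset_span (.inl ⟨r, rfl⟩)
  set S := Submodule.span ℂ ({x | ∃ r : R, x = (.X : ℂ[X]) • r} ∪
      {x | ∃ n x' y', x = lambdaCoeff n (D.bracket x' y')}) with hS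
  have hX : ∀ r : R, (.X : ℂ[X]) • r ∈ S := fun r => Submodule.subset_span (.inl ⟨r, rfl⟩)
  have hbrk : ∀ z a b, D.brk (.C z) a b ∈ S := fun z a b => by
    rw [brk_C]
    obtain ⟨M, hM⟩ := exists_eq_sum_lambdaCoeff (D.bracket a b)
    rw [hM M le_rfl, map_sum]
    refine sum_mem fun n _ => ?_
    rw [evalAt_tmul]
    exact S.smul_mem _ (Submodule.subset_span (.inr ⟨n, a, b, rfl⟩))
  rintro _ ⟨B, ⟨n, hB⟩, rfl⟩
  by_cases hn : n = 4
  · subst hn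
    have hi : ∀ i, e (dxi i (xi i * B)) ∈ S := fun i => by
      have h1 := hbrk 0 (e (xi i)) (e (xi i * B))
      rw [h.brk_zero_xi, xi_mul_xi_mul_self, map_zero, smul_zero, zero_add] at h1
      have h2 := S.smul_mem (-2) h1
      rw [smul_smul] at h2
      norm_num at h2
      exact h2
    have hsum : ∑ i, e (dxi i (xi i * B)) = ((N : ℂ) - 4) • e B := by
      have hE : ∑ i, e (xi i * dxi i B) = ((4 : ℕ) : ℂ) • e B := by
        rw [← map_sum, sum_xi_mul_dxi hB, map_smul]
      simp only [dxi_xi_mul, if_true, map_sub, Finset.sum_sub_distrib, hE]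
      simp [sub_smul, Nat.cast_smul_eq_nsmul]
    have hN' : (N : ℂ) - 4 ≠ 0 := by
      rw [sub_ne_zero]
      exact_mod_cast hN
    have h1 : ((N : ℂ) - 4) • e B ∈ S := hsum ▸ sum_mem fun i _ => hi i
    have h2 := S.smul_mem ((N : ℂ) - 4)⁻¹ h1
    rwa [smul_smul, inv_mul_cancel₀ hN', one_smul] at h2
  · have h1 := hbrk 1 (e 1) (e B)
    rw [h.isPrimary hB, sub_eq_add_neg, ← smul_neg] at h1
    have h2 : (1 * (2 - n / 2 : ℂ)) • -(e B) ∈ S :=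
      (S.add_mem_iff_right (S.neg_mem (hX (e B)))).1 (by simpa [smul_neg] using h1)
    have hne : (1 * (2 - n / 2 : ℂ)) ≠ 0 := fun h0 => hn (by
      have : (n : ℂ) = 4 := by linear_combination -2 * h0
      exact_mod_cast this)
    have h3 := S.neg_mem (S.smul_mem (1 * (2 - n / 2 : ℂ))⁻¹ h2)
    rwa [smul_smul, inv_mul_cancel₀ hne, one_smul, neg_neg] at h3

/-! ### Four variables force the central charge to vanish. -/

section FourVariables

/-- The cocycle identity for `(ξ_i, A, ξ_i A)`, `A = ξ_j B`, at first parameter `0`. Here `A^2 = 0`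
and the contraction of `A` with `ξ_i A` is `±ξ_i B^2`, so the left side is the constant term assumed
to vanish. -/
lemma X_mul_form_xi_mul (h : IsKModel D e) (hα : α ∈ D.twoCocycles) {i j : Fin N} (hij : i ≠ j)
    (hB : B ∈ degPart N n) (hi : dxi i B = 0) (hj : dxi j B = 0)
    (h0 : (α (e (xi i)) (e (xi i * (B * B)))).coeff 0 = 0) :
    .X * α (e (xi i * (xi j * B))) (e (xi i * (xi j * B))) =
      (-1 : ℂ) ^ (n + 1) • α (e (xi j * B)) (e (xi j * B)) := by
  set A := xi j * B with hA
  have hAd : A ∈ degPart N (n + 1) := xi_mul_mem_degPart j hB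
  have gA := IsGraded.of_degPart hAd
  have gB := IsGraded.of_degPart hB
  have hdA : dxi i A = 0 := by rw [hA, dxi_xi_mul, if_neg hij, hi, mul_zero, sub_zero]
  have hAA : A * A = 0 := by
    rw [hA, mul_assoc, gB.mul_xi j, mul_smul_comm, xi_mul_xi_mul_self, smul_zero]
  have hcA : contr A A = B * B := by
    rw [hA, contr_xi_mul_left, dxi_xi_mul, if_pos rfl, hj, mul_zero, sub_zero, contr_xi_mul_right,
      hj, zero_mul, zero_add, xi_mul_xi_mul_self, sub_zero]
  have hc : contr A (xi i * A) = (-1 : ℂ) ^ (n + 1) • (xi i * (B * B)) := by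
    rw [contr_xi_mul_right, hdA, zero_mul, zero_add, gA.gradeInv, contr_smul_left, hcA,
      mul_smul_comm]
  refine Polynomial.funext fun w => ?_
  have hJ := hα.2.2.2 1 _ _ (h.xi_mem_parity i) _ (h.emb_mem_parity_of_degPart hAd)
    (e (xi i * A)) 0 w
  rw [h.brk_emb_graded _ gA (gA.xi_mul i), gA.mul_xi, hAA, hc, h.brk_zero_xi, h.brk_zero_xi, hdA,
    xi_mul_xi_mul_self, dxi_xi_mul, if_pos rfl, hdA, ← neg_one_pow_eq_koszulSign_one] at hJ
  rw [Polynomial.coeff_zero_eq_eval_zero] at h0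
  simp only [mul_zero, smul_zero, map_zero, zero_add, map_smul, LinearMap.smul_apply,
    Polynomial.eval_smul, h0, eval_form_X_left hα, smul_eq_mul, add_zero, sub_zero] at hJ
  simp only [Polynomial.eval_mul, Polynomial.eval_X, Polynomial.eval_smul, smul_eq_mul]
  linear_combination -2 * hJ

/-- Adding the variables one at a time gives `cλ^3`, `cλ^2`, `-cλ`, `-c`, and the fourth variable
would require `λ` to divide the constant. -/
lemma coeff_three_eq_zero (h : IsKModel D e) (hN : N ≠ 4) (hα : α ∈ D.twoCocycles)
    (h1 : ∀ n ≠ 4, ∀ B ∈ degPart N n, (α (e 1) (e B)).coeff 1 = 0) {i j k l : Fin N}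
    (hij : i ≠ j) (hik : i ≠ k) (hil : i ≠ l) (hjk : j ≠ k) (hjl : j ≠ l) (hkl : k ≠ l) :
    (α (e 1) (e 1)).coeff 3 = 0 := by
  set c := (α (e 1) (e 1)).coeff 3 with hc
  have p1 : α (e (xi l)) (e (xi l)) = .C c * .X ^ 2 := by
    rw [h.form_xi_xi hN hα h1, if_pos rfl]
  have p2 : .X * α (e (xi k * (xi l * 1))) (e (xi k * (xi l * 1))) = _ :=
    h.X_mul_form_xi_mul hα hkl one_mem_degPart (dxi_one k) (dxi_one l) (by
      rw [one_mul, mul_one, h.form_xi_xi hN hα h1, if_pos rfl]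
      simp)
  have hll : (xi l * 1 * (xi l * 1) : Grassmann N) = 0 := by
    rw [mul_one, xi_mul_self]
  have d1 : ∀ {a : Fin N}, a ≠ l → dxi a (xi l * 1 : Grassmann N) = 0 := fun {a} ha => by
    rw [mul_one, dxi_xi, if_neg ha]
  have p3 : .X * α (e (xi j * (xi k * (xi l * 1)))) (e (xi j * (xi k * (xi l * 1)))) = _ :=
    h.X_mul_form_xi_mul hα hjk (xi_mul_mem_degPart l one_mem_degPart) (d1 hjl) (d1 hkl) (by
      rw [hll]; simp)
  have hkk : (xi k * (xi l * 1) * (xi k * (xi l * 1)) : Grassmann N) = 0 := by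
    rw [mul_one, mul_assoc, xi_mul_xi_mul l k, xi_mul_self]
    simp
  have d2 : ∀ {a : Fin N}, a ≠ k → a ≠ l → dxi a (xi k * (xi l * 1) : Grassmann N) = 0 :=
    fun {a} ha hb => by rw [dxi_xi_mul, if_neg ha, d1 hb, mul_zero, sub_zero]
  have p4 := h.X_mul_form_xi_mul hα hij
    (xi_mul_mem_degPart k (xi_mul_mem_degPart l one_mem_degPart)) (d2 hik hil) (d2 hjk hjl) (by
      rw [hkk]; simp)
  rw [mul_one] at p2 p3 p4
  rw [p1] at p2
  have q2 : α (e (xi k * xi l)) (e (xi k * xi l)) = -(.C c * .X) := by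
    refine mul_left_cancel₀ Polynomial.X_ne_zero (p2.trans ?_)
    norm_num
    ring
  rw [q2] at p3
  have q3 : α (e (xi j * (xi k * xi l))) (e (xi j * (xi k * xi l))) = -.C c := by
    refine mul_left_cancel₀ Polynomial.X_ne_zero (p3.trans ?_)
    norm_num
  rw [q3] at p4
  have := congrArg (Polynomial.coeff · 0) p4
  norm_num at this
  exact this.symm

end FourVariables

theorem twoCocycles_le_twoCoboundaries (h : IsKModel D e) (hN : 5 ≤ N) :
    D.twoCocycles ≤ D.twoCoboundaries := fun α hα => by
  have hN' : N ≠ 4 := by omega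
  obtain ⟨κ, hκ, hc, k3, n1, -⟩ := h.exists_normalised hN' hα
  have hne : ∀ {a b : ℕ} (ha : a < N) (hb : b < N), a ≠ b → (⟨a, ha⟩ : Fin N) ≠ ⟨b, hb⟩ :=
    fun ha hb hab h => hab (congrArg Fin.val h)
  have := h.coeff_three_eq_zero hN' hc n1 (hne (show 0 < N by omega) (show 1 < N by omega) (by omega))
    (hne _ (show 2 < N by omega) (by omega)) (hne _ (show 3 < N by omega) (by omega))
    (hne _ _ (by omega)) (hne _ _ (by omega)) (hne _ _ (by omega))
  rw [LinearMap.sub_apply, LinearMap.sub_apply, Polynomial.coeff_sub, k3, sub_zero] at this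
  exact h.mem_coboundaries hN' hα this

end IsKModel

theorem kAlg_hasOnlyTrivialCentralExtensions {N : ℕ} (hN : 5 ≤ N) :
    (KAlg N).HasOnlyTrivialCentralExtensions.{u} :=
  have h := kAlg_isKModel N
  ConformalData.hasOnlyTrivialCentralExtensions h.isLie (h.perfect (by omega))
    (h.twoCocycles_le_twoCoboundaries hN)

/-! ### The pairing on the Grassmann algebra. -/

section Pairing

variable {N : ℕ}

/-- The linear map `e_i ↦ ∂_i`. -/
def dxiHom (N : ℕ) : (Fin N → ℂ) →ₗ[ℂ] Module.End ℂ (Grassmann N) :=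
  ∑ i, (LinearMap.proj i : (Fin N → ℂ) →ₗ[ℂ] ℂ).smulRight (dxi i : Module.End ℂ (Grassmann N))

lemma dxiHom_mul_self (v : Fin N → ℂ) : dxiHom N v * dxiHom N v = 0 := by
  have : dxiHom N v = CliffordAlgebra.contractLeft (Q := (0 : QuadraticForm ℂ (Fin N → ℂ)))
      (∑ i, v i • (LinearMap.proj i : (Fin N → ℂ) →ₗ[ℂ] ℂ)) := by
    refine LinearMap.ext fun x => ?_
    simp [dxiHom, LinearMap.sum_apply, dxi]
  rw [this]
  refine LinearMap.ext fun x => ?_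
  exact CliffordAlgebra.contractLeft_contractLeft (Q := (0 : QuadraticForm ℂ (Fin N → ℂ)))
    (∑ i, v i • (LinearMap.proj i : (Fin N → ℂ) →ₗ[ℂ] ℂ)) x

/-- The action of `Λ(N)` on itself in which `ξ_i` acts by `∂_i`. -/
def dAction (N : ℕ) : Grassmann N →ₐ[ℂ] Module.End ℂ (Grassmann N) :=
  ExteriorAlgebra.lift ℂ ⟨dxiHom N, dxiHom_mul_self⟩

/-- The constant term of an element of `Λ(N)`. -/
def constTerm (N : ℕ) : Grassmann N →ₗ[ℂ] ℂ := ExteriorAlgebra.algebraMapInv.toLinearMap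

/-- The pairing `(A, B) ↦ (A(∂_1, …, ∂_N) B)(0)` on `Λ(N)`. -/
def pairing (N : ℕ) : Grassmann N →ₗ[ℂ] Grassmann N →ₗ[ℂ] ℂ :=
  (dAction N).toLinearMap.compr₂ (constTerm N)

lemma pairing_apply (A B : Grassmann N) : pairing N A B = constTerm N (dAction N A B) := rfl

lemma constTerm_one : constTerm N 1 = 1 := by simp [constTerm]

lemma constTerm_xi_mul (i : Fin N) (B : Grassmann N) : constTerm N (xi i * B) = 0 := by
  simp [constTerm, xi, ExteriorAlgebra.algebraMapInv]

lemma dAction_xi (i : Fin N) : dAction N (xi i) = dxi i := by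
  rw [dAction, xi, ExteriorAlgebra.lift_ι_apply, dxiHom, LinearMap.sum_apply, Finset.sum_eq_single i]
  · simp
  · intro j _ hj
    simp [hj]
  · simp

lemma pairing_one_left (B : Grassmann N) : pairing N 1 B = constTerm N B := by
  rw [pairing_apply, map_one, Module.End.one_apply]

lemma dAction_dxi (i : Fin N) (A B : Grassmann N) :
    dAction N A (dxi i B) = dxi i (dAction N (gradeInv N A) B) := by
  induction A using grassmann_induction generalizing B with
  | one => rw [gradeInv_one, map_one, Module.End.one_apply, Module.End.one_apply]
  | add x y hx hy => simp only [map_add, LinearMap.add_apply, hx, hy]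
  | smul z x hx => simp only [map_smul, LinearMap.smul_apply, hx]
  | mul j y hy =>
    rw [gradeInv_mul, gradeInv_xi, neg_mul, map_mul, map_neg, map_mul, Module.End.mul_apply, hy,
      dAction_xi, LinearMap.neg_apply, Module.End.mul_apply, map_neg, dxi_dxi]

lemma pairing_xi_mul (i : Fin N) (A B : Grassmann N) :
    pairing N (xi i * A) B = pairing N (gradeInv N A) (dxi i B) := by
  rw [pairing_apply, pairing_apply, dAction_dxi, gradeInv_gradeInv, map_mul, dAction_xi,
    Module.End.mul_apply]

lemma pairing_gradeInv (A B : Grassmann N) :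
    pairing N A (gradeInv N B) = pairing N (gradeInv N A) B := by
  induction A using grassmann_induction generalizing B with
  | one =>
    rw [gradeInv_one, pairing_one_left, pairing_one_left]
    induction B using grassmann_induction with
    | one => rw [gradeInv_one]
    | add x y hx hy => simp only [map_add, hx, hy]
    | smul z x hx => simp only [map_smul, hx]
    | mul i y _ => rw [gradeInv_mul, gradeInv_xi, neg_mul, map_neg, constTerm_xi_mul,
        constTerm_xi_mul, neg_zero]
  | add x y hx hy => simp only [map_add, LinearMap.add_apply, hx, hy]
  | smul z x hx => simp only [map_smul, LinearMap.smul_apply, hx]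
  | mul i y hy =>
    have e : dxi i (gradeInv N B) = -gradeInv N (dxi i B) := by rw [gradeInv_dxi, neg_neg]
    rw [gradeInv_mul, gradeInv_xi, neg_mul, map_neg, LinearMap.neg_apply, pairing_xi_mul,
      pairing_xi_mul, e, map_neg, ← hy, gradeInv_gradeInv, gradeInv_gradeInv]

lemma pairing_mul_xi (i : Fin N) (A B : Grassmann N) :
    pairing N A (xi i * B) = pairing N (gradeInv N (dxi i A)) B := by
  induction A using grassmann_induction generalizing B with
  | one => rw [dxi_one, map_zero, map_zero, LinearMap.zero_apply, pairing_one_left,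
      constTerm_xi_mul]
  | add x y hx hy => simp only [map_add, LinearMap.add_apply, hx, hy]
  | smul z x hx => simp only [map_smul, LinearMap.smul_apply, hx]
  | mul j y hy =>
    have e : gradeInv N (xi j * dxi i y) = -(xi j * gradeInv N (dxi i y)) := by
      rw [gradeInv_mul, gradeInv_xi, neg_mul]
    rw [pairing_xi_mul, dxi_xi_mul, dxi_xi_mul, map_sub, map_sub, map_sub, LinearMap.sub_apply, e,
      map_neg, LinearMap.neg_apply, pairing_xi_mul, ← pairing_gradeInv y (xi i * _), gradeInv_mul,
      gradeInv_xi, neg_mul, map_neg, hy, pairing_gradeInv, gradeInv_gradeInv]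
    by_cases h : i = j
    · subst h
      simp
    · simp [h, Ne.symm h]

/-- Multiplication by `ξ_i` and `∂_i` are adjoint to each other on both sides, up to the parity
automorphism, so factors can be moved across one at a time. -/
lemma pairing_comm (A B : Grassmann N) : pairing N A B = pairing N B A := by
  induction A using grassmann_induction generalizing B with
  | one =>
    rw [pairing_one_left]
    induction B using grassmann_induction with
    | one => rw [pairing_one_left]
    | add x y hx hy => simp only [map_add, LinearMap.add_apply, hx, hy]
    | smul z x hx => simp only [map_smul, LinearMap.smul_apply, hx]
    | mul i y _ => rw [constTerm_xi_mul, pairing_xi_mul, dxi_one, map_zero]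
  | add x y hx hy => simp only [map_add, LinearMap.add_apply, hx, hy]
  | smul z x hx => simp only [map_smul, LinearMap.smul_apply, hx]
  | mul i y hy => rw [pairing_xi_mul, pairing_mul_xi, ← pairing_gradeInv, hy]

/-- Each `ξ_i ∂_i` is self-adjoint. In consequence distinct degrees are orthogonal. -/
lemma pairing_euler (A B : Grassmann N) : pairing N (euler N A) B = pairing N A (euler N B) := by
  simp only [euler_apply, map_sum, LinearMap.sum_apply, pairing_xi_mul, pairing_mul_xi]

lemma pairing_eq_zero {m n : ℕ} {A B : Grassmann N} (hA : A ∈ degPart N m) (hB : B ∈ degPart N n)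
    (hmn : m ≠ n) : pairing N A B = 0 := by
  have h := pairing_euler A B
  rw [euler_of_mem_degPart hA, euler_of_mem_degPart hB, map_smul, map_smul, LinearMap.smul_apply,
    smul_eq_mul, smul_eq_mul] at h
  have h1 : ((m : ℂ) - n) * pairing N A B = 0 := by linear_combination h
  exact (mul_eq_zero.1 h1).resolve_left (sub_ne_zero.2 (by exact_mod_cast hmn))

lemma constTerm_eq_zero {n : ℕ} {B : Grassmann N} (hB : B ∈ degPart N n) (hn : n ≠ 0) :
    constTerm N B = 0 := by
  rw [← pairing_one_left]
  exact pairing_eq_zero one_mem_degPart hB hn.symm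

/-- The projection to degree `n` kills the basis of monomials, whose degrees are at most `N`. -/
lemma degPart_eq_zero {n : ℕ} (hn : N < n) {B : Grassmann N} (hB : B ∈ degPart N n) : B = 0 := by
  obtain ⟨T, hT⟩ := exists_degree_operator N fun m => if m = n then 1 else 0
  have h1 : T = 0 := by
    refine ((Pi.basisFun ℂ (Fin N)).ExteriorAlgebra).ext fun I => ?_
    change T (xiMono I) = 0
    rw [hT _ _ (xiMono_mem_degPart I), if_neg, zero_smul]
    have := Finset.card_le_univ I
    rw [Fintype.card_fin] at this
    omega
  have h2 := hT n B hB
  rw [h1, if_pos rfl, one_smul] at h2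
  exact h2.symm

lemma xiMono_eq_prod (I : Finset (Fin N)) :
    xiMono I = ((I.sort (· ≤ ·)).map xi).prod := by
  rw [xiMono, ExteriorAlgebra.basis_apply]
  change ExteriorAlgebra.ιMulti ℂ _ _ = _
  rw [ExteriorAlgebra.ιMulti_apply]
  congr 1
  refine List.ext_getElem (by simp) fun k h1 h2 => ?_
  simp [xi, Set.powersetCard.ofFinEmbEquiv_symm_apply, Finset.orderEmbOfFin_apply]

lemma xiMono_empty : (xiMono ∅ : Grassmann N) = 1 := by
  rw [xiMono_eq_prod]
  simp

lemma xiMono_insert {i : Fin N} {I : Finset (Fin N)} (h : ∀ j ∈ I, i < j) :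
    xiMono (insert i I) = xi i * xiMono I := by
  rw [xiMono_eq_prod, xiMono_eq_prod, Finset.sort_insert (r := (· ≤ ·)) (fun b hb => (h b hb).le)
    (fun hi => lt_irrefl _ (h i hi)), List.map_cons, List.prod_cons]

lemma dxi_xiMono_of_notMem {i : Fin N} {I : Finset (Fin N)} (hi : i ∉ I) :
    dxi i (xiMono I) = 0 := by
  induction I using Finset.induction_on_min with
  | empty => rw [xiMono_empty, dxi_one]
  | insert j I hj ih =>
    rw [Finset.mem_insert, not_or] at hi
    rw [xiMono_insert hj, dxi_xi_mul, if_neg hi.1, ih hi.2, mul_zero, sub_zero]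

/-- The derivations act on `ξ_I` in the order opposite to the one that strips its factors from the
left; the sign is that of the reversal of `|I|` odd factors. -/
lemma pairing_xiMono (I J : Finset (Fin N)) : pairing N (xiMono I) (xiMono J) =
    if I = J then (-1) ^ (I.card * (I.card - 1) / 2) else 0 := by
  induction I using Finset.induction_on_min generalizing J with
  | empty =>
    rw [xiMono_empty, pairing_one_left]
    split_ifs with h
    · subst h
      rw [xiMono_empty, constTerm_one]
      simp
    · refine constTerm_eq_zero (xiMono_mem_degPart J) fun h0 => h ?_
      exact (Finset.card_eq_zero.1 h0).symm
  | insert i I hi ih =>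
    have hiI : i ∉ I := fun h => lt_irrefl _ (hi i h)
    by_cases hiJ : i ∈ J
    · have hne : J.Nonempty := ⟨i, hiJ⟩
      set m := J.min' hne with hm
      have hJ : xiMono J = xi m * xiMono (J.erase m) := by
        rw [← xiMono_insert fun j hj => Finset.min'_lt_of_mem_erase_min' J hne hj,
          Finset.insert_erase (Finset.min'_mem J hne)]
      by_cases hmi : m = i
      · rw [xiMono_insert hi, pairing_xi_mul, hJ, hmi, dxi_xi_mul, if_pos rfl,
          dxi_xiMono_of_notMem (Finset.notMem_erase i J), mul_zero,
          sub_zero, gradeInv_of_mem_degPart (xiMono_mem_degPart I), map_smul,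
          LinearMap.smul_apply, ih]
        by_cases hIJ : I = J.erase i
        · rw [if_pos hIJ, if_pos (by rw [hIJ, Finset.insert_erase hiJ]),
            Finset.card_insert_of_notMem hiI, smul_eq_mul, ← pow_add, Nat.triangle_succ, add_comm]
        · rw [if_neg hIJ, if_neg, smul_zero]
          rintro rfl
          exact hIJ (Finset.erase_insert hiI).symm
      -- The least index `m` of `J` does not occur in `insert i I`, so moving `ξ_m` across the
      -- pairing gives zero.
      · have hlt : m < i := lt_of_le_of_ne (Finset.min'_le _ _ hiJ) hmi
        have hnot : m ∉ insert i I := fun h => by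
          rcases Finset.mem_insert.1 h with h | h
          · exact hmi h
          · exact lt_asymm hlt (hi m h)
        rw [hJ, pairing_mul_xi, dxi_xiMono_of_notMem hnot, map_zero, map_zero,
          LinearMap.zero_apply, if_neg]
        rintro rfl
        exact hnot (Finset.min'_mem _ _)
    · rw [xiMono_insert hi, pairing_xi_mul, dxi_xiMono_of_notMem hiJ, map_zero, if_neg]
      rintro rfl
      exact hiJ (Finset.mem_insert_self i I)

end Pairing

/-! ### Checking the cocycle axioms on generators and at generic parameters. -/

namespace ConformalData

section Cocycles

variable {R : Type*} [AddCommGroup R] [Module ℂ R] [Module ℂ[X] R]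

/-- The value at `λ = z` of a form, as a bilinear form. -/
def evalForm (α : LambdaForm R) (z : ℂ) : R →ₗ[ℂ] R →ₗ[ℂ] ℂ := α.compr₂ (Polynomial.leval z)

lemma evalForm_apply (α : LambdaForm R) (z : ℂ) (a b : R) : evalForm α z a b = (α a b).eval z := rfl

variable [IsScalarTower ℂ ℂ[X] R] {D : ConformalData R} {α : LambdaForm R}

/-- The cocycle axioms may be checked on homogeneous generators. -/
lemma mem_twoCocycles_of_span
    (hD : ∀ z a b, D.brk (.C z) ((.X : ℂ[X]) • a) b = -(z • D.brk (.C z) a b))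
    (hl : ∀ a b, α ((.X : ℂ[X]) • a) b = -(.X * α a b))
    (hr : ∀ a b, α a ((.X : ℂ[X]) • b) = .X * α a b)
    (T : ZMod 2 → Set R) (hT : ∀ j, D.parity j ≤ Submodule.span ℂ[X] (T j))
    (hskew : ∀ i j, ∀ a ∈ T i, ∀ b ∈ T j, α b a = -(koszulSign i j • (α a b).comp (-.X)))
    (hJ : ∀ i, ∀ a ∈ T i, D.JacobiFor (evalForm α) i a) : α ∈ D.twoCocycles := by
  refine ⟨hl, hr, fun i j a ha b hb => ?_, fun i j a ha b hb c z w => ?_⟩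
  · refine span_polynomial_induction (motive := fun a => α b a =
      -(koszulSign i j • (α a b).comp (-.X))) (fun a ha => ?_) ?_ (fun x y hx hy => ?_)
      (fun r x hx => ?_) (fun x hx => ?_) (hT i ha)
    · refine span_polynomial_induction (motive := fun b => α b a =
        -(koszulSign i j • (α a b).comp (-.X))) (fun b hb => hskew i j a ha b hb) ?_
        (fun x y hx hy => ?_) (fun r x hx => ?_) (fun x hx => ?_) (hT j hb)
      · simp
      · simp only [map_add, LinearMap.add_apply, hx, hy, Polynomial.add_comp]
        module
      · simp only [map_smul, LinearMap.smul_apply, hx, Polynomial.smul_comp]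
        module
      · simp only [hl, hr, hx, Polynomial.mul_comp, Polynomial.X_comp, Polynomial.smul_eq_C_mul]
        ring
    · simp
    · simp only [map_add, LinearMap.add_apply, hx, hy, Polynomial.add_comp]
      module
    · simp only [map_smul, LinearMap.smul_apply, hx, Polynomial.smul_comp]
      module
    · simp only [hl, hr, hx, Polynomial.mul_comp, Polynomial.X_comp, Polynomial.neg_comp,
        Polynomial.smul_eq_C_mul]
      ring
  · have : D.JacobiFor (evalForm α) i a := by
      refine span_polynomial_induction (motive := fun a => D.JacobiFor (evalForm α) i a) (hJ i)
        .zero (fun x y hx hy => hx.add hy) (fun z x hx => hx.smul z)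
        (fun x hx => hx.X_smul hD fun z a b => ?_) (hT i ha)
      rw [evalForm_apply, evalForm_apply, hl]
      simp
    exact this j b hb c z w

/-- The cocycle identity holds at all values of `λ`, `μ` if it does at generic ones. -/
lemma jacobiFor_of_generic {i : ZMod 2} {a : R} (h : ∀ z w : ℂ, z ≠ 0 → w ≠ 0 → z + w ≠ 0 →
      ∀ j, ∀ b ∈ D.parity j, ∀ c, (α a (D.brk (.C w) b c)).eval z =
        (α (D.brk (.C z) a b) c).eval (z + w) +
          koszulSign i j * (α b (D.brk (.C z) a c)).eval w) :
    D.JacobiFor (evalForm α) i a := fun j b hb c => by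
  -- A polynomial identity may be checked off a finite set. The excluded values are filled in for
  -- `z` first, with `w ≠ 0` fixed, and then for `w`.
  have poly : ∀ p q : ℂ[X], ∀ s : Finset ℂ, (∀ z ∉ s, p.eval z = q.eval z) → p = q :=
    fun p q s hpq => Polynomial.eq_of_infinite_eval_eq p q
      ((s.finite_toSet.infinite_compl).mono fun z hz => hpq z hz)
  obtain ⟨M, hM⟩ := exists_eq_sum_lambdaCoeff (D.bracket a b)
  have e1 : ∀ w, ∃ P : ℂ[X], ∀ z, P.eval z = (α (D.brk (.C z) a b) c).eval (z + w) := fun w => by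
    refine ⟨∑ n ∈ Finset.range M, .X ^ n * (α (lambdaCoeff n (D.bracket a b)) c).comp (.X + .C w),
      fun z => ?_⟩
    rw [brk_C]
    conv_rhs => rw [hM M le_rfl]
    simp [Polynomial.eval_finsetSum, evalAt_tmul, LinearMap.sum_apply]
  have e2 : ∀ w, ∃ P : ℂ[X], ∀ z, P.eval z = (α b (D.brk (.C z) a c)).eval w := fun w =>
    ⟨_, fun z => (eval_rid_lTensor (evalForm α w b) z (D.bracket a c)).trans (by rw [brk_C]; rfl)⟩
  have e3 : ∀ z, ∃ P : ℂ[X], ∀ w, P.eval w = (α a (D.brk (.C w) b c)).eval z := fun z =>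
    ⟨_, fun w => (eval_rid_lTensor (evalForm α z a) w (D.bracket b c)).trans (by rw [brk_C]; rfl)⟩
  have s1 : ∀ z w, w ≠ 0 → (α a (D.brk (.C w) b c)).eval z =
      (α (D.brk (.C z) a b) c).eval (z + w) +
        koszulSign i j * (α b (D.brk (.C z) a c)).eval w := fun z w hw => by
    obtain ⟨P₁, h1⟩ := e1 w
    obtain ⟨P₂, h2⟩ := e2 w
    have := poly (α a (D.brk (.C w) b c)) (P₁ + koszulSign i j • P₂) {0, -w} fun z hz => by
      simp only [Finset.mem_insert, Finset.mem_singleton, not_or] at hz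
      rw [Polynomial.eval_add, Polynomial.eval_smul, h1, h2, smul_eq_mul]
      exact h z w hz.1 hw (fun h0 => hz.2 (eq_neg_of_add_eq_zero_left h0)) j b hb c
    rw [this, Polynomial.eval_add, Polynomial.eval_smul, h1, h2, smul_eq_mul]
  intro z w
  obtain ⟨P₃, h3⟩ := e3 z
  have := poly P₃ ((α (D.brk (.C z) a b) c).comp (.C z + .X) +
      koszulSign i j • α b (D.brk (.C z) a c)) {0} fun w hw => by
    rw [h3, Polynomial.eval_add, Polynomial.eval_smul, smul_eq_mul, Polynomial.eval_comp]
    simpa using s1 z w (by simpa using hw)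
  have h4 := congrArg (Polynomial.eval w) this
  rw [h3, Polynomial.eval_add, Polynomial.eval_smul, smul_eq_mul, Polynomial.eval_comp] at h4
  simpa [evalForm_apply] using h4

/-- The restriction of a form to a submodule. -/
def restrictForm (α : LambdaForm R) (S : Submodule ℂ[X] R) : LambdaForm S :=
  α.compl₁₂ (S.subtype.restrictScalars ℂ) (S.subtype.restrictScalars ℂ)

lemma restrictForm_apply (S : Submodule ℂ[X] R) (a b : S) : restrictForm α S a b = α a b := rfl

lemma restrictForm_mem {S : Submodule ℂ[X] R} (hS : D.IsSubalgebra S) (hα : α ∈ D.twoCocycles) :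
    restrictForm α S ∈ (D.restrict S hS).twoCocycles := by
  refine ⟨fun a b => hα.1 a b, fun a b => hα.2.1 a b,
    fun i j a ha b hb => hα.2.2.1 i j a ha b hb, fun i j a ha b hb c z w => ?_⟩
  simp only [restrictForm_apply, brk_restrict]
  exact hα.2.2.2 i j a ha b hb c z w

end Cocycles

end ConformalData

namespace IsKModel

variable {N : ℕ} {R : Type*} [AddCommGroup R] [Module ℂ R] [Module ℂ[X] R] [IsScalarTower ℂ ℂ[X] R]
  {D : ConformalData R} {e : Grassmann N →ₗ[ℂ] R} {α : ConformalData.LambdaForm R}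

/-- The cocycle axioms for `K_N` may be checked for the first argument `1` or `ξ_i`. -/
lemma mem_twoCocycles (h : IsKModel D e)
    (hl : ∀ a b, α ((.X : ℂ[X]) • a) b = -(.X * α a b))
    (hr : ∀ a b, α a ((.X : ℂ[X]) • b) = .X * α a b)
    (hskew : ∀ m n : ℕ, ∀ A ∈ degPart N m, ∀ B ∈ degPart N n,
      α (e B) (e A) = -(koszulSign m n • (α (e A) (e B)).comp (-.X)))
    (h1 : D.JacobiFor (ConformalData.evalForm α) 0 (e 1))
    (hξ : ∀ i, D.JacobiFor (ConformalData.evalForm α) 1 (e (xi i))) : α ∈ D.twoCocycles := by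
  refine ConformalData.mem_twoCocycles_of_span h.sesq_left hl hr (fun j => e '' gradedSet N j)
    h.parity_le_span ?_ ?_
  · rintro i j _ ⟨A, ⟨m, rfl, hA⟩, rfl⟩ _ ⟨B, ⟨n, rfl, hB⟩, rfl⟩
    exact hskew m n A hA B hB
  · rintro i _ ⟨A, ⟨m, rfl, hA⟩, rfl⟩
    refine (h.jacobiFor_emb_and (fun z a b => ?_) (fun g x y => ⟨g 1 • α x y, fun z => ?_⟩)
      h1 hξ m A hA).2
    · rw [ConformalData.evalForm_apply, ConformalData.evalForm_apply, hl]
      simp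
    · rw [Polynomial.eval_smul, ConformalData.evalForm_apply, smul_eq_mul, mul_comm, ← smul_eq_mul,
        ← map_smul, smul_eq_mul, mul_one]

/-- The identity of `JacobiFor` at given `z`, `w` for a form may be checked on homogeneous elements
of `Λ(N)`. -/
lemma jacobi_of_degPart (h : IsKModel D e) {F : ℂ → R →ₗ[ℂ] R →ₗ[ℂ] ℂ}
    (hl : ∀ z a b, F z ((.X : ℂ[X]) • a) b = -(z * F z a b))
    (hr : ∀ z a b, F z a ((.X : ℂ[X]) • b) = z * F z a b) {a : R} {i : ZMod 2} (z w : ℂ)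
    (ha : ∀ m n : ℕ, ∀ B ∈ degPart N m, ∀ C ∈ degPart N n, F z a (D.brk (.C w) (e B) (e C)) =
        F (z + w) (D.brk (.C z) a (e B)) (e C)
          + koszulSign i m • F w (e B) (D.brk (.C z) a (e C))) :
    ∀ j, ∀ b ∈ D.parity j, ∀ c, F z a (D.brk (.C w) b c) =
      F (z + w) (D.brk (.C z) a b) c + koszulSign i j • F w b (D.brk (.C z) a c) := by
  refine ConformalData.jacobi_of_span h.sesq_left h.sesq_right hl 0 (fun z a b => ?_)
    (fun j => e '' gradedSet N j) h.parity_le_span _ h.span_graded z w ?_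
  · rw [hr, LinearMap.zero_apply, zero_add, smul_eq_mul]
  · rintro j _ ⟨B, ⟨m, rfl, hB⟩, rfl⟩ _ ⟨C, ⟨n, hC⟩, rfl⟩
    exact ha m n B hB C hC

end IsKModel

/-! ### Sesquilinear extension of forms, and degrees in the pairing. -/

section KForm

variable {N : ℕ} (b : Grassmann N →ₗ[ℂ] Grassmann N →ₗ[ℂ] ℂ[X])

/-- The sesquilinear extension to `K_N` of a form on `Λ(N)`. -/
def kForm : ConformalData.LambdaForm (KSpace N) :=
  (TensorProduct.map₂ ((LinearMap.mul ℂ ℂ[X]).compl₁₂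
    (Polynomial.aeval (-.X : ℂ[X])).toLinearMap LinearMap.id) b).compr₂ (LinearMap.mul' ℂ ℂ[X])

lemma kForm_tmul (f g : ℂ[X]) (A B : Grassmann N) :
    kForm b (f ⊗ₜ[ℂ] A) (g ⊗ₜ[ℂ] B) = f.comp (-.X) * g * b A B := by
  simp [kForm, Polynomial.comp, Polynomial.aeval_def, Polynomial.eval₂_eq_sum]

lemma kForm_emb (A B : Grassmann N) : kForm b (kEmb N A) (kEmb N B) = b A B := by
  rw [kEmb, TensorProduct.mk_apply, TensorProduct.mk_apply, kForm_tmul, Polynomial.one_comp,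
    one_mul, one_mul]

lemma kForm_X_smul_left (x y : KSpace N) :
    kForm b ((.X : ℂ[X]) • x) y = -(.X * kForm b x y) := by
  induction x using TensorProduct.induction_on with
  | zero => simp
  | add x x' hx hx' => rw [smul_add, map_add, LinearMap.add_apply, hx, hx', map_add,
      LinearMap.add_apply]; ring
  | tmul f A =>
    induction y using TensorProduct.induction_on with
    | zero => simp
    | add y y' hy hy' => rw [map_add, hy, hy', map_add]; ring
    | tmul g B =>
      rw [TensorProduct.smul_tmul', kForm_tmul, kForm_tmul, smul_eq_mul, Polynomial.mul_comp,
        Polynomial.X_comp]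
      ring

lemma kForm_X_smul_right (x y : KSpace N) :
    kForm b x ((.X : ℂ[X]) • y) = .X * kForm b x y := by
  induction x using TensorProduct.induction_on with
  | zero => simp
  | add x x' hx hx' => rw [map_add, LinearMap.add_apply, hx, hx', LinearMap.add_apply]; ring
  | tmul f A =>
    induction y using TensorProduct.induction_on with
    | zero => simp
    | add y y' hy hy' => rw [smul_add, map_add, hy, hy', map_add]; ring
    | tmul g B =>
      rw [TensorProduct.smul_tmul', kForm_tmul, kForm_tmul, smul_eq_mul]
      ring

end KForm

section PairingDegree

variable {N : ℕ} {r : ℕ} {B : Grassmann N}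

lemma constTerm_mul (A B : Grassmann N) : constTerm N (A * B) = constTerm N A * constTerm N B := by
  simp [constTerm]

lemma pairing_of_mem_degPart_zero (hB : B ∈ degPart N 0) (C : Grassmann N) :
    pairing N B C = constTerm N B * constTerm N C := by
  rw [degPart, pow_zero] at hB
  obtain ⟨z, rfl⟩ := Submodule.mem_one.1 hB
  rw [Algebra.algebraMap_eq_smul_one, map_smul, map_smul, LinearMap.smul_apply, pairing_one_left,
    constTerm_one, smul_eq_mul, smul_eq_mul, mul_one]

/-- Only the linear parts of the two arguments reach the constant term, and on these the contraction
is the pairing. -/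
lemma constTerm_contr (hB : B ∈ degPart N r) (C : Grassmann N) :
    constTerm N (contr B C) = if r = 1 then pairing N B C else 0 := by
  rw [contr, map_sum]
  split_ifs with hr
  · subst hr
    have h1 : B = ∑ i, xi i * dxi i B := by
      rw [← euler_apply, euler_of_mem_degPart hB, Nat.cast_one, one_smul]
    conv_rhs => rw [h1]
    rw [map_sum, LinearMap.sum_apply]
    refine Finset.sum_congr rfl fun i _ => ?_
    have h0 : dxi i B ∈ degPart N 0 := dxi_mem_degPart i hB
    rw [pairing_xi_mul, gradeInv_of_mem_degPart h0, pow_zero, one_smul,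
      pairing_of_mem_degPart_zero h0, constTerm_mul]
  · refine Finset.sum_eq_zero fun i _ => ?_
    rw [constTerm_mul]
    rcases r with _ | r
    · rw [dxi_of_mem_degPart_zero i hB, map_zero, zero_mul]
    · rw [constTerm_eq_zero (dxi_mem_degPart i hB) (by omega), zero_mul]

lemma constTerm_gradeInv (A : Grassmann N) : constTerm N (gradeInv N A) = constTerm N A := by
  rw [← pairing_one_left, pairing_gradeInv, gradeInv_one, pairing_one_left]

lemma pairing_xi (i : Fin N) (B : Grassmann N) : pairing N (xi i) B = constTerm N (dxi i B) := by
  rw [← mul_one (xi i), pairing_xi_mul, gradeInv_one, pairing_one_left]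

lemma constTerm_dxi_mul (i : Fin N) (B C : Grassmann N) : constTerm N (dxi i (B * C)) =
    constTerm N (dxi i B) * constTerm N C + constTerm N B * constTerm N (dxi i C) := by
  rw [dxi_mul, map_add, constTerm_mul, constTerm_mul, constTerm_gradeInv]

end PairingDegree

/-! ### The cocycle identity for `α` with Laurent exponents. -/

namespace IsKModel

section Alpha

variable {N : ℕ} {R : Type*} [AddCommGroup R] [Module ℂ R] [Module ℂ[X] R] [IsScalarTower ℂ ℂ[X] R]
  {D : ConformalData R} {e : Grassmann N →ₗ[ℂ] R} {F : ℂ → R →ₗ[ℂ] R →ₗ[ℂ] ℂ}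
  {r s : ℕ} {B C : Grassmann N} {z w : ℂ}

lemma smul_left_of_sesq (hl : ∀ z a b, F z ((.X : ℂ[X]) • a) b = -(z * F z a b)) (f : ℂ[X])
    (z : ℂ) (a b : R) : F z (f • a) b = f.eval (-z) * F z a b := by
  induction f using Polynomial.induction_on' with
  | add p q hp hq => rw [add_smul, map_add, LinearMap.add_apply, hp, hq, Polynomial.eval_add,
      add_mul]
  | monomial n c =>
    rw [← Polynomial.C_mul_X_pow_eq_monomial, mul_smul, C_smul_eq, map_smul, LinearMap.smul_apply,
      Polynomial.eval_C_mul, mul_assoc, smul_eq_mul]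
    congr 1
    induction n with
    | zero => simp
    | succ n ih => rw [pow_succ', mul_smul, hl, ih, Polynomial.eval_mul, Polynomial.eval_X]; ring

lemma smul_right_of_sesq (hr : ∀ z a b, F z a ((.X : ℂ[X]) • b) = z * F z a b) (f : ℂ[X])
    (z : ℂ) (a b : R) : F z a (f • b) = f.eval z * F z a b := by
  induction f using Polynomial.induction_on' with
  | add p q hp hq => rw [add_smul, map_add, hp, hq, Polynomial.eval_add, add_mul]
  | monomial n c =>
    rw [← Polynomial.C_mul_X_pow_eq_monomial, mul_smul, C_smul_eq, map_smul,
      Polynomial.eval_C_mul, mul_assoc, smul_eq_mul]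
    congr 1
    induction n with
    | zero => simp
    | succ n ih => rw [pow_succ', mul_smul, hr, ih, Polynomial.eval_mul, Polynomial.eval_X]; ring

/-- The form with value `λ ^ (3 - r) (A, B) / 12` at `A`, `B ∈ Λ(N)`, where `A` has degree `r`,
satisfies the cocycle identity for `1`. -/
lemma laurent_jacobi_one (h : IsKModel D e) (hN : N ≤ 4)
    (hl : ∀ z a b, F z ((.X : ℂ[X]) • a) b = -(z * F z a b))
    (hr : ∀ z a b, F z a ((.X : ℂ[X]) • b) = z * F z a b)
    (hF : ∀ n, ∀ A ∈ degPart N n, ∀ z B,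
      F z (e A) (e B) = z⁻¹ * (z ^ (4 - n) * (pairing N A B / 12)))
    (hB : B ∈ degPart N r) (hC : C ∈ degPart N s) (hw : w ≠ 0) (hzw : z + w ≠ 0) :
    F z (e 1) (D.brk (.C w) (e B) (e C)) =
      F (z + w) (D.brk (.C z) (e 1) (e B)) (e C) + F w (e B) (D.brk (.C z) (e 1) (e C)) := by
  have gB := IsGraded.of_degPart hB
  have gC := IsGraded.of_degPart hC
  have hsl := smul_left_of_sesq hl
  have hsr := smul_right_of_sesq hr
  rw [h.brk_emb_graded _ gB gC, h.brk_one_graded _ gB, h.brk_one_graded _ gC, map_add, hsr,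
    map_smul, hsl, hsr, hF 0 1 one_mem_degPart, hF 0 1 one_mem_degPart, hF r B hB, hF r B hB,
    pairing_one_left, pairing_one_left, constTerm_mul, constTerm_contr hB C]
  have hq : constTerm N B * constTerm N C = if r = 0 then pairing N B C else 0 := by
    split_ifs with h0
    · subst h0
      rw [pairing_of_mem_degPart_zero hB]
    · rw [constTerm_eq_zero hB h0, zero_mul]
  rw [hq]
  by_cases hrs : r = s
  · subst hrs
    by_cases h4 : 4 < r
    · simp [degPart_eq_zero (hN.trans_lt h4) hB]
    · generalize pairing N B C = q
      have : r ≤ 4 := not_lt.1 h4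
      simp only [Polynomial.eval_add, Polynomial.eval_sub, Polynomial.eval_mul, Polynomial.eval_C,
        Polynomial.eval_X]
      -- Only equal degrees `r = s ≤ 4` contribute, and each is a rational identity in `z`, `w`
      -- multiplied by `(B, C)`. No condition on `z` is needed, as the power of `z` attached to `1`
      -- is `z^3`.
      interval_cases r <;> norm_num <;> field_simp <;> ring
  · rw [pairing_eq_zero hB hC hrs]
    simp

/-- The form with value `λ ^ (3 - r) (A, B) / 12` at `A`, `B ∈ Λ(N)`, where `A` has degree `r`,
satisfies the cocycle identity for `ξ_i`. -/
lemma laurent_jacobi_xi (h : IsKModel D e) (hN : N ≤ 4)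
    (hl : ∀ z a b, F z ((.X : ℂ[X]) • a) b = -(z * F z a b))
    (hr : ∀ z a b, F z a ((.X : ℂ[X]) • b) = z * F z a b)
    (hF : ∀ n, ∀ A ∈ degPart N n, ∀ z B,
      F z (e A) (e B) = z⁻¹ * (z ^ (4 - n) * (pairing N A B / 12))) (i : Fin N)
    (hB : B ∈ degPart N r) (hC : C ∈ degPart N s) (hw : w ≠ 0) (hzw : z + w ≠ 0) :
    F z (e (xi i)) (D.brk (.C w) (e B) (e C)) =
      F (z + w) (D.brk (.C z) (e (xi i)) (e B)) (e C) +
        (-1) ^ r * F w (e B) (D.brk (.C z) (e (xi i)) (e C)) := by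
  have gB := IsGraded.of_degPart hB
  have gC := IsGraded.of_degPart hC
  have hsl := smul_left_of_sesq hl
  have hsr := smul_right_of_sesq hr
  have hxB := xi_mul_mem_degPart i hB
  have hdB := dxi_mem_degPart i hB
  have hdC := dxi_mem_degPart i hC
  have p1 : pairing N (xi i * B) C = (-1) ^ r * pairing N B (dxi i C) := by
    rw [pairing_xi_mul, gradeInv_of_mem_degPart hB, map_smul, LinearMap.smul_apply, smul_eq_mul]
  have p2 : pairing N B (xi i * C) = (-1) ^ (r - 1) * pairing N (dxi i B) C := by
    rw [pairing_mul_xi, gradeInv_of_mem_degPart hdB, map_smul, LinearMap.smul_apply, smul_eq_mul]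
  have q1 : constTerm N (dxi i B) * constTerm N C =
      if r = 1 then pairing N (dxi i B) C else 0 := by
    split_ifs with h0
    · subst h0
      rw [pairing_of_mem_degPart_zero hdB]
    · rcases r with _ | r
      · rw [dxi_of_mem_degPart_zero i hB, map_zero, zero_mul]
      · rw [constTerm_eq_zero hdB (by omega), zero_mul]
  have q2 : constTerm N B * constTerm N (dxi i C) =
      if r = 0 then pairing N B (dxi i C) else 0 := by
    split_ifs with h0
    · subst h0
      rw [pairing_of_mem_degPart_zero hB]
    · rw [constTerm_eq_zero hB h0, zero_mul]
  have q3 : constTerm N (dxi i (contr B C)) = -(if r = 2 then pairing N (dxi i B) C else 0) +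
      (-1) ^ r * if r = 1 then pairing N B (dxi i C) else 0 := by
    rw [dxi_contr, map_add, map_neg, gradeInv_of_mem_degPart hB, contr_smul_left, map_smul,
      constTerm_contr hB _, smul_eq_mul]
    congr 2
    rcases r with _ | r
    · rw [dxi_of_mem_degPart_zero i hB]
      simp [contr]
    · rw [constTerm_contr hdB C]
      simp
  rw [h.brk_emb_graded _ gB gC, h.brk_xi_graded _ _ gB, h.brk_xi_graded _ _ gC, map_add, hsr,
    map_smul, map_sub (F (z + w)), map_sub (F w (e B)), LinearMap.sub_apply, hsl, hsr,
    map_smul (F (z + w)), map_smul (F w (e B)), LinearMap.smul_apply, hF 1 _ (xi_mem_degPart i), hF 1 _ (xi_mem_degPart i),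
    hF _ _ hxB, hF _ _ hdB, hF r B hB, hF r B hB, p1, p2, pairing_xi, pairing_xi,
    constTerm_dxi_mul, q1, q2, q3]
  by_cases h4 : 4 < r
  · simp [degPart_eq_zero (hN.trans_lt h4) hB]
  · have h4' : r ≤ 4 := not_lt.1 h4
    have z1 : r + 1 ≠ s → pairing N B (dxi i C) = 0 := fun h0 => by
      rcases s with _ | s
      · rw [dxi_of_mem_degPart_zero i hC, map_zero]
      · exact pairing_eq_zero hB hdC (by omega)
    have z2 : r ≠ s + 1 → pairing N (dxi i B) C = 0 := fun h0 => by
      rcases r with _ | r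
      · rw [dxi_of_mem_degPart_zero i hB, map_zero, LinearMap.zero_apply]
      · exact pairing_eq_zero hdB hC (by omega)
    simp only [Polynomial.eval_add, Polynomial.eval_sub, Polynomial.eval_mul, Polynomial.eval_C,
        Polynomial.eval_X, smul_eq_mul]
    -- Only `s = r + 1`, through `(B, ∂_i C)`, and `r = s + 1`, through `(∂_i B, C)`, contribute.
    by_cases c1 : r + 1 = s
    · rw [z2 (by omega)]
      subst c1
      by_cases h5 : r = 4
      · subst h5
        rw [degPart_eq_zero (by omega : N < 4 + 1) hC]
        simp
      have h5 : r ≤ 3 := by omega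
      generalize pairing N B (dxi i C) = q
      interval_cases r <;> norm_num <;> field_simp <;> ring
    · rw [z1 c1]
      by_cases c2 : r = s + 1
      · generalize pairing N (dxi i B) C = q
        subst c2
        have h5 : s ≤ 3 := by omega
        interval_cases s <;> norm_num <;> field_simp <;> ring
      · rw [z2 c2]
        simp

end Alpha

end IsKModel

/-! ### The form `λα` and its division by `λ`. -/

section AlphaForm

variable {N : ℕ}

/-- For `k = 4` and `N ≤ 4` the difference `k - n` does not truncate on a non-zero `A`. The factor
`1/12` is `α_3(1,1)/3!`. -/
lemma exists_alpha_base (N k : ℕ) : ∃ b : Grassmann N →ₗ[ℂ] Grassmann N →ₗ[ℂ] ℂ[X],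
    ∀ n, ∀ A ∈ degPart N n, ∀ B, b A B = .C (pairing N A B / 12) * .X ^ (k - n) := by
  choose P hP using fun r : ℕ => exists_degree_operator N fun m => if m = r then 1 else 0
  refine ⟨∑ r ∈ Finset.range (N + 1), ((pairing N) ∘ₗ P r).compr₂
    (LinearMap.toSpanSingleton ℂ ℂ[X] (.C (1 / 12) * .X ^ (k - r))), fun n A hA B => ?_⟩
  by_cases hn : N < n
  · simp [degPart_eq_zero hn hA]
  · rw [LinearMap.sum_apply, LinearMap.sum_apply, Finset.sum_eq_single n]
    · rw [LinearMap.compr₂_apply, LinearMap.comp_apply, hP n n A hA, if_pos rfl, one_smul,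
        LinearMap.toSpanSingleton_apply, Polynomial.smul_eq_C_mul, ← mul_assoc, ← Polynomial.C_mul]
      congr 2
      ring
    · intro r _ hr
      rw [LinearMap.compr₂_apply, LinearMap.comp_apply, hP r n A hA, if_neg hr.symm, zero_smul]
      simp
    · intro h
      exact absurd (Finset.mem_range.2 (by omega)) h

/-- The form on `K_N`, `N ≤ 4`, with value `λ ^ (4 - r) (A, B) / 12` at `A`, `B ∈ Λ(N)`, where `A`
has degree `r`. -/
structure IsScaledAlpha {R : Type*} [AddCommGroup R] [Module ℂ R] [Module ℂ[X] R]
    (e : Grassmann N →ₗ[ℂ] R) (γ : ConformalData.LambdaForm R) : Prop where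
  X_smul_left : ∀ a b, γ ((.X : ℂ[X]) • a) b = -(.X * γ a b)
  X_smul_right : ∀ a b, γ a ((.X : ℂ[X]) • b) = .X * γ a b
  emb : ∀ n, ∀ A ∈ degPart N n, ∀ B, γ (e A) (e B) = .C (pairing N A B / 12) * .X ^ (4 - n)

lemma exists_isScaledAlpha (N : ℕ) : ∃ γ : ConformalData.LambdaForm (KSpace N),
    IsScaledAlpha (kEmb N) γ := by
  obtain ⟨b, hb⟩ := exists_alpha_base N 4
  exact ⟨kForm b, kForm_X_smul_left b, kForm_X_smul_right b, fun n A hA B => by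
    rw [kForm_emb, hb n A hA]⟩

lemma exists_X_mul_eq {R : Type*} [AddCommGroup R] [Module ℂ R] (γ : R →ₗ[ℂ] R →ₗ[ℂ] ℂ[X])
    (h : ∀ a b, (γ a b).coeff 0 = 0) : ∃ α : R →ₗ[ℂ] R →ₗ[ℂ] ℂ[X], ∀ a b, .X * α a b = γ a b := by
  let d : ℂ[X] →ₗ[ℂ] ℂ[X] :=
    { toFun := Polynomial.divX
      map_add' := fun _ _ => Polynomial.divX_add
      map_smul' := fun z p => by
        rw [Polynomial.smul_eq_C_mul, Polynomial.divX_C_mul, RingHom.id_apply,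
          Polynomial.smul_eq_C_mul] }
  refine ⟨γ.compr₂ d, fun a b => ?_⟩
  have := Polynomial.divX_mul_X_add (γ a b)
  rw [h, Polynomial.C_0, add_zero, mul_comm] at this
  exact this

namespace IsScaledAlpha

variable {R : Type*} [AddCommGroup R] [Module ℂ R] [Module ℂ[X] R] [IsScalarTower ℂ ℂ[X] R]
  {D : ConformalData R} {e : Grassmann N →ₗ[ℂ] R} {γ : ConformalData.LambdaForm R}

/-- The pairing is symmetric. In degree `m` the Koszul sign `(-1)^m` cancels the sign of `(-λ)^(4 -
m)`, so the form is symmetric in the graded sense and its quotient by `λ` is skew. -/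
lemma symm (hγ : IsScaledAlpha e γ) (h : IsKModel D e) (hN : N ≤ 4) (i j : ZMod 2) {a b : R}
    (ha : a ∈ D.parity i) (hb : b ∈ D.parity j) :
    γ b a = koszulSign i j • (γ a b).comp (-.X) := by
  refine span_polynomial_induction (motive := fun a => γ b a =
      koszulSign i j • (γ a b).comp (-.X)) (fun a ha => ?_) ?_ (fun x y hx hy => ?_)
      (fun r x hx => ?_) (fun x hx => ?_) (h.parity_le_span i ha)
  · refine span_polynomial_induction (motive := fun b => γ b a =
      koszulSign i j • (γ a b).comp (-.X)) (fun b hb => ?_) ?_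
      (fun x y hx hy => ?_) (fun r x hx => ?_) (fun x hx => ?_) (h.parity_le_span j hb)
    · obtain ⟨A, ⟨m, rfl, hA⟩, rfl⟩ := ha
      obtain ⟨B, ⟨n, rfl, hB⟩, rfl⟩ := hb
      rw [hγ.emb m A hA, hγ.emb n B hB]
      by_cases hmn : m = n
      · subst hmn
        by_cases hm : N < m
        · simp [degPart_eq_zero hm hA]
        have hm' : m ≤ 4 := by omega
        rw [pairing_comm B A]
        simp only [Polynomial.mul_comp, Polynomial.C_comp, Polynomial.X_pow_comp,
          Polynomial.smul_eq_C_mul, koszulSign]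
        clear hA hB
        generalize pairing N A B / 12 = q
        interval_cases m <;> simp [ZMod.val_one, show (2 : ZMod 2) = 0 from rfl,
          show (3 : ZMod 2) = 1 from rfl, show (4 : ZMod 2) = 0 from rfl, (show Odd 3 by decide).neg_pow, (show Even 4 by decide).neg_pow]
      · rw [pairing_eq_zero hA hB hmn, pairing_eq_zero hB hA (Ne.symm hmn)]
        simp
    · simp
    · simp only [map_add, LinearMap.add_apply, hx, hy, Polynomial.add_comp]
      module
    · simp only [map_smul, LinearMap.smul_apply, hx, Polynomial.smul_comp]
      module
    · simp only [hγ.X_smul_left, hγ.X_smul_right, hx, Polynomial.mul_comp, Polynomial.X_comp,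
        Polynomial.smul_eq_C_mul]
      ring
  · simp
  · simp only [map_add, LinearMap.add_apply, hx, hy, Polynomial.add_comp]
    module
  · simp only [map_smul, LinearMap.smul_apply, hx, Polynomial.smul_comp]
    module
  · simp only [hγ.X_smul_left, hγ.X_smul_right, hx, Polynomial.mul_comp, Polynomial.X_comp,
      Polynomial.neg_comp, Polynomial.smul_eq_C_mul]
    ring

variable {S : Type*} [AddCommGroup S] [Module ℂ S] [Module ℂ[X] S] [IsScalarTower ℂ ℂ[X] S]
  {D' : ConformalData S} {ι : S →ₗ[ℂ[X]] R} {α : ConformalData.LambdaForm S}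

lemma sesq_left (hγ : IsScaledAlpha e γ) (hα : ∀ a b, .X * α a b = γ (ι a) (ι b)) (a b : S) :
    α ((.X : ℂ[X]) • a) b = -(.X * α a b) := by
  refine mul_left_cancel₀ (Polynomial.X_ne_zero (R := ℂ)) ?_
  rw [hα, map_smul, hγ.X_smul_left, ← hα]
  ring

lemma sesq_right (hγ : IsScaledAlpha e γ) (hα : ∀ a b, .X * α a b = γ (ι a) (ι b)) (a b : S) :
    α a ((.X : ℂ[X]) • b) = .X * α a b := by
  refine mul_left_cancel₀ (Polynomial.X_ne_zero (R := ℂ)) ?_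
  rw [hα, map_smul, hγ.X_smul_right, ← hα]

lemma skew (hγ : IsScaledAlpha e γ) (h : IsKModel D e) (hN : N ≤ 4)
    (hpar : ∀ i, ∀ a ∈ D'.parity i, ι a ∈ D.parity i)
    (hα : ∀ a b, .X * α a b = γ (ι a) (ι b)) (i j : ZMod 2) {a b : S} (ha : a ∈ D'.parity i)
    (hb : b ∈ D'.parity j) : α b a = -(koszulSign i j • (α a b).comp (-.X)) := by
  refine mul_left_cancel₀ (Polynomial.X_ne_zero (R := ℂ)) ?_
  rw [hα, hγ.symm h hN i j (hpar i a ha) (hpar j b hb), ← hα, Polynomial.mul_comp,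
    Polynomial.X_comp, Polynomial.smul_eq_C_mul, Polynomial.smul_eq_C_mul]
  ring

/-- Off `λ = 0`, `α` is `z⁻¹` times the form on `R`, which makes sense on all of `R` even when `α`
exists only on the subalgebra `S`. The identity is therefore checked in `R` at generic parameters
and then restricted. -/
lemma jacobiFor (hγ : IsScaledAlpha e γ) (h : IsKModel D e)
    (hpar : ∀ i, ∀ a ∈ D'.parity i, ι a ∈ D.parity i)
    (hbrk : ∀ z a b, ι (D'.brk (.C z) a b) = D.brk (.C z) (ι a) (ι b))
    (hα : ∀ a b, .X * α a b = γ (ι a) (ι b)) {i : ZMod 2} {a : S}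
    (ha : ∀ F : ℂ → R →ₗ[ℂ] R →ₗ[ℂ] ℂ, (∀ z a b, F z ((.X : ℂ[X]) • a) b = -(z * F z a b)) →
      (∀ z a b, F z a ((.X : ℂ[X]) • b) = z * F z a b) →
      (∀ n, ∀ A ∈ degPart N n, ∀ z B,
        F z (e A) (e B) = z⁻¹ * (z ^ (4 - n) * (pairing N A B / 12))) →
      ∀ z w, w ≠ 0 → z + w ≠ 0 → ∀ r s : ℕ, ∀ B ∈ degPart N r, ∀ C ∈ degPart N s,
        F z (ι a) (D.brk (.C w) (e B) (e C)) = F (z + w) (D.brk (.C z) (ι a) (e B)) (e C) +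
          koszulSign i r • F w (e B) (D.brk (.C z) (ι a) (e C))) :
    D'.JacobiFor (ConformalData.evalForm α) i a := by
  refine ConformalData.jacobiFor_of_generic fun z w hz hw hzw j b hb c => ?_
  let F : ℂ → R →ₗ[ℂ] R →ₗ[ℂ] ℂ := fun z => z⁻¹ • ConformalData.evalForm γ z
  have hF : ∀ z a b, F z a b = z⁻¹ * (γ a b).eval z := fun z a b => rfl
  have hFα : ∀ z ≠ 0, ∀ a b, (α a b).eval z = F z (ι a) (ι b) := fun z hz a b => by
    rw [hF, ← hα, Polynomial.eval_mul, Polynomial.eval_X, ← mul_assoc, inv_mul_cancel₀ hz, one_mul]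
  have hl : ∀ z a b, F z ((.X : ℂ[X]) • a) b = -(z * F z a b) := fun z a b => by
    rw [hF, hF, hγ.X_smul_left, Polynomial.eval_neg, Polynomial.eval_mul, Polynomial.eval_X]
    ring
  have hr : ∀ z a b, F z a ((.X : ℂ[X]) • b) = z * F z a b := fun z a b => by
    rw [hF, hF, hγ.X_smul_right, Polynomial.eval_mul, Polynomial.eval_X]
    ring
  have key := h.jacobi_of_degPart hl hr z w (fun r s B hB C hC => ha F hl hr (fun n A hA z B => by
    rw [hF, hγ.emb n A hA, Polynomial.eval_mul, Polynomial.eval_C, Polynomial.eval_pow,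
      Polynomial.eval_X, mul_comm (_ / _)]) z w hw hzw r s B hB C hC) j (ι b) (hpar j b hb) (ι c)
  rw [hFα z hz, hFα _ hzw, hFα w hw, hbrk, hbrk, hbrk, key, smul_eq_mul]

lemma jacobiFor_one (hγ : IsScaledAlpha e γ) (h : IsKModel D e) (hN : N ≤ 4)
    (hpar : ∀ i, ∀ a ∈ D'.parity i, ι a ∈ D.parity i)
    (hbrk : ∀ z a b, ι (D'.brk (.C z) a b) = D.brk (.C z) (ι a) (ι b))
    (hα : ∀ a b, .X * α a b = γ (ι a) (ι b)) {a : S} (ha : ι a = e 1) :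
    D'.JacobiFor (ConformalData.evalForm α) 0 a := by
  refine hγ.jacobiFor h hpar hbrk hα fun F hl hr hF z w hw hzw r s B hB C hC => ?_
  rw [ha, h.laurent_jacobi_one hN hl hr hF hB hC hw hzw]
  simp [koszulSign]

lemma jacobiFor_xi (hγ : IsScaledAlpha e γ) (h : IsKModel D e) (hN : N ≤ 4)
    (hpar : ∀ i, ∀ a ∈ D'.parity i, ι a ∈ D.parity i)
    (hbrk : ∀ z a b, ι (D'.brk (.C z) a b) = D.brk (.C z) (ι a) (ι b))
    (hα : ∀ a b, .X * α a b = γ (ι a) (ι b)) {a : S} (i : Fin N) (ha : ι a = e (xi i)) :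
    D'.JacobiFor (ConformalData.evalForm α) 1 a := by
  refine hγ.jacobiFor h hpar hbrk hα fun F hl hr hF z w hw hzw r s B hB C hC => ?_
  rw [ha, h.laurent_jacobi_xi hN hl hr hF i hB hC hw hzw, neg_one_pow_eq_koszulSign_one,
    smul_eq_mul]

/-- For `N ≤ 3` every exponent `4 - n` that occurs is positive, and sesquilinearity preserves
divisibility by `λ`. -/
lemma coeff_zero (hγ : IsScaledAlpha e γ) (h : IsKModel D e) (hN : N ≤ 3) (a b : R) :
    (γ a b).coeff 0 = 0 := by
  have hab : ∀ n, ∀ A ∈ degPart N n, ∀ B, (γ (e A) (e B)).coeff 0 = 0 := fun n A hA B => by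
    by_cases hn : N < n
    · simp [degPart_eq_zero hn hA]
    · rw [hγ.emb n A hA, show 4 - n = (3 - n) + 1 by omega, pow_succ, ← mul_assoc]
      simp
  have ha : a ∈ Submodule.span ℂ[X] (e '' {A | ∃ n, A ∈ degPart N n}) := by
    rw [h.span_graded]; trivial
  have hb : b ∈ Submodule.span ℂ[X] (Set.range e) := by rw [h.span_emb]; trivial
  refine span_polynomial_induction (motive := fun a => (γ a b).coeff 0 = 0) ?_ (by simp)
    (fun x y hx hy => by simp [hx, hy]) (fun z x hx => by simp [hx])
    (fun x hx => by simp [hγ.X_smul_left]) ha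
  rintro _ ⟨A, ⟨n, hA⟩, rfl⟩
  refine span_polynomial_induction (motive := fun b => (γ (e A) b).coeff 0 = 0) ?_ (by simp)
    (fun x y hx hy => by simp [hx, hy]) (fun z x hx => by simp [hx])
    (fun x hx => by simp [hγ.X_smul_right]) hb
  rintro _ ⟨B, rfl⟩
  exact hab n A hA B

lemma exists_cocycle (hγ : IsScaledAlpha e γ) (h : IsKModel D e) (hN : N ≤ 3) :
    ∃ α ∈ D.twoCocycles, ∀ a b, .X * α a b = γ a b := by
  obtain ⟨α, hα⟩ := exists_X_mul_eq γ (hγ.coeff_zero h hN)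
  have hα' : ∀ a b, .X * α a b = γ (LinearMap.id (R := ℂ[X]) a) (LinearMap.id (R := ℂ[X]) b) := hα
  have hpar : ∀ i, ∀ a ∈ D.parity i, LinearMap.id (R := ℂ[X]) a ∈ D.parity i := fun _ _ ha => ha
  have hN' : N ≤ 4 := by omega
  exact ⟨α, h.mem_twoCocycles (hγ.sesq_left hα') (hγ.sesq_right hα')
    (fun m n A hA B hB => hγ.skew h hN' hpar hα' m n (h.emb_mem_parity_of_degPart hA)
      (h.emb_mem_parity_of_degPart hB))
    (hγ.jacobiFor_one h hN' hpar (fun _ _ _ => rfl) hα' rfl)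
    (fun i => hγ.jacobiFor_xi h hN' hpar (fun _ _ _ => rfl) hα' i rfl), hα⟩

end IsScaledAlpha

end AlphaForm

/-! ### Central extensions of `K_N` for `N ≤ 3`. -/

section AlphaClassification

variable {N : ℕ} {R : Type*} [AddCommGroup R] [Module ℂ R] [Module ℂ[X] R] [IsScalarTower ℂ ℂ[X] R]
  {D : ConformalData R} {e : Grassmann N →ₗ[ℂ] R} {γ : ConformalData.LambdaForm R}

lemma ConformalData.form_eq_zero_of_span {α : LambdaForm R}
    (hl : ∀ a b, α ((.X : ℂ[X]) • a) b = -(.X * α a b))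
    (hr : ∀ a b, α a ((.X : ℂ[X]) • b) = .X * α a b) {S T : Set R}
    (h : ∀ a ∈ S, ∀ b ∈ T, α a b = 0) {a b : R} (ha : a ∈ Submodule.span ℂ[X] S)
    (hb : b ∈ Submodule.span ℂ[X] T) : α a b = 0 := by
  refine span_polynomial_induction (motive := fun a => α a b = 0) (fun a ha => ?_) (by simp)
    (fun x y hx hy => by simp [hx, hy]) (fun z x hx => by simp [hx])
    (fun x hx => by simp [hl, hx]) ha
  exact span_polynomial_induction (motive := fun b => α a b = 0) (fun b hb => h a ha b hb) (by simp)
    (fun x y hx hy => by simp [hx, hy]) (fun z x hx => by simp [hx])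
    (fun x hx => by simp [hr, hx]) hb

lemma IsScaledAlpha.even (hγ : IsScaledAlpha e γ) (h : IsKModel D e) {i j : ZMod 2}
    (hij : i + j ≠ 0) {a b : R} (ha : a ∈ D.parity i) (hb : b ∈ D.parity j) : γ a b = 0 := by
  refine ConformalData.form_eq_zero_of_span hγ.X_smul_left hγ.X_smul_right ?_
    (h.parity_le_span i ha) (h.parity_le_span j hb)
  rintro _ ⟨A, ⟨m, rfl, hA⟩, rfl⟩ _ ⟨B, ⟨n, rfl, hB⟩, rfl⟩
  rw [hγ.emb m A hA, pairing_eq_zero hA hB, zero_div, Polynomial.C_0, zero_mul]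
  rintro rfl
  refine hij ?_
  rw [← two_mul, show (2 : ZMod 2) = 0 from rfl, zero_mul]

/-- The reversal signs `+, +, -, -` in degrees `0` to `3` are those of the prescribed values, and
the factorials turn `α_n` into coefficients of `λ^n`, all equal to `±1/12`. -/
lemma IsScaledAlpha.emb_xiMono (hγ : IsScaledAlpha e γ) (I J : Finset (Fin N))
    (hI : I.card ≤ 3) :
    γ (e (xiMono I)) (e (xiMono J)) = if I = J then .X * alphaPoly I.card else 0 := by
  rw [hγ.emb _ _ (xiMono_mem_degPart I), pairing_xiMono]
  split_ifs
  · generalize I.card = n at hI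
    interval_cases n <;> norm_num [alphaPoly, Nat.factorial] <;> ring
  · simp

/-- A coboundary is linear in `λ` at `(1, 1)`, because `[1_λ 1]` is. -/
lemma IsKModel.coeff_coboundary (h : IsKModel D e) {κ : ConformalData.LambdaForm R}
    (hκ : κ ∈ D.twoCoboundaries) : (κ (e 1) (e 1)).coeff 3 = 0 := by
  obtain ⟨φ, hφ, hκ⟩ := hκ
  have : κ (e 1) (e 1) = .C (-(2 * φ (e 1))) * .X := by
    refine Polynomial.funext fun z => ?_
    rw [hκ]
    refine (ConformalData.eval_coboundary (D := D) (φ := φ) (e 1) (e 1) z).trans ?_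
    rw [h.brk_one_graded _ (.of_degPart one_mem_degPart), map_smul_of_map_X_smul φ hφ]
    simp
    ring
  rw [this]
  simp

/-- The cocycle `α` parameterizes the central extensions of `K_N`, `N ≤ 3`. -/
theorem kAlg_parameterize {N : ℕ} (hN : N ≤ 3) : ∃ α : (KAlg N).twoCocycles, IsAlpha N α ∧
    ConformalData.ParameterizeCentralExtensions.{u} (KAlg N) ![α] := by
  have h := kAlg_isKModel N
  obtain ⟨γ, hγ⟩ := exists_isScaledAlpha N
  obtain ⟨α, hα, hαγ⟩ := hγ.exists_cocycle h hN
  have hI : IsAlpha N ⟨α, hα⟩ := fun I J => by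
    refine mul_left_cancel₀ (Polynomial.X_ne_zero (R := ℂ)) ((hαγ _ _).trans ?_)
    have hc : I.card ≤ 3 := (Finset.card_le_univ I).trans (by simpa using hN)
    refine (hγ.emb_xiMono I J hc).trans ?_
    split_ifs
    · rfl
    · rw [mul_zero]
  refine ⟨⟨α, hα⟩, hI, ConformalData.IsClassification.parameterize
    -- The coefficient of `λ^3` in `α(1,1)` is `1/12`; the factor `12` makes the detecting
    -- coefficient equal to `1`.
    (a := fun _ => (12 : ℂ) • kEmb N 1) (b := fun _ => kEmb N 1) (n := fun _ => 3) ?_ h.isLie⟩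
  have h12 : ∀ κ : ConformalData.LambdaForm (KSpace N), (κ ((12 : ℂ) • kEmb N 1) (kEmb N 1)).coeff 3 =
      12 * (κ (kEmb N 1) (kEmb N 1)).coeff 3 := fun κ => by
    rw [map_smul, LinearMap.smul_apply, Polynomial.coeff_smul, smul_eq_mul]
  have m1 := h.one_mem_parity
  constructor
  · intro i
    have := Submodule.smul_mem _ (.C 12 : ℂ[X]) m1
    rw [C_smul_eq] at this
    exact this
  · exact fun i => m1
  · intro k i j hij x hx y hy
    rw [Subsingleton.elim k 0]
    refine mul_left_cancel₀ (Polynomial.X_ne_zero (R := ℂ)) ((hαγ _ _).trans ?_)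
    rw [hγ.even h hij hx hy, mul_zero]
  · intro i
    rw [Subsingleton.elim i 0, Matrix.cons_val_zero, h12]
    have := hI ∅ ∅
    rw [xiMono_empty] at this
    rw [show α (kEmb N 1) (kEmb N 1) = _ from this]
    norm_num [alphaPoly, Nat.factorial]
  · intro i j hij
    exact absurd (Subsingleton.elim i j) hij
  · intro κ hκ i
    rw [h12, h.coeff_coboundary hκ, mul_zero]
  · exact h.perfect (by omega)
  · intro κ hκ h0
    have := h0 0
    rw [h12] at this
    exact h.mem_coboundaries (by omega) hκ ((mul_eq_zero.1 this).resolve_left (by norm_num))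

end AlphaClassification

/-! ### The coefficient of the top monomial. -/

section TopCoord

variable {N : ℕ} {r s : ℕ} {A B C : Grassmann N}

/-- The coefficient of `ξ_1 ⋯ ξ_N`. -/
def topCoord (N : ℕ) : Grassmann N →ₗ[ℂ] ℂ :=
  ((Pi.basisFun ℂ (Fin N)).ExteriorAlgebra).coord Finset.univ

lemma topCoord_xiMono (I : Finset (Fin N)) :
    topCoord N (xiMono I) = if I = Finset.univ then 1 else 0 := by
  rw [topCoord, xiMono, Module.Basis.coord_apply, Module.Basis.repr_self, Finsupp.single_apply]

lemma card_eq_iff_eq_univ (I : Finset (Fin N)) : I.card = N ↔ I = Finset.univ := by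
  rw [← Finset.card_eq_iff_eq_univ, Fintype.card_fin]

lemma topCoord_eq_zero (hA : A ∈ degPart N r) (hr : r ≠ N) : topCoord N A = 0 := by
  obtain ⟨T, hT⟩ := exists_degree_operator N fun m => if m = r then 1 else 0
  have h : topCoord N ∘ₗ T = 0 := by
    refine ((Pi.basisFun ℂ (Fin N)).ExteriorAlgebra).ext fun I => ?_
    change topCoord N (T (xiMono I)) = 0
    rw [hT _ _ (xiMono_mem_degPart I), map_smul, topCoord_xiMono]
    split_ifs with h1 h2
    · exact absurd ((card_eq_iff_eq_univ I).2 h2) (fun h3 => hr (h1.symm.trans h3))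
    · simp
    · simp
    · simp
  have := LinearMap.congr_fun h A
  rwa [LinearMap.comp_apply, hT r A hA, if_pos rfl, one_smul, LinearMap.zero_apply] at this

lemma eq_topCoord_smul (hA : A ∈ degPart N N) : A = topCoord N A • xiMono Finset.univ := by
  obtain ⟨T, hT⟩ := exists_degree_operator N fun m => if m = N then 1 else 0
  have h : T = (topCoord N).smulRight (xiMono Finset.univ) := by
    refine ((Pi.basisFun ℂ (Fin N)).ExteriorAlgebra).ext fun I => ?_
    change T (xiMono I) = topCoord N (xiMono I) • xiMono Finset.univ
    rw [hT _ _ (xiMono_mem_degPart I), topCoord_xiMono]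
    by_cases hI : I = Finset.univ
    · rw [if_pos ((card_eq_iff_eq_univ I).2 hI), if_pos hI, hI]
    · rw [if_neg fun h => hI ((card_eq_iff_eq_univ I).1 h), if_neg hI, zero_smul, zero_smul]
  have := LinearMap.congr_fun h A
  rwa [hT N A hA, if_pos rfl, one_smul] at this

lemma topCoord_dxi (i : Fin N) (hA : A ∈ degPart N r) : topCoord N (dxi i A) = 0 := by
  rcases r with _ | r
  · rw [dxi_of_mem_degPart_zero i hA, map_zero]
  · by_cases hr : N < r + 1
    · rw [degPart_eq_zero hr hA, map_zero, map_zero]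
    · exact topCoord_eq_zero (dxi_mem_degPart i hA) (by omega)

/-- As `∂_i^2 = 0`, the contraction equals `∑ ∂_i(A ∂_i B)`, and a derivative has no top-degree
term. -/
lemma topCoord_contr (hA : A ∈ degPart N r) (hB : B ∈ degPart N s) :
    topCoord N (contr A B) = 0 := by
  rw [contr, map_sum]
  refine Finset.sum_eq_zero fun i _ => ?_
  have := topCoord_dxi i (mul_mem_degPart hA (dxi_mem_degPart i hB))
  rwa [dxi_mul, dxi_dxi_self, mul_zero, add_zero] at this

lemma contr_eq_zero (hA : A ∈ degPart N r) (hB : B ∈ degPart N s) (h : contr A B ∈ degPart N N) :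
    contr A B = 0 := by
  rw [eq_topCoord_smul h, topCoord_contr hA hB, zero_smul]

end TopCoord

/-! ### The cocycle `β`. -/

section Beta

variable {R : Type*} [AddCommGroup R] [Module ℂ R] [Module ℂ[X] R] [IsScalarTower ℂ ℂ[X] R]
  {D : ConformalData R} {e : Grassmann 4 →ₗ[ℂ] R} {β : ConformalData.LambdaForm R}

/-- The cocycle `β` on `K_4`: `β_λ(A, B) = λ ∫ A B`. -/
theorem IsKModel.beta_mem_twoCocycles (h : IsKModel D e)
    (hl : ∀ a b, β ((.X : ℂ[X]) • a) b = -(.X * β a b))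
    (hr : ∀ a b, β a ((.X : ℂ[X]) • b) = .X * β a b)
    (hβ : ∀ A B, β (e A) (e B) = .C (topCoord 4 (A * B)) * .X) : β ∈ D.twoCocycles := by
  let F := ConformalData.evalForm β
  have hFe : ∀ z A B, F z (e A) (e B) = topCoord 4 (A * B) * z := fun z A B => by
    rw [ConformalData.evalForm_apply, hβ]
    simp
  have hl' : ∀ z a b, F z ((.X : ℂ[X]) • a) b = -(z * F z a b) := fun z a b => by
    rw [ConformalData.evalForm_apply, ConformalData.evalForm_apply, hl]
    simp
  have hr' : ∀ z a b, F z a ((.X : ℂ[X]) • b) = z * F z a b := fun z a b => by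
    rw [ConformalData.evalForm_apply, ConformalData.evalForm_apply, hr]
    simp
  have hsl := IsKModel.smul_left_of_sesq hl'
  have hsr := IsKModel.smul_right_of_sesq hr'
  refine h.mem_twoCocycles hl hr (fun m n A hA B hB => ?_) ?_ fun i => ?_
  · rw [hβ, hβ, mul_comm_of_evenOdd (degPart_le_evenOdd m hA) (degPart_le_evenOdd n hB), map_smul,
      Polynomial.mul_comp, Polynomial.C_comp, Polynomial.X_comp, smul_eq_mul, Polynomial.C_mul,
      Polynomial.smul_eq_C_mul]
    ring
  · intro j b hb c z w
    refine h.jacobi_of_degPart hl' hr' z w (fun r s B hB C hC => ?_) j b hb c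
    have gB := IsGraded.of_degPart hB
    have gC := IsGraded.of_degPart hC
    rw [h.brk_emb_graded _ gB gC, h.brk_one_graded _ gB, h.brk_one_graded _ gC, map_add, hsr,
      map_smul, hsl, hsr, hFe, hFe, hFe, hFe, one_mul, one_mul, topCoord_contr hB hC]
    by_cases hrs : r + s = 4
    · have : (s : ℂ) = 4 - r := by
        rw [eq_sub_iff_add_eq, add_comm]
        exact_mod_cast hrs
      simp [koszulSign, this]
      ring
    · rw [topCoord_eq_zero (mul_mem_degPart hB hC) hrs]
      simp
  · intro j b hb c z w
    refine h.jacobi_of_degPart hl' hr' z w (fun r s B hB C hC => ?_) j b hb c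
    have gB := IsGraded.of_degPart hB
    have gC := IsGraded.of_degPart hC
    have hε : ((-1 : ℂ) ^ r) * (-1) ^ r = 1 := by rw [← mul_pow]; norm_num
    -- Integration by parts: the top coefficient of `∂_i(BC)` is zero.
    have t1 : topCoord 4 (B * dxi i C) = -((-1) ^ r * topCoord 4 (dxi i B * C)) := by
      have := topCoord_dxi i (mul_mem_degPart hB hC)
      rw [dxi_mul, gB.gradeInv, smul_mul_assoc, map_add, map_smul, smul_eq_mul] at this
      linear_combination (-1) ^ r * this - topCoord 4 (B * dxi i C) * hε
    -- The same principle, applied to the contraction of `B` with `ξ_i C`.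
    have t2 : topCoord 4 (xi i * contr B C) = -((-1) ^ r * topCoord 4 (dxi i B * C)) := by
      have := topCoord_contr hB (xi_mul_mem_degPart i hC)
      rw [contr_xi_mul_right, gB.gradeInv, contr_smul_left, mul_smul_comm, map_add, map_smul,
        smul_eq_mul] at this
      linear_combination (-1) ^ r * this - topCoord 4 (xi i * contr B C) * hε
    rw [h.brk_emb_graded _ gB gC, h.brk_xi_graded _ _ gB, h.brk_xi_graded _ _ gC, map_add, hsr,
      map_smul, map_sub (F (z + w)), map_sub (F w (e B)), LinearMap.sub_apply, hsl, hsr,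
      map_smul (F (z + w)), map_smul (F w (e B)), LinearMap.smul_apply, hFe, hFe, hFe, hFe, hFe,
      hFe, gB.mul_xi, t1, t2, map_smul, ← neg_one_pow_eq_koszulSign_one, mul_assoc]
    simp only [smul_eq_mul]
    -- The product `ξ_i B C` reaches the top degree only for `r + s = 3`, and `(∂_i B) C` cannot do
    -- so there.
    by_cases hrs : r + s = 3
    · have hs : (s : ℂ) = 3 - r := by
        rw [eq_sub_iff_add_eq, add_comm]
        exact_mod_cast hrs
      have t3 : topCoord 4 (dxi i B * C) = 0 := by
        rcases r with _ | r
        · rw [dxi_of_mem_degPart_zero i hB, zero_mul, map_zero]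
        · exact topCoord_eq_zero (mul_mem_degPart (dxi_mem_degPart i hB) hC) (by omega)
      rw [t3]
      simp [hs]
      linear_combination (z * r / 2 + w / 2) * w * topCoord 4 (xi i * (B * C)) * hε
    · rw [topCoord_eq_zero (xi_mul_mem_degPart i (mul_mem_degPart hB hC)) (by omega)]
      simp
      linear_combination (-z / 2 - w / 2) * topCoord 4 (dxi i B * C) * hε

lemma exists_isBeta : ∃ β ∈ (KAlg 4).twoCocycles, ∀ A B : Grassmann 4,
    β (kEmb 4 A) (kEmb 4 B) = .C (topCoord 4 (A * B)) * .X := by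
  let b := (LinearMap.mul ℂ (Grassmann 4)).compr₂
    (LinearMap.toSpanSingleton ℂ ℂ[X] .X ∘ₗ topCoord 4)
  have hb : ∀ A B, kForm b (kEmb 4 A) (kEmb 4 B) = .C (topCoord 4 (A * B)) * .X := fun A B => by
    rw [kForm_emb]
    simp [b, Polynomial.smul_eq_C_mul]
  exact ⟨kForm b, (kAlg_isKModel 4).beta_mem_twoCocycles (kForm_X_smul_left b)
    (kForm_X_smul_right b) hb, hb⟩

end Beta

/-! ### Superconformal algebras with generators of positive weight. -/

namespace ConformalData

section Superconformal

variable {R : Type*} [AddCommGroup R] [Module ℂ R] [Module ℂ[X] R] [IsScalarTower ℂ ℂ[X] R]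
  {ι : Type*} {D : ConformalData R} {L : R} {G : ι → R} {T : Set R} {α : LambdaForm R}
  {Δ : ℂ} {a b : R}

/-- A Lie conformal superalgebra with conformal element `L` and elements `G i` of conformal weight
`3 / 2`, generated by a set `T` of primary elements of weights `2`, `3 / 2`, `1`, `1 / 2`. -/
structure IsSuperconformal (D : ConformalData R) (L : R) (G : ι → R) (T : Set R) : Prop where
  isLie : D.IsLie
  mem_L : L ∈ D.parity 0
  primary_L : D.IsPrimary L 2 L
  mem_G : ∀ i, G i ∈ D.parity 1
  primary_G : ∀ i, D.IsPrimary L (3 / 2) (G i)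
  span_eq_top : Submodule.span ℂ[X] T = ⊤
  primary : ∀ t ∈ T, ∃ Δ, (Δ = 2 ∨ Δ = 3 / 2 ∨ Δ = 1 ∨ Δ = 1 / 2) ∧ D.IsPrimary L Δ t

/-- On a primary `a` the form `φ([L_λ a])` is `-Δφ(a)λ`, so only the linear coefficient can be
changed by coboundaries. -/
lemma coeff_coboundary_of_primary (hα : α ∈ D.twoCoboundaries) (ha : D.IsPrimary L Δ a) {n : ℕ}
    (hn : n ≠ 1) : (α L a).coeff n = 0 := by
  obtain ⟨φ, hφ, hκ⟩ := hα
  have : α L a = .C (-(Δ * φ a)) * .X := by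
    refine Polynomial.funext fun z => ?_
    rw [hκ]
    refine (eval_coboundary (D := D) (φ := φ) L a z).trans ?_
    rw [ha, map_sub, map_neg, hφ, map_smul]
    simp
    ring
  rw [this, Polynomial.coeff_C_mul, Polynomial.coeff_X, if_neg hn.symm, mul_zero]

/-- Right sesquilinearity in terms of coefficients; it determines how the linear coefficient of
`[L_λ ·]` commutes with `∂`. -/
lemma lambdaCoeff_succ_bracket (hD : D.IsLie) (n : ℕ) (a b : R) :
    lambdaCoeff (n + 1) (D.bracket a ((.X : ℂ[X]) • b)) =
      (.X : ℂ[X]) • lambdaCoeff (n + 1) (D.bracket a b) + lambdaCoeff n (D.bracket a b) := by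
  let M : ℂ[X] ⊗[ℂ] R →ₗ[ℂ] ℂ[X] ⊗[ℂ] R :=
    (Algebra.lsmul ℂ ℂ R (.X : ℂ[X])).lTensor ℂ[X] + (LinearMap.mulLeft ℂ (.X : ℂ[X])).rTensor R
  have hM : D.bracket a ((.X : ℂ[X]) • b) = M (D.bracket a b) := by
    refine ext_evalAt fun z => ?_
    rw [← brk_C, hD.sesq_right, brk_C]
    generalize D.bracket a b = x
    induction x with
    | zero => simp
    | add x y hx hy => rw [map_add, smul_add, hx, hy, map_add, map_add]
    | tmul f r =>
      simp only [M, LinearMap.add_apply, LinearMap.lTensor_tmul, LinearMap.rTensor_tmul, map_add,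
        evalAt_tmul, Algebra.lsmul_coe, LinearMap.mulLeft_apply, Polynomial.eval_mul,
        Polynomial.eval_X, add_smul, C_smul_eq, mul_smul]
      rw [smul_comm]
  rw [hM]
  generalize D.bracket a b = x
  induction x with
  | zero => simp
  | add x y hx hy =>
    rw [map_add, map_add, hx, hy, map_add, map_add, smul_add]
    abel
  | tmul f r =>
    simp only [M, LinearMap.add_apply, LinearMap.lTensor_tmul, LinearMap.rTensor_tmul, map_add,
      lambdaCoeff_tmul, Algebra.lsmul_coe, LinearMap.mulLeft_apply, Polynomial.coeff_X_mul]
    rw [smul_comm]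

lemma lambdaCoeff_zero {R : Type*} [AddCommGroup R] [Module ℂ R] (x : ℂ[X] ⊗[ℂ] R) :
    lambdaCoeff 0 x = evalAt 0 x := by
  induction x with
  | zero => simp
  | add x y hx hy => rw [map_add, map_add, hx, hy]
  | tmul f r => rw [lambdaCoeff_tmul, evalAt_tmul, Polynomial.coeff_zero_eq_eval_zero]

namespace IsSuperconformal

lemma weight_ne_zero (hΔ : Δ = 2 ∨ Δ = 3 / 2 ∨ Δ = 1 ∨ Δ = 1 / 2) : Δ ≠ 0 := by
  rcases hΔ with rfl | rfl | rfl | rfl <;> norm_num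

lemma perfect (h : IsSuperconformal D L G T) :
    Submodule.span ℂ ({x | ∃ r : R, x = (.X : ℂ[X]) • r} ∪
      {x | ∃ n x' y', x = lambdaCoeff n (D.bracket x' y')}) = ⊤ := by
  refine span_eq_top_of_span h.span_eq_top _ (fun t ht => ?_)
    fun r => Submodule.subset_span (.inl ⟨r, rfl⟩)
  obtain ⟨Δ, hΔ, hp⟩ := h.primary t ht
  set S := Submodule.span ℂ ({x | ∃ r : R, x = (.X : ℂ[X]) • r} ∪
      {x | ∃ n x' y', x = lambdaCoeff n (D.bracket x' y')}) with hS
  have h1 : D.brk (.C 1) L t ∈ S := by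
    rw [brk_C]
    obtain ⟨M, hM⟩ := exists_eq_sum_lambdaCoeff (D.bracket L t)
    rw [hM M le_rfl, map_sum]
    refine sum_mem fun n _ => ?_
    rw [evalAt_tmul]
    exact S.smul_mem _ (Submodule.subset_span (.inr ⟨n, L, t, rfl⟩))
  rw [hp] at h1
  have h2 := add_mem h1 (Submodule.subset_span (.inl ⟨t, rfl⟩) : (.X : ℂ[X]) • t ∈ S)
  rw [neg_sub_comm, sub_add_cancel, one_mul] at h2
  have h3 := S.smul_mem (-Δ⁻¹) h2
  rwa [smul_neg, neg_smul, neg_neg, smul_smul, inv_mul_cancel₀ (weight_ne_zero hΔ), one_smul] at h3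

lemma lambdaCoeff_zero_bracket (h : IsSuperconformal D L G T) (a : R) :
    lambdaCoeff 0 (D.bracket L a) = -((.X : ℂ[X]) • a) := by
  rw [lambdaCoeff_zero, ← brk_C]
  have ha : a ∈ Submodule.span ℂ[X] T := by rw [h.span_eq_top]; trivial
  refine span_polynomial_induction (motive := fun a => D.brk (.C 0) L a = -((.X : ℂ[X]) • a))
    (fun t ht => ?_) (by simp [brk_zero_right])
    (fun x y hx hy => by rw [brk_add_right, hx, hy, smul_add, neg_add])
    (fun z x hx => by rw [brk_smul_right, hx, smul_neg, smul_comm])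
    (fun x hx => by rw [h.isLie.sesq_right, hx, Polynomial.C_0, add_zero, smul_neg]) ha
  obtain ⟨Δ, -, hp⟩ := h.primary t ht
  rw [hp, zero_mul, zero_smul, sub_zero]

lemma coeff_zero_form (h : IsSuperconformal D L G T) (hα : α ∈ D.twoCocycles) (a : R) :
    (α L a).coeff 0 = 0 := by
  have ha : a ∈ Submodule.span ℂ[X] T := by rw [h.span_eq_top]; trivial
  refine span_polynomial_induction (motive := fun a => (α L a).coeff 0 = 0)
    (fun t ht => ?_) (by simp) (fun x y hx hy => by simp [hx, hy]) (fun z x hx => by simp [hx])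
    (fun x hx => by rw [hα.2.1, Polynomial.coeff_X_mul_zero]) ha
  obtain ⟨Δ, hΔ, hp⟩ := h.primary t ht
  exact primary_coeff_zero hα h.mem_L h.primary_L hp (weight_ne_zero hΔ)

/-- Every cocycle can be normalised by a coboundary. -/
lemma exists_normalised (h : IsSuperconformal D L G T) (hα : α ∈ D.twoCocycles) :
    ∃ κ ∈ D.twoCoboundaries, α - κ ∈ D.twoCocycles ∧ ∀ t ∈ T, ((α - κ) L t).coeff 1 = 0 := by
  -- `E` acts by `-Δ` on a primary generator of weight `Δ`. The set `T` is not assumed free, so `φ`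
  -- cannot be prescribed on generators; it is assembled from `f` and powers of `E`.
  let E : R →ₗ[ℂ] R := lambdaCoeff 1 ∘ₗ D.bracket L
  let f : R →ₗ[ℂ] ℂ := Polynomial.lcoeff ℂ 1 ∘ₗ α L
  have hE : ∀ a, E ((.X : ℂ[X]) • a) = (.X : ℂ[X]) • (E a - a) := fun a => by
    change lambdaCoeff (0 + 1) (D.bracket L _) = _
    rw [lambdaCoeff_succ_bracket h.isLie, h.lambdaCoeff_zero_bracket, smul_sub, sub_eq_add_neg]
    rfl
  have hf : ∀ a, f ((.X : ℂ[X]) • a) = 0 := fun a => by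
    change (α L _).coeff (0 + 1) = 0
    rw [hα.2.1, Polynomial.coeff_X_mul, h.coeff_zero_form hα]
  have hEt : ∀ t Δ, D.IsPrimary L Δ t → E t = (-Δ) • t := fun t Δ hp => by
    have : D.bracket L t = (1 : ℂ[X]) ⊗ₜ[ℂ] (-((.X : ℂ[X]) • t)) + (.X : ℂ[X]) ⊗ₜ[ℂ] ((-Δ) • t) := by
      refine ext_evalAt fun z => ?_
      rw [← brk_C, hp, map_add, evalAt_tmul, evalAt_tmul]
      simp [smul_smul, sub_eq_add_neg]
    change lambdaCoeff 1 (D.bracket L t) = _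
    rw [this, map_add, lambdaCoeff_tmul, lambdaCoeff_tmul]
    simp [Polynomial.coeff_one]
  -- The coefficients belong to the cubic `q` interpolating `1/Δ` at the four weights: `1 - Δq(Δ) =
  -- (1 - Δ/2)(1 - 2Δ/3)(1 - Δ)(1 - 2Δ)`. The functional vanishes on `∂R` because `f` does and `E`
  -- preserves `∂R`.
  let φ : R →ₗ[ℂ] ℂ := -((25 / 6 : ℂ) • f + (35 / 6 : ℂ) • f ∘ₗ E + (10 / 3 : ℂ) • f ∘ₗ E ∘ₗ E +
    (2 / 3 : ℂ) • f ∘ₗ E ∘ₗ E ∘ₗ E)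
  have hφ : ∀ a, φ ((.X : ℂ[X]) • a) = 0 := fun a => by
    simp [φ, hE, hf]
  have hκ := coboundary_mem (D := D) hφ
  refine ⟨_, hκ, sub_mem hα (coboundary_mem_twoCocycles h.isLie hφ), fun t ht => ?_⟩
  obtain ⟨Δ, hΔ, hp⟩ := h.primary t ht
  have e1 : (scalarForm D.bracket φ L t).coeff 1 = φ (E t) := coeff_rid_lTensor φ 1 _
  rw [LinearMap.sub_apply, LinearMap.sub_apply, Polynomial.coeff_sub, e1, hEt t Δ hp, map_smul]
  have e2 : φ t = -(25 / 6 - 35 / 6 * Δ + 10 / 3 * Δ ^ 2 - 2 / 3 * Δ ^ 3) * (α L t).coeff 1 := by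
    simp [φ, hEt t Δ hp, f]
    ring
  rw [e2, smul_eq_mul]
  rcases hΔ with rfl | rfl | rfl | rfl <;> ring

/-- None of the four admitted weights is `-1/2`, so `α(L, ·)` determines `α(G_i, ·)` without
exception. -/
lemma form_G_eq_zero (h : IsSuperconformal D L G T) (hα : α ∈ D.twoCocycles)
    (hL : ∀ b, α L b = 0) (i : ι) (b : R) : α (G i) b = 0 := by
  have hb : b ∈ Submodule.span ℂ[X] T := by rw [h.span_eq_top]; trivial
  refine span_polynomial_induction (motive := fun b => α (G i) b = 0) (fun t ht => ?_) (by simp)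
    (fun x y hx hy => by simp [hx, hy]) (fun z x hx => by simp [hx])
    (fun x hx => by rw [hα.2.1, hx, mul_zero]) hb
  obtain ⟨Δ, hΔ, hp⟩ := h.primary t ht
  refine form_eq_of_brk_eq hα h.mem_L (h.mem_G i) (h.primary_G i) hp ?_ (by simp) ?_
  · rcases hΔ with rfl | rfl | rfl | rfl <;> norm_num
  · rw [hL]
    simp

/-- `α(L, J)` has no quadratic term if `J` is antisymmetric in two elements of weight `3 / 2`. -/
lemma coeff_two_eq_zero (h : IsSuperconformal D L G T) (hα : α ∈ D.twoCocycles) {i j : ι} {J : R}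
    (hJ : D.IsPrimary L 1 J) (h1 : (α L J).coeff 1 = 0)
    (hij : D.brk (.C 0) (G i) (G j) = -(1 / 2 : ℂ) • ((.X : ℂ[X]) • J))
    (hji : D.brk (.C 0) (G j) (G i) = (1 / 2 : ℂ) • ((.X : ℂ[X]) • J)) :
    (α L J).coeff 2 = 0 := by
  set c := (α L J).coeff 2 with hc
  have e0 : α L J = .C c * .X ^ 2 := by
    rw [primary_eq hα h.mem_L h.primary_L hJ one_ne_zero h1, primary_coeff_three hα h.mem_L
      h.primary_L hJ (by norm_num), Polynomial.C_0, zero_mul, add_zero]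
  have e1 : α (G i) (G j) = .C c * .X ^ 2 := by
    refine form_eq_of_brk_eq hα h.mem_L (h.mem_G i) (h.primary_G i) (h.primary_G j) (by norm_num)
      (by simp) ?_
    rw [hij, map_smul, hα.2.1, e0]
  have e2 : α (G j) (G i) = -(.C c * .X ^ 2) := by
    refine form_eq_of_brk_eq hα h.mem_L (h.mem_G j) (h.primary_G j) (h.primary_G i) (by norm_num)
      (by simp) ?_
    rw [hji, map_smul, hα.2.1, e0, neg_smul, mul_neg, smul_neg, neg_neg]
  have hs := congrArg (Polynomial.eval 1) (hα.2.2.1 1 1 _ (h.mem_G i) _ (h.mem_G j))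
  rw [e1, e2] at hs
  simp [koszulSign, ZMod.val_one] at hs
  exact self_eq_neg.1 hs.symm

end IsSuperconformal

end Superconformal

end ConformalData

/-! ### Models containing `Λ(N)` in degrees at most three. -/

section TruncatedModel

open ConformalData

variable {R : Type*} [AddCommGroup R] [Module ℂ R] [Module ℂ[X] R] [IsScalarTower ℂ ℂ[X] R]
  {D : ConformalData R} {N : ℕ} {e : Grassmann N →ₗ[ℂ] R} {T : Set R} {α : LambdaForm R} {n : ℕ}
  {B : Grassmann N}

/-- The features shared by `K_4'` and `CK_6`: `e` embeds `Λ(N)` in degrees at most three, and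
`e(1)`, `e(ξ_i)` act as in `K_N`. -/
structure IsTruncatedModel (D : ConformalData R) (e : Grassmann N →ₗ[ℂ] R) (T : Set R) : Prop where
  isSuperconformal : D.IsSuperconformal (e 1) (fun i => e (xi i)) T
  emb_mem : ∀ n ≤ 3, ∀ B ∈ degPart N n, e B ∈ T
  primary : ∀ n ≤ 3, ∀ B ∈ degPart N n, D.IsPrimary (e 1) (2 - n / 2) (e B)
  mem_parity : ∀ n ≤ 3, ∀ B ∈ degPart N n, e B ∈ D.parity n
  X_smul_xi_mul : ∀ n ≤ 2, ∀ B ∈ degPart N n, ∀ i, (.X : ℂ[X]) • e (xi i * B) =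
    -(2 : ℂ) • D.brk (.C 0) (e (xi i)) (e B) - e (dxi i B)

/-- The expression is the one for `∂(ξ_i B)`. It is kept apart from the induction because in `K_4'`
it also produces the generator in degree four. -/
lemma generation_step (hpar : ∀ n ≤ 3, ∀ B ∈ degPart N n, e B ∈ D.parity n)
    {P : ZMod 2 → R → Prop} (zero : ∀ j, P j 0) (add : ∀ j a b, P j a → P j b → P j (a + b))
    (smul : ∀ j (z : ℂ) a, P j a → P j (z • a))
    (brk : ∀ i j, ∀ b ∈ D.parity j, P j b → P (1 + j) (D.brk (.C 0) (e (xi i)) b))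
    (hn : n ≤ 3) (ih : ∀ m ≤ n, ∀ B ∈ degPart N m, P m (e B)) (hB : B ∈ degPart N n) (i : Fin N) :
    P (1 + n) (-(2 : ℂ) • D.brk (.C 0) (e (xi i)) (e B) - e (dxi i B)) := by
  rw [sub_eq_add_neg, ← neg_one_smul ℂ (e (dxi i B))]
  exact add _ _ _ (smul _ _ _ (brk i n _ (hpar n hn B hB) (ih n le_rfl B hB)))
    (smul _ _ _ (IsKModel.dxi_induction_step i hB zero fun m hm => ih m hm.le))

/-- The elements `e B` are generated by `e 1` and the `e ξ_i`. -/
lemma generation_of_xi (hpar : ∀ n ≤ 3, ∀ B ∈ degPart N n, e B ∈ D.parity n)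
    (hX : ∀ n ≤ 2, ∀ B ∈ degPart N n, ∀ i, (.X : ℂ[X]) • e (xi i * B) =
      -(2 : ℂ) • D.brk (.C 0) (e (xi i)) (e B) - e (dxi i B))
    {P : ZMod 2 → R → Prop} (zero : ∀ j, P j 0) (add : ∀ j a b, P j a → P j b → P j (a + b))
    (smul : ∀ j (z : ℂ) a, P j a → P j (z • a))
    (X_smul : ∀ j a, P j ((.X : ℂ[X]) • a) → P j a) (one : P 0 (e 1))
    (brk : ∀ i j, ∀ b ∈ D.parity j, P j b → P (1 + j) (D.brk (.C 0) (e (xi i)) b)) (n : ℕ)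
    (hn : n ≤ 3) : ∀ m ≤ n, ∀ B ∈ degPart N m, P m (e B) := by
  induction n with
  | zero =>
    intro m hm B hB
    obtain rfl : m = 0 := by omega
    rw [degPart, pow_zero] at hB
    obtain ⟨z, rfl⟩ := Submodule.mem_one.1 hB
    rw [Algebra.algebraMap_eq_smul_one, map_smul]
    exact smul _ z _ one
  | succ n ih =>
    intro m hm B hB
    have ih := ih (by omega)
    rcases hm.lt_or_eq with hm | rfl
    · exact ih m (by omega) B hB
    · refine degPart_succ_induction (motive := fun B => P (n + 1 : ℕ) (e B))
        (fun i y hy => X_smul _ _ ?_) (by rw [map_zero]; exact zero _)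
        (fun x y hx hy => by rw [map_add]; exact add _ _ _ hx hy)
        (fun z x hx => by rw [map_smul]; exact smul _ _ _ hx) hB
      rw [hX n (by omega) y hy, Nat.cast_add, add_comm (n : ZMod 2), Nat.cast_one]
      exact generation_step hpar zero add smul brk (by omega) ih hy i

namespace IsTruncatedModel

lemma form_emb_eq_zero (h : IsTruncatedModel D e T) (hα : α ∈ D.twoCocycles)
    (h1 : ∀ b, α (e 1) b = 0) (hn : n ≤ 3) (hB : B ∈ degPart N n) (b : R) : α (e B) b = 0 := by
  have hs := h.isSuperconformal
  have hG := hs.form_G_eq_zero hα h1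
  exact generation_of_xi h.mem_parity h.X_smul_xi_mul (P := fun _ a => ∀ b, α a b = 0) (by simp)
    (fun j a b ha hb c => by simp [ha, hb]) (fun j z a ha b => by simp [ha])
    (fun j a ha b => form_eq_zero_of_X_smul hα (ha b)) h1
    (fun i j b mb hb c => form_brk_eq_zero hα (hs.mem_G i) mb (hG i) hb 0 c) n hn n le_rfl B hB b

lemma coeff_two_eq_zero (h : IsTruncatedModel D e T) (hα : α ∈ D.twoCocycles)
    (h1 : ∀ t ∈ T, (α (e 1) t).coeff 1 = 0) (hB : B ∈ degPart N 2) :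
    (α (e 1) (e B)).coeff 2 = 0 := by
  have hij : ∀ i j : Fin N, (α (e 1) (e (xi i * xi j))).coeff 2 = 0 := fun i j => by
    by_cases hij : i = j
    · rw [hij, xi_mul_self, map_zero, map_zero, Polynomial.coeff_zero]
    have hb : ∀ i j : Fin N, i ≠ j → D.brk (.C 0) (e (xi i)) (e (xi j)) =
        -(1 / 2 : ℂ) • ((.X : ℂ[X]) • e (xi i * xi j)) := fun i j hij => by
      rw [h.X_smul_xi_mul 1 (by norm_num) _ (xi_mem_degPart j), dxi_xi, if_neg hij, map_zero e,
        sub_zero, smul_smul]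
      norm_num
    have hd := mul_mem_degPart (xi_mem_degPart i) (xi_mem_degPart j)
    have hp := h.primary 2 (by norm_num) _ hd
    norm_num at hp
    refine h.isSuperconformal.coeff_two_eq_zero hα (i := i) (j := j) hp
      (h1 _ (h.emb_mem 2 (by norm_num) _ hd)) (hb i j hij) ?_
    rw [hb j i (Ne.symm hij), xi_mul_xi, map_neg, smul_neg, neg_smul_neg]
  refine degPart_succ_induction (motive := fun B => (α (e 1) (e B)).coeff 2 = 0)
    (fun i y hy => ?_) (by simp) (fun x y hx hy => by simp [hx, hy]) (fun z x hx => by simp [hx]) hB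
  exact degPart_one_induction (motive := fun y => (α (e 1) (e (xi i * y))).coeff 2 = 0) (hij i)
    (by simp) (fun x y hx hy => by simp [mul_add, hx, hy]) (fun z x hx => by simp [hx]) hy

/-- A normalised cocycle is cubic at `e 1`. -/
lemma form_one_emb (h : IsTruncatedModel D e T) (hα : α ∈ D.twoCocycles)
    (h1 : ∀ t ∈ T, (α (e 1) t).coeff 1 = 0) (hn : n ≤ 3) (hB : B ∈ degPart N n) :
    α (e 1) (e B) = .C ((α (e 1) (e B)).coeff 3) * .X ^ 3 := by
  have hs := h.isSuperconformal
  have hp := h.primary n hn B hB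
  have hΔ : (2 - n / 2 : ℂ) ≠ 0 := by
    intro h0
    have : (n : ℂ) = 4 := by linear_combination -2 * h0
    have : n = 4 := by exact_mod_cast this
    omega
  have k2 : (α (e 1) (e B)).coeff 2 = 0 := by
    by_cases hn2 : n = 2
    · subst hn2
      exact h.coeff_two_eq_zero hα h1 hB
    · refine primary_coeff_two hα hs.mem_L hs.primary_L hp fun h0 => hn2 ?_
      have : (n : ℂ) = 2 := by linear_combination -2 * h0
      exact_mod_cast this
  conv_lhs => rw [primary_eq hα hs.mem_L hs.primary_L hp hΔ (h1 _ (h.emb_mem n hn B hB)), k2]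
  rw [Polynomial.C_0, zero_mul, zero_add]

/-- Positive degree means weight different from `2`, which excludes `λ^3`; degree zero is a multiple
of the assumed vanishing value. -/
lemma form_one_emb_eq_zero (h : IsTruncatedModel D e T) (hα : α ∈ D.twoCocycles)
    (h1 : ∀ t ∈ T, (α (e 1) t).coeff 1 = 0) (hn : n ≤ 3) (hB : B ∈ degPart N n)
    (h3 : n = 0 → (α (e 1) (e 1)).coeff 3 = 0) : α (e 1) (e B) = 0 := by
  have hs := h.isSuperconformal
  have k3 : (α (e 1) (e B)).coeff 3 = 0 := by
    rcases n with _ | n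
    · rw [degPart, pow_zero] at hB
      obtain ⟨z, rfl⟩ := Submodule.mem_one.1 hB
      rw [Algebra.algebraMap_eq_smul_one, map_smul, map_smul, Polynomial.coeff_smul, h3 rfl,
        smul_zero]
    · refine primary_coeff_three hα hs.mem_L hs.primary_L (h.primary _ hn B hB) fun h0 => ?_
      have : ((n + 1 : ℕ) : ℂ) = 0 := by linear_combination -2 * h0
      exact absurd (by exact_mod_cast this) (Nat.succ_ne_zero n)
  rw [h.form_one_emb hα h1 hn hB, k3, Polynomial.C_0, zero_mul]

end IsTruncatedModel

end TruncatedModel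

/-! ### Cocycles on a model of `K_4'`. -/

section K4Prime

open ConformalData

variable {R : Type*} [AddCommGroup R] [Module ℂ R] [Module ℂ[X] R] [IsScalarTower ℂ ℂ[X] R]
  {D : ConformalData R} {e : Grassmann 4 →ₗ[ℂ] R} {θ : R} {α : LambdaForm R} {n : ℕ}
  {B : Grassmann 4}

/-- The features of `K_4'` on which its structure theory rests. The map `e` is the inclusion of
`Λ(4)` in degrees less than `4`, and `θ` is `∂ ξ_1 ξ_2 ξ_3 ξ_4`. -/
structure IsK4'Model (D : ConformalData R) (e : Grassmann 4 →ₗ[ℂ] R) (θ : R) : Prop extends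
    IsTruncatedModel D e ({x | ∃ n ≤ 3, ∃ B ∈ degPart 4 n, x = e B} ∪ {θ}) where
  primary_theta : D.IsPrimary (e 1) 1 θ
  theta_mem_parity : θ ∈ D.parity 0
  smul_theta : ∀ B ∈ degPart 4 3, ∀ i, topCoord 4 (xi i * B) • θ =
    -(2 : ℂ) • D.brk (.C 0) (e (xi i)) (e B) - e (dxi i B)

namespace IsK4'Model

/-- `K_4'` is generated by `1` and the `ξ_i`. -/
lemma generation (h : IsK4'Model D e θ) {P : ZMod 2 → R → Prop} (zero : ∀ j, P j 0)
    (add : ∀ j a b, P j a → P j b → P j (a + b)) (smul : ∀ j (z : ℂ) a, P j a → P j (z • a))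
    (X_smul : ∀ j a, P j ((.X : ℂ[X]) • a) → P j a) (one : P 0 (e 1))
    (brk : ∀ i j, ∀ b ∈ D.parity j, P j b → P (1 + j) (D.brk (.C 0) (e (xi i)) b)) :
    (∀ n ≤ 3, ∀ B ∈ degPart 4 n, P n (e B)) ∧ P 0 θ := by
  have key := generation_of_xi h.mem_parity h.X_smul_xi_mul zero add smul X_smul one brk
  refine ⟨fun n hn => key n hn n le_rfl, ?_⟩
  set B : Grassmann 4 := xiMono (Finset.univ.erase 0) with hB
  have hBd : B ∈ degPart 4 3 := xiMono_mem_degPart (Finset.univ.erase (0 : Fin 4))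
  have e0 : xi 0 * B = xiMono Finset.univ := by
    rw [hB, ← xiMono_insert (by decide), Finset.insert_erase (Finset.mem_univ _)]
  have e1 := h.smul_theta B hBd 0
  rw [e0, topCoord_xiMono, if_pos rfl, one_smul] at e1
  rw [e1]
  exact generation_step h.mem_parity zero add smul brk le_rfl (key 3 le_rfl) hBd 0

/-- A cocycle on `K_4'` is determined by `α(1, ·)`. -/
lemma eq_zero (h : IsK4'Model D e θ) (hα : α ∈ D.twoCocycles) (h1 : ∀ b, α (e 1) b = 0) :
    α = 0 := by
  have hs := h.isSuperconformal
  have hG := hs.form_G_eq_zero hα h1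
  have key := h.generation (P := fun _ a => ∀ b, α a b = 0) (by simp)
    (fun j a b ha hb c => by simp [ha, hb]) (fun j z a ha b => by simp [ha])
    (fun j a ha b => form_eq_zero_of_X_smul hα (ha b)) h1
    (fun i j b mb hb c => form_brk_eq_zero hα (hs.mem_G i) mb (hG i) hb 0 c)
  ext1 a
  ext1 b
  have ha : a ∈ (⊤ : Submodule ℂ[X] R) := trivial
  rw [← hs.span_eq_top] at ha
  refine span_polynomial_induction (motive := fun a => α a b = 0) ?_ (by simp)
    (fun x y hx hy => by simp [hx, hy]) (fun z x hx => by simp [hx])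
    (fun x hx => by rw [hα.1, hx, mul_zero, neg_zero]) ha
  rintro _ (⟨n, hn, B, hB, rfl⟩ | rfl)
  · exact key.1 n hn B hB b
  · exact key.2 b

/-- After normalisation two coefficients can survive at `1`: the cubic one at `1` and the quadratic
one at `θ`, which has weight `1` but is not a product `ξ_i ξ_j`. Both are insensitive to the
coboundary subtracted. -/
theorem mem_coboundaries (h : IsK4'Model D e θ) (hα : α ∈ D.twoCocycles)
    (h3 : (α (e 1) (e 1)).coeff 3 = 0) (h2 : (α (e 1) θ).coeff 2 = 0) :
    α ∈ D.twoCoboundaries := by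
  have hs := h.isSuperconformal
  obtain ⟨κ, hκ, hc, h1⟩ := hs.exists_normalised hα
  have c3 : ((α - κ) (e 1) (e 1)).coeff 3 = 0 := by
    rw [LinearMap.sub_apply, LinearMap.sub_apply, Polynomial.coeff_sub, h3,
      coeff_coboundary_of_primary hκ hs.primary_L (by norm_num), sub_zero]
  have c2 : ((α - κ) (e 1) θ).coeff 2 = 0 := by
    rw [LinearMap.sub_apply, LinearMap.sub_apply, Polynomial.coeff_sub, h2,
      coeff_coboundary_of_primary hκ h.primary_theta (by norm_num), sub_zero]
  have key : α - κ = 0 := by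
    refine h.eq_zero hc fun b => ?_
    have hb : b ∈ (⊤ : Submodule ℂ[X] R) := trivial
    rw [← hs.span_eq_top] at hb
    refine span_polynomial_induction (motive := fun b => (α - κ) (e 1) b = 0) ?_ (by simp)
      (fun x y hx hy => by rw [map_add, hx, hy, add_zero]) (fun z x hx => by
        rw [map_smul, hx, smul_zero])
      (fun x hx => by rw [hc.2.1, hx, mul_zero]) hb
    rintro _ (⟨n, hn, B, hB, rfl⟩ | rfl)
    · exact h.form_one_emb_eq_zero hc h1 hn hB fun _ => c3
    · rw [primary_eq hc hs.mem_L hs.primary_L h.primary_theta one_ne_zero (h1 _ (.inr rfl)), c2,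
        primary_coeff_three hc hs.mem_L hs.primary_L h.primary_theta (by norm_num)]
      simp
  rwa [sub_eq_zero.1 key]

end IsK4'Model

end K4Prime

lemma contr_mem_degPart {N r s : ℕ} {A B : Grassmann N} (hA : A ∈ degPart N r)
    (hB : B ∈ degPart N s) : contr A B ∈ degPart N (r + s - 2) := by
  refine sum_mem fun i _ => ?_
  rcases r with _ | r
  · rw [dxi_of_mem_degPart_zero i hA, zero_mul]
    exact zero_mem _
  rcases s with _ | s
  · rw [dxi_of_mem_degPart_zero i hB, mul_zero]
    exact zero_mem _
  have := mul_mem_degPart (dxi_mem_degPart i hA) (dxi_mem_degPart i hB)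
  rwa [show r + 1 - 1 + (s + 1 - 1) = r + 1 + (s + 1) - 2 by omega] at this

namespace ConformalData

lemma brk_mem_derived {R : Type*} [AddCommGroup R] [Module ℂ R] [Module ℂ[X] R]
    [IsScalarTower ℂ ℂ[X] R] (D : ConformalData R) (p : ℂ[X]) (a b : R) :
    D.brk p a b ∈ D.derived :=
  brk_mem (S := D.derived) (fun n => Submodule.subset_span ⟨n, a, b, rfl⟩) p

lemma span_subtype_eq_top {R : Type*} [AddCommGroup R] [Module ℂ[X] R] {S : Submodule ℂ[X] R}
    {T : Set S} (h : S ≤ Submodule.span ℂ[X] (S.subtype '' T)) : Submodule.span ℂ[X] T = ⊤ := by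
  rw [eq_top_iff]
  rintro ⟨x, hx⟩ -
  have := h hx
  rw [Submodule.span_image] at this
  obtain ⟨y, hy, hxy⟩ := this
  rwa [show y = ⟨x, hx⟩ from Subtype.ext hxy] at hy

end ConformalData

/-! ### The derived algebra of `K_4`. -/

namespace IsKModel

open ConformalData

variable {N : ℕ} {R : Type*} [AddCommGroup R] [Module ℂ R] [Module ℂ[X] R] [IsScalarTower ℂ ℂ[X] R]

section Derived

variable {D : ConformalData R} {e : Grassmann N →ₗ[ℂ] R} {n : ℕ} {B : Grassmann N}

lemma X_smul_emb_mem_derived (h : IsKModel D e) (hB : B ∈ degPart N n) :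
    (.X : ℂ[X]) • e B ∈ D.derived := by
  have := D.brk_mem_derived (.C 0) (e 1) (e B)
  rw [h.isPrimary hB, zero_mul, zero_smul, sub_zero] at this
  exact neg_mem_iff.1 this

lemma emb_mem_derived (h : IsKModel D e) (hn : n ≠ 4) (hB : B ∈ degPart N n) :
    e B ∈ D.derived := by
  have h1 := add_mem (D.brk_mem_derived (.C 1) (e 1) (e B)) (h.X_smul_emb_mem_derived hB)
  rw [h.isPrimary hB, neg_sub_comm, sub_add_cancel, one_mul, ← smul_neg] at h1
  have h2 := D.derived.smul_mem (.C (-(2 - n / 2 : ℂ)⁻¹) : ℂ[X]) h1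
  have h0 : (2 - n / 2 : ℂ) ≠ 0 := fun h0 => hn (by
    have : (n : ℂ) = 4 := by linear_combination -2 * h0
    exact_mod_cast this)
  rwa [C_smul_eq, smul_smul, neg_mul, inv_mul_cancel₀ h0, neg_one_smul, neg_neg] at h2

end Derived

section Four

variable {D : ConformalData R} {e : Grassmann 4 →ₗ[ℂ] R}

/-- All degrees but `4` have non-zero weight and are reached by brackets with `1`, as is `∂` of
everything; the converse amounts to controlling the degree-four part of a bracket. -/
lemma derived_eq_span (h : IsKModel D e) : D.derived = Submodule.span ℂ[X]
    ({x | ∃ n ≤ 3, ∃ B ∈ degPart 4 n, x = e B} ∪ {(.X : ℂ[X]) • e (xiMono Finset.univ)}) := by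
  refine le_antisymm ?_ ?_
  · rw [derived, Submodule.span_le]
    rintro _ ⟨n, a, b, rfl⟩
    set M := Submodule.span ℂ[X] ({x | ∃ n ≤ 3, ∃ B ∈ degPart 4 n, x = e B} ∪
      {(.X : ℂ[X]) • e (xiMono Finset.univ)}) with hM
    have hlow : ∀ n ≠ 4, ∀ B ∈ degPart 4 n, e B ∈ M := fun n hn B hB => by
      rcases Nat.lt_or_ge n 4 with hn' | hn'
      · exact Submodule.subset_span (.inl ⟨n, by omega, B, hB, rfl⟩)
      · rw [degPart_eq_zero (by omega : 4 < n) hB, map_zero]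
        exact zero_mem _
    refine (forall_nthProduct_mem_iff M a b).2 (fun z => ?_) n
    have hspan : ∀ x : R, x ∈ Submodule.span ℂ[X] (e '' {A | ∃ n, A ∈ degPart 4 n}) := fun x => by
      rw [h.span_graded]; trivial
    refine span_polynomial_induction (motive := fun a => D.brk (.C z) a b ∈ M) ?_
      (by rw [brk_zero_left]; exact zero_mem _)
      (fun x y hx hy => by rw [brk_add_left]; exact add_mem hx hy)
      (fun w x hx => by
        rw [ConformalData.brk_smul_left, ← C_smul_eq]; exact M.smul_mem _ hx)
      (fun x hx => by rw [h.brk_smul_left]; exact M.smul_mem _ hx) (hspan a)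
    rintro _ ⟨A, ⟨r, hA⟩, rfl⟩
    refine span_polynomial_induction (motive := fun b => D.brk (.C z) (e A) b ∈ M) ?_
      (by rw [brk_zero_right]; exact zero_mem _)
      (fun x y hx hy => by rw [brk_add_right]; exact add_mem hx hy)
      (fun w x hx => by
        rw [ConformalData.brk_smul_right, ← C_smul_eq]; exact M.smul_mem _ hx)
      (fun x hx => by rw [h.brk_smul_right]; exact M.smul_mem _ hx) (hspan b)
    rintro _ ⟨B, ⟨s, hB⟩, rfl⟩
    rw [h.brk_emb_graded _ (.of_degPart hA) (.of_degPart hB), ← C_smul_eq ((-1) ^ r / 2 : ℂ)]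
    refine add_mem ?_ (M.smul_mem _ ?_)
    · have hAB := mul_mem_degPart hA hB
      -- In degree four the factor `(r + s)/2 - 2` of `λAB` is zero, so only a multiple of
      -- `∂ξ_1ξ_2ξ_3ξ_4` remains.
      by_cases hrs : r + s = 4
      · have : ((r + s : ℂ) / 2 - 2) = 0 := by
          have : (r + s : ℂ) = 4 := by exact_mod_cast hrs
          rw [this]; norm_num
        rw [hrs] at hAB
        rw [this, Polynomial.C_0, zero_mul, add_zero, eq_topCoord_smul hAB, map_smul, ← C_smul_eq,
          mul_smul, smul_comm (.X : ℂ[X])]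
        exact M.smul_mem _ (M.smul_mem _ (Submodule.subset_span (.inr rfl)))
      · exact M.smul_mem _ (hlow _ hrs _ hAB)
    · have hc := contr_mem_degPart hA hB
      -- A contraction is a sum of derivatives, hence has no component in the top degree.
      by_cases hrs : r + s - 2 = 4
      · rw [contr_eq_zero hA hB (by rwa [hrs] at hc), map_zero]
        exact zero_mem _
      · exact hlow _ hrs _ hc
  · rw [Submodule.span_le]
    rintro _ (⟨n, hn, B, hB, rfl⟩ | rfl)
    · exact h.emb_mem_derived (by omega) hB
    · exact h.X_smul_emb_mem_derived (xiMono_mem_degPart _)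

/-- The derived algebra of `K_4` is a model of `K_4'`. -/
theorem exists_isK4'Model (h : IsKModel D e) : ∃ (e' : Grassmann 4 →ₗ[ℂ] D.derived)
    (θ : D.derived), (∀ n ≤ 3, ∀ B ∈ degPart 4 n, (e' B : R) = e B) ∧
      (θ : R) = (.X : ℂ[X]) • e (xiMono Finset.univ) ∧
      IsK4'Model (D.restrict D.derived D.derived_isSubalgebra) e' θ := by
  -- `Q` removes degree four, which enters the derived algebra only after multiplication by `∂`.
  obtain ⟨Q, hQ⟩ := exists_degree_operator 4 fun n => if n = 4 then 0 else 1
  have hQe : ∀ A, e (Q A) ∈ D.derived := fun A => by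
    have hA : A ∈ ⨆ n, degPart 4 n := by rw [iSup_degPart]; trivial
    refine Submodule.iSup_induction _ (motive := fun A => e (Q A) ∈ D.derived) hA
      (fun n x hx => ?_) (by rw [map_zero, map_zero]; exact zero_mem _)
      fun x y hx hy => by rw [map_add, map_add]; exact add_mem hx hy
    rw [hQ n x hx]
    split_ifs with hn
    · rw [zero_smul, map_zero]
      exact zero_mem _
    · rw [one_smul]
      exact h.emb_mem_derived hn hx
  let e' : Grassmann 4 →ₗ[ℂ] D.derived :=
    { toFun := fun A => ⟨e (Q A), hQe A⟩
      map_add' := fun A B => Subtype.ext (by simp)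
      map_smul' := fun z A => Subtype.ext (by simp) }
  let w : Grassmann 4 := xiMono Finset.univ
  have hw : w ∈ degPart 4 4 := xiMono_mem_degPart Finset.univ
  let θ : D.derived := ⟨(.X : ℂ[X]) • e w, h.X_smul_emb_mem_derived hw⟩
  have he : ∀ n ≠ 4, ∀ B ∈ degPart 4 n, (e' B : R) = e B := fun n hn B hB => by
    change e (Q B) = e B
    rw [hQ n B hB, if_neg hn, one_smul]
  have he1 : (e' 1 : R) = e 1 := he 0 (by norm_num) 1 one_mem_degPart
  have hexi : ∀ i, (e' (xi i) : R) = e (xi i) := fun i => he 1 (by norm_num) _ (xi_mem_degPart i)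
  have hdxi : ∀ n ≤ 3, ∀ B ∈ degPart 4 n, ∀ i, (e' (dxi i B) : R) = e (dxi i B) :=
    fun n hn B hB i => he (n - 1) (by omega) _ (dxi_mem_degPart i hB)
  have hpar : ∀ n ≤ 3, ∀ B ∈ degPart 4 n,
      e' B ∈ (D.restrict D.derived D.derived_isSubalgebra).parity n := fun n hn B hB => by
    change (e' B : R) ∈ D.parity n
    rw [he n (by omega) B hB]
    exact h.emb_mem_parity_of_degPart hB
  have hprim : ∀ n ≤ 3, ∀ B ∈ degPart 4 n,
      (D.restrict D.derived D.derived_isSubalgebra).IsPrimary (e' 1) (2 - n / 2) (e' B) :=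
    fun n hn B hB z => Subtype.ext (by
      rw [brk_restrict, he1, he n (by omega) B hB, h.isPrimary hB]
      simp [he n (by omega) B hB])
  have hprimθ : (D.restrict D.derived D.derived_isSubalgebra).IsPrimary (e' 1) 1 θ := fun z =>
    Subtype.ext (by
      rw [brk_restrict, he1]
      change D.brk (.C z) (e 1) ((.X : ℂ[X]) • e w) = -((.X : ℂ[X]) • (.X : ℂ[X]) • e w) -
        (z * 1) • (.X : ℂ[X]) • e w
      -- The top monomial has weight `0`, and `∂` raises it to `1`, without correction terms
      -- precisely because the weight was `0`.
      rw [h.sesq_right, h.isPrimary hw, add_smul, C_smul_eq]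
      norm_num [sub_eq_add_neg])
  have hθ : θ ∈ (D.restrict D.derived D.derived_isSubalgebra).parity 0 := by
    change (.X : ℂ[X]) • e w ∈ D.parity 0
    have := h.emb_mem_parity_of_degPart hw
    rw [show ((4 : ℕ) : ZMod 2) = 0 from rfl] at this
    exact Submodule.smul_mem _ _ this
  refine ⟨e', θ, fun n hn => he n (by omega), rfl, ?_⟩
  refine ⟨⟨?_, fun n hn B hB => .inl ⟨n, hn, B, hB, rfl⟩, hprim, hpar, ?_⟩, hprimθ, hθ, ?_⟩
  · refine ⟨h.isLie.restrict _ _ _ h.derived_eq_span ?_, hpar 0 (by norm_num) 1 one_mem_degPart, ?_,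
      fun i => ?_, fun i => ?_, span_subtype_eq_top ?_, ?_⟩
    · rintro _ (⟨n, -, B, hB, rfl⟩ | rfl)
      · exact ⟨n, h.emb_mem_parity_of_degPart hB⟩
      · exact ⟨0, hθ⟩
    · have := hprim 0 (by norm_num) 1 one_mem_degPart
      norm_num at this
      exact this
    · have := hpar 1 (by norm_num) _ (xi_mem_degPart i)
      rwa [Nat.cast_one] at this
    · have := hprim 1 (by norm_num) _ (xi_mem_degPart i)
      norm_num at this
      exact this
    · conv_lhs => rw [h.derived_eq_span]
      refine Submodule.span_mono ?_
      rintro _ (⟨n, hn, B, hB, rfl⟩ | rfl)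
      · exact ⟨e' B, .inl ⟨n, hn, B, hB, rfl⟩, he n (by omega) B hB⟩
      · exact ⟨θ, .inr rfl, rfl⟩
    · rintro _ (⟨n, hn, B, hB, rfl⟩ | rfl)
      · refine ⟨_, ?_, hprim n hn B hB⟩
        interval_cases n <;> norm_num
      · exact ⟨1, by norm_num, hprimθ⟩
  · intro n hn B hB i
    refine Subtype.ext ?_
    have := h.X_smul_emb_xi_mul i B
    rw [← he (n + 1) (by omega) _ (xi_mul_mem_degPart i hB), ← he n (by omega) B hB, ← hexi,
      ← hdxi n (by omega) B hB, ← brk_restrict _ D.derived_isSubalgebra] at this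
    exact this
  · intro B hB i
    refine Subtype.ext ?_
    have := h.X_smul_emb_xi_mul i B
    rw [eq_topCoord_smul (xi_mul_mem_degPart i hB), map_smul, smul_comm, ← he 3 (by norm_num) B hB,
      ← hexi, ← hdxi 3 le_rfl B hB, ← brk_restrict _ D.derived_isSubalgebra] at this
    exact this

end Four

end IsKModel

lemma Submodule.le_of_isCompl {A M : Type*} [Ring A] [AddCommGroup M] [Module A M]
    {P Q S T : Submodule A M} (h : IsCompl P Q) (hS : S ≤ P) (hT : T ≤ Q) (hST : S ⊔ T = ⊤) :
    P ≤ S := fun x hx => by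
  have hx' : x ∈ S ⊔ T := by rw [hST]; trivial
  obtain ⟨s, hs, t, ht, rfl⟩ := Submodule.mem_sup.1 hx'
  rw [Submodule.disjoint_def.1 h.disjoint t ((P.add_mem_iff_right (hS hs)).1 hx) (hT ht), add_zero]
  exact hs

open ConformalData

/-! ### The cocycle `α` on `K_4'`. -/

section AlphaPrime

variable {R : Type*} [AddCommGroup R] [Module ℂ R] [Module ℂ[X] R] [IsScalarTower ℂ ℂ[X] R]
  {D : ConformalData R} {e : Grassmann 4 →ₗ[ℂ] R} {θ : R} {α : LambdaForm R}

/-- Homogeneous generators of `K_4'`. -/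
def k4'Set (e : Grassmann 4 →ₗ[ℂ] R) (θ : R) (j : ZMod 2) : Set R :=
  {x | (∃ n : ℕ, n ≤ 3 ∧ (n : ZMod 2) = j ∧ ∃ B ∈ degPart 4 n, x = e B) ∨ (j = 0 ∧ x = θ)}

namespace IsK4'Model

lemma span_k4'Set_le (h : IsK4'Model D e θ) (j : ZMod 2) :
    Submodule.span ℂ[X] (k4'Set e θ j) ≤ D.parity j := by
  rw [Submodule.span_le]
  rintro _ (⟨n, hn, rfl, B, hB, rfl⟩ | ⟨rfl, rfl⟩)
  · exact h.mem_parity n hn B hB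
  · exact h.theta_mem_parity

lemma parity_le_span (h : IsK4'Model D e θ) (j : ZMod 2) :
    D.parity j ≤ Submodule.span ℂ[X] (k4'Set e θ j) := by
  have hsup : Submodule.span ℂ[X] (k4'Set e θ 0) ⊔ Submodule.span ℂ[X] (k4'Set e θ 1) = ⊤ := by
    rw [← Submodule.span_union, eq_top_iff, ← h.isSuperconformal.span_eq_top]
    refine Submodule.span_mono ?_
    rintro _ (⟨n, hn, B, hB, rfl⟩ | rfl)
    · rcases eq_zero_or_eq_one_zmod (n : ZMod 2) with hj | hj
      · exact .inl (.inl ⟨n, hn, hj, B, hB, rfl⟩)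
      · exact .inr (.inl ⟨n, hn, hj, B, hB, rfl⟩)
    · exact .inl (.inr ⟨rfl, rfl⟩)
  have hc := h.isSuperconformal.isLie.isCompl
  rcases eq_zero_or_eq_one_zmod j with rfl | rfl
  · exact Submodule.le_of_isCompl hc (h.span_k4'Set_le 0) (h.span_k4'Set_le 1) hsup
  · exact Submodule.le_of_isCompl hc.symm (h.span_k4'Set_le 1) (h.span_k4'Set_le 0)
      (by rw [sup_comm, hsup])

/-- The cocycle axioms for `K_4'` may be checked for the first argument `1` or `ξ_i`. -/
lemma mem_twoCocycles (h : IsK4'Model D e θ)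
    (hl : ∀ a b, α ((.X : ℂ[X]) • a) b = -(.X * α a b))
    (hr : ∀ a b, α a ((.X : ℂ[X]) • b) = .X * α a b)
    (hskew : ∀ i j, ∀ a ∈ D.parity i, ∀ b ∈ D.parity j,
      α b a = -(koszulSign i j • (α a b).comp (-.X)))
    (h1 : D.JacobiFor (evalForm α) 0 (e 1)) (hξ : ∀ i, D.JacobiFor (evalForm α) 1 (e (xi i))) :
    α ∈ D.twoCocycles := by
  have hD := h.isSuperconformal.isLie
  have hJ : ∀ i, ∀ a ∈ D.parity i, D.JacobiFor D.brkAt i a := fun i a ha j b hb c z w => by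
    simpa only [brkAt_apply] using hD.jacobi i j a ha b hb c z w
  have hF : ∀ z a b, evalForm α z ((.X : ℂ[X]) • a) b = -(z • evalForm α z a b) := fun z a b => by
    rw [evalForm_apply, evalForm_apply, hl]
    simp
  have hP : ∀ (g : ℂ →ₗ[ℂ] ℂ) (x y : R), ∃ P : ℂ[X], ∀ z, P.eval z = g (evalForm α z x y) :=
    fun g x y => ⟨g 1 • α x y, fun z => by
      rw [Polynomial.eval_smul, evalForm_apply, smul_eq_mul, mul_comm, ← smul_eq_mul, ← map_smul,
        smul_eq_mul, mul_one]⟩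
  -- The Jacobi identity of `K_4'` is already available, so only the identity for the form has to be
  -- propagated from `1` and the `ξ_i`.
  have key := h.generation (P := fun j a => D.JacobiFor (evalForm α) j a) (fun _ => .zero)
    (fun _ _ _ ha hb => ha.add hb) (fun _ z _ ha => ha.smul z)
    (fun _ _ ha => ha.of_X_smul hD.sesq_left hF hP) h1
    (fun i j b mb hb => JacobiFor.brk (fun _ _ _ hx _ hy _ => hD.brk_mem_parity hx hy _)
      (h.isSuperconformal.mem_G i) mb (hJ 1 _ (h.isSuperconformal.mem_G i)) (hJ j _ mb) (hξ i) hb 0)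
  refine mem_twoCocycles_of_span hD.sesq_left hl hr (k4'Set e θ) h.parity_le_span
    (fun i j a ha b hb => hskew i j a (h.span_k4'Set_le i (Submodule.subset_span ha)) b
      (h.span_k4'Set_le j (Submodule.subset_span hb))) ?_
  rintro _ _ (⟨n, hn, rfl, B, hB, rfl⟩ | ⟨rfl, rfl⟩)
  · exact key.1 n hn B hB
  · exact key.2

end IsK4'Model

end AlphaPrime
open ConformalData

namespace IsScaledAlpha

variable {R : Type*} [AddCommGroup R] [Module ℂ R] [Module ℂ[X] R] [IsScalarTower ℂ ℂ[X] R]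
  {D : ConformalData R} {e : Grassmann 4 →ₗ[ℂ] R} {γ : LambdaForm R}

/-- In degrees at most three the exponent `4 - n` is positive; the remaining generator carries a
`∂`, hence a factor `λ`. -/
lemma coeff_zero_of_mem_derived (hγ : IsScaledAlpha e γ) (h : IsKModel D e) {a : R}
    (ha : a ∈ D.derived) (b : R) : (γ a b).coeff 0 = 0 := by
  rw [h.derived_eq_span] at ha
  have hb : b ∈ Submodule.span ℂ[X] (Set.range e) := by rw [h.span_emb]; trivial
  refine span_polynomial_induction (motive := fun a => (γ a b).coeff 0 = 0) ?_ (by simp)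
    (fun x y hx hy => by simp [hx, hy]) (fun z x hx => by simp [hx])
    (fun x hx => by simp [hγ.X_smul_left]) ha
  rintro _ (⟨n, hn, A, hA, rfl⟩ | rfl)
  · refine span_polynomial_induction (motive := fun b => (γ (e A) b).coeff 0 = 0) ?_ (by simp)
      (fun x y hx hy => by simp [hx, hy]) (fun z x hx => by simp [hx])
      (fun x hx => by simp [hγ.X_smul_right]) hb
    rintro _ ⟨B, rfl⟩
    rw [hγ.emb n A hA, show 4 - n = (3 - n) + 1 by omega, pow_succ, ← mul_assoc]
    simp
  · simp [hγ.X_smul_left]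

/-- The quotient by `λ` exists only on the derived algebra, while its cocycle identity is verified
with the form on all of `K_4`. -/
lemma exists_cocycle_derived (hγ : IsScaledAlpha e γ) (h : IsKModel D e) :
    ∃ α ∈ (D.restrict D.derived D.derived_isSubalgebra).twoCocycles,
      ∀ a b : D.derived, .X * α a b = γ a b := by
  obtain ⟨α, hα⟩ := exists_X_mul_eq (restrictForm γ D.derived)
    fun a b => hγ.coeff_zero_of_mem_derived h a.2 b
  have hα' : ∀ a b, .X * α a b = γ (D.derived.subtype a) (D.derived.subtype b) := hα
  obtain ⟨e', θ, he, -, h'⟩ := h.exists_isK4'Model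
  have hpar : ∀ i, ∀ a ∈ (D.restrict D.derived D.derived_isSubalgebra).parity i,
      D.derived.subtype a ∈ D.parity i := fun _ _ ha => ha
  have hbrk := fun z a b => brk_restrict (D := D) D.derived D.derived_isSubalgebra (.C z) a b
  refine ⟨α, h'.mem_twoCocycles (hγ.sesq_left hα') (hγ.sesq_right hα')
    (fun i j a ha b hb => hγ.skew h le_rfl hpar hα' i j ha hb)
    (hγ.jacobiFor_one h le_rfl hpar hbrk hα' (he 0 (by norm_num) 1 one_mem_degPart))
    (fun i => hγ.jacobiFor_xi h le_rfl hpar hbrk hα' i (he 1 (by norm_num) _ (xi_mem_degPart i))),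
    hα⟩

end IsScaledAlpha

/-! ### Products equal to the top monomial. -/

section TopProducts

/-- Apply `∂_i` to `ξ_i ξ_1 ⋯ ξ_N`, which is zero by degree. -/
lemma xi_mul_dxi_univ {N : ℕ} (i : Fin N) :
    xi i * dxi i (xiMono Finset.univ) = xiMono Finset.univ := by
  have h := degPart_eq_zero (N.lt_succ_self) (xi_mul_mem_degPart i
    (by simpa using xiMono_mem_degPart (Finset.univ : Finset (Fin N))))
  have := dxi_xi_mul i i (xiMono Finset.univ)
  rw [h, map_zero, if_pos rfl] at this
  exact (sub_eq_zero.1 this.symm).symm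

lemma xi_mul_xi_mul_dxi_dxi_univ {N : ℕ} {i j : Fin N} (hij : i ≠ j) :
    xi i * xi j * dxi i (dxi j (xiMono Finset.univ)) = -xiMono Finset.univ := by
  have := dxi_xi_mul i j (dxi j (xiMono Finset.univ))
  rw [if_neg hij, xi_mul_dxi_univ, zero_sub] at this
  rw [mul_assoc, ← neg_eq_iff_eq_neg.2 this, mul_neg, xi_mul_dxi_univ]

/-- If the degrees add up to `N` but the sets are not complementary, some index `i` occurs in
neither. The product `P` is then the derivative `∂_i(ξ_i P)`. -/
lemma topCoord_xiMono_mul {N : ℕ} {I J : Finset (Fin N)} (h : J ≠ Iᶜ) :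
    topCoord N (xiMono I * xiMono J) = 0 := by
  have hm := mul_mem_degPart (xiMono_mem_degPart I) (xiMono_mem_degPart J)
  by_cases hc : I.card + J.card = N
  · have : ∃ i, i ∉ I ∪ J := by
      by_contra! hall
      have hU : I ∪ J = Finset.univ := Finset.eq_univ_iff_forall.2 hall
      have h1 := Finset.card_union_add_card_inter I J
      rw [hU, Finset.card_univ, Fintype.card_fin, hc] at h1
      have h2 : I ∩ J = ∅ := Finset.card_eq_zero.1 (by omega)
      exact h ((isCompl_iff.2 ⟨Finset.disjoint_iff_inter_eq_empty.2 h2,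
        codisjoint_iff.2 hU⟩).compl_eq.symm)
    obtain ⟨i, hi⟩ := this
    rw [Finset.mem_union, not_or] at hi
    have h0 : dxi i (xiMono I * xiMono J) = 0 := by
      rw [dxi_mul, dxi_xiMono_of_notMem hi.1, dxi_xiMono_of_notMem hi.2, zero_mul, mul_zero,
        add_zero]
    have := dxi_xi_mul i i (xiMono I * xiMono J)
    rw [h0, mul_zero, sub_zero, if_pos rfl] at this
    rw [← this, topCoord_dxi i (xi_mul_mem_degPart i hm)]
  · exact topCoord_eq_zero hm hc

end TopProducts
open ConformalData

/-! ### Central extensions of `K_4'`. -/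

section Classification

lemma xiMono_singleton {N : ℕ} (i : Fin N) : xiMono {i} = xi i := by
  rw [← insert_empty_eq i, xiMono_insert (by simp), xiMono_empty, mul_one]

lemma k4'Gen_coe (I : Finset (Fin 4)) (hI : I ≠ Finset.univ) :
    (k4'Gen I : KSpace 4) = kEmb 4 (xiMono I) := by
  rw [k4'Gen, dif_neg hI]
  rfl

lemma k4'Gen_univ_coe :
    (k4'Gen Finset.univ : KSpace 4) = (.X : ℂ[X]) • kEmb 4 (xiMono Finset.univ) := by
  rw [k4'Gen, dif_pos rfl, smul_kEmb]

lemma card_le_three {I : Finset (Fin 4)} (hI : I ≠ Finset.univ) : I.card ≤ 3 := by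
  have h := Finset.card_le_univ I
  rw [Fintype.card_fin] at h
  have := mt (card_eq_iff_eq_univ I).1 hI
  omega

lemma pairing_xiMono_univ_self : pairing 4 (xiMono Finset.univ) (xiMono Finset.univ) = 1 := by
  rw [pairing_xiMono, if_pos rfl]
  norm_num

lemma isAlpha'_of_isScaledAlpha {γ : LambdaForm (KSpace 4)} (hγ : IsScaledAlpha (kEmb 4) γ)
    (α : K4'Alg.twoCocycles) (hα : ∀ a b : K4'Space, .X * α.1 a b = γ a b) : IsAlpha' α := by
  have hw : ∀ J : Finset (Fin 4), γ (kEmb 4 (xiMono Finset.univ)) (kEmb 4 (xiMono J)) =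
      if Finset.univ = J then .C (1 / 12) else 0 := fun J => by
    rw [hγ.emb 4 _ (xiMono_mem_degPart Finset.univ)]
    split_ifs with hJ
    · rw [← hJ, pairing_xiMono_univ_self]
      simp
    · rw [pairing_xiMono, if_neg hJ]
      simp
  refine ⟨fun I hI => ?_, ?_, fun I J hIJ => ?_⟩ <;>
    refine mul_left_cancel₀ (Polynomial.X_ne_zero (R := ℂ)) ((hα _ _).trans ?_)
  · rw [k4'Gen_coe I hI, hγ.emb_xiMono I I (card_le_three hI), if_pos rfl]
  · rw [k4'Gen_univ_coe, hγ.X_smul_left, hγ.X_smul_right, hw, if_pos rfl, neg_div,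
      Polynomial.C_neg]
    ring
  · rw [mul_zero]
    by_cases hI : I = Finset.univ
    · subst hI
      rw [k4'Gen_univ_coe, k4'Gen_coe J hIJ.symm, hγ.X_smul_left, hw, if_neg hIJ, mul_zero,
        neg_zero]
    · rw [k4'Gen_coe I hI]
      by_cases hJ : J = Finset.univ
      · subst hJ
        rw [k4'Gen_univ_coe, hγ.X_smul_right, hγ.emb_xiMono I _ (card_le_three hI), if_neg hIJ,
          mul_zero]
      · rw [k4'Gen_coe J hJ, hγ.emb_xiMono I J (card_le_three hI), if_neg hIJ]

lemma isBeta'_of_form {γ : LambdaForm (KSpace 4)} (hγ : γ ∈ (KAlg 4).twoCocycles)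
    (hγe : ∀ A B : Grassmann 4, γ (kEmb 4 A) (kEmb 4 B) = .C (topCoord 4 (A * B)) * .X)
    (β : K4'Alg.twoCocycles) (hβ : ∀ a b : K4'Space, β.1 a b = γ a b) : IsBeta' β := by
  refine ⟨?_, fun i => ?_, fun i j hij => ?_, fun I J hIJ => ?_⟩ <;> rw [hβ]
  · rw [k4'Gen_univ_coe, k4'Gen_coe ∅ (by decide), hγ.2.1, hγe, xiMono_empty, one_mul,
      topCoord_xiMono, if_pos rfl]
    norm_num
    ring
  · rw [k4'Gen_coe {i} (by revert i; decide)]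
    refine (hγe _ _).trans ?_
    rw [xiMono_singleton, xi_mul_dxi_univ, topCoord_xiMono, if_pos rfl, Polynomial.C_1, one_mul]
  · refine (hγe _ _).trans ?_
    rw [xi_mul_xi_mul_dxi_dxi_univ hij, map_neg, topCoord_xiMono, if_pos rfl, Polynomial.C_neg,
      Polynomial.C_1, neg_one_mul]
  · have h0 : γ (kEmb 4 (xiMono I)) (kEmb 4 (xiMono J)) = 0 := by
      rw [hγe, topCoord_xiMono_mul hIJ, Polynomial.C_0, zero_mul]
    by_cases hI : I = Finset.univ <;> by_cases hJ : J = Finset.univ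
    · rw [hI, hJ] at h0 ⊢
      rw [k4'Gen_univ_coe, hγ.1, hγ.2.1, h0, mul_zero, mul_zero, neg_zero]
    · rw [hI] at h0 ⊢
      rw [k4'Gen_univ_coe, k4'Gen_coe J hJ, hγ.1, h0, mul_zero, neg_zero]
    · rw [hJ] at h0 ⊢
      rw [k4'Gen_univ_coe, k4'Gen_coe I hI, hγ.2.1, h0, mul_zero]
    · rw [k4'Gen_coe I hI, k4'Gen_coe J hJ, h0]

/-- The cocycles `α`, `β` parameterize the central extensions of `K_4'`. -/
theorem k4'Alg_parameterize : K4'Alg.IsLie ∧ ∃ α β : K4'Alg.twoCocycles, IsAlpha' α ∧ IsBeta' β ∧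
    ParameterizeCentralExtensions.{u} K4'Alg ![α, β] := by
  have h := kAlg_isKModel 4
  obtain ⟨γ, hγ⟩ := exists_isScaledAlpha 4
  obtain ⟨α, hα, hαγ⟩ := hγ.exists_cocycle_derived h
  obtain ⟨δ, hδ, hδe⟩ := exists_isBeta
  have hβ := restrictForm_mem (KAlg 4).derived_isSubalgebra hδ
  obtain ⟨e, θ, he, hθ, h'⟩ := h.exists_isK4'Model
  have hs := h'.isSuperconformal
  have hL : (e 1 : KSpace 4) = kEmb 4 (xiMono ∅) := by
    rw [he 0 (by norm_num) 1 one_mem_degPart, xiMono_empty]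
  have eL : e 1 = k4'Gen ∅ := Subtype.ext (by rw [hL, k4'Gen_coe ∅ (by decide)])
  have eθ : θ = k4'Gen Finset.univ := Subtype.ext (by rw [hθ, k4'Gen_univ_coe])
  have hA := isAlpha'_of_isScaledAlpha hγ ⟨α, hα⟩ hαγ
  have hB := isBeta'_of_form hδ hδe ⟨_, hβ⟩ fun a b => rfl
  have a1 : α (e 1) (e 1) = alphaPoly 0 := by
    rw [eL]; exact hA.1 ∅ (by decide)
  have a2 : α (e 1) θ = 0 := by
    rw [eL, eθ]; exact hA.2.2 ∅ Finset.univ (by decide)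
  have b1 : restrictForm δ (KAlg 4).derived (e 1) (e 1) = 0 := by
    rw [eL]; exact hB.2.2.2 ∅ ∅ (by decide)
  have b2 : restrictForm δ (KAlg 4).derived (e 1) θ = .X ^ 2 := by
    rw [eL, eθ]
    refine hB.1.trans ?_
    norm_num
  have h12 : ∀ κ : LambdaForm (KAlg 4).derived, ∀ b, κ ((12 : ℂ) • e 1) b = (12 : ℂ) • κ (e 1) b :=
    fun κ b => by rw [map_smul, LinearMap.smul_apply]
  refine ⟨hs.isLie, ⟨α, hα⟩, ⟨_, hβ⟩, hA, hB, IsClassification.parameterize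
    -- The coefficient of `λ^3` at `(12·1, 1)` detects `α` and that of `λ^2` at `(1, θ)` detects
    -- `β`. Each vanishes on the other cocycle and on coboundaries, which are linear in `λ` at these
    -- arguments.
    (a := ![(12 : ℂ) • e 1, e 1]) (b := ![e 1, θ]) (n := ![3, 2]) ?_ hs.isLie⟩
  have m1 := hs.mem_L
  have mc : ∀ n : ℕ, n ≠ 1 → ∀ κ ∈ K4'Alg.twoCoboundaries, (κ (e 1) (e 1)).coeff n = 0 ∧
      (κ (e 1) θ).coeff n = 0 := fun n hn κ hκ =>
    ⟨coeff_coboundary_of_primary hκ hs.primary_L hn,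
      coeff_coboundary_of_primary hκ h'.primary_theta hn⟩
  refine ⟨Fin.forall_fin_two.2 ⟨?_, m1⟩, Fin.forall_fin_two.2 ⟨m1, h'.theta_mem_parity⟩,
    Fin.forall_fin_two.2 ⟨?_, ?_⟩, Fin.forall_fin_two.2 ⟨?_, ?_⟩, ?_, ?_, hs.perfect, ?_⟩
  · have := Submodule.smul_mem _ (.C 12 : ℂ[X]) m1
    rw [C_smul_eq] at this
    exact this
  · intro i j hij x hx y hy
    refine mul_left_cancel₀ (Polynomial.X_ne_zero (R := ℂ)) ((hαγ _ _).trans ?_)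
    rw [mul_zero]
    exact hγ.even h hij hx hy
  · intro i j hij x hx y hy
    refine form_eq_zero_of_span hδ.1 hδ.2.1 ?_ (h.parity_le_span i hx) (h.parity_le_span j hy)
    rintro _ ⟨A, ⟨m, rfl, hA⟩, rfl⟩ _ ⟨B, ⟨n, rfl, hB⟩, rfl⟩
    rw [hδe, topCoord_eq_zero (mul_mem_degPart hA hB), Polynomial.C_0, zero_mul]
    intro hmn
    refine hij ?_
    rw [← Nat.cast_add, hmn]
    rfl
  · change (α ((12 : ℂ) • e 1) (e 1)).coeff 3 = 1
    rw [h12, a1]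
    norm_num [alphaPoly, Nat.factorial]
  · change (restrictForm δ (KAlg 4).derived (e 1) θ).coeff 2 = 1
    rw [b2]
    simp
  · refine Fin.forall_fin_two.2 ⟨Fin.forall_fin_two.2 ⟨fun h => absurd rfl h, fun _ => ?_⟩,
      Fin.forall_fin_two.2 ⟨fun _ => ?_, fun h => absurd rfl h⟩⟩
    · change (restrictForm δ (KAlg 4).derived ((12 : ℂ) • e 1) (e 1)).coeff 3 = 0
      rw [h12, b1]
      simp
    · change (α (e 1) θ).coeff 2 = 0
      rw [a2]
      simp
  · refine fun κ hκ => Fin.forall_fin_two.2 ⟨?_, (mc 2 (by norm_num) κ hκ).2⟩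
    change (κ ((12 : ℂ) • e 1) (e 1)).coeff 3 = 0
    rw [h12, Polynomial.coeff_smul, (mc 3 (by norm_num) κ hκ).1, smul_zero]
  · intro κ hκ h0
    have h3 : (κ ((12 : ℂ) • e 1) (e 1)).coeff 3 = 0 := h0 0
    rw [h12, Polynomial.coeff_smul, smul_eq_mul] at h3
    exact h'.mem_coboundaries hκ ((mul_eq_zero.1 h3).resolve_left (by norm_num)) (h0 1)

end Classification

/-! ### The Hodge star operator. -/

section Hodge

variable {N : ℕ}

/-- The iterated contraction: `contrBy n (ξ_{i_1} ⋯ ξ_{i_r}) = ∂_{i_r} ⋯ ∂_{i_1} n`. -/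
def contrBy (N : ℕ) : Grassmann N →ₗ[ℂ] Grassmann N →ₗ[ℂ] Grassmann N :=
  CliffordAlgebra.foldl (0 : QuadraticForm ℂ (Fin N → ℂ))
    (CliffordAlgebra.contractLeft ∘ₗ (Pi.basisFun ℂ (Fin N)).toDual)
    fun m x => by simp [CliffordAlgebra.contractLeft_contractLeft]

lemma contractLeft_toDual_single (i : Fin N) (x : Grassmann N) :
    CliffordAlgebra.contractLeft (Q := (0 : QuadraticForm ℂ (Fin N → ℂ)))
      ((Pi.basisFun ℂ (Fin N)).toDual (Pi.single i 1)) x = dxi i x := by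
  have : (Pi.basisFun ℂ (Fin N)).toDual (Pi.single i 1) = LinearMap.proj i := by
    refine (Pi.basisFun ℂ (Fin N)).ext fun j => ?_
    rw [← Pi.basisFun_apply, Module.Basis.toDual_apply, Pi.basisFun_apply, LinearMap.proj_apply,
      Pi.single_apply]
  rw [this]
  rfl

lemma contrBy_mul (n A B : Grassmann N) : contrBy N n (A * B) = contrBy N (contrBy N n A) B :=
  CliffordAlgebra.foldl_mul _ _ _ _ _ _

lemma contrBy_xi (n : Grassmann N) (i : Fin N) : contrBy N n (xi i) = dxi i n :=
  (CliffordAlgebra.foldl_ι _ _ _ _ _).trans (contractLeft_toDual_single i n)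

lemma contrBy_one (n : Grassmann N) : contrBy N n 1 = n :=
  CliffordAlgebra.foldl_one _ _ _ _

lemma contrBy_xiMono_self (I : Finset (Fin N)) : contrBy N (xiMono I) (xiMono I) = 1 := by
  induction I using Finset.induction_on_min with
  | empty => rw [xiMono_empty, contrBy_one]
  | insert i I hi ih =>
    rw [xiMono_insert hi, contrBy_mul, contrBy_xi, dxi_xi_mul, if_pos rfl,
      dxi_xiMono_of_notMem fun h => lt_irrefl _ (hi i h), mul_zero, sub_zero, ih]

/-- The Hodge star operator `A ↦ A^*`. -/
def hodge (N : ℕ) : Grassmann N →ₗ[ℂ] Grassmann N := contrBy N (xiMono Finset.univ)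

lemma hodge_one : hodge N 1 = xiMono Finset.univ := contrBy_one _

lemma hodge_univ : hodge N (xiMono Finset.univ) = 1 := contrBy_xiMono_self _

lemma hodge_mul_xi (A : Grassmann N) (i : Fin N) : hodge N (A * xi i) = dxi i (hodge N A) := by
  rw [hodge, contrBy_mul, contrBy_xi]

/-- Replaces the recursion over the sorted index list by a linear operator on `Λ(N)`, for which
induction on degree is available. -/
lemma hodgeStar_eq (I : Finset (Fin N)) : hodgeStar I = hodge N (xiMono I) := by
  rw [xiMono_eq_prod, hodge, hodgeStar]
  generalize I.sort (· ≤ ·) = l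
  generalize xiMono Finset.univ = n
  induction l generalizing n with
  | nil => rw [List.foldl_nil, List.map_nil, List.prod_nil, contrBy_one]
  | cons i l ih => rw [List.foldl_cons, ih, List.map_cons, List.prod_cons, contrBy_mul, contrBy_xi]

variable {r : ℕ} {A : Grassmann N}

lemma dxi_hodge (i : Fin N) (hA : A ∈ degPart N r) :
    dxi i (hodge N A) = (-1 : ℂ) ^ r • hodge N (xi i * A) := by
  have := (IsGraded.of_degPart hA).mul_xi i 1
  rw [mul_one, mul_one] at this
  rw [← hodge_mul_xi, this, map_smul]

lemma hodge_xi_mul (i : Fin N) (hA : A ∈ degPart N r) :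
    hodge N (xi i * A) = (-1 : ℂ) ^ r • dxi i (hodge N A) := by
  rw [dxi_hodge i hA, smul_smul, ← mul_pow]
  norm_num

/-- The star exchanges `∂_i` and multiplication by `ξ_i` up to sign. The induction starts from `ξ_i`
times the top monomial, which is zero. -/
lemma xi_mul_hodge (i : Fin N) (hA : A ∈ degPart N r) :
    xi i * hodge N A = -(-1 : ℂ) ^ r • hodge N (dxi i A) := by
  induction r generalizing A with
  | zero =>
    rw [dxi_of_mem_degPart_zero i hA, map_zero, smul_zero]
    rw [degPart, pow_zero] at hA
    obtain ⟨z, rfl⟩ := Submodule.mem_one.1 hA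
    rw [Algebra.algebraMap_eq_smul_one, map_smul, hodge_one, mul_smul_comm,
      degPart_eq_zero N.lt_succ_self (xi_mul_mem_degPart i
        (by simpa using xiMono_mem_degPart (Finset.univ : Finset (Fin N)))), smul_zero]
  | succ n ih =>
    refine degPart_succ_induction (motive := fun A => xi i * hodge N A =
      -(-1 : ℂ) ^ (n + 1) • hodge N (dxi i A)) (fun j y hy => ?_) (by simp)
      (fun x y hx hy => ?_) (fun z x hx => ?_) hA
    · have h1 : xi i * dxi j (hodge N y) = (if i = j then hodge N y else 0) -
          dxi j (xi i * hodge N y) := by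
        rw [dxi_xi_mul, sub_sub_eq_add_sub, eq_sub_iff_add_eq, add_comm]
        simp only [eq_comm]
      have h2 : hodge N (xi j * dxi i y) = -(-1 : ℂ) ^ n • dxi j (hodge N (dxi i y)) := by
        rcases n with _ | n
        · rw [dxi_of_mem_degPart_zero i hy]
          simp
        · rw [hodge_xi_mul j (dxi_mem_degPart i hy), pow_succ, Nat.add_sub_cancel]
          simp
      rw [hodge_xi_mul j hy, mul_smul_comm, h1, ih hy, dxi_xi_mul, map_sub (hodge N), h2, map_smul]
      simp only [pow_succ]
      split_ifs <;> simp [smul_smul, ← mul_pow]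
    · rw [map_add, mul_add, hx, hy, map_add, map_add, smul_add]
    · rw [map_smul, mul_smul_comm, hx, map_smul, map_smul, smul_comm]

lemma hodge_mem_degPart (hr : r ≤ N) (hA : A ∈ degPart N r) : hodge N A ∈ degPart N (N - r) := by
  induction r generalizing A with
  | zero =>
    rw [degPart, pow_zero] at hA
    obtain ⟨z, rfl⟩ := Submodule.mem_one.1 hA
    rw [Algebra.algebraMap_eq_smul_one, map_smul, hodge_one]
    refine Submodule.smul_mem _ _ ?_
    simpa using xiMono_mem_degPart (Finset.univ : Finset (Fin N))
  | succ n ih =>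
    refine degPart_succ_induction (motive := fun A => hodge N A ∈ degPart N (N - (n + 1)))
      (fun i y hy => ?_) (by rw [map_zero]; exact zero_mem _)
      (fun x y hx hy => by rw [map_add]; exact add_mem hx hy)
      (fun z x hx => by rw [map_smul]; exact Submodule.smul_mem _ _ hx) hA
    rw [hodge_xi_mul i hy, ← Nat.sub_sub]
    exact Submodule.smul_mem _ _ (dxi_mem_degPart i (ih (by omega) hy))

/-- Exchanging `ξ_i` for `∂_i` and back costs the sign `-(-1)^N` for each factor. For `N = 6` this
is `-1`, so the square is `-1` in degree three. -/
lemma hodge_hodge (hr : r ≤ N) (hA : A ∈ degPart N r) :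
    hodge N (hodge N A) = (-(-1 : ℂ) ^ N) ^ r • A := by
  induction r generalizing A with
  | zero =>
    rw [degPart, pow_zero] at hA
    obtain ⟨z, rfl⟩ := Submodule.mem_one.1 hA
    rw [Algebra.algebraMap_eq_smul_one, map_smul, hodge_one, map_smul, hodge_univ, pow_zero,
      one_smul]
  | succ n ih =>
    refine degPart_succ_induction (motive := fun A => hodge N (hodge N A) =
      (-(-1 : ℂ) ^ N) ^ (n + 1) • A) (fun i y hy => ?_) (by simp)
      (fun x y hx hy => by rw [map_add, map_add, hx, hy, smul_add])
      (fun z x hx => by rw [map_smul, map_smul, hx, smul_comm]) hA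
    have h1 := xi_mul_hodge i (hodge_mem_degPart (by omega) hy)
    have h2 : (-1 : ℂ) ^ N = (-1) ^ n * (-1) ^ (N - n) := by rw [← pow_add]; congr 1; omega
    have h3 : ((-1 : ℂ) ^ (N - n)) * (-1) ^ (N - n) = 1 := by rw [← mul_pow]; norm_num
    rw [ih (by omega) hy, mul_smul_comm] at h1
    rw [hodge_xi_mul i hy, map_smul, pow_succ, mul_comm, mul_smul, h1, smul_smul, h2]
    congr 1
    linear_combination -(-1 : ℂ) ^ n * h3

end Hodge

section Hodge

variable {N r : ℕ} {A : Grassmann N}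

lemma hodge_xi (i : Fin N) : hodge N (xi i) = dxi i (xiMono Finset.univ) := by
  rw [hodge, contrBy_xi]

lemma xiMono_univ_mem_degPart : xiMono (Finset.univ : Finset (Fin N)) ∈ degPart N N := by
  simpa using xiMono_mem_degPart (Finset.univ : Finset (Fin N))

lemma hodge_xi_mem_degPart (i : Fin N) : hodge N (xi i) ∈ degPart N (N - 1) := by
  rw [hodge_xi]
  exact dxi_mem_degPart i xiMono_univ_mem_degPart

lemma univ_mul_eq_zero (hr : 0 < r) (hA : A ∈ degPart N r) : xiMono Finset.univ * A = 0 :=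
  degPart_eq_zero (by omega) (mul_mem_degPart xiMono_univ_mem_degPart hA)

/-- For `r + s = N + 2` the contraction would lie in the top degree, where derivatives vanish;
beyond that the degree is too large. -/
lemma contr_eq_zero_of_le {s : ℕ} {B : Grassmann N} (hA : A ∈ degPart N r) (hB : B ∈ degPart N s)
    (h : N + 2 ≤ r + s) : contr A B = 0 := by
  have hc := contr_mem_degPart hA hB
  rcases h.eq_or_lt with h | h
  · exact contr_eq_zero hA hB (by rwa [← h, Nat.add_sub_cancel] at hc)
  · exact degPart_eq_zero (by omega) hc

lemma contr_univ_xi (hA : A ∈ degPart N 1) : contr (xiMono Finset.univ) A = hodge N A := by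
  refine degPart_one_induction (motive := fun A => contr (xiMono Finset.univ) A = hodge N A)
    (fun k => ?_) (by simp [contr]) (fun x y hx hy => by rw [contr_add_right, hx, hy, map_add])
    (fun z x hx => by rw [contr_smul_right, hx, map_smul]) hA
  have := contr_xi_mul_right k (xiMono Finset.univ) 1
  rw [mul_one, mul_one, contr_one_right, mul_zero, add_zero] at this
  rw [this, hodge_xi]

lemma contr_hodge_xi (i : Fin N) (hA : A ∈ degPart N 1) :
    contr (hodge N (xi i)) A = hodge N (xi i * A) := by
  refine degPart_one_induction (motive := fun A => contr (hodge N (xi i)) A = hodge N (xi i * A))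
    (fun k => ?_) (by simp [contr]) (fun x y hx hy => by rw [contr_add_right, hx, hy, mul_add, map_add])
    (fun z x hx => by rw [contr_smul_right, hx, mul_smul_comm, map_smul]) hA
  have := contr_xi_mul_right k (hodge N (xi i)) 1
  rw [mul_one, mul_one, contr_one_right, mul_zero, add_zero] at this
  rw [this, hodge_mul_xi]

lemma hodge_xi_mul_of_mem (hN : Even N) (i : Fin N) (hA : A ∈ degPart N 1) :
    hodge N (xi i) * A = -hodge N (dxi i A) := by
  refine degPart_one_induction (motive := fun A => hodge N (xi i) * A = -hodge N (dxi i A))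
    (fun k => ?_) (by simp) (fun x y hx hy => by rw [mul_add, hx, hy, map_add, map_add, neg_add])
    (fun z x hx => by rw [mul_smul_comm, hx, map_smul, map_smul, smul_neg]) hA
  have h1 := (IsGraded.of_degPart (hodge_xi_mem_degPart i)).mul_xi k 1
  have h2 : (-1 : ℂ) ^ (N - 1) = -1 := by
    have : N ≠ 0 := fun h => (h ▸ i).elim0
    exact (Nat.Even.sub_odd (by omega) hN odd_one).neg_one_pow
  rw [mul_one, mul_one, h2, xi_mul_hodge k (xi_mem_degPart i)] at h1
  rw [h1, dxi_xi, dxi_xi]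
  simp [eq_comm]

/-- By linearity `A = ξ_k ξ_l`. Moving all factors through the star leaves stars of elements of
degree one, compared according to the coincidences among `i`, `k`, `l`. -/
lemma contr_hodge_xi_two (hN : Even N) (i : Fin N) (hA : A ∈ degPart N 2) :
    contr (hodge N (xi i)) A = hodge N (dxi i A) := by
  have h2 : (-1 : ℂ) ^ (N - 1) = -1 := by
    have : N ≠ 0 := fun h => (h ▸ i).elim0
    exact (Nat.Even.sub_odd (by omega) hN odd_one).neg_one_pow
  have hu := (IsGraded.of_degPart (hodge_xi_mem_degPart i)).gradeInv
  rw [h2, neg_one_smul] at hu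
  refine degPart_succ_induction (motive := fun A => contr (hodge N (xi i)) A = hodge N (dxi i A))
    (fun k y hy => ?_) (by simp [contr]) (fun x y hx hy => by rw [contr_add_right, hx, hy, map_add, map_add])
    (fun z x hx => by rw [contr_smul_right, hx, map_smul, map_smul]) hA
  have hik := mul_mem_degPart (xi_mem_degPart i) (xi_mem_degPart k)
  rw [contr_xi_mul_right, hu, contr_neg_left, contr_hodge_xi i hy, mul_neg,
    xi_mul_hodge k (mul_mem_degPart (xi_mem_degPart i) hy), ← hodge_mul_xi]
  refine degPart_one_induction (motive := fun y => hodge N (xi i * xi k) * y +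
      -(-(-1 : ℂ) ^ (1 + 1) • hodge N (dxi k (xi i * y))) = hodge N (dxi i (xi k * y)))
    (fun l => ?_) (by simp) (fun x y hx hy => ?_) (fun z x hx => ?_) hy
  · by_cases hN2 : N = 1
    · subst hN2
      exact absurd hN (by decide)
    have h3 := (IsGraded.of_degPart (hodge_mem_degPart (by have := i.isLt; omega) hik)).mul_xi l 1
    have h4 : (-1 : ℂ) ^ (N - (1 + 1)) = 1 := ((Nat.even_sub (by have := i.isLt; omega)).2 (by simp [hN])).neg_one_pow
    rw [mul_one, mul_one, h4, one_smul, xi_mul_hodge l hik] at h3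
    rw [h3, dxi_xi_mul, dxi_xi_mul, dxi_xi_mul, dxi_xi, dxi_xi, dxi_xi]
    rcases eq_or_ne k i with rfl | h1 <;> rcases eq_or_ne l k with rfl | h2
    · simp
    · simp [h2, h2.symm]
    · simp [h1, h1.symm]
    · rcases eq_or_ne l i with rfl | h5
      · simp [h1, h1.symm]
      · simp [h1, h1.symm, h2, h2.symm, h5, h5.symm]
  · rw [mul_add, mul_add, mul_add, map_add (dxi k), map_add (dxi i), map_add (hodge N),
      map_add (hodge N), ← hx, ← hy]
    module
  · rw [mul_smul_comm, mul_smul_comm, mul_smul_comm, map_smul (dxi k), map_smul (dxi i),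
      map_smul (hodge N), map_smul (hodge N), ← hx]
    module

end Hodge

/-- The scalars in the generators `A + c_r ∂ ^ (3 - r) A^*` of `CK_6`. -/
def ck6Coeff (r : ℕ) : ℂ := -(Complex.I * (-1) ^ (r * (r + 1) / 2) * (-1) ^ (3 - r))

/-! ### The generators of `CK_6` and their brackets with `1` and `ξ_i`. -/

section

variable {R : Type*} [AddCommGroup R] [Module ℂ R] [Module ℂ[X] R] [IsScalarTower ℂ ℂ[X] R]

/-- `ε` is the map `A ↦ A + c_r ∂ ^ (3 - r) A^*` in degrees `r ≤ 3`, and zero in higher degrees. -/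
structure IsCK6Emb (e ε : Grassmann 6 →ₗ[ℂ] R) : Prop where
  low : ∀ r ≤ 3, ∀ A ∈ degPart 6 r,
    ε A = e A + (.C (ck6Coeff r) * .X ^ (3 - r) : ℂ[X]) • e (hodge 6 A)
  high : ∀ r > 3, ∀ A ∈ degPart 6 r, ε A = 0

lemma exists_isCK6Emb (e : Grassmann 6 →ₗ[ℂ] R) : ∃ ε, IsCK6Emb e ε := by
  choose P hP using fun r : ℕ => exists_degree_operator 6 fun m => if m = r then 1 else 0
  let F : ℕ → Grassmann 6 →ₗ[ℂ] R := fun r =>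
    e + Algebra.lsmul ℂ ℂ R (.C (ck6Coeff r) * .X ^ (3 - r) : ℂ[X]) ∘ₗ e ∘ₗ hodge 6
  have key : ∀ r, ∀ A ∈ degPart 6 r, (∑ s ∈ Finset.range 4, F s ∘ₗ P s) A =
      if r ∈ Finset.range 4 then F r A else 0 := fun r A hA => by
    rw [LinearMap.sum_apply]
    simp only [LinearMap.comp_apply, hP _ r A hA, ite_smul, one_smul, zero_smul, apply_ite (F _),
      map_zero]
    exact Finset.sum_ite_eq _ r _
  refine ⟨∑ s ∈ Finset.range 4, F s ∘ₗ P s, fun r hr A hA => ?_, fun r hr A hA => ?_⟩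
  · rw [key r A hA, if_pos (Finset.mem_range.2 (by omega))]
    rfl
  · rw [key r A hA, if_neg (by simpa using Nat.succ_le_of_lt hr)]

namespace IsCK6Emb

variable {D : ConformalData R} {e ε : Grassmann 6 →ₗ[ℂ] R} {r : ℕ} {A : Grassmann 6}

open ConformalData

lemma apply_zero (hε : IsCK6Emb e ε) :
    ε 1 = e 1 + (.C Complex.I * .X ^ 3 : ℂ[X]) • e (xiMono Finset.univ) := by
  rw [hε.low 0 (by norm_num) _ one_mem_degPart, hodge_one]
  norm_num [ck6Coeff, Odd.neg_pow (show Odd 3 by decide)]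

lemma apply_one (hε : IsCK6Emb e ε) (hA : A ∈ degPart 6 1) :
    ε A = e A + (.C Complex.I * .X ^ 2 : ℂ[X]) • e (hodge 6 A) := by
  rw [hε.low 1 (by norm_num) _ hA]
  norm_num [ck6Coeff]

lemma apply_two (hε : IsCK6Emb e ε) (hA : A ∈ degPart 6 2) :
    ε A = e A + (.C (-Complex.I) * .X : ℂ[X]) • e (hodge 6 A) := by
  rw [hε.low 2 (by norm_num) _ hA]
  norm_num [ck6Coeff, Odd.neg_pow (show Odd 3 by decide)]

lemma apply_three (hε : IsCK6Emb e ε) (hA : A ∈ degPart 6 3) :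
    ε A = e A + (.C (-Complex.I) : ℂ[X]) • e (hodge 6 A) := by
  rw [hε.low 3 (by norm_num) _ hA]
  norm_num [ck6Coeff]

/-- `A^*` and `A` give proportional generators in degree three. -/
lemma hodge_three (hε : IsCK6Emb e ε) (hA : A ∈ degPart 6 3) :
    ε (hodge 6 A) = Complex.I • ε A := by
  rw [hε.apply_three (hodge_mem_degPart (by norm_num) hA), hε.apply_three hA,
    hodge_hodge (by norm_num) hA, map_smul e, C_smul_eq, C_smul_eq, smul_add, smul_smul, smul_smul]
  norm_num
  abel

/-- The generators of `CK_6` are primary. -/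
lemma isPrimary (hε : IsCK6Emb e ε) (h : IsKModel D e) (hr : r ≤ 3) (hA : A ∈ degPart 6 r) :
    D.IsPrimary (ε 1) (2 - r / 2) (ε A) := fun z => by
  have hw := xiMono_univ_mem_degPart (N := 6)
  have gw := IsGraded.of_degPart hw
  have gA := IsGraded.of_degPart hA
  have hs := hodge_mem_degPart (by omega) hA
  have gs := IsGraded.of_degPart hs
  -- The two dual terms have total degree at least `9`: their product and contraction vanish.
  have e1 : D.brk (.C z) (e (xiMono Finset.univ)) (e (hodge 6 A)) = 0 := by
    rw [h.brk_emb_graded _ gw gs, univ_mul_eq_zero (by omega) hs,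
      contr_eq_zero_of_le hw hs (by omega)]
    simp
  have e2 : ∀ f g : ℂ[X], ∀ a b, D.brk (.C z) (f • a) (g • b) = _ := h.brk_smul_smul (.C z)
  rw [hε.apply_zero, hε.low r hr A hA, brk_add_left, brk_add_right, brk_add_right, e2, e1,
    smul_zero, add_zero, h.brk_smul_left, h.brk_smul_right, h.brk_one_graded _ gA,
    h.brk_one_graded _ gs, h.brk_emb_graded _ gw gA]
  rw [← C_smul_eq (_ / 2 : ℂ), ← C_smul_eq (z * _)]
  interval_cases r
  · rw [degPart, pow_zero] at hA
    obtain ⟨c, rfl⟩ := Submodule.mem_one.1 hA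
    rw [Algebra.algebraMap_eq_smul_one, contr_smul_right, contr_one_right, mul_smul_comm, mul_one,
      map_smul (hodge 6), hodge_one, smul_zero, map_zero e, map_smul e, map_smul e]
    generalize e 1 = x
    generalize e (xiMono Finset.univ) = y
    match_scalars <;> refine Polynomial.funext fun t => ?_ <;> simp [ck6Coeff] <;> ring_nf
  · rw [contr_univ_xi hA, univ_mul_eq_zero one_pos hA]
    simp only [map_zero, smul_zero, zero_add]
    generalize e A = x
    generalize e (hodge 6 A) = y
    match_scalars <;> refine Polynomial.funext fun t => ?_ <;> simp [ck6Coeff] <;> ring_nf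
  · rw [contr_eq_zero_of_le hw hA (by norm_num), univ_mul_eq_zero two_pos hA]
    simp only [map_zero, smul_zero, add_zero]
    generalize e A = x
    generalize e (hodge 6 A) = y
    match_scalars <;> refine Polynomial.funext fun t => ?_ <;> simp [ck6Coeff] <;> ring_nf
  · rw [contr_eq_zero_of_le hw hA (by norm_num), univ_mul_eq_zero three_pos hA]
    simp only [map_zero, smul_zero, add_zero]
    generalize e A = x
    generalize e (hodge 6 A) = y
    match_scalars <;> refine Polynomial.funext fun t => ?_ <;> simp [ck6Coeff] <;> ring_nf

/-- Of the four terms of the bilinear expansion, the one between the two dual parts vanishes by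
degree; the duals of `ξ_i A` and `∂_i A` appear by commuting `∂_i` and `ξ_i` with the star. -/
lemma brk_xi_expand (hε : IsCK6Emb e ε) (h : IsKModel D e) (hr : r ≤ 3) (hA : A ∈ degPart 6 r)
    (i : Fin 6) (z : ℂ) : D.brk (.C z) (ε (xi i)) (ε A) =
      ((.C ((r - 3) / 2) * .C z - .C (1 / 2) * .X : ℂ[X]) • e (xi i * A)
        - (.C (1 / 2) : ℂ[X]) • e (dxi i A)) +
      (.C (ck6Coeff r) * (.X + .C z) ^ (3 - r) : ℂ[X]) •
        ((.C ((3 - r) / 2) * .C z - .C (1 / 2) * .X : ℂ[X]) • e (-(-1 : ℂ) ^ r • hodge 6 (dxi i A))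
        - (.C (1 / 2) : ℂ[X]) • e ((-1 : ℂ) ^ r • hodge 6 (xi i * A))) +
      (.C (Complex.I * z ^ 2) : ℂ[X]) •
        ((.C (3 / 2) * .X + .C ((r + 1) / 2) * .C z : ℂ[X]) • e (hodge 6 (xi i) * A)
        - (.C (1 / 2) : ℂ[X]) • e (contr (hodge 6 (xi i)) A)) := by
  have hu := hodge_xi_mem_degPart (N := 6) i
  have gu := IsGraded.of_degPart hu
  have gA := IsGraded.of_degPart hA
  have hs := hodge_mem_degPart (by omega) hA
  have gs := IsGraded.of_degPart hs
  have e1 : D.brk (.C z) (e (hodge 6 (xi i))) (e (hodge 6 A)) = 0 := by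
    rw [h.brk_emb_graded _ gu gs, contr_eq_zero_of_le hu hs (by omega),
      degPart_eq_zero (by omega) (mul_mem_degPart hu hs)]
    simp
  have e2 : ∀ f g : ℂ[X], ∀ a b, D.brk (.C z) (f • a) (g • b) = _ := h.brk_smul_smul (.C z)
  rw [hε.apply_one (xi_mem_degPart i), hε.low r hr A hA, brk_add_left, brk_add_right, brk_add_right,
    e2, e1, smul_zero, add_zero, h.brk_smul_left, h.brk_smul_right, h.brk_xi_graded _ _ gA,
    h.brk_xi_graded _ _ gs, h.brk_emb_graded _ gu gA, dxi_hodge i hA, xi_mul_hodge i hA,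
    ← C_smul_eq (1 / 2 : ℂ), ← C_smul_eq (1 / 2 : ℂ), ← C_smul_eq (_ / 2 : ℂ)]
  have c1 : (((6 - r : ℕ) : ℂ) - 3) / 2 = (3 - r) / 2 := by
    rw [Nat.cast_sub (by omega)]
    push_cast
    ring
  have c2 : (((6 - 1 : ℕ) : ℂ) / 2 - 1) = 3 / 2 := by norm_num
  have c3 : (((6 - 1 : ℕ) : ℂ) + r) / 2 - 2 = (r + 1) / 2 := by
    norm_num
    ring
  have c4 : (-1 : ℂ) ^ (6 - 1) / 2 = -(1 / 2) := by norm_num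
  rw [c1, c2, c3, c4, Polynomial.C_neg, neg_smul (.C (1 / 2) : ℂ[X]), ← sub_eq_add_neg]
  congr 2
  · simp
  · simp

/-- The bracket of `ξ_i` with a generator of degree at most two. -/
lemma brk_xi (hε : IsCK6Emb e ε) (h : IsKModel D e) (hr : r ≤ 2) (hA : A ∈ degPart 6 r)
    (i : Fin 6) (z : ℂ) : D.brk (.C z) (ε (xi i)) (ε A) =
      (.C ((r - 3) / 2) * .C z - .C (1 / 2) * .X : ℂ[X]) • ε (xi i * A)
        - (.C (1 / 2) : ℂ[X]) • ε (dxi i A) := by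
  have hN : Even 6 := by decide
  rw [hε.brk_xi_expand h (by omega) hA, hε.low _ (by omega) _ (xi_mul_mem_degPart i hA),
    hε.low _ (by omega) _ (dxi_mem_degPart i hA), map_smul e, map_smul e, ← C_smul_eq,
    ← C_smul_eq]
  interval_cases r
  · rw [degPart, pow_zero] at hA
    obtain ⟨c, rfl⟩ := Submodule.mem_one.1 hA
    rw [Algebra.algebraMap_eq_smul_one, contr_smul_right, contr_one_right, mul_smul_comm, mul_one,
      mul_smul_comm, mul_one, map_smul (dxi i), dxi_one, smul_zero, map_zero (hodge 6),
      map_zero e, map_smul (hodge 6), map_smul e, map_smul e]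
    generalize e (xi i) = x
    generalize e (hodge 6 (xi i)) = y
    match_scalars <;> refine Polynomial.funext fun t => ?_ <;> simp [ck6Coeff] <;> ring_nf
  · rw [hodge_xi_mul_of_mem hN i hA, contr_hodge_xi i hA, map_neg e]
    generalize e (xi i * A) = x
    generalize e (hodge 6 (xi i * A)) = x'
    generalize e (dxi i A) = y
    generalize e (hodge 6 (dxi i A)) = y'
    match_scalars <;> refine Polynomial.funext fun t => ?_ <;> simp [ck6Coeff] <;> ring_nf
  · rw [contr_hodge_xi_two hN i hA, degPart_eq_zero (by norm_num)
      (mul_mem_degPart (hodge_xi_mem_degPart i) hA), map_zero e]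
    generalize e (xi i * A) = x
    generalize e (hodge 6 (xi i * A)) = x'
    generalize e (dxi i A) = y
    generalize e (hodge 6 (dxi i A)) = y'
    match_scalars <;> refine Polynomial.funext fun t => ?_ <;> simp [ck6Coeff] <;> ring_nf

/-- The bracket of `ξ_i` with a generator of degree three. -/
lemma brk_xi_three (hε : IsCK6Emb e ε) (h : IsKModel D e) (hA : A ∈ degPart 6 3)
    (i : Fin 6) (z : ℂ) : D.brk (.C z) (ε (xi i)) (ε A) =
      (.C (-(Complex.I / 2)) : ℂ[X]) • ε (hodge 6 (xi i * A))
        - (.C (1 / 2) : ℂ[X]) • ε (dxi i A) := by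
  have hiA := xi_mul_mem_degPart i hA
  have h2 := hodge_mem_degPart (by norm_num) hiA
  have hu := hodge_xi_mem_degPart (N := 6) i
  -- The element `ξ_i A` has degree four and no generator of its own. Since its double star is
  -- itself, `∂(ξ_i A)` is supplied by the generator attached to its star, of degree two.
  rw [hε.brk_xi_expand h le_rfl hA, hε.apply_two h2, hε.apply_two (dxi_mem_degPart i hA),
    hodge_hodge (by norm_num) hiA, contr_eq_zero_of_le hu hA (by norm_num),
    degPart_eq_zero (by norm_num) (mul_mem_degPart hu hA), map_smul e, map_smul e, map_smul e,
    map_zero e, ← C_smul_eq, ← C_smul_eq, ← C_smul_eq]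
  generalize e (xi i * A) = x
  generalize e (hodge 6 (xi i * A)) = x'
  generalize e (dxi i A) = y
  generalize e (hodge 6 (dxi i A)) = y'
  match_scalars <;> refine Polynomial.funext fun t => ?_ <;> simp [ck6Coeff] <;> ring_nf
  rw [Complex.I_sq]
  ring

end IsCK6Emb

end

/-! ### Elements preserving a submodule. -/

namespace ConformalData

variable {R : Type*} [AddCommGroup R] [Module ℂ R] [Module ℂ[X] R] [IsScalarTower ℂ ℂ[X] R]
  {D : ConformalData R} {S : Submodule ℂ[X] R} {a : R}

/-- Left sesquilinearity shifts the coefficients of the bracket by one, so those of `[a_λ b]` all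
reappear, up to sign, in `[∂a_λ b]`. -/
lemma brk_mem_of_X_smul (hD : D.IsLie) {b : R} (h : ∀ z, D.brk (.C z) ((.X : ℂ[X]) • a) b ∈ S)
    (z : ℂ) : D.brk (.C z) a b ∈ S := by
  have e : D.bracket ((.X : ℂ[X]) • a) b =
      -(LinearMap.mulLeft ℂ (.X : ℂ[X])).rTensor R (D.bracket a b) := by
    refine ext_evalAt fun z => ?_
    rw [← brk_C, hD.sesq_left, brk_C, map_neg]
    generalize D.bracket a b = x
    congr 1
    induction x with
    | zero => simp
    | add x y hx hy => rw [map_add, smul_add, hx, hy, map_add, map_add]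
    | tmul f r => simp [evalAt_tmul, mul_smul]
  have e' : ∀ n, lambdaCoeff (n + 1) (D.bracket ((.X : ℂ[X]) • a) b) =
      -lambdaCoeff n (D.bracket a b) := fun n => by
    rw [e, map_neg]
    generalize D.bracket a b = x
    congr 1
    induction x with
    | zero => simp
    | add x y hx hy => rw [map_add, map_add, hx, hy, map_add]
    | tmul f r => simp [lambdaCoeff_tmul]
  refine (forall_nthProduct_mem_iff S a b).1 (fun n => ?_) z
  have := (forall_nthProduct_mem_iff S _ b).2 h (n + 1)
  rw [nthProduct_mem_iff, e', neg_mem_iff] at this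
  exact (nthProduct_mem_iff S n a b).2 this

/-- The elements mapping `S` to itself under all products with them on the left. -/
def Preserves (D : ConformalData R) (S : Submodule ℂ[X] R) (a : R) : Prop :=
  ∀ b ∈ S, ∀ z, D.brk (.C z) a b ∈ S

lemma preserves_of_span (hD : D.IsLie) {T : Set R} (hT : S = Submodule.span ℂ[X] T)
    (h : ∀ t ∈ T, ∀ z, D.brk (.C z) a t ∈ S) : D.Preserves S a := fun b hb z => by
  have hb' := hb
  rw [hT] at hb'
  refine span_polynomial_induction (motive := fun b => D.brk (.C z) a b ∈ S) (fun t ht => h t ht z)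
    (by rw [brk_zero_right]; exact zero_mem _)
    (fun x y hx hy => by rw [brk_add_right]; exact add_mem hx hy)
    (fun w x hx => by
      rw [ConformalData.brk_smul_right, ← C_smul_eq]; exact S.smul_mem _ hx)
    (fun x hx => by rw [hD.sesq_right]; exact S.smul_mem _ hx) hb'

lemma isSubalgebra_of_preserves (hD : D.IsLie) {T : Set R} (hT : S = Submodule.span ℂ[X] T)
    (h : ∀ t ∈ T, D.Preserves S t) : D.IsSubalgebra S := fun a ha b hb => by
  refine (forall_nthProduct_mem_iff S a b).2 fun z => ?_
  have ha' := ha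
  rw [hT] at ha'
  refine span_polynomial_induction (motive := fun a => D.brk (.C z) a b ∈ S)
    (fun t ht => h t ht b hb z)
    (by rw [brk_zero_left]; exact zero_mem _)
    (fun x y hx hy => by rw [brk_add_left]; exact add_mem hx hy)
    (fun w x hx => by
      rw [ConformalData.brk_smul_left, ← C_smul_eq]; exact S.smul_mem _ hx)
    (fun x hx => by rw [hD.sesq_left, ← C_smul_eq]; exact neg_mem (S.smul_mem _ hx)) ha'

/-- The Jacobi identity writes the action of `[a_0 b]` as a graded commutator of the actions of `a`
and `b`. -/
lemma Preserves.brk (hD : D.IsLie) {i j : ZMod 2} {b : R} (ma : a ∈ D.parity i)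
    (mb : b ∈ D.parity j) (ha : D.Preserves S a) (hb : D.Preserves S b) :
    D.Preserves S (D.brk (.C 0) a b) := fun c hc z => by
  have := hD.jacobi i j a ma b mb c 0 z
  rw [zero_add, ← sub_eq_iff_eq_add] at this
  rw [← this, ← C_smul_eq]
  exact sub_mem (ha _ (hb c hc z) 0) (S.smul_mem _ (hb _ (ha c hc 0) z))

end ConformalData

namespace IsCK6Emb

open ConformalData

variable {R : Type*} [AddCommGroup R] [Module ℂ R] [Module ℂ[X] R] [IsScalarTower ℂ ℂ[X] R]
  {D : ConformalData R} {e ε : Grassmann 6 →ₗ[ℂ] R} {S : Submodule ℂ[X] R} {r : ℕ}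
  {A : Grassmann 6}

lemma mem_parity (hε : IsCK6Emb e ε) (h : IsKModel D e) (hr : r ≤ 3) (hA : A ∈ degPart 6 r) :
    ε A ∈ D.parity r := by
  rw [hε.low r hr A hA]
  have h2 := h.emb_mem_parity_of_degPart (hodge_mem_degPart (by omega) hA)
  rw [show ((6 - r : ℕ) : ZMod 2) = r by interval_cases r <;> rfl] at h2
  exact add_mem (h.emb_mem_parity_of_degPart hA) (Submodule.smul_mem _ _ h2)

lemma X_smul_xi_mul (hε : IsCK6Emb e ε) (h : IsKModel D e) (hr : r ≤ 2) (hA : A ∈ degPart 6 r)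
    (i : Fin 6) : (.X : ℂ[X]) • ε (xi i * A) =
      -(2 : ℂ) • D.brk (.C 0) (ε (xi i)) (ε A) - ε (dxi i A) := by
  rw [hε.brk_xi h hr hA, ← C_smul_eq (-2 : ℂ)]
  match_scalars <;> refine Polynomial.funext fun t => ?_ <;> simp

lemma apply_mem (hε : IsCK6Emb e ε)
    (hS : S = Submodule.span ℂ[X] {x | ∃ n ≤ 3, ∃ B ∈ degPart 6 n, x = ε B}) (A : Grassmann 6) :
    ε A ∈ S := by
  have hA : A ∈ ⨆ n, degPart 6 n := by rw [iSup_degPart]; trivial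
  refine Submodule.iSup_induction _ (motive := fun A => ε A ∈ S) hA
    (fun n x hx => ?_) (by rw [map_zero]; exact zero_mem _)
    fun x y hx hy => by rw [map_add]; exact add_mem hx hy
  by_cases hn : n ≤ 3
  · rw [hS]
    exact Submodule.subset_span ⟨n, hn, x, hx, rfl⟩
  · rw [hε.high n (by omega) x hx]
    exact zero_mem _

/-- `CK_6` is a subalgebra of `K_6`. -/
theorem isSubalgebra (hε : IsCK6Emb e ε) (h : IsKModel D e)
    (hS : S = Submodule.span ℂ[X] {x | ∃ n ≤ 3, ∃ B ∈ degPart 6 n, x = ε B}) :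
    D.IsSubalgebra S := by
  have hmem := hε.apply_mem hS
  have h1 : D.Preserves S (ε 1) := by
    refine preserves_of_span h.isLie hS ?_
    rintro _ ⟨n, hn, B, hB, rfl⟩ z
    rw [hε.isPrimary h hn hB, ← C_smul_eq (z * _)]
    exact sub_mem (neg_mem (S.smul_mem _ (hmem B))) (S.smul_mem _ (hmem B))
  have hξ : ∀ i, D.Preserves S (ε (xi i)) := fun i => by
    refine preserves_of_span h.isLie hS ?_
    rintro _ ⟨n, hn, B, hB, rfl⟩ z
    rcases hn.lt_or_eq with hn | rfl
    · rw [hε.brk_xi h (by omega) hB]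
      exact sub_mem (S.smul_mem _ (hmem _)) (S.smul_mem _ (hmem _))
    · rw [hε.brk_xi_three h hB]
      exact sub_mem (S.smul_mem _ (hmem _)) (S.smul_mem _ (hmem _))
  -- Elements preserving `S` are closed under brackets and under division by `∂`, so it was enough
  -- to treat `1` and the `ξ_i`.
  have key := generation_of_xi (D := D) (fun n hn B hB => hε.mem_parity h hn hB)
    (fun n hn B hB i => hε.X_smul_xi_mul h hn hB i) (P := fun _ a => D.Preserves S a)
    (fun _ b _ z => by rw [brk_zero_left]; exact zero_mem _)
    (fun _ a b ha hb c hc z => by rw [brk_add_left]; exact add_mem (ha c hc z) (hb c hc z))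
    (fun _ w a ha c hc z => by
      rw [ConformalData.brk_smul_left, ← C_smul_eq]; exact S.smul_mem _ (ha c hc z))
    (fun _ a ha b hb => brk_mem_of_X_smul h.isLie (ha b hb)) h1
    (fun i j b mb hb => .brk h.isLie (by
      have := hε.mem_parity h (by norm_num) (xi_mem_degPart i)
      rwa [Nat.cast_one] at this) mb (hξ i) hb)
  refine isSubalgebra_of_preserves h.isLie hS ?_
  rintro _ ⟨n, hn, B, hB, rfl⟩
  exact key n hn n le_rfl B hB

end IsCK6Emb

/-! ### Cohomology of `CK_6`. -/

section CK6

open ConformalData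

variable {R : Type*} [AddCommGroup R] [Module ℂ R] [Module ℂ[X] R] [IsScalarTower ℂ ℂ[X] R]
  {D : ConformalData R} {ε : Grassmann 6 →ₗ[ℂ] R} {α : LambdaForm R} {r : ℕ}
  {B : Grassmann 6}

namespace ConformalData.IsSuperconformal

variable {ι : Type*} {L : R} {G : ι → R} {T : Set R} {j : ZMod 2} {b : R}

lemma coeff_one_form (h : IsSuperconformal D L G T) (hα : α ∈ D.twoCocycles)
    (h1 : ∀ t ∈ T, (α L t).coeff 1 = 0) (a : R) : (α L a).coeff 1 = 0 := by
  have ha : a ∈ Submodule.span ℂ[X] T := by rw [h.span_eq_top]; trivial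
  exact span_polynomial_induction (motive := fun a => (α L a).coeff 1 = 0) h1 (by simp)
    (fun x y hx hy => by simp [hx, hy]) (fun z x hx => by simp [hx])
    (fun x hx => by rw [hα.2.1, Polynomial.coeff_X_mul, h.coeff_zero_form hα]) ha

/-- For a normalised cocycle, `α_0(G_i, ·) = 0`. -/
lemma coeff_zero_form_G (h : IsSuperconformal D L G T) (hα : α ∈ D.twoCocycles)
    (h1 : ∀ t ∈ T, (α L t).coeff 1 = 0) (i : ι) (a : R) : (α (G i) a).coeff 0 = 0 := by
  have ha : a ∈ Submodule.span ℂ[X] T := by rw [h.span_eq_top]; trivial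
  refine span_polynomial_induction (motive := fun a => (α (G i) a).coeff 0 = 0) (fun t ht => ?_)
    (by simp) (fun x y hx hy => by simp [hx, hy]) (fun z x hx => by simp [hx])
    (fun x hx => by rw [hα.2.1, Polynomial.coeff_X_mul_zero]) ha
  obtain ⟨Δ, hΔ, hp⟩ := h.primary t ht
  have := congrArg (Polynomial.coeff · 1) (X_mul_primary hα h.mem_L (h.mem_G i) (h.primary_G i) hp)
  simp only [Polynomial.coeff_X_mul, Polynomial.coeff_add, Polynomial.coeff_C_zero,
    Polynomial.coeff_smul, h.coeff_one_form hα h1, smul_zero] at this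
  have h2 : (1 + 2 * Δ) * (α (G i) t).coeff 0 = 0 := by linear_combination this
  refine (mul_eq_zero.1 h2).resolve_left ?_
  rcases hΔ with rfl | rfl | rfl | rfl <;> norm_num

/-- For a normalised cocycle, `G_i` acts by skew-adjoint operators. -/
lemma form_brk_G (h : IsSuperconformal D L G T) (hα : α ∈ D.twoCocycles)
    (h1 : ∀ t ∈ T, (α L t).coeff 1 = 0) (i : ι) (hb : b ∈ D.parity j) (c : R) :
    α (D.brk (.C 0) (G i) b) c = -(koszulSign 1 j • α b (D.brk (.C 0) (G i) c)) := by
  refine Polynomial.funext fun w => ?_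
  have := hα.2.2.2 1 j _ (h.mem_G i) b hb c 0 w
  rw [← Polynomial.coeff_zero_eq_eval_zero, h.coeff_zero_form_G hα h1, zero_add] at this
  rw [Polynomial.eval_neg, Polynomial.eval_smul, smul_eq_mul]
  linear_combination -this

end ConformalData.IsSuperconformal

/-- The features of `CK_6` on which the computation of its cohomology rests. -/
structure IsCK6Model (D : ConformalData R) (ε : Grassmann 6 →ₗ[ℂ] R) : Prop extends
    IsTruncatedModel D ε {x | ∃ n ≤ 3, ∃ B ∈ degPart 6 n, x = ε B} where
  brk_xi_xi_mul : ∀ B ∈ degPart 6 2, ∀ i, dxi i B = 0 →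
    D.brk (.C 0) (ε (xi i)) (ε (xi i * B)) = -(1 / 2 : ℂ) • ε B
  dual : ε (xi 3 * (xi 4 * xi 5)) = Complex.I • ε (xi 0 * (xi 1 * xi 2))

namespace IsCK6Model

/-- The recursion for the values `α(B, B)`, `B` a monomial. -/
lemma X_mul_form (h : IsCK6Model D ε) (hα : α ∈ D.twoCocycles)
    (h1 : ∀ n ≤ 3, ∀ B ∈ degPart 6 n, (α (ε 1) (ε B)).coeff 1 = 0) (hr : r ≤ 2)
    (hB : B ∈ degPart 6 r) (i : Fin 6) (hi : dxi i B = 0) :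
    .X * α (ε (xi i * B)) (ε (xi i * B)) = (-1 : ℂ) ^ r • α (ε B) (ε B) := by
  have hs := h.isSuperconformal
  have e1 := hs.form_brk_G hα (by rintro _ ⟨n, hn, B, hB, rfl⟩; exact h1 n hn B hB) i
    (h.mem_parity r (by omega) B hB) (ε (xi i * B))
  have e2 := h.X_smul_xi_mul r hr B hB i
  rw [hi, map_zero ε, sub_zero] at e2
  -- Below degree two this is the generation formula for `ξ_i(ξ_i B) = 0`. In degree two `ξ_i B` is
  -- already in the last degree of the truncation, so a separate feature of the model is used.
  have e3 : D.brk (.C 0) (ε (xi i)) (ε (xi i * B)) = -(1 / 2 : ℂ) • ε B := by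
    rcases hr.lt_or_eq with hr | rfl
    · have := h.X_smul_xi_mul (r + 1) (by omega) _ (xi_mul_mem_degPart i hB) i
      rw [← mul_assoc, xi_mul_self, zero_mul, map_zero ε, smul_zero, dxi_xi_mul, if_pos rfl, hi,
        mul_zero, sub_zero, eq_comm, sub_eq_zero] at this
      rw [← this, smul_smul]
      norm_num
    · exact h.brk_xi_xi_mul B hB i hi
  have e4 : α ((.X : ℂ[X]) • ε (xi i * B)) (ε (xi i * B)) =
      -(2 : ℂ) • α (D.brk (.C 0) (ε (xi i)) (ε B)) (ε (xi i * B)) := by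
    rw [e2, map_smul, LinearMap.smul_apply]
  rw [hα.1, e1, e3, map_smul, ← neg_one_pow_eq_koszulSign_one] at e4
  rw [neg_eq_iff_eq_neg.1 e4]
  module

/-- Only the cubic term at `(1, 1)` can survive normalisation, and the self-duality of the
generators in degree three rules it out. -/
theorem mem_coboundaries (h : IsCK6Model D ε) (hα : α ∈ D.twoCocycles) :
    α ∈ D.twoCoboundaries := by
  have hs := h.isSuperconformal
  obtain ⟨κ, hκ, hc, h1⟩ := hs.exists_normalised hα
  have h1' : ∀ n ≤ 3, ∀ B ∈ degPart 6 n, ((α - κ) (ε 1) (ε B)).coeff 1 = 0 :=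
    fun n hn B hB => h1 _ ⟨n, hn, B, hB, rfl⟩
  -- Three steps of the recursion, in degrees `0`, `1`, `2`, with signs `+`, `-`, `+`.
  have triple : ∀ i j k : Fin 6, i ≠ j → i ≠ k → j ≠ k → .X ^ 3 *
      (α - κ) (ε (xi i * (xi j * xi k))) (ε (xi i * (xi j * xi k))) =
        -(α - κ) (ε 1) (ε 1) := fun i j k hij hik hjk => by
    have t1 := h.X_mul_form hc h1' (r := 2) le_rfl (mul_mem_degPart (xi_mem_degPart j)
      (xi_mem_degPart k)) i (by simp [dxi_xi_mul, dxi_xi, hij, hik])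
    have t2 := h.X_mul_form hc h1' (r := 1) (by norm_num) (xi_mem_degPart k) j
      (by simp [dxi_xi, hjk])
    have t3 := h.X_mul_form hc h1' (r := 0) (by norm_num) one_mem_degPart k (dxi_one k)
    rw [mul_one] at t3
    rw [pow_succ, mul_assoc, t1, pow_two, mul_assoc, mul_smul_comm, t2, mul_smul_comm,
      mul_smul_comm, t3]
    module
  -- The generators at `ξ_4ξ_5ξ_6` and `ξ_1ξ_2ξ_3` differ by the factor `√-1`, so their values
  -- differ by `-1`, whereas both are given by `-α(1,1)`.
  have c3 : (α - κ) (ε 1) (ε 1) = 0 := by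
    have t := triple 3 4 5 (by decide) (by decide) (by decide)
    have t' := triple 0 1 2 (by decide) (by decide) (by decide)
    rw [h.dual, map_smul, map_smul, LinearMap.smul_apply, smul_smul, Complex.I_mul_I,
      mul_smul_comm, t', neg_smul, one_smul, neg_neg] at t
    exact self_eq_neg.1 t
  have key : α - κ = 0 := by
    have h0 : ∀ b, (α - κ) (ε 1) b = 0 := fun b => by
      have hb : b ∈ (⊤ : Submodule ℂ[X] R) := trivial
      rw [← hs.span_eq_top] at hb
      refine span_polynomial_induction (motive := fun b => (α - κ) (ε 1) b = 0) ?_ (by simp)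
        (fun x y hx hy => by rw [map_add, hx, hy, add_zero]) (fun z x hx => by
          rw [map_smul, hx, smul_zero])
        (fun x hx => by rw [hc.2.1, hx, mul_zero]) hb
      rintro _ ⟨n, hn, B, hB, rfl⟩
      exact h.form_one_emb_eq_zero hc h1 hn hB fun _ => by rw [c3, Polynomial.coeff_zero]
    ext1 a
    ext1 b
    have ha : a ∈ (⊤ : Submodule ℂ[X] R) := trivial
    rw [← hs.span_eq_top] at ha
    refine span_polynomial_induction (motive := fun a => (α - κ) a b = 0) ?_ (by simp)
      (fun x y hx hy => by rw [map_add, LinearMap.add_apply, hx, hy, add_zero])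
      (fun z x hx => by rw [map_smul, LinearMap.smul_apply, hx, smul_zero])
      (fun x hx => by rw [hc.1, hx, mul_zero, neg_zero]) ha
    rintro _ ⟨n, hn, B, hB, rfl⟩
    exact h.form_emb_eq_zero hc h0 hn hB b
  rwa [sub_eq_zero.1 key]

end IsCK6Model

end CK6

/-! ### `CK_6` as a model, and the final assembly. -/

section CK6

open ConformalData

/-- Together with `IsCK6Emb.hodge_three` this supplies the relation `dual` of the model. -/
lemma hodge_xi_xi_xi : hodge 6 (xi 0 * (xi 1 * xi 2)) = xi 3 * (xi 4 * xi 5) := by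
  have hw : xiMono (Finset.univ : Finset (Fin 6)) =
      xi 0 * (xi 1 * (xi 2 * (xi 3 * (xi 4 * xi 5)))) := by
    rw [show (Finset.univ : Finset (Fin 6)) = {0, 1, 2, 3, 4, 5} from rfl, xiMono_insert (by decide),
      xiMono_insert (by decide), xiMono_insert (by decide), xiMono_insert (by decide),
      xiMono_insert (by decide), xiMono_singleton]
  rw [hodge, contrBy_mul, contrBy_mul, contrBy_xi, contrBy_xi, contrBy_xi, hw]
  simp [dxi_xi_mul, dxi_xi]

variable {R : Type*} [AddCommGroup R] [Module ℂ R] [Module ℂ[X] R] [IsScalarTower ℂ ℂ[X] R]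
  {D : ConformalData R} {e ε : Grassmann 6 →ₗ[ℂ] R} {S : Submodule ℂ[X] R}

theorem IsCK6Emb.exists_isCK6Model (hε : IsCK6Emb e ε) (h : IsKModel D e)
    (hS : S = Submodule.span ℂ[X] {x | ∃ n ≤ 3, ∃ B ∈ degPart 6 n, x = ε B})
    (hsub : D.IsSubalgebra S) : ∃ ε' : Grassmann 6 →ₗ[ℂ] S, IsCK6Model (D.restrict S hsub) ε' := by
  let ε' : Grassmann 6 →ₗ[ℂ] S :=
    { toFun := fun A => ⟨ε A, hε.apply_mem hS A⟩
      map_add' := fun A B => Subtype.ext (by simp)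
      map_smul' := fun z A => Subtype.ext (by simp) }
  have hpar : ∀ n ≤ 3, ∀ B ∈ degPart 6 n, ε' B ∈ (D.restrict S hsub).parity n :=
    fun n hn B hB => hε.mem_parity h hn hB
  have hprim : ∀ n ≤ 3, ∀ B ∈ degPart 6 n,
      (D.restrict S hsub).IsPrimary (ε' 1) (2 - n / 2) (ε' B) := fun n hn B hB z =>
    Subtype.ext (by rw [brk_restrict]; exact hε.isPrimary h hn hB z)
  refine ⟨ε', ⟨⟨?_, fun n hn B hB => ⟨n, hn, B, hB, rfl⟩, hprim, hpar, fun n hn B hB i =>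
    Subtype.ext ?_⟩, fun B hB i hi => Subtype.ext ?_, Subtype.ext ?_⟩⟩
  · refine ⟨h.isLie.restrict _ _ _ hS ?_, hpar 0 (by norm_num) 1 one_mem_degPart, ?_,
      fun i => ?_, fun i => ?_, span_subtype_eq_top ?_, ?_⟩
    · rintro _ ⟨n, hn, B, hB, rfl⟩
      exact ⟨n, hε.mem_parity h hn hB⟩
    · have := hprim 0 (by norm_num) 1 one_mem_degPart
      norm_num at this
      exact this
    · have := hpar 1 (by norm_num) _ (xi_mem_degPart i)
      rwa [Nat.cast_one] at this
    · have := hprim 1 (by norm_num) _ (xi_mem_degPart i)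
      norm_num at this
      exact this
    · conv_lhs => rw [hS]
      refine Submodule.span_mono ?_
      rintro _ ⟨n, hn, B, hB, rfl⟩
      exact ⟨ε' B, ⟨n, hn, B, hB, rfl⟩, rfl⟩
    · rintro _ ⟨n, hn, B, hB, rfl⟩
      refine ⟨_, ?_, hprim n hn B hB⟩
      interval_cases n <;> norm_num
  · have := hε.X_smul_xi_mul h hn hB i
    change (.X : ℂ[X]) • ε (xi i * B) =
      -(2 : ℂ) • ((D.restrict S hsub).brk (.C 0) (ε' (xi i)) (ε' B) : R) - ε (dxi i B)
    rw [brk_restrict]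
    exact this
  · rw [brk_restrict]
    refine (hε.brk_xi_three h (xi_mul_mem_degPart i hB) i 0).trans ?_
    rw [← mul_assoc, xi_mul_self, zero_mul, map_zero (hodge 6), map_zero ε, smul_zero, dxi_xi_mul,
      if_pos rfl, hi, mul_zero, sub_zero, zero_sub, C_smul_eq, ← neg_smul]
    rfl
  · change ε _ = Complex.I • ε _
    rw [← hodge_xi_xi_xi]
    exact hε.hodge_three (mul_mem_degPart (xi_mem_degPart 0)
      (mul_mem_degPart (xi_mem_degPart 1) (xi_mem_degPart 2)))

/-- The star is linear, so monomials may be replaced by arbitrary homogeneous elements; the sign of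
`(-∂)^(3 - r)` is absorbed in `ck6Coeff`. -/
lemma ck6Space_eq_span {ε : Grassmann 6 →ₗ[ℂ] KSpace 6} (hε : IsCK6Emb (kEmb 6) ε) :
    CK6Space = Submodule.span ℂ[X] {x | ∃ n ≤ 3, ∃ B ∈ degPart 6 n, x = ε B} := by
  have hI : ∀ I : Finset (Fin 6), I.card ≤ 3 → (1 : ℂ[X]) ⊗ₜ[ℂ] xiMono I
      - (Complex.I * (-1 : ℂ) ^ (I.card * (I.card + 1) / 2)) •
        (((-.X : ℂ[X]) ^ (3 - I.card)) ⊗ₜ[ℂ] hodgeStar I) = ε (xiMono I) := fun I hI => by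
    have e : ∀ (c : ℂ) (p : ℂ[X]) (v : Grassmann 6), c • (p ⊗ₜ[ℂ] v) = (.C c * p) ⊗ₜ[ℂ] v :=
      fun c p v => by rw [TensorProduct.smul_tmul', Polynomial.smul_eq_C_mul]
    rw [hε.low _ hI _ (xiMono_mem_degPart I), smul_kEmb, hodgeStar_eq, e, sub_eq_add_neg,
      ← TensorProduct.neg_tmul, neg_pow]
    congr 2
    simp only [ck6Coeff, Polynomial.C_neg, Polynomial.C_mul, Polynomial.C_pow, Polynomial.C_1]
    ring
  refine le_antisymm (Submodule.span_mono ?_) (Submodule.span_le.2 ?_)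
  · rintro _ ⟨I, hc, rfl⟩
    exact ⟨I.card, hc, _, xiMono_mem_degPart I, hI I hc⟩
  · rintro _ ⟨n, -, B, -, rfl⟩
    have hB : B ∈ Submodule.span ℂ (Set.range ((Pi.basisFun ℂ (Fin 6)).ExteriorAlgebra)) := by
      rw [Module.Basis.span_eq]
      trivial
    induction hB using Submodule.span_induction with
    | mem x hx =>
      obtain ⟨I, rfl⟩ := hx
      change ε (xiMono I) ∈ CK6Space
      by_cases hc : I.card ≤ 3
      · exact Submodule.subset_span ⟨I, hc, (hI I hc).symm⟩
      · rw [hε.high _ (by omega) _ (xiMono_mem_degPart I)]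
        exact zero_mem _
    | zero =>
      change ε 0 ∈ CK6Space
      rw [map_zero]
      exact zero_mem _
    | add x y _ _ hx hy =>
      change ε (x + y) ∈ CK6Space
      rw [map_add]
      exact add_mem hx hy
    | smul z x _ hx =>
      change ε (z • x) ∈ CK6Space
      have := CK6Space.smul_mem (.C z : ℂ[X]) hx
      rw [C_smul_eq] at this
      rw [map_smul]
      exact this

/-- `CK_6` has no non-trivial central extensions. -/
theorem ck6_hasOnlyTrivialCentralExtensions : ∃ h : (KAlg 6).IsSubalgebra CK6Space,
    ((KAlg 6).restrict CK6Space h).IsLie ∧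
      HasOnlyTrivialCentralExtensions.{u} ((KAlg 6).restrict CK6Space h) := by
  have hK := kAlg_isKModel 6
  obtain ⟨ε, hε⟩ := exists_isCK6Emb (kEmb 6)
  have hS := ck6Space_eq_span hε
  have hsub := hε.isSubalgebra hK hS
  obtain ⟨ε', h⟩ := hε.exists_isCK6Model hK hS hsub
  have hs := h.isSuperconformal
  exact ⟨hsub, hs.isLie, hasOnlyTrivialCentralExtensions hs.isLie hs.perfect
    fun α hα => h.mem_coboundaries hα⟩

end CK6

theorem mainTheorem11 :
    (K4'Alg.IsLie ∧ ∃ α β : K4'Alg.twoCocycles, IsAlpha' α ∧ IsBeta' β ∧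
      ConformalData.ParameterizeCentralExtensions.{u} K4'Alg ![α, β]) ∧
    (∀ N : ℕ, N ≤ 3 → (KAlg N).IsLie ∧ ∃ α : (KAlg N).twoCocycles, IsAlpha N α ∧
      ConformalData.ParameterizeCentralExtensions.{u} (KAlg N) ![α]) ∧
    (∀ N : ℕ, 5 ≤ N → (KAlg N).IsLie ∧
      ConformalData.HasOnlyTrivialCentralExtensions.{u} (KAlg N)) ∧
    (∃ h : (KAlg 6).IsSubalgebra CK6Space,
      ((KAlg 6).restrict CK6Space h).IsLie ∧
      ConformalData.HasOnlyTrivialCentralExtensions.{u} ((KAlg 6).restrict CK6Space h)) :=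
  ⟨k4'Alg_parameterize,
    fun N hN => ⟨(kAlg_isKModel N).isLie, kAlg_parameterize hN⟩,
    fun N hN => ⟨(kAlg_isKModel N).isLie, kAlg_hasOnlyTrivialCentralExtensions hN⟩,
    ck6_hasOnlyTrivialCentralExtensions⟩

end
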